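/- Theorem. Let $k$ be a field of characteristic $0$; all vector spaces are $\mathbb Z/2$-graded over $k$, and $|\cdot|$ denotes parity. A wheeled PROP $P$ consists of spaces $P(m,n)$ ($m$ outputs, $n$ inputs, $m,n\ge 0$) with actions of $\Sigma_m\times\Sigma_n$, horizontal compositions $\otimes$, contractions $\xi^i_j:P(m+1,n+1)\to P(m,n)$ joining output $i$ to input $j$, and units in $P(1,1)$ and $P(0,0)$, all even and subject to the usual axioms (everything is compatible with relabelling of legs; $\otimes$ is associative, unital and graded commutative up to relabelling; contractions commute with each other and with $\otimes$; joining an input or output of an operation to the unit of $P(1,1)$ changes nothing); a differential is an odd derivation of square zero. (1) Let $\mathsf{PolyV}^{\circlearrowright}$ be the free wheeled PROP generated by the bimodules $\mathrm{sgn}_m\otimes \mathbf 1_n$ in parity $m \bmod 2$, $m,n\ge 0$, that is, by one $(m,n)$-corolla $c_{m,n}$ for all $m,n\ge0$, skew-symmetric in its outputs and symmetric in its inputs. There is a differential $\delta$ on $\mathsf{PolyV}^{\circlearrowright}$ with $$\delta c_{m,n}=\sum_{I_1\sqcup I_2=\{1,\dots,m\},\ J_1\sqcup J_2=\{1,\dots,n\}}(-1)^{\sigma(I_1\sqcup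 I_2)+|I_1||I_2|}\,G^{I_1,I_2}_{J_1,J_2}+(-1)^m\,\xi^1_1(c_{m+1,n+1}),$$ where $(-1)^{\sigma(I_1\sqcup I_2)}$ is the sign of the shuffle and $G^{I_1,I_2}_{J_1,J_2}$ is obtained from $c_{|I_1|+1,|J_1|}\otimes c_{|I_2|,|J_2|+1}$ by contracting the last output of the first factor with the first input of the second one and labelling the remaining legs of the two factors, in order, by $I_1,J_1$ and $I_2,J_2$. (2) Let $(M_0,d_0)$ be a finite-dimensional superspace with an odd endomorphism $d_0$, $d_0^2=0$, let $\{e_a\}$ be a homogeneous basis of $M_0$ and $d_0e_a=\sum_c D_a^c e_c$. Let $A$ be the algebra of formal power series in supercommuting variables $x^a$ of parity $|e_a|$ and $\psi_a$ of parity $|e_a|+1$ (formal polyvector fields on $M_0$). With left derivatives put $$\Delta=\sum_a\frac{\partial^2}{\partial x^a\partial\psi_a},\qquad [f\bullet g]=(-1)^{|f|}\Delta(fg)-(-1)^{|f|}\Delta(f)g-f\Delta(g),\qquad df=[\vec d_0\bullet f],\quad \vec d_0=\sum_{a,c}(-1)^{|e_a|}x^aD_a^c\psi_c.$$ A wheeled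 representation of $(\mathsf{PolyV}^{\circlearrowright},\delta)$ in $(M_0,d_0)$ is a morphism $R$ of wheeled PROPs from $\mathsf{PolyV}^{\circlearrowright}$ to the wheeled endomorphism PROP of $M_0$ (whose contractions are partial supertraces) such that $R\,\delta=d_{\mathrm{End}}R$, where $d_{\mathrm{End}}f=d_0\circ f-(-1)^{|f|}f\circ d_0$. Write $R(c_{m,n})(e_{\beta_1}\otimes\dots\otimes e_{\beta_n})=\sum_\alpha R^{\alpha_1\dots\alpha_m}_{\beta_1\dots\beta_n}\,e_{\alpha_1}\otimes\dots\otimes e_{\alpha_m}$. Then $$R\longmapsto S_R=\sum_{m,n\ge0}\frac1{m!\,n!}\sum_{\alpha,\beta}(-1)^{\sum_l|e_{\beta_l}|+\sum_{s=1}^m(m-s)|e_{\alpha_s}|}\,R^{\alpha_1\dots\alpha_m}_{\beta_1\dots\beta_n}\,x^{\beta_1}\cdots x^{\beta_n}\psi_{\alpha_m}\cdots\psi_{\alpha_1}$$ is a bijection from the set of wheeled representations of $(\mathsf{PolyV}^{\circlearrowright},\delta)$ in $(M_0,d_0)$ onto the set of even elements $S\in A$ satisfying the master equation $$dS+\Delta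 S+\tfrac12[S\bullet S]=0.$$ -/

import Mathlib

open scoped TensorProduct

universe u v w

noncomputable section

/-! ### Signs and permutations of finite ordinals -/

/-- The Koszul sign of a bijection `σ` that moves the factor in position `i`, of parity `q i`, to
position `σ i`: a factor `-1` for each inverted pair of odd factors. -/
def koszulSign {m m' : ℕ} (σ : Fin m ≃ Fin m') (q : Fin m → ZMod 2) : ℤˣ :=
  ∏ x : Fin m × Fin m, if x.1 < x.2 ∧ σ x.2 < σ x.1 then (-1 : ℤˣ) ^ (q x.1 * q x.2) else 1

/-- The sign of a bijection between finite ordinals, `(-1)` to the number of inversions. -/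
def inversionSign {m m' : ℕ} (σ : Fin m ≃ Fin m') : ℤˣ :=
  koszulSign σ fun _ => 1

/-- The block bijection `σ ⊔ σ'`. -/
def blockSum {m m' n n' : ℕ} (σ : Fin m ≃ Fin m') (σ' : Fin n ≃ Fin n') :
    Fin (m + n) ≃ Fin (m' + n') :=
  finSumFinEquiv.symm.trans ((Equiv.sumCongr σ σ').trans finSumFinEquiv)

/-- `σ` is increasing on the first `a` positions and on the remaining positions, so that it encodes
an ordered decomposition `{1, …, m} = I₁ ⊔ I₂` with `|I₁| = a`. -/
def IsShuffle (a : ℕ) {l m : ℕ} (σ : Fin l ≃ Fin m) : Prop :=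
  ∀ i j : Fin l, i < j → ((j : ℕ) < a ∨ a ≤ (i : ℕ)) → σ i < σ j

/-! ### Wheeled PROPs in `ℤ/2`-graded vector spaces -/

/-- The underlying data of a (`ℤ/2`-graded, `k`-linear) wheeled PROP. `carrier m n` is the space of
operations with `m` outputs and `n` inputs; `act σ τ` relabels outputs along `σ` and inputs along
`τ` (since `Fin m ≃ Fin m'` is empty unless `m = m'`, this is a family of actions of `S_m × S_n`);
`hcomp` is the horizontal composition; `contract i j` connects the output `i` to the input `j`. -/
structure WheeledPropData (k : Type u) [Field k] where
  carrier : ℕ → ℕ → Type v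
  [addCommGroup : ∀ m n, AddCommGroup (carrier m n)]
  [module : ∀ m n, Module k (carrier m n)]
  gr : ∀ m n, ZMod 2 → Submodule k (carrier m n)
  act : ∀ {m n m' n' : ℕ}, (Fin m ≃ Fin m') → (Fin n ≃ Fin n') →
    (carrier m n →ₗ[k] carrier m' n')
  hcomp : ∀ {m n m' n' : ℕ}, carrier m n →ₗ[k] carrier m' n' →ₗ[k] carrier (m + m') (n + n')
  contract : ∀ {m n : ℕ}, Fin (m + 1) → Fin (n + 1) →
    (carrier (m + 1) (n + 1) →ₗ[k] carrier m n)
  one : carrier 1 1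
  empty : carrier 0 0

attribute [instance] WheeledPropData.addCommGroup WheeledPropData.module

namespace WheeledPropData

variable {k : Type u} [Field k]

/-- The axioms of a wheeled PROP, in terms of relabellings, horizontal compositions and
contractions. The vertical and dioperadic compositions are derived operations: horizontal
compositions followed by contractions. -/
structure IsWheeledProp (P : WheeledPropData.{u, v} k) : Prop where
  isInternal : ∀ m n, DirectSum.IsInternal (P.gr m n)
  act_mem : ∀ {m n m' n' : ℕ} (σ : Fin m ≃ Fin m') (τ : Fin n ≃ Fin n') (q : ZMod 2),
    ∀ f ∈ P.gr m n q, P.act σ τ f ∈ P.gr m' n' q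
  hcomp_mem : ∀ {m n m' n' : ℕ} (q r : ZMod 2), ∀ f ∈ P.gr m n q, ∀ g ∈ P.gr m' n' r,
    P.hcomp f g ∈ P.gr (m + m') (n + n') (q + r)
  contract_mem : ∀ {m n : ℕ} (i : Fin (m + 1)) (j : Fin (n + 1)) (q : ZMod 2),
    ∀ f ∈ P.gr (m + 1) (n + 1) q, P.contract i j f ∈ P.gr m n q
  one_mem : P.one ∈ P.gr 1 1 0
  empty_mem : P.empty ∈ P.gr 0 0 0
  act_refl : ∀ {m n : ℕ} (f : P.carrier m n), P.act (Equiv.refl _) (Equiv.refl _) f = f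
  act_act : ∀ {m n m' n' m'' n'' : ℕ} (σ : Fin m ≃ Fin m') (τ : Fin n ≃ Fin n')
    (σ' : Fin m' ≃ Fin m'') (τ' : Fin n' ≃ Fin n'') (f : P.carrier m n),
    P.act σ' τ' (P.act σ τ f) = P.act (σ.trans σ') (τ.trans τ') f
  hcomp_act : ∀ {m n m' n' a b a' b' : ℕ} (σ : Fin m ≃ Fin m') (τ : Fin n ≃ Fin n')
    (σ' : Fin a ≃ Fin a') (τ' : Fin b ≃ Fin b') (f : P.carrier m n) (g : P.carrier a b),
    P.hcomp (P.act σ τ f) (P.act σ' τ' g) = P.act (blockSum σ σ') (blockSum τ τ') (P.hcomp f g)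
  hcomp_assoc : ∀ {m n m' n' m'' n'' : ℕ} (f : P.carrier m n) (g : P.carrier m' n')
    (h : P.carrier m'' n''),
    P.act (finCongr (Nat.add_assoc m m' m'')) (finCongr (Nat.add_assoc n n' n''))
      (P.hcomp (P.hcomp f g) h) = P.hcomp f (P.hcomp g h)
  empty_hcomp : ∀ {m n : ℕ} (f : P.carrier m n),
    P.act (finCongr (Nat.zero_add m)) (finCongr (Nat.zero_add n)) (P.hcomp P.empty f) = f
  hcomp_comm : ∀ {m n m' n' : ℕ} (q r : ZMod 2), ∀ f ∈ P.gr m n q, ∀ g ∈ P.gr m' n' r,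
    P.act finAddFlip finAddFlip (P.hcomp f g) = ((-1 : ℤˣ) ^ (q * r)) • P.hcomp g f
  /-- Equivariance: `σ'`, `τ'` are the bijections that `σ`, `τ` induce on the labels that are
  left after the removal of the contracted ones. -/
  contract_act : ∀ {m n m' n' : ℕ} (σ : Fin (m + 1) ≃ Fin (m' + 1)) (τ : Fin (n + 1) ≃ Fin (n' + 1))
    (σ' : Fin m ≃ Fin m') (τ' : Fin n ≃ Fin n') (i : Fin (m + 1)) (j : Fin (n + 1)),
    (∀ x, σ (i.succAbove x) = (σ i).succAbove (σ' x)) →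
    (∀ x, τ (j.succAbove x) = (τ j).succAbove (τ' x)) →
    ∀ f : P.carrier (m + 1) (n + 1),
      P.contract (σ i) (τ j) (P.act σ τ f) = P.act σ' τ' (P.contract i j f)
  /-- Two contractions may be performed in either order. -/
  contract_contract : ∀ {m n : ℕ} (i : Fin (m + 2)) (j : Fin (n + 2)) (i' : Fin (m + 1))
    (j' : Fin (n + 1)) (f : P.carrier (m + 2) (n + 2)),
    P.contract i' j' (P.contract i j f) =
      P.contract (i'.predAbove i) (j'.predAbove j)
        (P.contract (i.succAbove i') (j.succAbove j') f)
  contract_hcomp : ∀ {m n a b : ℕ} (i : Fin (m + 1)) (j : Fin (n + 1))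
    (f : P.carrier (m + 1) (n + 1)) (g : P.carrier a b),
    P.contract (finCongr (Nat.add_right_comm m 1 a) (Fin.castAdd a i))
      (finCongr (Nat.add_right_comm n 1 b) (Fin.castAdd b j))
      (P.act (finCongr (Nat.add_right_comm m 1 a)) (finCongr (Nat.add_right_comm n 1 b))
        (P.hcomp f g)) = P.hcomp (P.contract i j f) g
  /-- Plugging the output of the unit into an input changes nothing. -/
  one_input : ∀ {m n : ℕ} (f : P.carrier m (n + 1)),
    P.contract 0 1 (P.act (finCongr (Nat.add_comm 1 m)) (finCongr (Nat.add_comm 1 (n + 1)))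
      (P.hcomp P.one f)) = f
  /-- Plugging an output into the input of the unit changes nothing. -/
  one_output : ∀ {m n : ℕ} (f : P.carrier (m + 1) n),
    P.contract 1 0 (P.act (finCongr (Nat.add_comm 1 (m + 1))) (finCongr (Nat.add_comm 1 n))
      (P.hcomp P.one f)) = f

/-- Morphisms of wheeled PROPs. -/
structure Hom (P : WheeledPropData.{u, v} k) (Q : WheeledPropData.{u, w} k) where
  map : ∀ m n, P.carrier m n →ₗ[k] Q.carrier m n
  map_mem : ∀ m n q, ∀ f ∈ P.gr m n q, map m n f ∈ Q.gr m n q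
  map_act : ∀ {m n m' n' : ℕ} (σ : Fin m ≃ Fin m') (τ : Fin n ≃ Fin n') (f : P.carrier m n),
    map m' n' (P.act σ τ f) = Q.act σ τ (map m n f)
  map_hcomp : ∀ {m n m' n' : ℕ} (f : P.carrier m n) (g : P.carrier m' n'),
    map (m + m') (n + n') (P.hcomp f g) = Q.hcomp (map m n f) (map m' n' g)
  map_contract : ∀ {m n : ℕ} (i : Fin (m + 1)) (j : Fin (n + 1)) (f : P.carrier (m + 1) (n + 1)),
    map m n (P.contract i j f) = Q.contract i j (map (m + 1) (n + 1) f)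
  map_one : map 1 1 P.one = Q.one
  map_empty : map 0 0 P.empty = Q.empty

/-- `δ` is a differential of the wheeled PROP `P`: an odd derivation of square zero. -/
structure IsDifferential (P : WheeledPropData.{u, v} k)
    (δ : ∀ m n, P.carrier m n →ₗ[k] P.carrier m n) : Prop where
  odd : ∀ m n q, ∀ f ∈ P.gr m n q, δ m n f ∈ P.gr m n (q + 1)
  sq_zero : ∀ m n f, δ m n (δ m n f) = 0
  map_act : ∀ {m n m' n' : ℕ} (σ : Fin m ≃ Fin m') (τ : Fin n ≃ Fin n') (f : P.carrier m n),
    δ m' n' (P.act σ τ f) = P.act σ τ (δ m n f)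
  leibniz : ∀ {m n m' n' : ℕ} (q : ZMod 2), ∀ f ∈ P.gr m n q, ∀ g : P.carrier m' n',
    δ (m + m') (n + n') (P.hcomp f g) =
      P.hcomp (δ m n f) g + ((-1 : ℤˣ) ^ q) • P.hcomp f (δ m' n' g)
  map_contract : ∀ {m n : ℕ} (i : Fin (m + 1)) (j : Fin (n + 1)) (f : P.carrier (m + 1) (n + 1)),
    δ m n (P.contract i j f) = P.contract i j (δ (m + 1) (n + 1) f)
  map_one : δ 1 1 P.one = 0
  map_empty : δ 0 0 P.empty = 0

/-- A family of elements spanning images of the `(S_m, S_n)`-bimodules `sgn_m ⊗ 1_n`, placed in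
parity `m mod 2`: one `(m, n)`-corolla for all `m, n ≥ 0`, skew-symmetric in the outputs and
symmetric in the inputs. -/
structure IsCorollaFamily (P : WheeledPropData.{u, v} k) (c : ∀ m n, P.carrier m n) : Prop where
  mem : ∀ m n, c m n ∈ P.gr m n (m : ZMod 2)
  act : ∀ m n (σ : Equiv.Perm (Fin m)) (τ : Equiv.Perm (Fin n)),
    P.act σ τ (c m n) = Equiv.Perm.sign σ • c m n

/-- `P` is the free wheeled PROP generated by the bimodules `sgn_m ⊗ 1_n` in parity `m mod 2`,
`m, n ≥ 0`, with the corollas `c` as basis vectors of the generators. -/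
structure IsFreeOnCorollas (P : WheeledPropData.{u, v} k) (c : ∀ m n, P.carrier m n) : Prop where
  isCorollaFamily : P.IsCorollaFamily c
  existsUnique : ∀ Q : WheeledPropData.{u, v} k, Q.IsWheeledProp →
    ∀ c' : ∀ m n, Q.carrier m n, Q.IsCorollaFamily c' →
      ∃! φ : Hom P Q, ∀ m n, φ.map m n (c m n) = c' m n

/-- The two-vertex composition: the last output of `f` (the lower vertex) is plugged into the first
input of `g` (the upper vertex); the other legs of `f` precede those of `g`. -/
def graft (P : WheeledPropData.{u, v} k) {a b l r : ℕ} (f : P.carrier (a + 1) l)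
    (g : P.carrier b (r + 1)) : P.carrier (a + b) (l + r) :=
  P.contract (⟨a, by omega⟩ : Fin (a + b + 1)) (⟨l, by omega⟩ : Fin (l + r + 1))
    (P.act (finCongr (Nat.add_right_comm a 1 b)) (finCongr (Nat.add_assoc l r 1).symm)
      (P.hcomp f g))

open scoped Classical in
/-- The value of the differential on the `(m, n)`-corolla: the sum, over all decompositions
`I₁ ⊔ I₂` of the outputs and `J₁ ⊔ J₂` of the inputs, of the two-vertex graphs with the sign
`(-1)^{σ(I₁ ⊔ I₂) + |I₁||I₂|}`, plus `(-1)^m` times the `(m + 1, n + 1)`-corolla with a loop. -/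
def corollaDifferential (P : WheeledPropData.{u, v} k) (c : ∀ m n, P.carrier m n) (m n : ℕ) :
    P.carrier m n :=
  (∑ ab ∈ Finset.HasAntidiagonal.antidiagonal m, ∑ lr ∈ Finset.HasAntidiagonal.antidiagonal n,
    ∑ σ : Fin (ab.1 + ab.2) ≃ Fin m, ∑ τ : Fin (lr.1 + lr.2) ≃ Fin n,
      if IsShuffle ab.1 σ ∧ IsShuffle lr.1 τ then
        (inversionSign σ * (-1) ^ (ab.1 * ab.2)) •
          P.act σ τ (P.graft (c (ab.1 + 1) lr.1) (c ab.2 (lr.2 + 1)))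
      else 0) +
  ((-1 : ℤˣ) ^ m) • P.contract 0 0 (c (m + 1) (n + 1))

end WheeledPropData

/-! ### The wheeled endomorphism PROP of a finite-dimensional superspace -/

section Endomorphism

variable {k : Type u} [Field k] {M : Type v} [AddCommGroup M] [Module k M]
  {ι : Type w} [Fintype ι] [DecidableEq ι]

/-- The basis `e_{α₁} ⊗ ⋯ ⊗ e_{αₙ}` of `M^{⊗ n}`. -/
def tensorBasis (b : Module.Basis ι k M) (n : ℕ) :
    Module.Basis (Fin n → ι) k (⨂[k] _ : Fin n, M) :=
  Basis.piTensorProduct fun _ => b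

/-- Linear maps `M^{⊗ n} → M^{⊗ m}` as arrays: the entry of `f` at `(β, α)` is the
coefficient of `e_{β₁} ⊗ ⋯ ⊗ e_{βₘ}` in `f (e_{α₁} ⊗ ⋯ ⊗ e_{αₙ})`. -/
def tensorCoeff (b : Module.Basis ι k M) (m n : ℕ) :
    ((⨂[k] _ : Fin n, M) →ₗ[k] (⨂[k] _ : Fin m, M)) ≃ₗ[k]
      Matrix (Fin m → ι) (Fin n → ι) k :=
  LinearMap.toMatrix (tensorBasis b n) (tensorBasis b m)

/-- The relabelling `Π_σ ∘ f ∘ Π_τ⁻¹`, where `Π_σ` permutes tensor factors with Koszul signs. -/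
def arrayAct (k : Type u) [Field k] (p : ι → ZMod 2) {m n m' n' : ℕ} (σ : Fin m ≃ Fin m')
    (τ : Fin n ≃ Fin n') :
    Matrix (Fin m → ι) (Fin n → ι) k →ₗ[k] Matrix (Fin m' → ι) (Fin n' → ι) k where
  toFun A := Matrix.of fun β α =>
    (koszulSign σ (fun i => p (β (σ i))) * koszulSign τ (fun i => p (α (τ i)))) •
      A (β ∘ σ) (α ∘ τ)
  map_add' A B := by ext β α; simp
  map_smul' r A := by
    ext β α
    simp only [Matrix.of_apply, Matrix.smul_apply, RingHom.id_apply]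
    exact smul_comm _ _ _

/-- The tensor product `(f ⊗ g) (x ⊗ y) = (-1)^{|g||x|} f x ⊗ g y`. -/
def arrayTensor (k : Type u) [Field k] (p : ι → ZMod 2) {m n m' n' : ℕ} :
    Matrix (Fin m → ι) (Fin n → ι) k →ₗ[k] Matrix (Fin m' → ι) (Fin n' → ι) k →ₗ[k]
      Matrix (Fin (m + m') → ι) (Fin (n + n') → ι) k :=
  LinearMap.mk₂ k
    (fun A B => Matrix.of fun β α =>
      ((-1 : ℤˣ) ^ (((∑ i, p (β (Fin.natAdd m i))) + ∑ j, p (α (Fin.natAdd n j))) *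
          ∑ j, p (α (Fin.castAdd n' j)))) •
        (A (fun i => β (Fin.castAdd m' i)) (fun j => α (Fin.castAdd n' j)) *
          B (fun i => β (Fin.natAdd m i)) (fun j => α (Fin.natAdd n j))))
    (by intro A A' B; ext β α; simp [add_mul])
    (by intro r A B; ext β α
        simp only [Matrix.of_apply, Matrix.smul_apply, smul_mul_assoc]
        exact smul_comm _ _ _)
    (by intro A B B'; ext β α; simp [mul_add])
    (by intro r A B; ext β α
        simp only [Matrix.of_apply, Matrix.smul_apply, mul_smul_comm]
        exact smul_comm _ _ _)

/-- The contraction of the output `i` with the input `j`: the partial supertrace, with the Koszul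
signs of moving both factors to the last position. -/
def arrayContract (k : Type u) [Field k] (p : ι → ZMod 2) {m n : ℕ} (i : Fin (m + 1))
    (j : Fin (n + 1)) :
    Matrix (Fin (m + 1) → ι) (Fin (n + 1) → ι) k →ₗ[k] Matrix (Fin m → ι) (Fin n → ι) k where
  toFun A := Matrix.of fun β α => ∑ γ : ι,
    ((-1 : ℤˣ) ^ (p γ * (1 + (∑ l : Fin m, if i ≤ l.castSucc then p (β l) else 0) +
      ∑ l : Fin n, if j ≤ l.castSucc then p (α l) else 0))) •
      A (i.insertNth γ β) (j.insertNth γ α)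
  map_add' A B := by ext β α; simp [Finset.sum_add_distrib]
  map_smul' r A := by
    ext β α
    simp only [Matrix.of_apply, Matrix.smul_apply, RingHom.id_apply, Finset.smul_sum]
    exact Finset.sum_congr rfl fun _ _ => smul_comm _ _ _

/-- The wheeled endomorphism PROP of the superspace `M` with homogeneous basis `b`, the basis vector
`b a` being of parity `p a`. -/
def endWheeledProp (b : Module.Basis ι k M) (p : ι → ZMod 2) : WheeledPropData k where
  carrier m n := (⨂[k] _ : Fin n, M) →ₗ[k] (⨂[k] _ : Fin m, M)
  gr m n q :=
    { carrier := {f | ∀ β α, tensorCoeff b m n f β α ≠ 0 → (∑ i, p (β i)) + ∑ j, p (α j) = q}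
      zero_mem' := by intro β α h; simp at h
      add_mem' := by
        intro f g hf hg β α h
        by_cases hfz : tensorCoeff b m n f β α = 0
        · refine hg β α fun hgz => h ?_
          simp [hfz, hgz]
        · exact hf β α hfz
      smul_mem' := by
        intro r f hf β α h
        refine hf β α fun hfz => h ?_
        simp [hfz] }
  act σ τ := (tensorCoeff b _ _).symm.toLinearMap ∘ₗ arrayAct k p σ τ ∘ₗ
    (tensorCoeff b _ _).toLinearMap
  hcomp := ((arrayTensor k p).compl₁₂ (tensorCoeff b _ _).toLinearMap
    (tensorCoeff b _ _).toLinearMap).compr₂ (tensorCoeff b _ _).symm.toLinearMap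
  contract i j := (tensorCoeff b _ _).symm.toLinearMap ∘ₗ arrayContract k p i j ∘ₗ
    (tensorCoeff b _ _).toLinearMap
  one := PiTensorProduct.map fun _ => LinearMap.id
  empty := LinearMap.id

/-- The parity involution `x ↦ (-1)^{|x|} x` of `M`. -/
def parityMap (b : Module.Basis ι k M) (p : ι → ZMod 2) : M →ₗ[k] M :=
  b.constr k fun a => ((-1 : ℤˣ) ^ p a) • b a

/-- The differential of `M^{⊗ n}`:
`x₁ ⊗ ⋯ ⊗ xₙ ↦ ∑ᵢ (-1)^{|x₁| + ⋯ + |xᵢ₋₁|} x₁ ⊗ ⋯ ⊗ d₀ xᵢ ⊗ ⋯ ⊗ xₙ`. -/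
def tensorDifferential (b : Module.Basis ι k M) (p : ι → ZMod 2) (d₀ : M →ₗ[k] M) (n : ℕ) :
    (⨂[k] _ : Fin n, M) →ₗ[k] (⨂[k] _ : Fin n, M) :=
  ∑ i : Fin n, PiTensorProduct.map fun j =>
    if j < i then parityMap b p else if j = i then d₀ else LinearMap.id

/-- The differential `f ↦ d₀ ∘ f - (-1)^{|f|} f ∘ d₀` of the endomorphism PROP; conjugation by the
parity involutions produces the sign `(-1)^{|f|}`. -/
def endDifferential (b : Module.Basis ι k M) (p : ι → ZMod 2) (d₀ : M →ₗ[k] M) (m n : ℕ)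
    (f : (⨂[k] _ : Fin n, M) →ₗ[k] (⨂[k] _ : Fin m, M)) :
    (⨂[k] _ : Fin n, M) →ₗ[k] (⨂[k] _ : Fin m, M) :=
  tensorDifferential b p d₀ m ∘ₗ f -
    (PiTensorProduct.map fun _ => parityMap b p) ∘ₗ f ∘ₗ
      (PiTensorProduct.map fun _ => parityMap b p) ∘ₗ tensorDifferential b p d₀ n

end Endomorphism

/-! ### The dGBV algebra of formal polyvector fields -/

section Polyvector

variable {ι : Type w}

/-- The parities of the variables: `x^a = Sum.inl a` has the parity `p a` of the basis vector `e_a`,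
and `ψ_a = Sum.inr a` has the opposite parity. -/
def varParity (p : ι → ZMod 2) : ι ⊕ ι → ZMod 2 :=
  Sum.elim p fun a => p a + 1

/-- The even variables. -/
abbrev EvenVar (p : ι → ZMod 2) : Type w := {v : ι ⊕ ι // varParity p v = 0}

/-- The odd variables. -/
abbrev OddVar (p : ι → ZMod 2) : Type w := {v : ι ⊕ ι // varParity p v = 1}

/-- Formal functions in the variables `x^a`, `ψ_a`: the free supercommutative algebra, completed to
power series, that is, power series in the even variables with coefficients in the exterior
algebra on the odd ones. -/
abbrev Polyvector (k : Type u) [Field k] (p : ι → ZMod 2) : Type (max u w) :=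
  MvPowerSeries (EvenVar p) (ExteriorAlgebra k (OddVar p →₀ k))

variable {k : Type u} [Field k] {p : ι → ZMod 2}

/-- A variable, as an element of the algebra. -/
def variableElt (k : Type u) [Field k] (p : ι → ZMod 2) (v : ι ⊕ ι) : Polyvector k p :=
  if h : varParity p v = 0 then MvPowerSeries.X ⟨v, h⟩
  else MvPowerSeries.C (ExteriorAlgebra.ι k (Finsupp.single ⟨v, Fin.eq_one_of_ne_zero _ h⟩ 1))

/-- The left partial derivative with respect to a variable. -/
def partialDeriv (v : ι ⊕ ι) (f : Polyvector k p) : Polyvector k p :=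
  if h : varParity p v = 0 then MvPowerSeries.pderivFun ⟨v, h⟩ f
  else fun e =>
    CliffordAlgebra.contractLeft (Finsupp.lapply ⟨v, Fin.eq_one_of_ne_zero _ h⟩)
      (MvPowerSeries.coeff e f)

/-- The involution `f ↦ (-1)^{|f|} f`. -/
def parityInvolution (f : Polyvector k p) : Polyvector k p :=
  fun e => CliffordAlgebra.involute (MvPowerSeries.coeff e f)

variable [Fintype ι]

/-- The odd Laplacian `Δ = ∑_a ∂² / ∂x^a ∂ψ_a`. -/
def oddLaplacian (f : Polyvector k p) : Polyvector k p :=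
  ∑ a : ι, partialDeriv (Sum.inl a) (partialDeriv (Sum.inr a) f)

/-- The odd bracket `[f • g] = (-1)^{|f|} Δ(f g) - (-1)^{|f|} Δ(f) g - f Δ(g)`. -/
def oddBracket (f g : Polyvector k p) : Polyvector k p :=
  oddLaplacian (parityInvolution f * g) - oddLaplacian (parityInvolution f) * g -
    f * oddLaplacian g

variable [DecidableEq ι] {M : Type v} [AddCommGroup M] [Module k M]

/-- The linear vector field `∑_{a, c} (-1)^{|e_a|} x^a D_a^c ψ_c` of the endomorphism
`d₀ e_a = ∑_c D_a^c e_c`. -/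
def linearVectorField (b : Module.Basis ι k M) (p : ι → ZMod 2) (d₀ : M →ₗ[k] M) :
    Polyvector k p :=
  ∑ a : ι, ∑ c : ι, ((-1 : ℤˣ) ^ p a) • (LinearMap.toMatrix b b d₀ c a •
    (variableElt k p (Sum.inl a) * variableElt k p (Sum.inr c)))

/-- `S` is a master function: it is even and `d S + Δ S + ½ [S • S] = 0`, where `d` is the bracket
with the linear vector field of `d₀`. -/
def IsMasterFunction (b : Module.Basis ι k M) (p : ι → ZMod 2) (d₀ : M →ₗ[k] M)
    (S : Polyvector k p) : Prop :=
  parityInvolution S = S ∧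
    oddBracket (linearVectorField b p d₀) S + oddLaplacian S + (1 / 2 : k) • oddBracket S S = 0

/-- The contribution
`(1 / m! n!) ∑ ± R^{α₁…αₘ}_{β₁…βₙ} x^{β₁} ⋯ x^{βₙ} ψ_{αₘ} ⋯ ψ_{α₁}` of a linear map
`R : M^{⊗ n} → M^{⊗ m}` to the generating function; the exponent of the sign `±` is
`∑ₗ |e_{βₗ}| + ∑ₛ (m - s) |e_{αₛ}|`, with `s` running from `1` to `m`. -/
def generatingTerm (b : Module.Basis ι k M) (p : ι → ZMod 2) (m n : ℕ)
    (R : (⨂[k] _ : Fin n, M) →ₗ[k] (⨂[k] _ : Fin m, M)) : Polyvector k p :=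
  (1 / ((m.factorial : k) * (n.factorial : k))) •
    ∑ α : Fin m → ι, ∑ β : Fin n → ι,
      ((-1 : ℤˣ) ^ ((∑ l, p (β l)) + ∑ s : Fin m, ((s.rev : ℕ) : ZMod 2) * p (α s))) •
        (tensorCoeff b m n R α β •
          ((List.ofFn fun l => variableElt k p (Sum.inl (β l))).prod *
            (List.ofFn fun s => variableElt k p (Sum.inr (α s))).reverse.prod))

/-- The generating function `∑_{m, n ≥ 0}` of the above contributions of a family of linear maps
`R m n : M^{⊗ n} → M^{⊗ m}`. The `(m, n)`-term is homogeneous of degree `m + n` in the variables,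
so only finitely many terms contribute to the coefficient of a monomial in the even variables. -/
def generatingFunction (b : Module.Basis ι k M) (p : ι → ZMod 2)
    (R : ∀ m n : ℕ, (⨂[k] _ : Fin n, M) →ₗ[k] (⨂[k] _ : Fin m, M)) : Polyvector k p :=
  fun e => ∑ᶠ mn : ℕ × ℕ, MvPowerSeries.coeff e (generatingTerm b p mn.1 mn.2 (R mn.1 mn.2))

end Polyvector

end

/-! The free wheeled PROP is built as formal composites of corollas modulo the relations forced by
the axioms. An odd derivation of it may be prescribed on corollas as soon as the prescribed values
have the symmetry of the corollas (`termDifferential_rel`), so the formula in (1) defines an odd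
derivation δ. Since δ² is again a derivation, only δ² c = 0 remains to be shown.

This is done without cancelling graphs one by one. In any wheeled PROP, pass to the coinvariants:
all operations modulo relabelling, up to the sign of the permutation of the outputs. Horizontal
composition yields multiplication operators, graded commutative for the parity plus the number of
outputs, under which every corolla is even. The signed sum of all contractions yields an operator D
with D² = 0 (`laplacian_sq`). It is of second order: its double commutator with two even
multiplications is multiplication by the sum of the contractions along one edge between the factors
(`laplacian_mulOp_mulOp`). Let L be the exponential generating series of the corollas in two formal
variables s, t, and let N = ½[[D, L], L]. Labels are invisible in coinvariants, so the formula for δ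
becomes the master equation st·δL + DL + N = 0 on the class of the empty operation
(`master_relation`). Applying δ and substituting the equation twice expresses (st)²·δ²L through D² =
0 and the Jacobi identity, hence it is zero (`formal_master_identity`). In characteristic 0 a
skew-symmetric operation is determined by its class, so δ² c = 0 (`derivation_corollaDifferential`).

For (2), freeness identifies morphisms into the endomorphism PROP with families of arrays having the
symmetry and parity of corollas. Such a morphism respects the differentials if and only if it does
so on corollas (`free_comm_differential`). The signs in the generating function are those for which
∂/∂ψ_a and ∂/∂x^b act on a family by fixing its last output or its first input. Therefore ΔS, ½[S •
S] and dS are the generating functions of the loops, of the two-vertex graphs and of the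
differential, and the left side of the master equation is the generating function of the defect of
compatibility on corollas, up to signs (`master_genSeries`). Taylor coefficients invert the passage
from families to series (`taylor_genSeries`, `genSeries_taylor`). This gives both the equivalence of
the two equations and the bijection. The infinite sums make sense because there are only finitely
many odd variables. -/

noncomputable section

/-! ### Koszul signs -/

lemma ZMod.two_add_self (x : ZMod 2) : x + x = 0 := by revert x; decide

/-- The exponent of the Koszul sign. -/
def koszulExp {m m' : ℕ} (σ : Fin m ≃ Fin m') (q : Fin m → ZMod 2) : ZMod 2 :=
  ∑ x : Fin m, ∑ y : Fin m, if x < y ∧ σ y < σ x then q x * q y else 0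

lemma units_pow_sum {ι : Type*} (s : Finset ι) (f : ι → ZMod 2) :
    (-1 : ℤˣ) ^ (∑ i ∈ s, f i) = ∏ i ∈ s, (-1 : ℤˣ) ^ f i := by
  classical
  induction s using Finset.induction_on with
  | empty => simp
  | insert a s ha ih => rw [Finset.sum_insert ha, Finset.prod_insert ha, uzpow_add, ih]

/-- Signs are carried as exponents in `ZMod 2`, so that sign identities become polynomial
identities, closed by `ring`, `linear_combination` or `decide`. -/
lemma koszulSign_eq {m m' : ℕ} (σ : Fin m ≃ Fin m') (q : Fin m → ZMod 2) :
    koszulSign σ q = (-1) ^ koszulExp σ q := by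
  rw [koszulSign, koszulExp, ← Fintype.sum_prod_type', units_pow_sum]
  refine Finset.prod_congr rfl fun x _ => ?_
  split_ifs <;> simp

/-- The pairs (x, y) and (y, x) cancel. Comparing two inversion counts is thereby reduced to a
single unordered pair of positions. -/
lemma sum_pairs_eq_zero {m : ℕ} (H : Fin m → Fin m → ZMod 2) (hd : ∀ x, H x x = 0)
    (h : ∀ x y, x < y → H x y + H y x = 0) : ∑ x, ∑ y, H x y = 0 := by
  rw [← Fintype.sum_prod_type']
  refine Finset.sum_involution (fun x _ => x.swap) ?_ ?_ ?_ ?_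
  · rintro ⟨x, y⟩ -
    rcases lt_trichotomy x y with hxy | rfl | hxy
    · exact h x y hxy
    · simp [hd]
    · rw [add_comm]; exact h y x hxy
  · rintro ⟨x, y⟩ - hne heq
    apply hne
    have : y = x := congrArg Prod.fst heq
    subst this
    exact hd _
  · simp
  · simp

/-- A pair is inverted by the composite exactly when it is inverted by one and only one of the two
bijections. -/
lemma koszulExp_trans {m m' m'' : ℕ} (σ : Fin m ≃ Fin m') (τ : Fin m' ≃ Fin m'')
    (q : Fin m → ZMod 2) :
    koszulExp (σ.trans τ) q = koszulExp σ q + koszulExp τ (q ∘ σ.symm) := by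
  have h2 : koszulExp τ (q ∘ σ.symm) =
      ∑ x : Fin m, ∑ y : Fin m, if σ x < σ y ∧ τ (σ y) < τ (σ x) then q x * q y else 0 := by
    rw [koszulExp, ← σ.sum_comp]
    refine Finset.sum_congr rfl fun x _ => ?_
    rw [← σ.sum_comp]
    simp
  rw [h2, ← sub_eq_zero]
  simp only [koszulExp, ← Finset.sum_add_distrib, ← Finset.sum_sub_distrib]
  refine sum_pairs_eq_zero _ (fun x => by simp) fun x y hxy => ?_
  have h1 : σ x ≠ σ y := σ.injective.ne hxy.ne
  have h3 : τ (σ x) ≠ τ (σ y) := τ.injective.ne h1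
  have h4 : ∀ z : ZMod 2, z + z = 0 := by decide
  have h5 : ∀ z : ZMod 2, -z = z := by decide
  rcases lt_or_gt_of_ne h1 with h1 | h1 <;> rcases lt_or_gt_of_ne h3 with h3 | h3 <;>
    simp [hxy, hxy.not_gt, h1, h1.not_gt, h3, h3.not_gt, mul_comm (q y), h4, h5]

lemma koszulSign_trans {m m' m'' : ℕ} (σ : Fin m ≃ Fin m') (τ : Fin m' ≃ Fin m'')
    (q : Fin m → ZMod 2) :
    koszulSign (σ.trans τ) q = koszulSign σ q * koszulSign τ (q ∘ σ.symm) := by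
  simp only [koszulSign_eq, koszulExp_trans, uzpow_add]

lemma koszulExp_of_strictMono {m m' : ℕ} (σ : Fin m ≃ Fin m') (hσ : StrictMono σ)
    (q : Fin m → ZMod 2) : koszulExp σ q = 0 := by
  refine Finset.sum_eq_zero fun x _ => Finset.sum_eq_zero fun y _ => if_neg ?_
  rintro ⟨h, h'⟩
  exact (hσ h).not_gt h'

@[simp] lemma koszulExp_finCongr {m m' : ℕ} (h : m = m') (q : Fin m → ZMod 2) :
    koszulExp (finCongr h) q = 0 :=
  koszulExp_of_strictMono _ (fun _ _ h => h) q

@[simp] lemma koszulExp_refl {m : ℕ} (q : Fin m → ZMod 2) :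
    koszulExp (Equiv.refl _) q = 0 :=
  koszulExp_of_strictMono _ (fun _ _ h => h) q

@[simp] lemma koszulSign_finCongr {m m' : ℕ} (h : m = m') (q : Fin m → ZMod 2) :
    koszulSign (finCongr h) q = 1 := by simp [koszulSign_eq]

@[simp] lemma koszulSign_refl {m : ℕ} (q : Fin m → ZMod 2) :
    koszulSign (Equiv.refl _) q = 1 := by simp [koszulSign_eq]

@[simp] lemma blockSum_castAdd {m m' n n' : ℕ} (σ : Fin m ≃ Fin m') (σ' : Fin n ≃ Fin n')
    (i : Fin m) : blockSum σ σ' (Fin.castAdd n i) = Fin.castAdd n' (σ i) := by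
  simp [blockSum]

@[simp] lemma blockSum_natAdd {m m' n n' : ℕ} (σ : Fin m ≃ Fin m') (σ' : Fin n ≃ Fin n')
    (i : Fin n) : blockSum σ σ' (Fin.natAdd m i) = Fin.natAdd m' (σ' i) := by
  simp [blockSum]

lemma koszulExp_blockSum {m m' n n' : ℕ} (σ : Fin m ≃ Fin m') (σ' : Fin n ≃ Fin n')
    (q : Fin (m + n) → ZMod 2) :
    koszulExp (blockSum σ σ') q =
      koszulExp σ (fun i => q (Fin.castAdd n i)) + koszulExp σ' (fun i => q (Fin.natAdd m i)) := by
  simp only [koszulExp, Fin.sum_univ_add, Finset.sum_add_distrib, blockSum_castAdd, blockSum_natAdd]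
  have h1 : ∀ (a b : ℕ) (x : Fin a) (y : Fin b), Fin.castAdd b x < Fin.natAdd a y := fun a b x y => by
    simp only [Fin.lt_def, Fin.val_castAdd, Fin.val_natAdd]; omega
  have h2 : ∀ (a b : ℕ) (x : Fin a) (y : Fin b), ¬ Fin.natAdd a y < Fin.castAdd b x := fun a b x y =>
    (h1 a b x y).not_gt
  have h3 : ∀ (a b : ℕ) (x y : Fin a), Fin.castAdd b x < Fin.castAdd b y ↔ x < y := fun a b x y =>
    Iff.rfl
  have h4 : ∀ (a b : ℕ) (x y : Fin b), Fin.natAdd a x < Fin.natAdd a y ↔ x < y := fun a b x y => by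
    simp
  simp only [h1, h2, h3, h4, and_false, false_and, if_false, Finset.sum_const_zero, add_zero,
    zero_add]

lemma koszulExp_finAddFlip {m n : ℕ} (q : Fin (m + n) → ZMod 2) :
    koszulExp (finAddFlip : Fin (m + n) ≃ Fin (n + m)) q =
      (∑ i, q (Fin.castAdd n i)) * ∑ j, q (Fin.natAdd m j) := by
  simp only [koszulExp, Fin.sum_univ_add, Finset.sum_add_distrib, finAddFlip_apply_castAdd,
    finAddFlip_apply_natAdd]
  have h1 : ∀ (a b : ℕ) (x : Fin a) (y : Fin b), Fin.castAdd b x < Fin.natAdd a y := fun a b x y => by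
    simp only [Fin.lt_def, Fin.val_castAdd, Fin.val_natAdd]; omega
  have h2 : ∀ (a b : ℕ) (x : Fin a) (y : Fin b), ¬ Fin.natAdd a y < Fin.castAdd b x := fun a b x y =>
    (h1 a b x y).not_gt
  have h3 : ∀ (a b : ℕ) (x y : Fin a), Fin.castAdd b x < Fin.castAdd b y ↔ x < y := fun a b x y =>
    Iff.rfl
  have h4 : ∀ (a b : ℕ) (x y : Fin b), Fin.natAdd a x < Fin.natAdd a y ↔ x < y := fun a b x y => by
    simp
  have h5 : ∀ (a : ℕ) (x y : Fin a), ¬ (x < y ∧ y < x) := fun a x y h => h.1.not_gt h.2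
  simp only [h1, h2, h3, h4, h5, and_true, if_false, if_true, false_and,
    Finset.sum_const_zero, add_zero, zero_add, Finset.sum_mul_sum]

/-- Deleting the factor at `i` loses the pairs containing it. Such a pair is inverted when exactly
one of "the other factor is behind `i`" and "its image is behind `σ i`" holds, which modulo 2 is the
sum of the two indicators. -/
lemma koszulExp_succAbove {m m' : ℕ} (σ : Fin (m + 1) ≃ Fin (m' + 1)) (σ' : Fin m ≃ Fin m')
    (i : Fin (m + 1)) (h : ∀ x, σ (i.succAbove x) = (σ i).succAbove (σ' x))
    (q : Fin (m + 1) → ZMod 2) :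
    koszulExp σ q = koszulExp σ' (fun x => q (i.succAbove x)) +
      q i * ((∑ l, if i ≤ l.castSucc then q (i.succAbove l) else 0) +
        ∑ l, if σ i ≤ (σ' l).castSucc then q (i.succAbove l) else 0) := by
  simp only [koszulExp, Fin.sum_univ_succAbove _ i, h, Finset.sum_add_distrib, mul_add,
    Finset.mul_sum]
  simp only [lt_self_iff_false, false_and, if_false, zero_add, Fin.succAbove_lt_succAbove_iff,
    Fin.lt_succAbove_iff_le_castSucc, Fin.succAbove_lt_iff_castSucc_lt, mul_ite, mul_zero]
  have key : ∀ A B C D : Fin m → ZMod 2, (∀ x, A x + B x = C x + D x) → ∀ z : ZMod 2,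
      (∑ x, A x) + ((∑ x, B x) + z) = z + ((∑ x, C x) + ∑ x, D x) := by
    intro A B C D hx z
    have := Finset.sum_congr (rfl : (Finset.univ : Finset (Fin m)) = _) fun x _ => hx x
    simp only [Finset.sum_add_distrib] at this
    linear_combination this
  refine key _ _ _ _ (fun x => ?_) _
  have h5 : ∀ z : ZMod 2, z + z = 0 := by decide
  by_cases h1 : i ≤ x.castSucc <;> by_cases h2 : σ i ≤ (σ' x).castSucc <;>
    simp [h1, h2, not_lt.2, not_le.1, mul_comm, h5]

lemma inversionSign_perm {m : ℕ} (σ : Equiv.Perm (Fin m)) :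
    inversionSign σ = Equiv.Perm.sign σ := by
  rw [Equiv.Perm.sign_eq_prod_prod_Iio, inversionSign, koszulSign, Fintype.prod_prod_type,
    Finset.prod_comm]
  refine Finset.prod_congr rfl fun j _ => ?_
  rw [← Finset.prod_subset (Finset.subset_univ (Finset.Iio j))]
  · refine Finset.prod_congr rfl fun i hi => ?_
    have hij : i < j := Finset.mem_Iio.1 hi
    rcases lt_or_gt_of_ne (σ.injective.ne hij.ne) with h | h <;> simp [hij, h, h.not_gt]
  · intro i _ hi
    simp only [Finset.mem_Iio] at hi
    simp [hi]

lemma inversionSign_eq {m m' : ℕ} (σ : Fin m ≃ Fin m') :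
    inversionSign σ = (-1) ^ koszulExp σ (fun _ => 1) :=
  koszulSign_eq _ _

lemma inversionSign_trans {m m' m'' : ℕ} (σ : Fin m ≃ Fin m') (τ : Fin m' ≃ Fin m'') :
    inversionSign (σ.trans τ) = inversionSign σ * inversionSign τ :=
  koszulSign_trans _ _ _

@[simp] lemma inversionSign_finCongr {m m' : ℕ} (h : m = m') :
    inversionSign (finCongr h) = 1 := koszulSign_finCongr _ _

@[simp] lemma inversionSign_refl {m : ℕ} :
    inversionSign (Equiv.refl (Fin m)) = 1 := koszulSign_refl _

lemma inversionSign_mul_self {m m' : ℕ} (σ : Fin m ≃ Fin m') :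
    inversionSign σ * inversionSign σ = 1 := by
  rw [← Units.val_inj]
  rcases Int.units_eq_one_or (inversionSign σ) with h | h <;> simp [h]

@[simp] lemma inversionSign_symm {m m' : ℕ} (σ : Fin m ≃ Fin m') :
    inversionSign σ.symm = inversionSign σ := by
  have h := inversionSign_trans σ σ.symm
  rw [Equiv.self_trans_symm, inversionSign_refl] at h
  rw [← mul_left_cancel_iff (a := inversionSign σ), ← h, inversionSign_mul_self]

lemma inversionSign_blockSum {m m' n n' : ℕ} (σ : Fin m ≃ Fin m') (σ' : Fin n ≃ Fin n') :
    inversionSign (blockSum σ σ') = inversionSign σ * inversionSign σ' := by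
  simp only [inversionSign_eq, koszulExp_blockSum, uzpow_add]

lemma inversionSign_finAddFlip {m n : ℕ} :
    inversionSign (finAddFlip : Fin (m + n) ≃ Fin (n + m)) = (-1) ^ ((m : ZMod 2) * (n : ZMod 2)) := by
  simp [inversionSign_eq, koszulExp_finAddFlip]

lemma Fin.card_filter_le_castSucc {m : ℕ} (i : Fin (m + 1)) :
    (∑ l : Fin m, if i ≤ l.castSucc then (1 : ℕ) else 0) + i = m := by
  have h : ∀ l : Fin m, (if i ≤ l.castSucc then (1 : ℕ) else 0) +
      (if (l : ℕ) < i then 1 else 0) = 1 := by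
    intro l
    by_cases hl : i ≤ l.castSucc
    · have h2 : ¬ (l : ℕ) < i := by simpa [Fin.le_def] using hl
      simp [hl, h2]
    · have h2 : (l : ℕ) < i := by simpa [Fin.le_def] using hl
      simp [hl, h2]
  have h1 : ∑ l : Fin m, (if (l : ℕ) < i then 1 else 0) = (i : ℕ) := by
    rw [Fin.sum_univ_eq_sum_range (fun l => if l < (i : ℕ) then 1 else 0) m, Finset.sum_ite,
      Finset.sum_const_zero, add_zero, Finset.sum_const, smul_eq_mul, mul_one]
    have : Finset.filter (fun l => l < (i : ℕ)) (Finset.range m) = Finset.range i := by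
      ext l; simp; omega
    rw [this, Finset.card_range]
  have h2 : ∑ l : Fin m, ((if i ≤ l.castSucc then (1 : ℕ) else 0) +
      (if (l : ℕ) < i then 1 else 0)) = m := by simp [h]
  rw [Finset.sum_add_distrib, h1] at h2
  exact h2

/-- With all factors odd, m - i factors lie behind `i` and m - σ i behind its image, so the lost
sign depends only on the parity of i + σ i. -/
lemma inversionSign_succAbove {m m' : ℕ} (σ : Fin (m + 1) ≃ Fin (m' + 1)) (σ' : Fin m ≃ Fin m')
    (i : Fin (m + 1)) (h : ∀ x, σ (i.succAbove x) = (σ i).succAbove (σ' x)) :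
    inversionSign σ = inversionSign σ' * ((-1) ^ (i : ℕ) * (-1) ^ (σ i : ℕ)) := by
  obtain rfl : m = m' := by simpa using Fintype.card_congr σ'
  simp only [inversionSign_eq, koszulExp_succAbove σ σ' i h, uzpow_add, one_mul]
  have h2 : ∑ l, (if σ i ≤ (σ' l).castSucc then (1 : ZMod 2) else 0) =
      ∑ l : Fin m, (if σ i ≤ l.castSucc then (1 : ZMod 2) else 0) :=
    σ'.sum_comp (fun l => if σ i ≤ l.castSucc then (1 : ZMod 2) else 0)
  have h3 : ∀ j : Fin (m + 1), ∑ l : Fin m, (if j ≤ l.castSucc then (1 : ZMod 2) else 0) =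
      (m : ZMod 2) + ((j : ℕ) : ZMod 2) := by
    intro j
    have h4 := congrArg (Nat.cast (R := ZMod 2)) (Fin.card_filter_le_castSucc j)
    push_cast at h4
    have h5 : ∀ z : ZMod 2, z + z = 0 := by decide
    rw [← h4, add_assoc, h5, add_zero]
  rw [h2, h3, h3, ← uzpow_add, ← uzpow_natCast (R := ZMod 2), ← uzpow_natCast (R := ZMod 2),
    ← uzpow_add, ← uzpow_add, ← uzpow_add]
  congr 2
  have h5 : ∀ z y w : ZMod 2, z + y + (z + w) = y + w := by decide
  exact h5 _ _ _

/-- The bijection induced on the complements of a point and of its image. -/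
lemma exists_succAbove_equiv {m m' : ℕ} (σ : Fin (m + 1) ≃ Fin (m' + 1)) (i : Fin (m + 1)) :
    ∃ σ' : Fin m ≃ Fin m', ∀ x, σ (i.succAbove x) = (σ i).succAbove (σ' x) := by
  let e : {x // x ≠ i} ≃ {y // y ≠ σ i} :=
    σ.subtypeEquiv fun x => by simp
  refine ⟨((finSuccAboveEquiv i).trans e).trans (finSuccAboveEquiv (σ i)).symm,
    fun x => ?_⟩
  have h := (finSuccAboveEquiv (σ i)).apply_symm_apply (e (finSuccAboveEquiv i x))
  have h' := congrArg Subtype.val h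
  rw [finSuccAboveEquiv_apply] at h'
  exact h'.symm

/-! ### Shuffles -/

section Shuffle

lemma isShuffle_iff {a b m : ℕ} (σ : Fin (a + b) ≃ Fin m) :
    IsShuffle a σ ↔ StrictMono (fun i : Fin a => σ (Fin.castAdd b i)) ∧
      StrictMono (fun i : Fin b => σ (Fin.natAdd a i)) := by
  constructor
  · intro h
    refine ⟨fun i j hij => h _ _ hij (Or.inl (by simp)),
      fun i j hij => h _ _ (by simpa using hij) (Or.inr (by simp))⟩
  · rintro ⟨h1, h2⟩ i j hij hor
    induction i using Fin.addCases with
    | left i =>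
      induction j using Fin.addCases with
      | left j => exact h1 hij
      | right j => simp at hor; have := i.2; omega
    | right i =>
      induction j using Fin.addCases with
      | left j => simp [Fin.lt_def] at hij; have := j.2; omega
      | right j => exact h2 (by simpa using hij)

lemma blockSum_trans {m m' m'' n n' n'' : ℕ} (σ : Fin m ≃ Fin m') (σ' : Fin n ≃ Fin n')
    (τ : Fin m' ≃ Fin m'') (τ' : Fin n' ≃ Fin n'') :
    (blockSum σ σ').trans (blockSum τ τ') = blockSum (σ.trans τ) (σ'.trans τ') := by
  ext x
  induction x using Fin.addCases <;> simp

@[simp] lemma blockSum_refl {m n : ℕ} :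
    blockSum (Equiv.refl (Fin m)) (Equiv.refl (Fin n)) = Equiv.refl _ := by
  ext x
  induction x using Fin.addCases <;> simp

/-- Sorting the values on each of the two blocks produces the shuffle. It is unique because a
strictly increasing map is determined by its range. -/
lemma shuffle_bijective (a b m : ℕ) :
    Function.Bijective (fun x : {σ : Fin (a + b) ≃ Fin m // IsShuffle a σ} ×
      Equiv.Perm (Fin a) × Equiv.Perm (Fin b) => (blockSum x.2.1 x.2.2).trans x.1.1) := by
  constructor
  · rintro ⟨⟨s, hs⟩, ρ, ρ'⟩ ⟨⟨t, ht⟩, τ, τ'⟩ h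
    rw [isShuffle_iff] at hs ht
    simp only at h
    have h1 : ∀ i, s (Fin.castAdd b (ρ i)) = t (Fin.castAdd b (τ i)) := fun i => by
      simpa using congrArg (fun e => e (Fin.castAdd b i)) h
    have h2 : ∀ i, s (Fin.natAdd a (ρ' i)) = t (Fin.natAdd a (τ' i)) := fun i => by
      simpa using congrArg (fun e => e (Fin.natAdd a i)) h
    have e1 : (fun i : Fin a => s (Fin.castAdd b i)) = fun i => t (Fin.castAdd b i) := by
      refine (hs.1.range_inj ht.1).1 ?_
      rw [← ρ.surjective.range_comp, ← τ.surjective.range_comp (fun i => t (Fin.castAdd b i))]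
      exact congrArg Set.range (funext h1)
    have e2 : (fun i : Fin b => s (Fin.natAdd a i)) = fun i => t (Fin.natAdd a i) := by
      refine (hs.2.range_inj ht.2).1 ?_
      rw [← ρ'.surjective.range_comp, ← τ'.surjective.range_comp (fun i => t (Fin.natAdd a i))]
      exact congrArg Set.range (funext h2)
    have hst : s = t := by
      ext x
      induction x using Fin.addCases with
      | left i => exact congrArg Fin.val (congrFun e1 i)
      | right i => exact congrArg Fin.val (congrFun e2 i)
    subst hst
    have hρ : ρ = τ := Equiv.ext fun i => by simpa using h1 i
    have hρ' : ρ' = τ' := Equiv.ext fun i => by simpa using h2 i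
    subst hρ hρ'
    rfl
  · intro σ
    have hf : Function.Injective (fun i : Fin a => σ (Fin.castAdd b i)) :=
      σ.injective.comp (Fin.castAdd_injective a b)
    have hg : Function.Injective (fun i : Fin b => σ (Fin.natAdd a i)) :=
      σ.injective.comp (Fin.natAdd_injective b a)
    let ρ := Tuple.sort (fun i : Fin a => σ (Fin.castAdd b i))
    let ρ' := Tuple.sort (fun i : Fin b => σ (Fin.natAdd a i))
    refine ⟨⟨⟨(blockSum ρ ρ').trans σ, ?_⟩, ρ.symm, ρ'.symm⟩, ?_⟩
    · rw [isShuffle_iff]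
      constructor
      · have := (Tuple.monotone_sort (fun i : Fin a => σ (Fin.castAdd b i))).strictMono_of_injective
          (hf.comp ρ.injective)
        intro i j hij
        simpa using this hij
      · have := (Tuple.monotone_sort (fun i : Fin b => σ (Fin.natAdd a i))).strictMono_of_injective
          (hg.comp ρ'.injective)
        intro i j hij
        simpa using this hij
    · simp only [← Equiv.trans_assoc, blockSum_trans, Equiv.symm_trans_self, blockSum_refl,
        Equiv.refl_trans]

open scoped Classical in
-- Sums over shuffles are traded for sums over all bijections, whose behaviour under relabelling is
-- immediate, at the price of factorials.
lemma sum_equiv_eq_sum_shuffle {W : Type*} [AddCommMonoid W] {a b m : ℕ}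
    (F : (Fin (a + b) ≃ Fin m) → W)
    (hF : ∀ (ρ : Equiv.Perm (Fin a)) (ρ' : Equiv.Perm (Fin b)) σ,
      F ((blockSum ρ ρ').trans σ) = F σ) :
    ∑ σ, F σ = (a.factorial * b.factorial) • ∑ σ, if IsShuffle a σ then F σ else 0 := by
  rw [← (shuffle_bijective a b m).sum_comp, Fintype.sum_prod_type]
  simp only [hF, Finset.sum_const, Finset.card_univ, Fintype.card_prod, Fintype.card_perm,
    Fintype.card_fin]
  rw [← Finset.smul_sum, ← Finset.sum_filter]
  congr 1
  exact (Finset.sum_subtype _ (by simp) _).symm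

end Shuffle

/-- The extension of a bijection by `i ↦ i'`. -/
def extendEquiv {m m' : ℕ} (i : Fin (m + 1)) (i' : Fin (m' + 1)) (σ : Fin m ≃ Fin m') :
    Fin (m + 1) ≃ Fin (m' + 1) :=
  (finSuccEquiv' i).trans ((Equiv.optionCongr σ).trans (finSuccEquiv' i').symm)

@[simp] lemma extendEquiv_self {m m' : ℕ} (i : Fin (m + 1)) (i' : Fin (m' + 1))
    (σ : Fin m ≃ Fin m') : extendEquiv i i' σ i = i' := by simp [extendEquiv]

@[simp] lemma extendEquiv_succAbove {m m' : ℕ} (i : Fin (m + 1)) (i' : Fin (m' + 1))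
    (σ : Fin m ≃ Fin m') (x : Fin m) :
    extendEquiv i i' σ (i.succAbove x) = i'.succAbove (σ x) := by simp [extendEquiv]

lemma inversionSign_extendEquiv {m m' : ℕ} (i : Fin (m + 1)) (i' : Fin (m' + 1))
    (σ : Fin m ≃ Fin m') : inversionSign (extendEquiv i i' σ) =
      inversionSign σ * ((-1) ^ (i : ℕ) * (-1) ^ (i' : ℕ)) := by
  rw [inversionSign_succAbove _ σ i (by simp), extendEquiv_self]

lemma units_smul_apply {k : Type*} [Field k] {V W : Type*} [AddCommGroup V] [Module k V] [AddCommGroup W] [Module k W]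
    (f : V →ₗ[k] W) (ε : ℤˣ) (x : V) : f (ε • x) = ε • f x := by
  rw [Units.smul_def, Units.smul_def, map_zsmul]

lemma units_smul_apply₂ {k : Type*} [Field k] {V V' W : Type*} [AddCommGroup V] [Module k V] [AddCommGroup V']
    [Module k V'] [AddCommGroup W] [Module k W]
    (f : V →ₗ[k] V' →ₗ[k] W) (ε : ℤˣ) (x : V) (y : V') : f (ε • x) y = ε • f x y :=
  units_smul_apply (f.flip y) ε x

lemma units_smul_linearMap_apply {k : Type*} [Field k] {V W : Type*} [AddCommGroup V] [Module k V]
    [AddCommGroup W] [Module k W] (f : V →ₗ[k] W) (ε : ℤˣ) (x : V) : (ε • f) x = ε • f x := by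
  rw [Units.smul_def, Units.smul_def, LinearMap.smul_apply]

/-! ### The corolla differential as a sum over all bijections, and its symmetry -/

namespace WheeledPropData

variable {k : Type u} [Field k] {P : WheeledPropData.{u, v} k}

/-- A family of functionals on operations that is skew-invariant under relabellings of outputs and
invariant under relabellings of inputs. -/
def IsCoinvariant {W : Type*} [AddCommGroup W] [Module k W]
    (φ : ∀ m n, P.carrier m n →ₗ[k] W) : Prop :=
  ∀ {m n m' n' : ℕ} (σ : Fin m ≃ Fin m') (τ : Fin n ≃ Fin n') (f : P.carrier m n),
    φ m' n' (P.act σ τ f) = inversionSign σ • φ m n f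

lemma corolla_act {c : ∀ m n, P.carrier m n} (hc : P.IsCorollaFamily c) {m n m' n' : ℕ}
    (σ : Fin m ≃ Fin m') (τ : Fin n ≃ Fin n') :
    P.act σ τ (c m n) = inversionSign σ • c m' n' := by
  obtain rfl : m = m' := by simpa using Fintype.card_congr σ
  obtain rfl : n = n' := by simpa using Fintype.card_congr τ
  rw [inversionSign_perm]
  exact hc.act m n σ τ

namespace IsWheeledProp

variable (hP : P.IsWheeledProp)
include hP

/-- The relabellings of the two factors have to respect the legs to be joined, which is what
`extendEquiv` arranges. The statement is then the equivariance of the contraction for the bijections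
`σ`, `θ` induced on the legs of the horizontal composite. -/
lemma graft_act {a b l r a' b' l' r' : ℕ} (ρ : Fin a ≃ Fin a') (ρ' : Fin b ≃ Fin b')
    (τ : Fin l ≃ Fin l') (τ' : Fin r ≃ Fin r') (f : P.carrier (a + 1) l)
    (g : P.carrier b (r + 1)) :
    P.graft (P.act (extendEquiv (Fin.last a) (Fin.last a') ρ) τ f)
      (P.act ρ' (extendEquiv 0 0 τ') g) =
      P.act (blockSum ρ ρ') (blockSum τ τ') (P.graft f g) := by
  unfold graft
  rw [hP.hcomp_act, hP.act_act]
  let σ : Fin (a + b + 1) ≃ Fin (a' + b' + 1) :=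
    (finCongr (Nat.add_right_comm a 1 b)).symm.trans
      ((blockSum (extendEquiv (Fin.last a) (Fin.last a') ρ) ρ').trans
        (finCongr (Nat.add_right_comm a' 1 b')))
  let θ : Fin (l + r + 1) ≃ Fin (l' + r' + 1) :=
    (finCongr (Nat.add_assoc l r 1)).trans
      ((blockSum τ (extendEquiv 0 0 τ')).trans (finCongr (Nat.add_assoc l' r' 1).symm))
  have hσ1 : σ ⟨a, by omega⟩ = ⟨a', by omega⟩ := by
    have h : (finCongr (Nat.add_right_comm a 1 b)).symm ⟨a, by omega⟩ =
        Fin.castAdd b (Fin.last a) := rfl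
    simp only [σ, Equiv.trans_apply, h, blockSum_castAdd, extendEquiv_self]
    rfl
  have hθ1 : θ ⟨l, by omega⟩ = ⟨l', by omega⟩ := by
    have h : (finCongr (Nat.add_assoc l r 1)) ⟨l, by omega⟩ =
        Fin.natAdd l (0 : Fin (r + 1)) := by ext; simp
    simp only [θ, Equiv.trans_apply, h, blockSum_natAdd, extendEquiv_self]
    ext; simp
  have key := hP.contract_act σ θ (blockSum ρ ρ') (blockSum τ τ') ⟨a, by omega⟩ ⟨l, by omega⟩
    ?_ ?_ (P.act (finCongr (Nat.add_right_comm a 1 b)) (finCongr (Nat.add_assoc l r 1).symm)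
      (P.hcomp f g))
  · rw [hσ1, hθ1, hP.act_act] at key
    rw [← key]
    congr 1
  · intro x
    rw [hσ1]
    induction x using Fin.addCases with
    | left x =>
      have h : (finCongr (Nat.add_right_comm a 1 b)).symm
          (Fin.succAbove (⟨a, by omega⟩ : Fin (a + b + 1)) (Fin.castAdd b x)) =
          Fin.castAdd b ((Fin.last a).succAbove x) := by
        ext; simp [Fin.succAbove, Fin.lt_def]
      simp only [σ, Equiv.trans_apply, h, blockSum_castAdd, extendEquiv_succAbove]
      ext; simp [Fin.succAbove, Fin.lt_def]
    | right x =>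
      have h : (finCongr (Nat.add_right_comm a 1 b)).symm
          (Fin.succAbove (⟨a, by omega⟩ : Fin (a + b + 1)) (Fin.natAdd a x)) =
          Fin.natAdd (a + 1) x := by
        ext; simp [Fin.succAbove, Fin.lt_def]; omega
      simp only [σ, Equiv.trans_apply, h, blockSum_natAdd]
      ext; simp [Fin.succAbove, Fin.lt_def]; omega
  · intro x
    rw [hθ1]
    induction x using Fin.addCases with
    | left x =>
      have h : (finCongr (Nat.add_assoc l r 1))
          (Fin.succAbove (⟨l, by omega⟩ : Fin (l + r + 1)) (Fin.castAdd r x)) =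
          Fin.castAdd (r + 1) x := by
        ext; simp [Fin.succAbove, Fin.lt_def]
      simp only [θ, Equiv.trans_apply, h, blockSum_castAdd]
      ext; simp [Fin.succAbove, Fin.lt_def]
    | right x =>
      have h : (finCongr (Nat.add_assoc l r 1))
          (Fin.succAbove (⟨l, by omega⟩ : Fin (l + r + 1)) (Fin.natAdd l x)) =
          Fin.natAdd l ((0 : Fin (r + 1)).succAbove x) := by
        ext; simp [Fin.succAbove, Fin.lt_def]; omega
      simp only [θ, Equiv.trans_apply, h, blockSum_natAdd, extendEquiv_succAbove]
      ext; simp [Fin.succAbove, Fin.lt_def]; omega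


/-- Extending a permutation by fixing the last output adds no inversion, and inputs cost no sign, so
the symmetry of the two corollas survives the grafting with the sign of the block permutation. -/
lemma graft_corolla_act {c : ∀ m n, P.carrier m n} (hc : P.IsCorollaFamily c) {a b l r : ℕ}
    (ρ : Equiv.Perm (Fin a)) (ρ' : Equiv.Perm (Fin b)) (τ : Equiv.Perm (Fin l))
    (τ' : Equiv.Perm (Fin r)) :
    P.act (blockSum ρ ρ') (blockSum τ τ') (P.graft (c (a + 1) l) (c b (r + 1))) =
      inversionSign (blockSum ρ ρ') • P.graft (c (a + 1) l) (c b (r + 1)) := by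
  rw [← hP.graft_act, corolla_act hc, corolla_act hc, inversionSign_extendEquiv,
    inversionSign_blockSum]
  have h : ((-1 : ℤˣ) ^ ((Fin.last a : Fin (a + 1)) : ℕ) * (-1) ^ ((Fin.last a : Fin (a + 1)) : ℕ))
      = 1 := by rw [← mul_pow]; simp
  rw [h, mul_one]
  unfold graft
  rw [units_smul_apply₂]
  simp only [units_smul_apply, smul_smul]

open scoped Classical in
-- Permuting the legs inside the blocks changes the graft and `inversionSign σ` by the same sign, so
-- the summand is constant on each coset of block permutations, and these are represented by
-- shuffles.
lemma graftSum_eq [CharZero k] {c : ∀ m n, P.carrier m n} (hc : P.IsCorollaFamily c)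
    (a b l r m n : ℕ) :
    (∑ σ : Fin (a + b) ≃ Fin m, ∑ τ : Fin (l + r) ≃ Fin n,
      if IsShuffle a σ ∧ IsShuffle l τ then
        (inversionSign σ * (-1) ^ (a * b)) •
          P.act σ τ (P.graft (c (a + 1) l) (c b (r + 1)))
      else 0) =
    ((a.factorial : k) * b.factorial * (l.factorial * r.factorial))⁻¹ •
      (-1 : ℤˣ) ^ (a * b) • ∑ σ : Fin (a + b) ≃ Fin m, ∑ τ : Fin (l + r) ≃ Fin n,
        inversionSign σ • P.act σ τ (P.graft (c (a + 1) l) (c b (r + 1))) := by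
  set G := P.graft (c (a + 1) l) (c b (r + 1)) with hG
  have hρ : ∀ (ρ : Equiv.Perm (Fin a)) (ρ' : Equiv.Perm (Fin b)) (σ : Fin (a + b) ≃ Fin m)
      (τ : Fin (l + r) ≃ Fin n), P.act ((blockSum ρ ρ').trans σ) τ G =
        inversionSign (blockSum ρ ρ') • P.act σ τ G := by
    intro ρ ρ' σ τ
    have h := hP.graft_corolla_act hc ρ ρ' (Equiv.refl (Fin l)) (Equiv.refl (Fin r))
    have h2 := hP.act_act (blockSum ρ ρ') (blockSum (Equiv.refl (Fin l)) (Equiv.refl (Fin r))) σ τ G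
    rw [hG, h, units_smul_apply, ← hG, blockSum_refl, Equiv.refl_trans] at h2
    exact h2.symm
  have hτ : ∀ (ρ : Equiv.Perm (Fin l)) (ρ' : Equiv.Perm (Fin r)) (σ : Fin (a + b) ≃ Fin m)
      (τ : Fin (l + r) ≃ Fin n), P.act σ ((blockSum ρ ρ').trans τ) G = P.act σ τ G := by
    intro ρ ρ' σ τ
    have h := hP.graft_corolla_act hc (Equiv.refl (Fin a)) (Equiv.refl (Fin b)) ρ ρ'
    have h2 := hP.act_act (blockSum (Equiv.refl (Fin a)) (Equiv.refl (Fin b))) (blockSum ρ ρ') σ τ G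
    rw [hG, h, units_smul_apply, ← hG, blockSum_refl, Equiv.refl_trans, inversionSign_refl,
      one_smul] at h2
    exact h2.symm
  have h1 : ∀ σ : Fin (a + b) ≃ Fin m, ∑ τ : Fin (l + r) ≃ Fin n, inversionSign σ • P.act σ τ G =
      (l.factorial * r.factorial) • ∑ τ : Fin (l + r) ≃ Fin n,
        if IsShuffle l τ then inversionSign σ • P.act σ τ G else 0 := fun σ =>
    sum_equiv_eq_sum_shuffle _ fun ρ ρ' τ => by rw [hτ]
  rw [sum_equiv_eq_sum_shuffle (a := a) (b := b)
    (fun σ => ∑ τ : Fin (l + r) ≃ Fin n, inversionSign σ • P.act σ τ G)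
    (fun ρ ρ' σ => Finset.sum_congr rfl fun τ _ => by
      rw [hρ, smul_smul, inversionSign_trans, mul_right_comm, inversionSign_mul_self, one_mul])]
  simp only [h1]
  have hfac : ((a.factorial : k) * b.factorial * (l.factorial * r.factorial)) ≠ 0 := by
    simp [Nat.factorial_ne_zero]
  rw [eq_inv_smul_iff₀ hfac]
  simp only [Units.smul_def, ← Nat.cast_smul_eq_nsmul k, ← Int.cast_smul_eq_zsmul k,
    Finset.smul_sum, smul_ite, smul_zero]
  refine Finset.sum_congr rfl fun σ _ => ?_
  by_cases hs : IsShuffle a σ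
  · simp only [hs, true_and, if_true]
    refine Finset.sum_congr rfl fun τ _ => ?_
    split_ifs
    · simp only [smul_smul]
      congr 1
      push_cast
      ring
    · simp
  · simp [hs]

lemma corollaDifferential_eq [CharZero k] {c : ∀ m n, P.carrier m n} (hc : P.IsCorollaFamily c)
    (m n : ℕ) :
    P.corollaDifferential c m n =
      (∑ ab ∈ Finset.HasAntidiagonal.antidiagonal m, ∑ lr ∈ Finset.HasAntidiagonal.antidiagonal n,
        ((ab.1.factorial : k) * ab.2.factorial * (lr.1.factorial * lr.2.factorial))⁻¹ •
          (-1 : ℤˣ) ^ (ab.1 * ab.2) •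
            ∑ σ : Fin (ab.1 + ab.2) ≃ Fin m, ∑ τ : Fin (lr.1 + lr.2) ≃ Fin n,
              inversionSign σ • P.act σ τ (P.graft (c (ab.1 + 1) lr.1) (c ab.2 (lr.2 + 1)))) +
      ((-1 : ℤˣ) ^ m) • P.contract 0 0 (c (m + 1) (n + 1)) := by
  unfold corollaDifferential
  simp only [hP.graftSum_eq hc]

/-- The corolla differential is skew-symmetric in the outputs and symmetric in the inputs. -/
lemma corollaDifferential_act [CharZero k] {c : ∀ m n, P.carrier m n} (hc : P.IsCorollaFamily c)
    {m n m' n' : ℕ} (σ : Fin m ≃ Fin m') (τ : Fin n ≃ Fin n') :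
    P.act σ τ (P.corollaDifferential c m n) =
      inversionSign σ • P.corollaDifferential c m' n' := by
  obtain rfl : m = m' := by simpa using Fintype.card_congr σ
  obtain rfl : n = n' := by simpa using Fintype.card_congr τ
  have hgr : ∀ ab lr : ℕ × ℕ, P.act σ τ (∑ θ : Fin (ab.1 + ab.2) ≃ Fin m,
      ∑ η : Fin (lr.1 + lr.2) ≃ Fin n,
        inversionSign θ • P.act θ η (P.graft (c (ab.1 + 1) lr.1) (c ab.2 (lr.2 + 1)))) =
      inversionSign σ • ∑ θ : Fin (ab.1 + ab.2) ≃ Fin m, ∑ η : Fin (lr.1 + lr.2) ≃ Fin n,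
        inversionSign θ • P.act θ η (P.graft (c (ab.1 + 1) lr.1) (c ab.2 (lr.2 + 1))) := by
    intro ab lr
    simp only [map_sum, units_smul_apply, hP.act_act, Finset.smul_sum]
    refine Fintype.sum_equiv (Equiv.equivCongr (Equiv.refl _) σ) _ _ fun θ => ?_
    refine Fintype.sum_equiv (Equiv.equivCongr (Equiv.refl _) τ) _ _ fun η => ?_
    have h1 : (Equiv.equivCongr (Equiv.refl _) σ) θ = θ.trans σ := rfl
    have h2 : (Equiv.equivCongr (Equiv.refl _) τ) η = η.trans τ := rfl
    rw [h1, h2, smul_smul, inversionSign_trans, mul_comm, mul_assoc, inversionSign_mul_self,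
      mul_one]
  simp only [hP.corollaDifferential_eq hc, map_add, map_sum, map_smul, units_smul_apply, smul_add,
    hgr]
  congr 1
  · rw [Finset.smul_sum]
    refine Finset.sum_congr rfl fun ab _ => ?_
    rw [Finset.smul_sum]
    refine Finset.sum_congr rfl fun lr _ => ?_
    rw [smul_comm (inversionSign σ), smul_comm (inversionSign σ)]
  · rw [← hP.contract_act (extendEquiv 0 0 σ) (extendEquiv 0 0 τ) σ τ 0 0 (fun x => by rw [extendEquiv_self, extendEquiv_succAbove])
      (fun x => by rw [extendEquiv_self, extendEquiv_succAbove]),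
      corolla_act hc, inversionSign_extendEquiv, extendEquiv_self, extendEquiv_self,
      units_smul_apply, smul_comm]
    simp

/-- For a coinvariant functional the m! n! relabellings of a graph contribute equally. What is left
are the inverse factorials of the block sizes, which are the coefficients of a product of
exponential generating series. -/
lemma coinvariant_corollaDifferential [CharZero k] {W : Type*} [AddCommGroup W] [Module k W]
    {φ : ∀ m n, P.carrier m n →ₗ[k] W} (hφ : IsCoinvariant φ)
    {c : ∀ m n, P.carrier m n} (hc : P.IsCorollaFamily c) (m n : ℕ) :
    ((m.factorial : k) * n.factorial)⁻¹ • φ m n (P.corollaDifferential c m n) =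
      (∑ ab ∈ Finset.HasAntidiagonal.antidiagonal m, ∑ lr ∈ Finset.HasAntidiagonal.antidiagonal n,
        ((ab.1.factorial : k) * ab.2.factorial * (lr.1.factorial * lr.2.factorial))⁻¹ •
          (-1 : ℤˣ) ^ (ab.1 * ab.2) •
            φ _ _ (P.graft (c (ab.1 + 1) lr.1) (c ab.2 (lr.2 + 1)))) +
      ((m.factorial : k) * n.factorial)⁻¹ •
        ((-1 : ℤˣ) ^ m) • φ m n (P.contract 0 0 (c (m + 1) (n + 1))) := by
  have hfac : ((m.factorial : k) * n.factorial) ≠ 0 := by simp [Nat.factorial_ne_zero]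
  rw [hP.corollaDifferential_eq hc, map_add, units_smul_apply, smul_add]
  congr 1
  rw [map_sum, Finset.smul_sum]
  refine Finset.sum_congr rfl fun ab hab => ?_
  rw [map_sum, Finset.smul_sum]
  refine Finset.sum_congr rfl fun lr hlr => ?_
  obtain ⟨a, b⟩ := ab
  obtain ⟨l, r⟩ := lr
  obtain rfl : a + b = m := by simpa using hab
  obtain rfl : l + r = n := by simpa using hlr
  simp only [map_smul, units_smul_apply, map_sum, hφ _ _ _, smul_smul, inversionSign_mul_self,
    one_smul, Finset.sum_const, Finset.card_univ, Fintype.card_perm, Fintype.card_fin]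
  rw [smul_comm ((-1 : ℤˣ) ^ (a * b)) ((a + b).factorial * (l + r).factorial),
    ← Nat.cast_smul_eq_nsmul k, smul_smul]
  congr 1
  rw [Nat.cast_mul, mul_right_comm, inv_mul_cancel₀ hfac, one_mul]

end IsWheeledProp

end WheeledPropData

/-! ### The free wheeled PROP on corollas -/

/-- Formal composites of corollas. -/
inductive WheeledTerm : ℕ → ℕ → Type
  | corolla (m n : ℕ) : WheeledTerm m n
  | act {m n m' n' : ℕ} (σ : Fin m ≃ Fin m') (τ : Fin n ≃ Fin n') (t : WheeledTerm m n) :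
      WheeledTerm m' n'
  | hcomp {m n m' n' : ℕ} (t : WheeledTerm m n) (t' : WheeledTerm m' n') :
      WheeledTerm (m + m') (n + n')
  | contract {m n : ℕ} (i : Fin (m + 1)) (j : Fin (n + 1)) (t : WheeledTerm (m + 1) (n + 1)) :
      WheeledTerm m n
  | one : WheeledTerm 1 1
  | empty : WheeledTerm 0 0

namespace WheeledTerm

/-- The parity of a formal composite. -/
def deg : ∀ {m n : ℕ}, WheeledTerm m n → ZMod 2
  | _, _, corolla m _ => m
  | _, _, act _ _ t => t.deg
  | _, _, hcomp t t' => t.deg + t'.deg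
  | _, _, contract _ _ t => t.deg
  | _, _, one => 0
  | _, _, empty => 0

/-- `Rel t t' ε` says that `t = ε t'` follows from the axioms of wheeled PROPs and the symmetry of
the corollas. -/
inductive Rel : ∀ {m n : ℕ}, WheeledTerm m n → WheeledTerm m n → ℤˣ → Prop
  | corolla_act (m n : ℕ) (σ : Equiv.Perm (Fin m)) (τ : Equiv.Perm (Fin n)) :
      Rel (act σ τ (corolla m n)) (corolla m n) (Equiv.Perm.sign σ)
  | act_congr {m n m' n' : ℕ} (σ : Fin m ≃ Fin m') (τ : Fin n ≃ Fin n') {t t' : WheeledTerm m n}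
      {ε : ℤˣ} : Rel t t' ε → Rel (act σ τ t) (act σ τ t') ε
  | hcomp_left {m n m' n' : ℕ} {t t' : WheeledTerm m n} (s : WheeledTerm m' n') {ε : ℤˣ} :
      Rel t t' ε → Rel (hcomp t s) (hcomp t' s) ε
  | hcomp_right {m n m' n' : ℕ} (s : WheeledTerm m n) {t t' : WheeledTerm m' n'} {ε : ℤˣ} :
      Rel t t' ε → Rel (hcomp s t) (hcomp s t') ε
  | contract_congr {m n : ℕ} (i : Fin (m + 1)) (j : Fin (n + 1))
      {t t' : WheeledTerm (m + 1) (n + 1)} {ε : ℤˣ} :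
      Rel t t' ε → Rel (contract i j t) (contract i j t') ε
  | act_refl {m n : ℕ} (t : WheeledTerm m n) : Rel (act (Equiv.refl _) (Equiv.refl _) t) t 1
  | act_act {m n m' n' m'' n'' : ℕ} (σ : Fin m ≃ Fin m') (τ : Fin n ≃ Fin n')
      (σ' : Fin m' ≃ Fin m'') (τ' : Fin n' ≃ Fin n'') (t : WheeledTerm m n) :
      Rel (act σ' τ' (act σ τ t)) (act (σ.trans σ') (τ.trans τ') t) 1
  | hcomp_act {m n m' n' a b a' b' : ℕ} (σ : Fin m ≃ Fin m') (τ : Fin n ≃ Fin n')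
      (σ' : Fin a ≃ Fin a') (τ' : Fin b ≃ Fin b') (t : WheeledTerm m n) (t' : WheeledTerm a b) :
      Rel (hcomp (act σ τ t) (act σ' τ' t')) (act (blockSum σ σ') (blockSum τ τ') (hcomp t t')) 1
  | hcomp_assoc {m n m' n' m'' n'' : ℕ} (t : WheeledTerm m n) (t' : WheeledTerm m' n')
      (t'' : WheeledTerm m'' n'') :
      Rel (act (finCongr (Nat.add_assoc m m' m'')) (finCongr (Nat.add_assoc n n' n''))
        (hcomp (hcomp t t') t'')) (hcomp t (hcomp t' t'')) 1
  | empty_hcomp {m n : ℕ} (t : WheeledTerm m n) :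
      Rel (act (finCongr (Nat.zero_add m)) (finCongr (Nat.zero_add n)) (hcomp empty t)) t 1
  | hcomp_comm {m n m' n' : ℕ} (t : WheeledTerm m n) (t' : WheeledTerm m' n') :
      Rel (act finAddFlip finAddFlip (hcomp t t')) (hcomp t' t) ((-1) ^ (t.deg * t'.deg))
  | contract_act {m n m' n' : ℕ} (σ : Fin (m + 1) ≃ Fin (m' + 1))
      (τ : Fin (n + 1) ≃ Fin (n' + 1)) (σ' : Fin m ≃ Fin m') (τ' : Fin n ≃ Fin n')
      (i : Fin (m + 1)) (j : Fin (n + 1))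
      (hσ : ∀ x, σ (i.succAbove x) = (σ i).succAbove (σ' x))
      (hτ : ∀ x, τ (j.succAbove x) = (τ j).succAbove (τ' x)) (t : WheeledTerm (m + 1) (n + 1)) :
      Rel (contract (σ i) (τ j) (act σ τ t)) (act σ' τ' (contract i j t)) 1
  | contract_contract {m n : ℕ} (i : Fin (m + 2)) (j : Fin (n + 2)) (i' : Fin (m + 1))
      (j' : Fin (n + 1)) (t : WheeledTerm (m + 2) (n + 2)) :
      Rel (contract i' j' (contract i j t)) (contract (i'.predAbove i) (j'.predAbove j)
        (contract (i.succAbove i') (j.succAbove j') t)) 1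
  | contract_hcomp {m n a b : ℕ} (i : Fin (m + 1)) (j : Fin (n + 1))
      (t : WheeledTerm (m + 1) (n + 1)) (t' : WheeledTerm a b) :
      Rel (contract (finCongr (Nat.add_right_comm m 1 a) (Fin.castAdd a i))
        (finCongr (Nat.add_right_comm n 1 b) (Fin.castAdd b j))
        (act (finCongr (Nat.add_right_comm m 1 a)) (finCongr (Nat.add_right_comm n 1 b))
          (hcomp t t'))) (hcomp (contract i j t) t') 1
  | one_input {m n : ℕ} (t : WheeledTerm m (n + 1)) :
      Rel (contract 0 1 (act (finCongr (Nat.add_comm 1 m)) (finCongr (Nat.add_comm 1 (n + 1)))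
        (hcomp one t))) t 1
  | one_output {m n : ℕ} (t : WheeledTerm (m + 1) n) :
      Rel (contract 1 0 (act (finCongr (Nat.add_comm 1 (m + 1))) (finCongr (Nat.add_comm 1 n))
        (hcomp one t))) t 1

/-- The relations are homogeneous, so the parity of terms grades the quotient. -/
lemma Rel.deg_eq {m n : ℕ} {t t' : WheeledTerm m n} {ε : ℤˣ} (h : Rel t t' ε) :
    t.deg = t'.deg := by
  induction h <;> simp_all [deg, add_assoc, add_comm]

end WheeledTerm

open WheeledTerm

section Free

variable (k : Type u) [Field k]

/-- The relations of the free wheeled PROP. -/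
def freeRelations (m n : ℕ) : Submodule k (WheeledTerm m n →₀ k) :=
  Submodule.span k {x | ∃ t t' ε, Rel t t' ε ∧
    x = Finsupp.single t 1 - ε • Finsupp.single t' 1}

/-- The operations of the free wheeled PROP. -/
abbrev FreeCarrier (m n : ℕ) : Type u :=
  (WheeledTerm m n →₀ k) ⧸ freeRelations k m n

/-- The class of a formal composite. -/
def termClass {m n : ℕ} (t : WheeledTerm m n) : FreeCarrier k m n :=
  Submodule.Quotient.mk (Finsupp.single t 1)

variable {k}

lemma termClass_rel {m n : ℕ} {t t' : WheeledTerm m n} {ε : ℤˣ} (h : Rel t t' ε) :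
    termClass k t = ε • termClass k t' := by
  have h1 : (Submodule.Quotient.mk (Finsupp.single t 1) : FreeCarrier k m n) =
      Submodule.Quotient.mk (ε • Finsupp.single t' 1) :=
    (Submodule.Quotient.eq _).2 (Submodule.subset_span ⟨t, t', ε, h, rfl⟩)
  rw [termClass, h1]
  exact units_smul_apply (freeRelations k m n).mkQ ε _

lemma FreeCarrier.ind {m n : ℕ} {p : FreeCarrier k m n → Prop}
    (cls : ∀ t, p (termClass k t)) (add : ∀ x y, p x → p y → p (x + y))
    (smul : ∀ (r : k) x, p x → p (r • x)) (x : FreeCarrier k m n) : p x := by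
  obtain ⟨y, rfl⟩ := Submodule.Quotient.mk_surjective _ x
  induction y using Finsupp.induction_linear with
  | zero =>
    -- Zero is obtained as a multiple of the class of some term. Every arity contains one, namely
    -- its corolla.
    have := smul 0 _ (cls (WheeledTerm.corolla m n))
    rwa [zero_smul] at this
  | add f g hf hg => exact add _ _ hf hg
  | single t r =>
    have := smul r _ (cls t)
    rwa [termClass, ← Submodule.Quotient.mk_smul, Finsupp.smul_single, smul_eq_mul, mul_one] at this

/-- Linear extension of a function on formal composites. -/
def freeLift {W : Type*} [AddCommGroup W] [Module k W] {m n : ℕ} (φ : WheeledTerm m n → W)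
    (hφ : ∀ t t' ε, Rel t t' ε → φ t = ε • φ t') : FreeCarrier k m n →ₗ[k] W :=
  (freeRelations k m n).liftQ (Finsupp.linearCombination k φ) (by
    rw [freeRelations, Submodule.span_le]
    rintro _ ⟨t, t', ε, h, rfl⟩
    rw [SetLike.mem_coe, LinearMap.mem_ker, map_sub, units_smul_apply]
    simp [hφ t t' ε h])

@[simp] lemma freeLift_termClass {W : Type*} [AddCommGroup W] [Module k W] {m n : ℕ}
    (φ : WheeledTerm m n → W) (hφ : ∀ t t' ε, Rel t t' ε → φ t = ε • φ t') (t : WheeledTerm m n) :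
    freeLift (k := k) φ hφ (termClass k t) = φ t := by
  simp [freeLift, termClass]

lemma FreeCarrier.hom_ext {W : Type*} [AddCommGroup W] [Module k W] {m n : ℕ}
    {f g : FreeCarrier k m n →ₗ[k] W} (h : ∀ t, f (termClass k t) = g (termClass k t)) : f = g := by
  refine LinearMap.ext fun x => ?_
  induction x using FreeCarrier.ind with
  | cls t => exact h t
  | add x y hx hy => rw [map_add, map_add, hx, hy]
  | smul r x hx => rw [map_smul, map_smul, hx]

variable (k)

/-- The horizontal composition with a formal composite. -/
def freeHcompLeft {m n m' n' : ℕ} (t : WheeledTerm m n) :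
    FreeCarrier k m' n' →ₗ[k] FreeCarrier k (m + m') (n + n') :=
  freeLift (fun t' => termClass k (WheeledTerm.hcomp t t'))
    fun _ _ _ h => termClass_rel (.hcomp_right t h)

/-- The horizontal composition of the free wheeled PROP. -/
def freeHcomp {m n m' n' : ℕ} :
    FreeCarrier k m n →ₗ[k] FreeCarrier k m' n' →ₗ[k] FreeCarrier k (m + m') (n + n') :=
  freeLift (fun t => freeHcompLeft k t) fun t t' ε h => FreeCarrier.hom_ext fun s => by
    rw [freeHcompLeft, freeLift_termClass, termClass_rel (.hcomp_left s h)]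
    simp [freeHcompLeft, Units.smul_def]

/-- The data of the free wheeled PROP. -/
def freeData : WheeledPropData.{u, u} k where
  carrier := FreeCarrier k
  gr m n q := Submodule.span k {x | ∃ t : WheeledTerm m n, t.deg = q ∧ termClass k t = x}
  act σ τ := freeLift (fun t => termClass k (WheeledTerm.act σ τ t))
    fun _ _ _ h => termClass_rel (.act_congr σ τ h)
  hcomp := freeHcomp k
  contract i j := freeLift (fun t => termClass k (WheeledTerm.contract i j t))
    fun _ _ _ h => termClass_rel (.contract_congr i j h)
  one := termClass k .one
  empty := termClass k .empty

variable {k}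

/-- The class of a formal composite, as an operation of the free wheeled PROP. -/
def freeCls (k : Type u) [Field k] {m n : ℕ} (t : WheeledTerm m n) : (freeData k).carrier m n :=
  termClass k t

/-- The corollas of the free wheeled PROP. -/
def freeCorolla (k : Type u) [Field k] (m n : ℕ) : (freeData k).carrier m n :=
  freeCls k (.corolla m n)

lemma freeCls_rel {m n : ℕ} {t t' : WheeledTerm m n} {ε : ℤˣ} (h : Rel t t' ε) :
    freeCls k t = ε • freeCls k t' := termClass_rel h

lemma freeCls_rel_one {m n : ℕ} {t t' : WheeledTerm m n} (h : Rel t t' 1) :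
    freeCls k t = freeCls k t' := by simpa using freeCls_rel (k := k) h

lemma freeData_ind {m n : ℕ} {p : (freeData k).carrier m n → Prop}
    (cls : ∀ t, p (freeCls k t)) (add : ∀ x y, p x → p y → p (x + y))
    (smul : ∀ (r : k) x, p x → p (r • x)) (x : (freeData k).carrier m n) : p x :=
  FreeCarrier.ind cls add smul x

@[simp] lemma freeData_act {m n m' n' : ℕ} (σ : Fin m ≃ Fin m') (τ : Fin n ≃ Fin n')
    (t : WheeledTerm m n) :
    (freeData k).act σ τ (freeCls k t) = freeCls k (WheeledTerm.act σ τ t) :=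
  freeLift_termClass (fun t => termClass k (WheeledTerm.act σ τ t))
    (fun _ _ _ h => termClass_rel (.act_congr σ τ h)) t

@[simp] lemma freeData_hcomp {m n m' n' : ℕ} (t : WheeledTerm m n) (t' : WheeledTerm m' n') :
    (freeData k).hcomp (freeCls k t) (freeCls k t') = freeCls k (WheeledTerm.hcomp t t') := by
  show freeHcomp k (termClass k t) (termClass k t') = termClass k (WheeledTerm.hcomp t t')
  rw [freeHcomp, freeLift_termClass, freeHcompLeft, freeLift_termClass]

@[simp] lemma freeData_contract {m n : ℕ} (i : Fin (m + 1)) (j : Fin (n + 1))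
    (t : WheeledTerm (m + 1) (n + 1)) :
    (freeData k).contract i j (freeCls k t) = freeCls k (WheeledTerm.contract i j t) :=
  freeLift_termClass (fun t => termClass k (WheeledTerm.contract i j t))
    (fun _ _ _ h => termClass_rel (.contract_congr i j h)) t

lemma freeData_one : (freeData k).one = freeCls k .one := rfl

lemma freeData_empty : (freeData k).empty = freeCls k .empty := rfl

/-- Linear maps out of the free wheeled PROP. -/
def freeMap {W : Type*} [AddCommGroup W] [Module k W] {m n : ℕ} (φ : WheeledTerm m n → W)
    (hφ : ∀ t t' ε, Rel t t' ε → φ t = ε • φ t') : (freeData k).carrier m n →ₗ[k] W :=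
  (show FreeCarrier k m n →ₗ[k] W from freeLift φ hφ)

@[simp] lemma freeMap_freeCls {W : Type*} [AddCommGroup W] [Module k W] {m n : ℕ}
    (φ : WheeledTerm m n → W) (hφ : ∀ t t' ε, Rel t t' ε → φ t = ε • φ t') (t : WheeledTerm m n) :
    freeMap (k := k) φ hφ (freeCls k t) = φ t :=
  freeLift_termClass (k := k) φ hφ t

lemma freeData_hom_ext {W : Type*} [AddCommGroup W] [Module k W] {m n : ℕ}
    {f g : (freeData k).carrier m n →ₗ[k] W} (h : ∀ t, f (freeCls k t) = g (freeCls k t)) : f = g :=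
  LinearMap.ext fun x => by
    induction x using freeData_ind with
    | cls t => exact h t
    | add x y hx hy => rw [map_add, map_add, hx, hy]
    | smul r x hx => rw [map_smul, map_smul, hx]

lemma freeCls_mem {m n : ℕ} (t : WheeledTerm m n) : freeCls k t ∈ (freeData k).gr m n t.deg := by
  show termClass k t ∈ Submodule.span k {x : FreeCarrier k m n |
    ∃ t' : WheeledTerm m n, t'.deg = t.deg ∧ termClass k t' = x}
  exact Submodule.subset_span ⟨t, rfl, rfl⟩

lemma free_gr_induction {m n : ℕ} {q : ZMod 2} {p : (freeData k).carrier m n → Prop}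
    (cls : ∀ t : WheeledTerm m n, t.deg = q → p (freeCls k t)) (zero : p 0)
    (add : ∀ x y, p x → p y → p (x + y)) (smul : ∀ (r : k) x, p x → p (r • x))
    {f : (freeData k).carrier m n} (hf : f ∈ (freeData k).gr m n q) : p f := by
  have hf' : (f : FreeCarrier k m n) ∈ Submodule.span k {x : FreeCarrier k m n |
    ∃ t' : WheeledTerm m n, t'.deg = q ∧ termClass k t' = x} := hf
  refine Submodule.span_induction (M := FreeCarrier k m n) (p := fun x _ => p x) ?_ zero
    (fun x y _ _ => add x y) (fun r x _ => smul r x) hf'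
  rintro _ ⟨t, ht, rfl⟩
  exact cls t ht

/-- The inverse of the canonical map sends the class of a term into the summand of its parity. It is
well defined because relations preserve parities. -/
lemma free_isInternal (m n : ℕ) : DirectSum.IsInternal ((freeData k).gr m n) := by
  let dec : (freeData k).carrier m n →ₗ[k] DirectSum (ZMod 2) (fun q => (freeData k).gr m n q) :=
    freeMap (fun t => DirectSum.lof k (ZMod 2) (fun q => (freeData k).gr m n q) t.deg
      ⟨freeCls k t, freeCls_mem t⟩) (by
      intro t t' ε h
      have hd := h.deg_eq
      have h2 := freeCls_rel (k := k) h
      -- The parities of `t` and `t'` are equal only by a proof, so the index is generalised before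
      -- it is identified with `t'.deg`.
      have h3 : ∀ (q : ZMod 2) (hq : q = t'.deg) (hm : freeCls k t ∈ (freeData k).gr m n q),
          DirectSum.lof k (ZMod 2) (fun q => (freeData k).gr m n q) q ⟨freeCls k t, hm⟩ =
          ε • DirectSum.lof k (ZMod 2) (fun q => (freeData k).gr m n q) t'.deg
            ⟨freeCls k t', freeCls_mem t'⟩ := by
        rintro _ rfl hm
        rw [← units_smul_apply]
        congr 1
        exact Subtype.ext h2
      exact h3 _ hd _)
  have hdec : ∀ t, dec (freeCls k t) = DirectSum.lof k (ZMod 2) (fun q => (freeData k).gr m n q)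
      t.deg ⟨freeCls k t, freeCls_mem t⟩ := fun t => freeMap_freeCls _ _ t
  have h1 : ∀ x, DirectSum.coeLinearMap ((freeData k).gr m n) (dec x) = x := by
    intro x
    induction x using freeData_ind with
    | cls t => rw [hdec]; exact DirectSum.coeLinearMap_lof _ _ _
    | add x y hx hy => rw [map_add, map_add, hx, hy]
    | smul r x hx => rw [map_smul, map_smul, hx]
  have h2 : ∀ (q : ZMod 2) (x) (hx : x ∈ (freeData k).gr m n q),
      dec x = DirectSum.lof k (ZMod 2) (fun q => (freeData k).gr m n q) q ⟨x, hx⟩ := by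
    intro q x hx
    have : ∃ hx : x ∈ (freeData k).gr m n q,
        dec x = DirectSum.lof k (ZMod 2) (fun q => (freeData k).gr m n q) q ⟨x, hx⟩ := by
      refine free_gr_induction (p := fun x => ∃ hx : x ∈ (freeData k).gr m n q,
        dec x = DirectSum.lof k (ZMod 2) (fun q => (freeData k).gr m n q) q ⟨x, hx⟩)
        ?_ ?_ ?_ ?_ hx
      · rintro t rfl
        exact ⟨freeCls_mem t, hdec t⟩
      · exact ⟨zero_mem _, by rw [map_zero]; exact (map_zero _).symm⟩
      · rintro x y ⟨hx, hx'⟩ ⟨hy, hy'⟩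
        exact ⟨add_mem hx hy, by rw [map_add, hx', hy', ← map_add]; rfl⟩
      · rintro r x ⟨hx, hx'⟩
        exact ⟨Submodule.smul_mem _ r hx, by rw [map_smul, hx', ← map_smul]; rfl⟩
    exact this.2
  refine ⟨?_, fun x => ⟨dec x, h1 x⟩⟩
  refine Function.LeftInverse.injective (g := dec) fun y => ?_
  show dec (DirectSum.coeLinearMap ((freeData k).gr m n) y) = y
  induction y using DirectSum.induction_on with
  | zero => rw [map_zero, map_zero]
  | of q x =>
    have h3 : DirectSum.coeLinearMap ((freeData k).gr m n)
      (DirectSum.of (fun q => (freeData k).gr m n q) q x) = x := DirectSum.coeLinearMap_lof _ _ _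
    rw [h3, h2 q x x.2]
    rfl
  | add x y hx hy => rw [map_add, map_add, hx, hy]

/-- On classes of terms each axiom is one of the relations. It extends to all operations by
linearity, in the homogeneous parts for graded commutativity. -/
lemma free_isWheeledProp : (freeData k).IsWheeledProp where
  isInternal := free_isInternal
  act_mem σ τ q f hf := by
    refine free_gr_induction (p := fun f => (freeData k).act σ τ f ∈ (freeData k).gr _ _ q) (fun t ht => ?_) ?_ (fun x y hx hy => ?_)
      (fun r x hx => ?_) hf
    · rw [freeData_act, ← ht]; exact freeCls_mem (WheeledTerm.act σ τ t)
    · simp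
    · rw [map_add]; exact add_mem hx hy
    · rw [map_smul]; exact Submodule.smul_mem _ _ hx
  hcomp_mem q r f hf g hg := by
    refine free_gr_induction (p := fun f => (freeData k).hcomp f g ∈ (freeData k).gr _ _ (q + r)) (fun t ht => ?_) ?_ (fun x y hx hy => ?_)
      (fun r x hx => ?_) hf
    · refine free_gr_induction (p := fun g => (freeData k).hcomp (freeCls k t) g ∈ (freeData k).gr _ _ (q + r)) (fun t' ht' => ?_) ?_ (fun x y hx hy => ?_)
        (fun r x hx => ?_) hg
      · rw [freeData_hcomp, ← ht, ← ht']; exact freeCls_mem (WheeledTerm.hcomp t t')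
      · simp
      · rw [map_add]; exact add_mem hx hy
      · rw [map_smul]; exact Submodule.smul_mem _ _ hx
    · simp
    · rw [map_add]; exact add_mem hx hy
    · rw [map_smul]; exact Submodule.smul_mem _ _ hx
  contract_mem i j q f hf := by
    refine free_gr_induction (p := fun f => (freeData k).contract i j f ∈ (freeData k).gr _ _ q) (fun t ht => ?_) ?_ (fun x y hx hy => ?_)
      (fun r x hx => ?_) hf
    · rw [freeData_contract, ← ht]; exact freeCls_mem (WheeledTerm.contract i j t)
    · simp
    · rw [map_add]; exact add_mem hx hy
    · rw [map_smul]; exact Submodule.smul_mem _ _ hx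
  one_mem := freeCls_mem WheeledTerm.one
  empty_mem := freeCls_mem WheeledTerm.empty
  act_refl f := by
    induction f using freeData_ind with
    | cls t => rw [freeData_act]; exact freeCls_rel_one (.act_refl t)
    | add x y hx hy => rw [map_add, hx, hy]
    | smul r x hx => rw [map_smul, hx]
  act_act σ τ σ' τ' f := by
    induction f using freeData_ind with
    | cls t => simp only [freeData_act]; exact freeCls_rel_one (.act_act σ τ σ' τ' t)
    | add x y hx hy => simp only [map_add, hx, hy]
    | smul r x hx => simp only [map_smul, hx]
  hcomp_act σ τ σ' τ' f g := by
    induction f using freeData_ind with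
    | cls t =>
      induction g using freeData_ind with
      | cls t' =>
        simp only [freeData_act, freeData_hcomp]
        exact freeCls_rel_one (.hcomp_act σ τ σ' τ' t t')
      | add x y hx hy => simp only [map_add, hx, hy]
      | smul r x hx => simp only [map_smul, hx]
    | add x y hx hy => simp only [map_add, LinearMap.add_apply, hx, hy]
    | smul r x hx => simp only [map_smul, LinearMap.smul_apply, hx]
  hcomp_assoc f g h := by
    induction f using freeData_ind with
    | cls t =>
      induction g using freeData_ind with
      | cls t' =>
        induction h using freeData_ind with
        | cls t'' =>
          simp only [freeData_act, freeData_hcomp]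
          exact freeCls_rel_one (.hcomp_assoc t t' t'')
        | add x y hx hy => simp only [map_add, hx, hy]
        | smul r x hx => simp only [map_smul, hx]
      | add x y hx hy => simp only [map_add, LinearMap.add_apply, hx, hy]
      | smul r x hx => simp only [map_smul, LinearMap.smul_apply, hx]
    | add x y hx hy => simp only [map_add, LinearMap.add_apply, hx, hy]
    | smul r x hx => simp only [map_smul, LinearMap.smul_apply, hx]
  empty_hcomp f := by
    induction f using freeData_ind with
    | cls t =>
      simp only [freeData_empty, freeData_hcomp, freeData_act]
      exact freeCls_rel_one (.empty_hcomp t)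
    | add x y hx hy => simp only [map_add, hx, hy]
    | smul r x hx => simp only [map_smul, hx]
  hcomp_comm q r f hf g hg := by
    refine free_gr_induction (p := fun f => (freeData k).act finAddFlip finAddFlip ((freeData k).hcomp f g) =
        ((-1 : ℤˣ) ^ (q * r)) • (freeData k).hcomp g f) (fun t ht => ?_) ?_ (fun x y hx hy => ?_)
      (fun r x hx => ?_) hf
    · refine free_gr_induction (p := fun g => (freeData k).act finAddFlip finAddFlip ((freeData k).hcomp (freeCls k t) g) =
        ((-1 : ℤˣ) ^ (q * r)) • (freeData k).hcomp g (freeCls k t)) (fun t' ht' => ?_) ?_ (fun x y hx hy => ?_)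
        (fun r x hx => ?_) hg
      · simp only [freeData_act, freeData_hcomp, ← ht, ← ht']
        exact freeCls_rel (.hcomp_comm t t')
      · simp
      · simp only [map_add, LinearMap.add_apply, hx, hy, smul_add]
      · simp only [map_smul, LinearMap.smul_apply, hx]; rw [smul_comm]
    · simp
    · simp only [map_add, LinearMap.add_apply, hx, hy, smul_add]
    · simp only [map_smul, LinearMap.smul_apply, hx]; rw [smul_comm]
  contract_act σ τ σ' τ' i j hσ hτ f := by
    induction f using freeData_ind with
    | cls t =>
      simp only [freeData_act, freeData_contract]
      exact freeCls_rel_one (.contract_act σ τ σ' τ' i j hσ hτ t)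
    | add x y hx hy => simp only [map_add, hx, hy]
    | smul r x hx => simp only [map_smul, hx]
  contract_contract i j i' j' f := by
    induction f using freeData_ind with
    | cls t =>
      simp only [freeData_contract]
      exact freeCls_rel_one (.contract_contract i j i' j' t)
    | add x y hx hy => simp only [map_add, hx, hy]
    | smul r x hx => simp only [map_smul, hx]
  contract_hcomp i j f g := by
    induction f using freeData_ind with
    | cls t =>
      induction g using freeData_ind with
      | cls t' =>
        simp only [freeData_act, freeData_hcomp, freeData_contract]
        exact freeCls_rel_one (.contract_hcomp i j t t')
      | add x y hx hy => simp only [map_add, hx, hy]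
      | smul r x hx => simp only [map_smul, hx]
    | add x y hx hy => simp only [map_add, LinearMap.add_apply, hx, hy]
    | smul r x hx => simp only [map_smul, LinearMap.smul_apply, hx]
  one_input f := by
    induction f using freeData_ind with
    | cls t =>
      simp only [freeData_one, freeData_hcomp, freeData_act, freeData_contract]
      exact freeCls_rel_one (.one_input t)
    | add x y hx hy => simp only [map_add, hx, hy]
    | smul r x hx => simp only [map_smul, hx]
  one_output f := by
    induction f using freeData_ind with
    | cls t =>
      simp only [freeData_one, freeData_hcomp, freeData_act, freeData_contract]
      exact freeCls_rel_one (.one_output t)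
    | add x y hx hy => simp only [map_add, hx, hy]
    | smul r x hx => simp only [map_smul, hx]

end Free

open WheeledTerm

/-! ### The universal property of the free wheeled PROP -/

section FreeUniversal

variable {k : Type u} [Field k]

/-- The value of a formal composite in a wheeled PROP with chosen corollas. -/
def WheeledTerm.eval (Q : WheeledPropData.{u, w} k) (c : ∀ m n, Q.carrier m n) :
    ∀ {m n : ℕ}, WheeledTerm m n → Q.carrier m n
  | _, _, corolla m n => c m n
  | _, _, act σ τ t => Q.act σ τ (t.eval Q c)
  | _, _, hcomp t t' => Q.hcomp (t.eval Q c) (t'.eval Q c)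
  | _, _, contract i j t => Q.contract i j (t.eval Q c)
  | _, _, one => Q.one
  | _, _, empty => Q.empty

variable {Q : WheeledPropData.{u, w} k} (hQ : Q.IsWheeledProp) {c : ∀ m n, Q.carrier m n}
  (hc : Q.IsCorollaFamily c)

include hQ hc in
lemma WheeledTerm.eval_mem {m n : ℕ} (t : WheeledTerm m n) : t.eval Q c ∈ Q.gr m n t.deg := by
  induction t with
  | corolla m n => exact hc.mem m n
  | act σ τ t ih => exact hQ.act_mem σ τ _ _ ih
  | hcomp t t' ih ih' => exact hQ.hcomp_mem _ _ _ ih _ ih'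
  | contract i j t ih => exact hQ.contract_mem i j _ _ ih
  | one => exact hQ.one_mem
  | empty => exact hQ.empty_mem

include hQ hc in
-- Soundness of the relations: each is an instance of an axiom or of the symmetry of the chosen
-- corollas. The parity of a value is needed only for graded commutativity.
lemma WheeledTerm.eval_rel {m n : ℕ} {t t' : WheeledTerm m n} {ε : ℤˣ} (h : Rel t t' ε) :
    t.eval Q c = ε • t'.eval Q c := by
  induction h with
  | corolla_act m n σ τ => exact hc.act m n σ τ
  | act_congr σ τ _ ih => simp only [eval, ih, units_smul_apply]
  | hcomp_left s _ ih => simp only [eval, ih, units_smul_apply₂]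
  | hcomp_right s _ ih => simp only [eval, ih, units_smul_apply]
  | contract_congr i j _ ih => simp only [eval, ih, units_smul_apply]
  | act_refl t => rw [one_smul]; exact hQ.act_refl _
  | act_act σ τ σ' τ' t => rw [one_smul]; exact hQ.act_act _ _ _ _ _
  | hcomp_act σ τ σ' τ' t t' => rw [one_smul]; exact hQ.hcomp_act _ _ _ _ _ _
  | hcomp_assoc t t' t'' => rw [one_smul]; exact hQ.hcomp_assoc _ _ _
  | empty_hcomp t => rw [one_smul]; exact hQ.empty_hcomp _
  | hcomp_comm t t' => exact hQ.hcomp_comm _ _ _ (t.eval_mem hQ hc) _ (t'.eval_mem hQ hc)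
  | contract_act σ τ σ' τ' i j hσ hτ t =>
    rw [one_smul]; exact hQ.contract_act σ τ σ' τ' i j hσ hτ _
  | contract_contract i j i' j' t => rw [one_smul]; exact hQ.contract_contract i j i' j' _
  | contract_hcomp i j t t' => rw [one_smul]; exact hQ.contract_hcomp i j _ _
  | one_input t => rw [one_smul]; exact hQ.one_input _
  | one_output t => rw [one_smul]; exact hQ.one_output _

/-- The morphism from the free wheeled PROP determined by the images of the corollas. -/
def freeHom : WheeledPropData.Hom (freeData k) Q where
  map m n := freeMap (fun t => t.eval Q c) fun _ _ _ h => eval_rel hQ hc h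
  map_mem m n q f hf := by
    refine free_gr_induction (p := fun f => freeMap (fun t => t.eval Q c)
      (fun _ _ _ h => eval_rel hQ hc h) f ∈ Q.gr m n q) (fun t ht => ?_) ?_ (fun x y hx hy => ?_)
      (fun r x hx => ?_) hf
    · rw [freeMap_freeCls, ← ht]; exact t.eval_mem hQ hc
    · simp
    · rw [map_add]; exact add_mem hx hy
    · rw [map_smul]; exact Submodule.smul_mem _ _ hx
  map_act σ τ f := by
    induction f using freeData_ind with
    | cls t => rw [freeData_act, freeMap_freeCls, freeMap_freeCls, eval]
    | add x y hx hy => simp only [map_add, hx, hy]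
    | smul r x hx => simp only [map_smul, hx]
  map_hcomp f g := by
    induction f using freeData_ind with
    | cls t =>
      induction g using freeData_ind with
      | cls t' => rw [freeData_hcomp, freeMap_freeCls, freeMap_freeCls, freeMap_freeCls, eval]
      | add x y hx hy => simp only [map_add, hx, hy]
      | smul r x hx => simp only [map_smul, hx]
    | add x y hx hy => simp only [map_add, LinearMap.add_apply, hx, hy]
    | smul r x hx => simp only [map_smul, LinearMap.smul_apply, hx]
  map_contract i j f := by
    induction f using freeData_ind with
    | cls t => rw [freeData_contract, freeMap_freeCls, freeMap_freeCls, eval]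
    | add x y hx hy => simp only [map_add, hx, hy]
    | smul r x hx => simp only [map_smul, hx]
  map_one := by rw [freeData_one, freeMap_freeCls, eval]
  map_empty := by rw [freeData_empty, freeMap_freeCls, eval]

lemma freeHom_corolla (m n : ℕ) : (freeHom hQ hc).map m n (freeCorolla k m n) = c m n :=
  freeMap_freeCls (fun t => t.eval Q c) (fun _ _ _ h => eval_rel hQ hc h) (corolla m n)

omit hQ hc in
lemma freeHom_ext {φ ψ : WheeledPropData.Hom (freeData k) Q}
    (h : ∀ m n, φ.map m n (freeCorolla k m n) = ψ.map m n (freeCorolla k m n)) : φ = ψ := by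
  have h1 : ∀ {m n : ℕ} (t : WheeledTerm m n), φ.map m n (freeCls k t) = ψ.map m n (freeCls k t) := by
    intro m n t
    induction t with
    | corolla m n => exact h m n
    | act σ τ t ih => rw [← freeData_act, φ.map_act, ψ.map_act, ih]
    | hcomp t t' ih ih' => rw [← freeData_hcomp, φ.map_hcomp, ψ.map_hcomp, ih, ih']
    | contract i j t ih => rw [← freeData_contract, φ.map_contract, ψ.map_contract, ih]
    | one => rw [← freeData_one, φ.map_one, ψ.map_one]
    | empty => rw [← freeData_empty, φ.map_empty, ψ.map_empty]
  have h2 : φ.map = ψ.map := by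
    funext m n
    exact freeData_hom_ext h1
  cases φ
  cases ψ
  simp only at h2
  subst h2
  rfl

lemma freeCorolla_isCorollaFamily : (freeData k).IsCorollaFamily (freeCorolla k) where
  mem m n := freeCls_mem (WheeledTerm.corolla m n)
  act m n σ τ := by
    rw [freeCorolla, freeData_act]
    exact freeCls_rel (.corolla_act m n σ τ)

lemma free_isFreeOnCorollas : (freeData k).IsFreeOnCorollas (freeCorolla k) where
  isCorollaFamily := freeCorolla_isCorollaFamily
  existsUnique _ hQ _ hc :=
    ⟨freeHom hQ hc, freeHom_corolla hQ hc, fun ψ hψ => freeHom_ext fun m n => by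
      rw [hψ, freeHom_corolla]⟩

end FreeUniversal

/-! ### The odd derivation of the free wheeled PROP -/

section FreeDifferential

namespace WheeledPropData.IsWheeledProp

variable {k : Type u} [Field k] {P : WheeledPropData.{u, v} k} (hP : P.IsWheeledProp)
include hP

lemma graft_mem {a b l r : ℕ} {q s : ZMod 2} {f : P.carrier (a + 1) l} {g : P.carrier b (r + 1)}
    (hf : f ∈ P.gr _ _ q) (hg : g ∈ P.gr _ _ s) : P.graft f g ∈ P.gr _ _ (q + s) :=
  hP.contract_mem _ _ _ _ (hP.act_mem _ _ _ _ (hP.hcomp_mem _ _ _ hf _ hg))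

lemma corollaDifferential_mem [CharZero k] {c : ∀ m n, P.carrier m n} (hc : P.IsCorollaFamily c)
    (m n : ℕ) : P.corollaDifferential c m n ∈ P.gr m n ((m : ZMod 2) + 1) := by
  have hz : ∀ (ε : ℤˣ) (q : ZMod 2) (x : P.carrier m n), x ∈ P.gr m n q → ε • x ∈ P.gr m n q :=
    fun ε q x hx => by rw [Units.smul_def]; exact zsmul_mem hx _
  rw [hP.corollaDifferential_eq hc]
  refine add_mem (sum_mem fun ab hab => sum_mem fun lr _ => Submodule.smul_mem _ _ (hz _ _ _
    (sum_mem fun σ _ => sum_mem fun τ _ => hz _ _ _ (hP.act_mem _ _ _ _ ?_)))) (hz _ _ _ ?_)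
  · have h := hP.graft_mem (hc.mem (ab.1 + 1) lr.1) (hc.mem ab.2 (lr.2 + 1))
    have hab' : ab.1 + ab.2 = m := by simpa using hab
    rw [← hab']
    convert h using 2
    push_cast; ring
  · have h := hP.contract_mem 0 0 _ _ (hc.mem (m + 1) (n + 1))
    simpa using h

end WheeledPropData.IsWheeledProp

variable (k : Type u) [Field k]

/-- The differential on formal composites. -/
def termDifferential : ∀ {m n : ℕ}, WheeledTerm m n → (freeData k).carrier m n
  | _, _, corolla m n => (freeData k).corollaDifferential (freeCorolla k) m n
  | _, _, act σ τ t => (freeData k).act σ τ (termDifferential t)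
  | _, _, hcomp t t' => (freeData k).hcomp (termDifferential t) (freeCls k t') +
      ((-1 : ℤˣ) ^ t.deg) • (freeData k).hcomp (freeCls k t) (termDifferential t')
  | _, _, contract i j t => (freeData k).contract i j (termDifferential t)
  | _, _, one => 0
  | _, _, empty => 0

variable {k} [CharZero k]

lemma termDifferential_mem {m n : ℕ} (t : WheeledTerm m n) :
    termDifferential k t ∈ (freeData k).gr m n (t.deg + 1) := by
  have hP := free_isWheeledProp (k := k)
  induction t with
  | corolla m n => exact hP.corollaDifferential_mem freeCorolla_isCorollaFamily m n
  | act σ τ t ih => exact hP.act_mem _ _ _ _ ih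
  | hcomp t t' ih ih' =>
    refine add_mem ?_ ?_
    · have := hP.hcomp_mem _ _ _ ih _ (freeCls_mem t')
      rwa [add_right_comm] at this
    · rw [Units.smul_def]
      have := hP.hcomp_mem _ _ _ (freeCls_mem t) _ ih'
      rw [← add_assoc] at this
      exact zsmul_mem this _
  | contract i j t ih => exact hP.contract_mem _ _ _ _ ih
  | one => exact zero_mem _
  | empty => exact zero_mem _

/-- The derivation is well defined on the quotient: symmetry of the corollas is respected by
`corollaDifferential_act`, and the structural relations are compatible with the Leibniz rule. -/
lemma termDifferential_rel {m n : ℕ} {t t' : WheeledTerm m n} {ε : ℤˣ} (h : Rel t t' ε) :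
    termDifferential k t = ε • termDifferential k t' := by
  have hP := free_isWheeledProp (k := k)
  induction h with
  | corolla_act m n σ τ =>
    rw [← inversionSign_perm]
    exact hP.corollaDifferential_act freeCorolla_isCorollaFamily σ τ
  | act_congr σ τ _ ih => simp only [termDifferential, ih, units_smul_apply]
  | hcomp_left s h ih =>
    simp only [termDifferential, ih, units_smul_apply₂, freeCls_rel h, h.deg_eq, smul_add]
    rw [smul_comm]
  | hcomp_right s h ih =>
    simp only [termDifferential, ih, units_smul_apply, freeCls_rel h, smul_add]
    rw [smul_comm]
  | contract_congr i j _ ih => simp only [termDifferential, ih, units_smul_apply]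
  | act_refl t => rw [one_smul]; exact hP.act_refl _
  | act_act σ τ σ' τ' t => rw [one_smul]; exact hP.act_act _ _ _ _ _
  | hcomp_act σ τ σ' τ' t t' =>
    simp only [termDifferential, ← freeData_act, hP.hcomp_act, deg, map_add, units_smul_apply,
      one_smul]
  | hcomp_assoc t t' t'' =>
    simp only [termDifferential, ← freeData_hcomp, deg, map_add, units_smul_apply, LinearMap.add_apply,
      one_smul, one_mul,
      units_smul_linearMap_apply, hP.hcomp_assoc, smul_add, smul_smul, uzpow_add, add_assoc]
  | empty_hcomp t =>
    simp only [termDifferential, ← freeData_empty, deg, map_zero, LinearMap.zero_apply, zero_add,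
      uzpow_zero, one_smul, hP.empty_hcomp]
  | hcomp_comm t t' =>
    simp only [termDifferential, map_add, units_smul_apply]
    -- The flip carries each Leibniz summand to the opposite summand of the other side. The sign
    -- accounts for the factor whose parity the differential has raised.
    rw [hP.hcomp_comm _ _ _ (termDifferential_mem t) _ (freeCls_mem t'),
      hP.hcomp_comm _ _ _ (freeCls_mem t) _ (termDifferential_mem t'), smul_add, smul_smul,
      smul_smul, ← uzpow_add, ← uzpow_add]
    have h1 : ∀ x y : ZMod 2, (x + 1) * y = x * y + y := by decide
    have h2 : ∀ x y : ZMod 2, x + x * (y + 1) = x * y := by decide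
    rw [h1, h2]
    exact add_comm _ _
  | contract_act σ τ σ' τ' i j hσ hτ t =>
    rw [one_smul]; exact hP.contract_act σ τ σ' τ' i j hσ hτ _
  | contract_contract i j i' j' t => rw [one_smul]; exact hP.contract_contract i j i' j' _
  | contract_hcomp i j t t' =>
    simp only [termDifferential, ← freeData_contract, deg, map_add, units_smul_apply,
      one_smul, ← hP.contract_hcomp]
  | one_input t =>
    simp only [termDifferential, ← freeData_one, deg, map_zero, LinearMap.zero_apply, zero_add,
      uzpow_zero, one_smul, hP.one_input]
  | one_output t =>
    simp only [termDifferential, ← freeData_one, deg, map_zero, LinearMap.zero_apply, zero_add,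
      uzpow_zero, one_smul, hP.one_output]

/-- The differential of the free wheeled PROP. -/
def freeDifferential (k : Type u) [Field k] [CharZero k] (m n : ℕ) :
    (freeData k).carrier m n →ₗ[k] (freeData k).carrier m n :=
  freeMap (fun t => termDifferential k t) fun _ _ _ h => termDifferential_rel h

@[simp] lemma freeDifferential_freeCls {m n : ℕ} (t : WheeledTerm m n) :
    freeDifferential k m n (freeCls k t) = termDifferential k t :=
  freeMap_freeCls _ _ _

lemma freeDifferential_corolla (m n : ℕ) : freeDifferential k m n (freeCorolla k m n) =
    (freeData k).corollaDifferential (freeCorolla k) m n :=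
  freeDifferential_freeCls (corolla m n)

lemma freeDifferential_odd {m n : ℕ} {q : ZMod 2} {f : (freeData k).carrier m n}
    (hf : f ∈ (freeData k).gr m n q) : freeDifferential k m n f ∈ (freeData k).gr m n (q + 1) := by
  refine free_gr_induction (p := fun f => freeDifferential k m n f ∈ (freeData k).gr m n (q + 1))
    (fun t ht => ?_) ?_ (fun x y hx hy => ?_) (fun r x hx => ?_) hf
  · rw [freeDifferential_freeCls, ← ht]; exact termDifferential_mem t
  · simp
  · rw [map_add]; exact add_mem hx hy
  · rw [map_smul]; exact Submodule.smul_mem _ _ hx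

lemma freeDifferential_act {m n m' n' : ℕ} (σ : Fin m ≃ Fin m') (τ : Fin n ≃ Fin n')
    (f : (freeData k).carrier m n) : freeDifferential k m' n' ((freeData k).act σ τ f) =
      (freeData k).act σ τ (freeDifferential k m n f) := by
  induction f using freeData_ind with
  | cls t => rw [freeData_act, freeDifferential_freeCls, freeDifferential_freeCls, termDifferential]
  | add x y hx hy => simp only [map_add, hx, hy]
  | smul r x hx => simp only [map_smul, hx]

lemma freeDifferential_hcomp {m n m' n' : ℕ} (q : ZMod 2) (f : (freeData k).carrier m n)
    (hf : f ∈ (freeData k).gr m n q) (g : (freeData k).carrier m' n') :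
    freeDifferential k (m + m') (n + n') ((freeData k).hcomp f g) =
      (freeData k).hcomp (freeDifferential k m n f) g +
        ((-1 : ℤˣ) ^ q) • (freeData k).hcomp f (freeDifferential k m' n' g) := by
  refine free_gr_induction (p := fun f => freeDifferential k (m + m') (n + n')
    ((freeData k).hcomp f g) = (freeData k).hcomp (freeDifferential k m n f) g +
        ((-1 : ℤˣ) ^ q) • (freeData k).hcomp f (freeDifferential k m' n' g))
    (fun t ht => ?_) ?_ (fun x y hx hy => ?_) (fun r x hx => ?_) hf
  · induction g using freeData_ind with
    | cls t' =>
      rw [freeData_hcomp, freeDifferential_freeCls, freeDifferential_freeCls,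
        freeDifferential_freeCls, termDifferential, ht]
    | add x y hx hy => simp only [map_add, hx, hy, smul_add]; abel
    | smul r x hx => simp only [map_smul, hx, smul_add]; rw [smul_comm]
  · simp
  · simp only [map_add, LinearMap.add_apply, hx, hy, smul_add]; abel
  · simp only [map_smul, LinearMap.smul_apply, hx, smul_add]; rw [smul_comm]

lemma freeDifferential_contract {m n : ℕ} (i : Fin (m + 1)) (j : Fin (n + 1))
    (f : (freeData k).carrier (m + 1) (n + 1)) :
    freeDifferential k m n ((freeData k).contract i j f) =
      (freeData k).contract i j (freeDifferential k (m + 1) (n + 1) f) := by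
  induction f using freeData_ind with
  | cls t =>
    rw [freeData_contract, freeDifferential_freeCls, freeDifferential_freeCls, termDifferential]
  | add x y hx hy => simp only [map_add, hx, hy]
  | smul r x hx => simp only [map_smul, hx]

/-- The square of an odd derivation is a derivation, because the two mixed terms in the Leibniz rule
cancel. It therefore vanishes once it vanishes on generators. -/
lemma freeDifferential_sq_zero_of_corolla
    (h : ∀ m n, freeDifferential k m n (freeDifferential k m n (freeCorolla k m n)) = 0)
    {m n : ℕ} (f : (freeData k).carrier m n) :
    freeDifferential k m n (freeDifferential k m n f) = 0 := by
  have hc : ∀ {m n : ℕ} (t : WheeledTerm m n),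
      freeDifferential k m n (freeDifferential k m n (freeCls k t)) = 0 := by
    intro m n t
    induction t with
    | corolla m n => exact h m n
    | act σ τ t ih => rw [← freeData_act, freeDifferential_act, freeDifferential_act, ih, map_zero]
    | hcomp t t' ih ih' =>
      rw [← freeData_hcomp, freeDifferential_hcomp _ _ (freeCls_mem t), map_add, units_smul_apply,
        freeDifferential_hcomp _ _ (freeDifferential_odd (freeCls_mem t)),
        freeDifferential_hcomp _ _ (freeCls_mem t), ih, ih', map_zero, LinearMap.zero_apply,
        map_zero, smul_zero, zero_add, add_zero, uzpow_add, uzpow_one, mul_neg_one,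
        Units.neg_smul]
      exact neg_add_cancel _
    | contract i j t ih =>
      rw [← freeData_contract, freeDifferential_contract, freeDifferential_contract, ih, map_zero]
    | one => rw [freeDifferential_freeCls, termDifferential, map_zero]
    | empty => rw [freeDifferential_freeCls, termDifferential, map_zero]
  induction f using freeData_ind with
  | cls t => exact hc t
  | add x y hx hy => rw [map_add, map_add, hx, hy, add_zero]
  | smul r x hx => rw [map_smul, map_smul, hx, smul_zero]

end FreeDifferential

namespace WheeledPropData

variable {k : Type u} [Field k] {P : WheeledPropData.{u, v} k}

lemma _root_.units_pow_eq_smul {W : Type*} [AddCommGroup W] {x y : ZMod 2} (h : x = y) (w : W) :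
    ((-1 : ℤˣ) ^ x) • w = ((-1 : ℤˣ) ^ y) • w := by rw [h]

/-! ### Coinvariants -/

/-- The relations defining the coinvariants. -/
def coinvariantRelations (P : WheeledPropData.{u, v} k) :
    Submodule k (DirectSum (ℕ × ℕ) fun mn => P.carrier mn.1 mn.2) :=
  Submodule.span k {x | ∃ (m n m' n' : ℕ) (σ : Fin m ≃ Fin m') (τ : Fin n ≃ Fin n')
    (f : P.carrier m n), x = DirectSum.lof k (ℕ × ℕ) (fun mn => P.carrier mn.1 mn.2) (m', n')
      (P.act σ τ f) - inversionSign σ •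
        DirectSum.lof k (ℕ × ℕ) (fun mn => P.carrier mn.1 mn.2) (m, n) f}

/-- All operations of `P` modulo relabellings, up to the sign of the relabelling of the outputs. -/
def Coinvariants (P : WheeledPropData.{u, v} k) : Type v :=
  (DirectSum (ℕ × ℕ) fun mn => P.carrier mn.1 mn.2) ⧸ P.coinvariantRelations

instance : AddCommGroup P.Coinvariants :=
  inferInstanceAs (AddCommGroup (_ ⧸ P.coinvariantRelations))

instance : Module k P.Coinvariants :=
  inferInstanceAs (Module k (_ ⧸ P.coinvariantRelations))

/-- The class of an operation in the coinvariants. -/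
def cls (P : WheeledPropData.{u, v} k) (m n : ℕ) : P.carrier m n →ₗ[k] P.Coinvariants :=
  P.coinvariantRelations.mkQ ∘ₗ DirectSum.lof k (ℕ × ℕ) (fun mn => P.carrier mn.1 mn.2) (m, n)

lemma cls_isCoinvariant : IsCoinvariant P.cls := by
  intro m n m' n' σ τ f
  show P.coinvariantRelations.mkQ _ = inversionSign σ • P.coinvariantRelations.mkQ _
  rw [← units_smul_apply]
  exact (Submodule.Quotient.eq _).2 (Submodule.subset_span ⟨m, n, m', n', σ, τ, f, rfl⟩)

/-- The linear map on coinvariants induced by a coinvariant family of functionals. -/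
def coinvariantLift {W : Type*} [AddCommGroup W] [Module k W]
    (φ : ∀ m n, P.carrier m n →ₗ[k] W) (hφ : IsCoinvariant φ) : P.Coinvariants →ₗ[k] W :=
  P.coinvariantRelations.liftQ (DirectSum.toModule k (ℕ × ℕ) W fun mn => φ mn.1 mn.2) (by
    rw [coinvariantRelations, Submodule.span_le]
    rintro _ ⟨m, n, m', n', σ, τ, f, rfl⟩
    rw [SetLike.mem_coe, LinearMap.mem_ker, map_sub, units_smul_apply, DirectSum.toModule_lof,
      DirectSum.toModule_lof, hφ, sub_self])

@[simp] lemma coinvariantLift_cls {W : Type*} [AddCommGroup W] [Module k W]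
    (φ : ∀ m n, P.carrier m n →ₗ[k] W) (hφ : IsCoinvariant φ) {m n : ℕ} (f : P.carrier m n) :
    coinvariantLift φ hφ (P.cls m n f) = φ m n f := by
  show P.coinvariantRelations.liftQ _ _ (P.coinvariantRelations.mkQ _) = _
  rw [Submodule.mkQ_apply, Submodule.liftQ_apply, DirectSum.toModule_lof]

/-- The contraction of the output `i` with the input `j`, followed by a functional and multiplied
by `(-1)^i`. -/
def wcontract {W : Type*} [AddCommGroup W] [Module k W] (φ : ∀ m n, P.carrier m n →ₗ[k] W) :
    ∀ {m n : ℕ}, Fin m → Fin n → (P.carrier m n →ₗ[k] W)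
  -- Without outputs or without inputs there is no pair of legs. These values only allow `m` and `n`
  -- to be arbitrary in sums over legs.
  | 0, _, _, _ => 0
  | _ + 1, 0, _, _ => 0
  | m + 1, n + 1, i, j => ((-1 : ℤˣ) ^ (i : ℕ)) • (φ m n ∘ₗ P.contract i j)

lemma wcontract_succ {W : Type*} [AddCommGroup W] [Module k W] (φ : ∀ m n, P.carrier m n →ₗ[k] W)
    {m n : ℕ} (i : Fin (m + 1)) (j : Fin (n + 1)) (f : P.carrier (m + 1) (n + 1)) :
    wcontract φ i j f = ((-1 : ℤˣ) ^ (i : ℕ)) • φ m n (P.contract i j f) := by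
  rw [wcontract, units_smul_linearMap_apply, LinearMap.comp_apply]

namespace IsWheeledProp

variable (hP : P.IsWheeledProp)
include hP

lemma gr_induction {m n : ℕ} {p : P.carrier m n → Prop} (h : ∀ q, ∀ f ∈ P.gr m n q, p f)
    (add : ∀ f g, p f → p g → p (f + g)) (f : P.carrier m n) : p f := by
  have h1 : f ∈ ⨆ q, P.gr m n q := by
    rw [(hP.isInternal m n).submodule_iSup_eq_top]; trivial
  exact Submodule.iSup_induction _ (motive := p) h1 h (h 0 0 (zero_mem _)) add

lemma coinvariants_hom_ext {W : Type*} [AddCommGroup W] [Module k W]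
    {f g : P.Coinvariants →ₗ[k] W}
    (h : ∀ m n q, ∀ x ∈ P.gr m n q, f (P.cls m n x) = g (P.cls m n x)) : f = g := by
  refine Submodule.linearMap_qext P.coinvariantRelations (DirectSum.linearMap_ext k ?_)
  rintro ⟨m, n⟩
  refine LinearMap.ext fun (x : P.carrier m n) => ?_
  show f (P.cls m n x) = g (P.cls m n x)
  induction x using hP.gr_induction with
  | h q x hx => exact h m n q x hx
  | add x y hx hy => simp only [map_add, hx, hy]

/-- The weight (-1)^i is what makes this hold: the bijection induced on the remaining outputs
differs in sign from `σ` by (-1)^(i + σ i). -/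
lemma wcontract_act {W : Type*} [AddCommGroup W] [Module k W]
    {φ : ∀ m n, P.carrier m n →ₗ[k] W} (hφ : IsCoinvariant φ) {m n m' n' : ℕ}
    (σ : Fin m ≃ Fin m') (τ : Fin n ≃ Fin n') (i : Fin m) (j : Fin n) (f : P.carrier m n) :
    wcontract φ (σ i) (τ j) (P.act σ τ f) = inversionSign σ • wcontract φ i j f := by
  obtain rfl : m = m' := by simpa using Fintype.card_congr σ
  obtain rfl : n = n' := by simpa using Fintype.card_congr τ
  cases m with
  | zero => exact i.elim0
  | succ m =>
    cases n with
    | zero => exact j.elim0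
    | succ n =>
      obtain ⟨σ', hσ⟩ := exists_succAbove_equiv σ i
      obtain ⟨τ', hτ⟩ := exists_succAbove_equiv τ j
      rw [wcontract_succ, wcontract_succ, hP.contract_act σ τ σ' τ' i j hσ hτ, hφ,
        inversionSign_succAbove σ σ' i hσ, smul_smul, smul_smul]
      congr 1
      have : ((-1 : ℤˣ) ^ (i : ℕ)) * (-1) ^ (i : ℕ) = 1 := by rw [← mul_pow]; simp
      calc _ = inversionSign σ' * (((-1 : ℤˣ) ^ (i : ℕ)) * (-1) ^ (i : ℕ)) * (-1) ^ (σ i : ℕ) := by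
            rw [this, mul_one, mul_comm]
        _ = _ := by simp only [mul_assoc, mul_comm, mul_left_comm]

/-- The parity involution of the operations. -/
def par (m n : ℕ) : P.carrier m n →ₗ[k] P.carrier m n :=
  (DirectSum.toModule k (ZMod 2) (P.carrier m n) fun q => ((-1 : ℤˣ) ^ q) • (P.gr m n q).subtype) ∘ₗ
    (LinearEquiv.ofBijective (DirectSum.coeLinearMap (P.gr m n)) (hP.isInternal m n)).symm

lemma par_of_mem {m n : ℕ} {q : ZMod 2} {f : P.carrier m n} (hf : f ∈ P.gr m n q) :
    hP.par m n f = ((-1 : ℤˣ) ^ q) • f := by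
  have h : (LinearEquiv.ofBijective (DirectSum.coeLinearMap (P.gr m n)) (hP.isInternal m n)).symm f
      = DirectSum.lof k _ (fun q => P.gr m n q) q ⟨f, hf⟩ := by
    rw [LinearEquiv.symm_apply_eq]
    show f = DirectSum.coeLinearMap (P.gr m n) (DirectSum.lof k _ (fun q => P.gr m n q) q ⟨f, hf⟩)
    rw [DirectSum.coeLinearMap_lof]
  rw [par, LinearMap.comp_apply, LinearEquiv.coe_coe, h, DirectSum.toModule_lof,
    units_smul_linearMap_apply, Submodule.subtype_apply]

lemma par_pow_of_mem {m n : ℕ} {q : ZMod 2} {f : P.carrier m n} (hf : f ∈ P.gr m n q) (a : ℕ) :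
    (hP.par m n ^ a) f = ((-1 : ℤˣ) ^ ((a : ZMod 2) * q)) • f := by
  induction a with
  | zero => simp
  | succ a ih =>
    rw [pow_succ', Module.End.mul_apply, ih, units_smul_apply, hP.par_of_mem hf, smul_smul,
      ← uzpow_add]
    congr 2
    push_cast; ring

lemma hcomp_cls_isCoinvariant {a b : ℕ} (F : P.carrier a b) :
    IsCoinvariant (fun m n => P.cls (a + m) (b + n) ∘ₗ P.hcomp F) := by
  intro m n m' n' σ τ f
  have h := hP.hcomp_act (Equiv.refl _) (Equiv.refl _) σ τ F f
  rw [hP.act_refl] at h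
  rw [LinearMap.comp_apply, h, cls_isCoinvariant, inversionSign_blockSum, inversionSign_refl,
    one_mul, LinearMap.comp_apply]

lemma cls_hcomp_isCoinvariant {a b : ℕ} (G : P.carrier a b) :
    IsCoinvariant (fun m n => P.cls (m + a) (n + b) ∘ₗ P.hcomp.flip G) := by
  intro m n m' n' σ τ f
  have h := hP.hcomp_act σ τ (Equiv.refl _) (Equiv.refl _) f G
  rw [hP.act_refl] at h
  rw [LinearMap.comp_apply, LinearMap.flip_apply, h, cls_isCoinvariant, inversionSign_blockSum,
    inversionSign_refl, mul_one, LinearMap.comp_apply, LinearMap.flip_apply]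

/-- To the Koszul sign of the operations the coinvariants add the sign of exchanging the blocks of
outputs. -/
lemma cls_hcomp_comm {m n m' n' : ℕ} {q r : ZMod 2} {f : P.carrier m n} {g : P.carrier m' n'}
    (hf : f ∈ P.gr m n q) (hg : g ∈ P.gr m' n' r) :
    P.cls _ _ (P.hcomp f g) = ((-1 : ℤˣ) ^ (q * r + m * m')) • P.cls _ _ (P.hcomp g f) := by
  have h := congrArg (P.cls _ _) (hP.hcomp_comm q r f hf g hg)
  rw [cls_isCoinvariant, inversionSign_finAddFlip, units_smul_apply] at h
  have h2 := congrArg (fun x => ((-1 : ℤˣ) ^ ((m : ZMod 2) * m')) • x) h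
  simp only [smul_smul, ← uzpow_add] at h2
  rw [ZMod.two_add_self, uzpow_zero, one_smul, add_comm ((m : ZMod 2) * m')] at h2
  exact h2

lemma coinvariant_par {W : Type*} [AddCommGroup W] [Module k W]
    {φ : ∀ m n, P.carrier m n →ₗ[k] W} (hφ : IsCoinvariant φ) (a : ℕ) :
    IsCoinvariant (fun m n => φ m n ∘ₗ (hP.par m n ^ a)) := by
  intro m n m' n' σ τ f
  induction f using hP.gr_induction with
  | h q f hf =>
    rw [LinearMap.comp_apply, LinearMap.comp_apply, hP.par_pow_of_mem (hP.act_mem σ τ q f hf),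
      hP.par_pow_of_mem hf, units_smul_apply, units_smul_apply, hφ, smul_comm]
  | add f g hf hg => rw [map_add, map_add, map_add, smul_add, hf, hg]

/-- The operator `[G] ↦ (-1)^{m |G|} [F ⊗ G]` on coinvariants. -/
def mulOpFun {m n : ℕ} (F : P.carrier m n) : Module.End k P.Coinvariants :=
  coinvariantLift _ (hP.coinvariant_par (hP.hcomp_cls_isCoinvariant F) m)

lemma mulOpFun_cls {m n m' n' : ℕ} (F : P.carrier m n) {r : ZMod 2} {G : P.carrier m' n'}
    (hG : G ∈ P.gr m' n' r) :
    hP.mulOpFun F (P.cls m' n' G) = ((-1 : ℤˣ) ^ ((m : ZMod 2) * r)) • P.cls _ _ (P.hcomp F G) := by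
  rw [mulOpFun, coinvariantLift_cls _ (hP.coinvariant_par (hP.hcomp_cls_isCoinvariant F) m), LinearMap.comp_apply, LinearMap.comp_apply,
    hP.par_pow_of_mem hG, units_smul_apply, units_smul_apply]

/-- The operators `[G] ↦ (-1)^{m |G|} [F ⊗ G]` on coinvariants, as a linear function of `F`. -/
def mulOp (m n : ℕ) : P.carrier m n →ₗ[k] Module.End k P.Coinvariants where
  toFun F := hP.mulOpFun F
  map_add' F F' := hP.coinvariants_hom_ext fun m' n' q x hx => by
    rw [LinearMap.add_apply, hP.mulOpFun_cls _ hx, hP.mulOpFun_cls _ hx, hP.mulOpFun_cls _ hx,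
      map_add, LinearMap.add_apply, map_add, smul_add]
  map_smul' r F := hP.coinvariants_hom_ext fun m' n' q x hx => by
    rw [LinearMap.smul_apply, hP.mulOpFun_cls _ hx, hP.mulOpFun_cls _ hx, map_smul,
      LinearMap.smul_apply, map_smul, smul_comm, RingHom.id_apply]

lemma mulOp_cls {m n m' n' : ℕ} (F : P.carrier m n) {r : ZMod 2} {G : P.carrier m' n'}
    (hG : G ∈ P.gr m' n' r) :
    hP.mulOp m n F (P.cls m' n' G) = ((-1 : ℤˣ) ^ ((m : ZMod 2) * r)) • P.cls _ _ (P.hcomp F G) :=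
  hP.mulOpFun_cls F hG

lemma mulOp_isCoinvariant : IsCoinvariant hP.mulOp := by
  intro m n m' n' σ τ f
  obtain rfl : m = m' := by simpa using Fintype.card_congr σ
  refine hP.coinvariants_hom_ext fun a b q x hx => ?_
  rw [hP.mulOp_cls _ hx, units_smul_linearMap_apply, hP.mulOp_cls _ hx]
  have h := hP.cls_hcomp_isCoinvariant x σ τ f
  rw [LinearMap.comp_apply, LinearMap.flip_apply] at h
  rw [h, LinearMap.comp_apply, LinearMap.flip_apply, smul_comm]

/-- The sign (-1)^(m |G|) built into `mulOp` turns the commutation rule into that of the total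
parity, the parity plus the number of outputs. An operation of parity equal to its number of
outputs, such as a corolla, is totally even. -/
lemma mulOp_comm {m n m' n' : ℕ} {q r : ZMod 2} {F : P.carrier m n} {G : P.carrier m' n'}
    (hF : F ∈ P.gr m n q) (hG : G ∈ P.gr m' n' r) :
    hP.mulOp m n F * hP.mulOp m' n' G =
      ((-1 : ℤˣ) ^ ((q + m) * (r + m'))) • (hP.mulOp m' n' G * hP.mulOp m n F) := by
  refine hP.coinvariants_hom_ext fun a b s K hK => ?_
  rw [units_smul_linearMap_apply, Module.End.mul_apply, Module.End.mul_apply, hP.mulOp_cls _ hK,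
    hP.mulOp_cls _ hK, units_smul_apply, units_smul_apply,
    hP.mulOp_cls _ (hP.hcomp_mem _ _ _ hG _ hK), hP.mulOp_cls _ (hP.hcomp_mem _ _ _ hF _ hK)]
  have h1 := hP.hcomp_assoc F G K
  have h2 := hP.hcomp_assoc G F K
  have h3 := hP.hcomp_comm _ _ F hF G hG
  have h4 := hP.cls_hcomp_isCoinvariant K finAddFlip finAddFlip (P.hcomp F G)
  simp only [LinearMap.comp_apply, LinearMap.flip_apply] at h4
  rw [← h1, ← h2, cls_isCoinvariant, cls_isCoinvariant, inversionSign_finCongr,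
    inversionSign_finCongr, one_smul, one_smul]
  rw [h3, inversionSign_finAddFlip, units_smul_apply₂, units_smul_apply] at h4
  have h5 := congrArg (fun x => ((-1 : ℤˣ) ^ ((m : ZMod 2) * m')) • x) h4
  simp only [smul_smul, ← uzpow_add] at h5
  rw [ZMod.two_add_self, uzpow_zero, one_smul] at h5
  rw [← h5]
  simp only [smul_smul, ← uzpow_add]
  refine units_pow_eq_smul ?_ _
  have h6 : ∀ q r s m m' : ZMod 2, m' * s + (m * (r + s) + (m * m' + q * r)) =
      (q + m) * (r + m') + (m * s + m' * (q + s)) := by decide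
  exact h6 _ _ _ _ _

end IsWheeledProp

end WheeledPropData

/-! ### The Laplacian on coinvariants and its commutator with multiplications -/

namespace WheeledPropData

variable {k : Type u} [Field k] {P : WheeledPropData.{u, v} k}

section

variable {W : Type*} [AddCommGroup W] [Module k W] (φ : ∀ m n, P.carrier m n →ₗ[k] W)

/-- The sum of all weighted contractions. -/
def totalContract (m n : ℕ) : P.carrier m n →ₗ[k] W :=
  ∑ i, ∑ j, wcontract φ i j

lemma totalContract_apply {m n : ℕ} (f : P.carrier m n) :
    totalContract φ m n f = ∑ i, ∑ j, wcontract φ i j f := by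
  simp [totalContract, LinearMap.sum_apply]

/-- The sum of the weighted contractions of `F ⊗ G` that join `F` and `G`. -/
def mixedContract {m n m' n' : ℕ} (F : P.carrier m n) (G : P.carrier m' n') : W :=
  (∑ i, ∑ j, wcontract φ (Fin.castAdd m' i) (Fin.natAdd n j) (P.hcomp F G)) +
    ∑ i, ∑ j, wcontract φ (Fin.natAdd m i) (Fin.castAdd n' j) (P.hcomp F G)

end

namespace IsWheeledProp

variable (hP : P.IsWheeledProp)
include hP

lemma totalContract_isCoinvariant {W : Type*} [AddCommGroup W] [Module k W]
    {φ : ∀ m n, P.carrier m n →ₗ[k] W} (hφ : IsCoinvariant φ) :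
    IsCoinvariant (totalContract φ) := by
  intro m n m' n' σ τ f
  rw [totalContract_apply, totalContract_apply, Finset.smul_sum, ← σ.sum_comp]
  refine Finset.sum_congr rfl fun i _ => ?_
  rw [Finset.smul_sum, ← τ.sum_comp]
  exact Finset.sum_congr rfl fun j _ => hP.wcontract_act hφ σ τ i j f

/-- The Laplacian `[f] ↦ (-1)^{|f|} ∑ (-1)^i [ξ^i_j f]` on coinvariants. -/
def laplacian : Module.End k P.Coinvariants :=
  coinvariantLift _ (hP.coinvariant_par (hP.totalContract_isCoinvariant cls_isCoinvariant) 1)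

lemma laplacian_cls {m n : ℕ} {q : ZMod 2} {f : P.carrier m n} (hf : f ∈ P.gr m n q) :
    hP.laplacian (P.cls m n f) = ((-1 : ℤˣ) ^ q) • totalContract P.cls m n f := by
  rw [laplacian, coinvariantLift_cls _
    (hP.coinvariant_par (hP.totalContract_isCoinvariant cls_isCoinvariant) 1),
    LinearMap.comp_apply, hP.par_pow_of_mem hf, units_smul_apply]
  simp

lemma wcontract_cast {W : Type*} [AddCommGroup W] [Module k W]
    {φ : ∀ m n, P.carrier m n →ₗ[k] W} (hφ : IsCoinvariant φ) {m n m' n' : ℕ}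
    (hm : m = m') (hn : n = n') (i : Fin m) (j : Fin n) (f : P.carrier m n) :
    wcontract φ (finCongr hm i) (finCongr hn j) (P.act (finCongr hm) (finCongr hn) f) =
      wcontract φ i j f := by
  rw [hP.wcontract_act hφ, inversionSign_finCongr, one_smul]

lemma wcontract_hcomp_left {W : Type*} [AddCommGroup W] [Module k W]
    {φ : ∀ m n, P.carrier m n →ₗ[k] W} (hφ : IsCoinvariant φ) {m n m' n' : ℕ} (i : Fin m)
    (j : Fin n) (f : P.carrier m n) (g : P.carrier m' n') :
    wcontract φ (Fin.castAdd m' i) (Fin.castAdd n' j) (P.hcomp f g) =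
      wcontract (fun a b => φ (a + m') (b + n') ∘ₗ P.hcomp.flip g) i j f := by
  cases m with
  | zero => exact i.elim0
  | succ m =>
    cases n with
    | zero => exact j.elim0
    | succ n =>
      rw [← hP.wcontract_cast hφ (Nat.add_right_comm m 1 m') (Nat.add_right_comm n 1 n'),
        wcontract_succ, wcontract_succ, hP.contract_hcomp]
      rfl

/-- Reduced by graded commutativity to contractions of the left factor. The output `i` of `g` stands
at position m + i, which accounts for the sign. -/
lemma wcontract_hcomp_right {m n m' n' : ℕ} {q r : ZMod 2} {f : P.carrier m n}
    {g : P.carrier m' n'} (hf : f ∈ P.gr m n q) (hg : g ∈ P.gr m' n' r) (i : Fin m') (j : Fin n') :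
    wcontract P.cls (Fin.natAdd m i) (Fin.natAdd n j) (P.hcomp f g) =
      ((-1 : ℤˣ) ^ (m : ZMod 2)) •
        wcontract (fun a b => P.cls (m + a) (n + b) ∘ₗ P.hcomp f) i j g := by
  have h1 := hP.wcontract_act cls_isCoinvariant finAddFlip finAddFlip (Fin.castAdd m i)
    (Fin.castAdd n j) (P.hcomp g f)
  rw [finAddFlip_apply_castAdd, finAddFlip_apply_castAdd, hP.hcomp_comm r q g hg f hf,
    units_smul_apply, inversionSign_finAddFlip, hP.wcontract_hcomp_left cls_isCoinvariant] at h1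
  have h2 := congrArg (fun x => ((-1 : ℤˣ) ^ (r * q)) • x) h1
  simp only [smul_smul, ← uzpow_add] at h2
  rw [ZMod.two_add_self, uzpow_zero, one_smul] at h2
  rw [h2]
  cases m' with
  | zero => exact i.elim0
  | succ m' =>
    cases n' with
    | zero => exact j.elim0
    | succ n' =>
      rw [wcontract_succ, wcontract_succ, LinearMap.comp_apply, LinearMap.comp_apply,
        LinearMap.flip_apply, hP.cls_hcomp_comm (hP.contract_mem i j r g hg) hf]
      rw [smul_comm ((-1 : ℤˣ) ^ (i : ℕ)), smul_comm ((-1 : ℤˣ) ^ (m : ZMod 2)), smul_smul,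
        ← uzpow_add]
      have key : ∀ r q m m' : ZMod 2, r * q + (m' + 1) * m + (r * q + m' * m) = m := by decide
      rw [Nat.cast_succ, key, smul_comm]

lemma wcontract_assoc {W : Type*} [AddCommGroup W] [Module k W]
    {φ : ∀ m n, P.carrier m n →ₗ[k] W} (hφ : IsCoinvariant φ) {m n m' n' m'' n'' : ℕ}
    (F : P.carrier m n) (G : P.carrier m' n') (K : P.carrier m'' n'')
    (i : Fin (m + m' + m'')) (j : Fin (n + n' + n'')) :
    wcontract φ (finCongr (Nat.add_assoc m m' m'') i) (finCongr (Nat.add_assoc n n' n'') j)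
      (P.hcomp F (P.hcomp G K)) = wcontract φ i j (P.hcomp (P.hcomp F G) K) := by
  rw [← hP.hcomp_assoc, hP.wcontract_cast hφ]

omit hP in
/-- The exchange of the first two of three blocks. -/
def _root_.blockSwap (a b c : ℕ) : Fin (a + (b + c)) ≃ Fin (b + (a + c)) :=
  (finCongr (Nat.add_assoc a b c)).symm.trans
    ((blockSum finAddFlip (Equiv.refl (Fin c))).trans (finCongr (Nat.add_assoc b a c)))

omit hP [Field k] in
lemma _root_.blockSwap_middle (a b c : ℕ) (i : Fin b) :
    blockSwap a b c (Fin.natAdd a (Fin.castAdd c i)) = Fin.castAdd (a + c) i := by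
  have h : (finCongr (Nat.add_assoc a b c)).symm (Fin.natAdd a (Fin.castAdd c i)) =
    Fin.castAdd c (Fin.natAdd a i) := by ext; simp
  rw [blockSwap, Equiv.trans_apply, h, Equiv.trans_apply, blockSum_castAdd,
    finAddFlip_apply_natAdd]
  ext; simp

omit hP [Field k] in
lemma _root_.blockSwap_right (a b c : ℕ) (i : Fin c) :
    blockSwap a b c (Fin.natAdd a (Fin.natAdd b i)) = Fin.natAdd b (Fin.natAdd a i) := by
  have h : (finCongr (Nat.add_assoc a b c)).symm (Fin.natAdd a (Fin.natAdd b i)) =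
    Fin.natAdd (a + b) i := by ext; simp [add_assoc]
  rw [blockSwap, Equiv.trans_apply, h, Equiv.trans_apply, blockSum_natAdd]
  ext; simp [add_assoc]

omit hP [Field k] in
lemma _root_.inversionSign_blockSwap (a b c : ℕ) :
    inversionSign (blockSwap a b c) = (-1) ^ ((a : ZMod 2) * b) := by
  rw [blockSwap, inversionSign_trans, inversionSign_trans, inversionSign_symm,
    inversionSign_finCongr, inversionSign_finCongr, inversionSign_blockSum,
    inversionSign_finAddFlip, inversionSign_refl]
  simp

lemma act_blockSwap {m n m' n' m'' n'' : ℕ} {q r : ZMod 2} {F : P.carrier m n}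
    {G : P.carrier m' n'} (hF : F ∈ P.gr m n q) (hG : G ∈ P.gr m' n' r) (K : P.carrier m'' n'') :
    P.act (blockSwap m' m m'') (blockSwap n' n n'') (P.hcomp G (P.hcomp F K)) =
      ((-1 : ℤˣ) ^ (r * q)) • P.hcomp F (P.hcomp G K) := by
  rw [← hP.hcomp_assoc G, ← hP.hcomp_assoc F, hP.act_act, blockSwap, blockSwap,
    ← Equiv.trans_assoc, Equiv.self_trans_symm, Equiv.refl_trans,
    ← Equiv.trans_assoc (finCongr (Nat.add_assoc n' n n'')), Equiv.self_trans_symm,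
    Equiv.refl_trans, ← hP.act_act, ← hP.hcomp_act, hP.act_refl,
    hP.hcomp_comm r q G hG F hF, units_smul_apply₂, units_smul_apply]

/-- For totally even F and G the Koszul sign of their exchange cancels the sign of exchanging their
blocks of outputs. -/
lemma wcontract_swap {W : Type*} [AddCommGroup W] [Module k W]
    {φ : ∀ m n, P.carrier m n →ₗ[k] W} (hφ : IsCoinvariant φ) {m n m' n' m'' n'' : ℕ}
    {F : P.carrier m n} {G : P.carrier m' n'} (hF : F ∈ P.gr m n m) (hG : G ∈ P.gr m' n' m')
    (K : P.carrier m'' n'') (i : Fin (m' + (m + m''))) (j : Fin (n' + (n + n''))) :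
    wcontract φ (blockSwap m' m m'' i) (blockSwap n' n n'' j) (P.hcomp F (P.hcomp G K)) =
      wcontract φ i j (P.hcomp G (P.hcomp F K)) := by
  have h := hP.wcontract_act hφ (blockSwap m' m m'') (blockSwap n' n n'') i j
    (P.hcomp G (P.hcomp F K))
  rw [hP.act_blockSwap hF hG, units_smul_apply, inversionSign_blockSwap] at h
  have h2 := congrArg (fun x => ((-1 : ℤˣ) ^ ((m' : ZMod 2) * m)) • x) h
  simp only [smul_smul, ← uzpow_add] at h2
  rwa [ZMod.two_add_self, uzpow_zero, one_smul, one_smul] at h2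

/-- The contracted operation has one output less, and m - 1 and m + 1 agree modulo 2. -/
lemma wcontract_mulOp_cls {m n m' n' : ℕ} {s : ZMod 2} (F : P.carrier m n) {K : P.carrier m' n'}
    (hK : K ∈ P.gr m' n' s) (i : Fin m) (j : Fin n) :
    wcontract hP.mulOp i j F (P.cls m' n' K) = ((-1 : ℤˣ) ^ (((m : ZMod 2) + 1) * s)) •
      wcontract (fun a b => P.cls (a + m') (b + n') ∘ₗ P.hcomp.flip K) i j F := by
  cases m with
  | zero => exact i.elim0
  | succ m =>
    cases n with
    | zero => exact j.elim0
    | succ n =>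
      rw [wcontract_succ, wcontract_succ, units_smul_linearMap_apply, hP.mulOp_cls _ hK, smul_comm]
      refine units_pow_eq_smul ?_ _
      push_cast
      have : ∀ m s : ZMod 2, m * s = (m + 1 + 1) * s := by decide
      exact this _ _

lemma mulOp_wcontract_cls {m n m' n' : ℕ} {s : ZMod 2} (G : P.carrier m n) {K : P.carrier m' n'}
    (hK : K ∈ P.gr m' n' s) (i : Fin m') (j : Fin n') :
    hP.mulOp m n G (wcontract P.cls i j K) = ((-1 : ℤˣ) ^ ((m : ZMod 2) * s)) •
      wcontract (fun a b => P.cls (m + a) (n + b) ∘ₗ P.hcomp G) i j K := by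
  cases m' with
  | zero => exact i.elim0
  | succ m' =>
    cases n' with
    | zero => exact j.elim0
    | succ n' =>
      rw [wcontract_succ, wcontract_succ, units_smul_apply,
        hP.mulOp_cls _ (hP.contract_mem i j s K hK), smul_comm]
      rfl

/-- A contraction of a horizontal composite joins two legs of F, or two legs of K, or one leg of
each. -/
lemma totalContract_hcomp {m n m' n' : ℕ} {q r : ZMod 2} {F : P.carrier m n}
    {K : P.carrier m' n'} (hF : F ∈ P.gr m n q) (hK : K ∈ P.gr m' n' r) :
    totalContract P.cls _ _ (P.hcomp F K) =
      totalContract (fun a b => P.cls (a + m') (b + n') ∘ₗ P.hcomp.flip K) m n F +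
      ((-1 : ℤˣ) ^ (m : ZMod 2)) •
        totalContract (fun a b => P.cls (m + a) (n + b) ∘ₗ P.hcomp F) m' n' K +
      mixedContract P.cls F K := by
  simp only [totalContract_apply, mixedContract, Fin.sum_univ_add, Finset.sum_add_distrib,
    hP.wcontract_hcomp_left cls_isCoinvariant, hP.wcontract_hcomp_right hF hK, Finset.smul_sum]
  abel

lemma totalContract_mulOp_cls {m n m' n' : ℕ} {s : ZMod 2} (F : P.carrier m n)
    {K : P.carrier m' n'} (hK : K ∈ P.gr m' n' s) :
    totalContract hP.mulOp m n F (P.cls m' n' K) = ((-1 : ℤˣ) ^ (((m : ZMod 2) + 1) * s)) •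
      totalContract (fun a b => P.cls (a + m') (b + n') ∘ₗ P.hcomp.flip K) m n F := by
  simp only [totalContract_apply, LinearMap.sum_apply, hP.wcontract_mulOp_cls F hK,
    Finset.smul_sum]

lemma mulOp_totalContract_cls {m n m' n' : ℕ} {s : ZMod 2} (G : P.carrier m n)
    {K : P.carrier m' n'} (hK : K ∈ P.gr m' n' s) :
    hP.mulOp m n G (totalContract P.cls m' n' K) = ((-1 : ℤˣ) ^ ((m : ZMod 2) * s)) •
      totalContract (fun a b => P.cls (m + a) (n + b) ∘ₗ P.hcomp G) m' n' K := by
  simp only [totalContract_apply, map_sum, hP.mulOp_wcontract_cls G hK, Finset.smul_sum]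

/-- The commutator of the Laplacian with the multiplication by an element of even total parity. -/
lemma laplacian_mulOp_sub {m n m' n' : ℕ} {s : ZMod 2} {F : P.carrier m n}
    (hF : F ∈ P.gr m n m) {K : P.carrier m' n'} (hK : K ∈ P.gr m' n' s) :
    (hP.laplacian * hP.mulOp m n F - hP.mulOp m n F * hP.laplacian) (P.cls m' n' K) =
      ((-1 : ℤˣ) ^ (m : ZMod 2)) • totalContract hP.mulOp m n F (P.cls m' n' K) +
      ((-1 : ℤˣ) ^ ((m : ZMod 2) * s + m + s)) • mixedContract P.cls F K := by
  rw [LinearMap.sub_apply, Module.End.mul_apply, Module.End.mul_apply, hP.mulOp_cls F hK,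
    units_smul_apply, hP.laplacian_cls (hP.hcomp_mem _ _ _ hF _ hK), hP.totalContract_hcomp hF hK,
    hP.laplacian_cls hK, units_smul_apply, hP.mulOp_totalContract_cls F hK,
    hP.totalContract_mulOp_cls F hK]
  simp only [smul_add, smul_smul, ← uzpow_add]
  have h1 : ∀ m s : ZMod 2, m * s + (m + s) = m + (m + 1) * s := by decide
  have h2 : ∀ m s : ZMod 2, m * s + (m + s + m) = s + m * s := by decide
  have h3 : ∀ m s : ZMod 2, m + (m + 1) * s = m * s + m + s := by decide
  rw [h2, h1, h3]
  abel

end IsWheeledProp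

end WheeledPropData

/-! ### A formal computation with the operators of the master equation -/

/-- The commutator with L, applied three times to D * D = 0, gives this identity. The first
commutator of D is E, the second is N + N, the third is zero, and the Leibniz rule leaves 3 · 2
copies of E * N + N * E up to sign. It is the Jacobi identity for the bracket of L with itself. -/
lemma formal_bracket_identity {R : Type*} [Ring R] {D L E N : R} (hDD : D * D = 0)
    (hE : D * L - L * D = E) (hN : N + N = E * L - L * E) (hNL : N * L = L * N) :
    (6 : ℕ) • (E * N + N * E) = 0 := by
  have h1 : E * D + D * E = 0 := by
    have : E * D + D * E = (D * D) * L - L * (D * D) := by rw [← hE]; noncomm_ring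
    rw [this, hDD, zero_mul, mul_zero, sub_zero]
  have h2 : E * E + E * E = E * (D * L - L * D) + (D * L - L * D) * E := by rw [hE]
  have h3 : (N + N) * D + (E * E + E * E) + D * (N + N) = 0 := by
    have : (N + N) * D + (E * E + E * E) + D * (N + N) =
        (E * D + D * E) * L - L * (E * D + D * E) := by
      rw [hN, h2]
      noncomm_ring
    rw [this, h1, zero_mul, mul_zero, sub_zero]
  have h4 : (6 : ℕ) • (E * N + N * E) = ((N + N) * D + (E * E + E * E) + D * (N + N)) * L -
      L * ((N + N) * D + (E * E + E * E) + D * (N + N)) := by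
    have h5 : ((N + N) * D + (E * E + E * E) + D * (N + N)) * L -
      L * ((N + N) * D + (E * E + E * E) + D * (N + N)) = (2 : ℕ) • (N * (D * L - L * D) +
        (D * L - L * D) * N) + (2 : ℕ) • (E * (E * L - L * E) + (E * L - L * E) * E) +
        (2 : ℕ) • ((N * L - L * N) * D + D * (N * L - L * N)) := by
      noncomm_ring
    rw [h5, hE, ← hN, hNL, sub_self, zero_mul, mul_zero]
    noncomm_ring
  rw [h4, h3, zero_mul, mul_zero, sub_zero]

/-- Here M is δ applied to L, and the last hypothesis is the master equation with δ L multiplied by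
a central parameter ε. Applying δ produces M again, which one more factor ε allows to be eliminated
by the same equation. What remains is a bracket of L with N, zero by `formal_bracket_identity`. -/
lemma formal_master_identity {R V : Type*} [Ring R] [AddCommGroup V] [Module R V]
    {v : V} {D δ L M N ε : R} (hε : ∀ x, ε * x = x * ε) (hDD : D * D = 0)
    (hδD : δ * D = -(D * δ)) (hδL : δ * L = L * δ + M)
    (hN : N + N = (D * L - L * D) * L - L * (D * L - L * D)) (hNL : N * L = L * N)
    (hML : M * L = L * M) (hMN : M * N = -(N * M)) (hMM : M * M = 0) (hNN : N * N = 0)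
    (hD : D • v = 0) (hδ : δ • v = 0) (h : (ε * M + D * L + N) • v = 0) :
    (6 : ℕ) • ((ε * ε * (δ * M)) • v) = 0 := by
  have eD (x : V) : D • D • x = 0 := by rw [← mul_smul, hDD, zero_smul]
  have eM (x : V) : M • M • x = 0 := by rw [← mul_smul, hMM, zero_smul]
  have eNN (x : V) : N • N • x = 0 := by rw [← mul_smul, hNN, zero_smul]
  have eδD (x : V) : δ • D • x = -(D • δ • x) := by rw [← mul_smul, hδD, neg_smul, mul_smul]
  have eδL (x : V) : δ • L • x = L • δ • x + M • x := by
    rw [← mul_smul, hδL, add_smul, mul_smul]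
  have eML (x : V) : M • L • x = L • M • x := by rw [← mul_smul, hML, mul_smul]
  have eMN (x : V) : M • N • x = -(N • M • x) := by rw [← mul_smul, hMN, neg_smul, mul_smul]
  have eN (x : V) : N • x + N • x =
      D • L • L • x - L • D • L • x - L • D • L • x + L • L • D • x := by
    rw [← add_smul, hN]
    simp only [sub_smul, mul_smul, smul_sub]
    abel
  have eε (x : R) (y : V) : ε • x • y = x • ε • y := by rw [← mul_smul, hε, mul_smul]
  have e1 : ε • M • v = -(D • L • v) - N • v := by
    simp only [add_smul, mul_smul] at h
    rw [← sub_eq_zero, ← h]; abel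
  have e2 : ε • δ • M • v = D • M • v - δ • N • v := by
    rw [eε, e1]
    simp only [smul_sub, smul_neg, eδD, eδL, hδ, smul_zero, zero_add, neg_neg]
  -- Twice N is a double commutator, so only 2 δ N can be expressed through D, L and M without
  -- dividing.
  have e3 : δ • N • v + δ • N • v = -(D • L • M • v) - D • L • M • v + L • D • M • v +
      L • D • M • v - M • D • L • v - M • D • L • v := by
    rw [← smul_add, eN]
    simp only [hD, smul_zero, add_zero, smul_sub, eδD, eδL, hδ, smul_zero, zero_add, smul_add,
      eML, smul_neg]
    abel
  -- The equation is used twice. The diagonal terms disappear by M * M = 0 and N * N = 0.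
  have e4 : M • ε • D • L • v = -(N • D • L • v) := by
    have : D • L • v = -(ε • M • v) - N • v := by rw [e1]; abel
    rw [← eε, this]
    simp only [smul_sub, smul_neg, eMN]
    rw [← eε M (M • v), eM]
    rw [eε N, e1]
    simp only [smul_sub, smul_neg, smul_zero, eNN]
    abel
  have e5 : D • N • v + D • N • v = -(D • L • D • L • v) - D • L • D • L • v := by
    rw [← smul_add, eN]
    simp only [hD, smul_zero, add_zero, smul_sub, smul_add, eD]
    abel
  have e6 : (2 : ℕ) • ε • ε • δ • M • v = -((2 : ℕ) • D • L • N • v) + (2 : ℕ) • L • D • N • v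
      - (2 : ℕ) • N • D • L • v := by
    have : (2 : ℕ) • ε • δ • M • v = (2 : ℕ) • D • M • v + (2 : ℕ) • D • L • M • v
        - (2 : ℕ) • L • D • M • v + (2 : ℕ) • M • D • L • v := by
      rw [e2, smul_sub, two_nsmul (δ • N • v), e3]; abel
    have h2 := congrArg (fun x => ε • x) this
    simp only [smul_sub, smul_add, smul_comm ε (2 : ℕ)] at h2
    rw [h2, eε D, eε D, eε L, eε L, eε D, eε M (D • L • v), e4, e1]
    simp only [smul_sub, smul_neg, eD, smul_zero]
    rw [two_nsmul (D • N • v), e5]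
    abel
  -- Tripling `e6` gives the coefficient 6 for which the bracket identity is available.
  have h7 : (6 : ℕ) • (ε • ε • δ • M • v) = -((6 : ℕ) •
      (((D * L - L * D) * N + N * (D * L - L * D)) • v)) := by
    rw [show (6 : ℕ) = 3 * 2 from rfl, mul_smul, e6]
    simp only [add_smul, sub_smul, mul_smul, smul_sub, hD, smul_zero]
    abel
  rw [mul_smul, mul_smul, mul_smul, h7, ← smul_assoc, formal_bracket_identity hDD rfl hN hNL,
    zero_smul, neg_zero]

/-! ### Power series with coefficients in a noncommutative ring -/

namespace PowerSeries

lemma mul_eq_zsmul_mul {R : Type*} [Ring R] {A B : PowerSeries R} {z : ℤ}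
    (h : ∀ i j, coeff i A * coeff j B = z • (coeff j B * coeff i A)) : A * B = z • (B * A) := by
  ext n
  rw [coeff_mul, map_zsmul, coeff_mul, ← Finset.Nat.sum_antidiagonal_swap, Finset.smul_sum]
  exact Finset.sum_congr rfl fun x _ => h _ _

end PowerSeries

/-! ### The Laplacian as an operator of second order -/

namespace WheeledPropData

variable {k : Type u} [Field k] {P : WheeledPropData.{u, v} k}

section

variable {W : Type*} [AddCommGroup W] [Module k W] (φ : ∀ m n, P.carrier m n →ₗ[k] W)

/-- The sum of the weighted contractions of `F ⊗ G` that join outputs of `F` to inputs of `G`. -/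
def joinContract {m n m' n' : ℕ} (F : P.carrier m n) (G : P.carrier m' n') : W :=
  ∑ i, ∑ j, wcontract φ (Fin.castAdd m' i) (Fin.natAdd n j) (P.hcomp F G)

end

namespace IsWheeledProp

variable (hP : P.IsWheeledProp)
include hP

/-- For totally even F and G the edges directed from G to F may be counted in G ⊗ F, since the two
exchange signs agree. -/
lemma mixedContract_eq {W : Type*} [AddCommGroup W] [Module k W]
    {φ : ∀ m n, P.carrier m n →ₗ[k] W} (hφ : IsCoinvariant φ) {m n m' n' : ℕ} {F : P.carrier m n}
    {G : P.carrier m' n'} (hF : F ∈ P.gr m n m) (hG : G ∈ P.gr m' n' m') :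
    mixedContract φ F G = joinContract φ F G + joinContract φ G F := by
  rw [mixedContract, joinContract, joinContract]
  congr 1
  refine Finset.sum_congr rfl fun i _ => Finset.sum_congr rfl fun j _ => ?_
  have h := hP.wcontract_act hφ finAddFlip finAddFlip (Fin.castAdd m i) (Fin.natAdd n' j)
    (P.hcomp G F)
  rw [finAddFlip_apply_castAdd, finAddFlip_apply_natAdd, hP.hcomp_comm _ _ G hG F hF,
    units_smul_apply, inversionSign_finAddFlip] at h
  exact smul_left_cancel _ h

/-- An edge between F and G ⊗ K has its other end in G or in K: joining with F is a derivation of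
horizontal composition. -/
lemma mixedContract_hcomp {m n m' n' m'' n'' : ℕ} {s : ZMod 2} {F : P.carrier m n}
    {G : P.carrier m' n'} {K : P.carrier m'' n''} (hF : F ∈ P.gr m n m) (hG : G ∈ P.gr m' n' m')
    (hK : K ∈ P.gr m'' n'' s) :
    mixedContract P.cls F (P.hcomp G K) =
      mixedContract (fun a b => P.cls (a + m'') (b + n'') ∘ₗ P.hcomp.flip K) F G +
      ((-1 : ℤˣ) ^ (m' : ZMod 2)) •
        mixedContract (fun a b => P.cls (m' + a) (n' + b) ∘ₗ P.hcomp G) F K := by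
  have h1 (i : Fin (m + m')) (j : Fin (n + n')) :
      wcontract P.cls (finCongr (Nat.add_assoc m m' m'') (Fin.castAdd m'' i))
        (finCongr (Nat.add_assoc n n' n'') (Fin.castAdd n'' j)) (P.hcomp F (P.hcomp G K)) =
      wcontract (fun a b => P.cls (a + m'') (b + n'') ∘ₗ P.hcomp.flip K) i j (P.hcomp F G) := by
    rw [hP.wcontract_assoc cls_isCoinvariant, hP.wcontract_hcomp_left cls_isCoinvariant]
  have h2 (i : Fin (m + m'')) (j : Fin (n + n'')) :
      wcontract P.cls (blockSwap m' m m'' (Fin.natAdd m' i)) (blockSwap n' n n'' (Fin.natAdd n' j))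
        (P.hcomp F (P.hcomp G K)) = ((-1 : ℤˣ) ^ (m' : ZMod 2)) •
      wcontract (fun a b => P.cls (m' + a) (n' + b) ∘ₗ P.hcomp G) i j (P.hcomp F K) := by
    rw [hP.wcontract_swap cls_isCoinvariant hF hG,
      hP.wcontract_hcomp_right hG (hP.hcomp_mem _ _ _ hF _ hK)]
  have c1 (a b c : ℕ) (i : Fin a) : finCongr (Nat.add_assoc a b c) (Fin.castAdd c (Fin.castAdd b i))
      = Fin.castAdd (b + c) i := by ext; simp
  have c2 (a b c : ℕ) (i : Fin b) : finCongr (Nat.add_assoc a b c) (Fin.castAdd c (Fin.natAdd a i))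
      = Fin.natAdd a (Fin.castAdd c i) := by ext; simp
  simp only [mixedContract, Fin.sum_univ_add, Finset.sum_add_distrib, ← h1, c1, c2,
    Finset.smul_sum, smul_add, ← h2, blockSwap_middle, blockSwap_right]
  abel

lemma mulOp_mixedContract_cls {m n m' n' m'' n'' : ℕ} {s : ZMod 2} {F : P.carrier m n}
    {G : P.carrier m' n'} {K : P.carrier m'' n''} (hF : F ∈ P.gr m n m)
    (hK : K ∈ P.gr m'' n'' s) :
    hP.mulOp m' n' G (mixedContract P.cls F K) = ((-1 : ℤˣ) ^ ((m' : ZMod 2) * (m + s))) •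
        mixedContract (fun a b => P.cls (m' + a) (n' + b) ∘ₗ P.hcomp G) F K := by
  simp only [mixedContract, map_add, map_sum, smul_add, Finset.smul_sum,
    hP.mulOp_wcontract_cls G (hP.hcomp_mem _ _ _ hF _ hK)]

lemma mixedContract_mulOp_cls {m n m' n' m'' n'' : ℕ} {s : ZMod 2} {F : P.carrier m n}
    {G : P.carrier m' n'} {K : P.carrier m'' n''} (hK : K ∈ P.gr m'' n'' s) :
    mixedContract hP.mulOp F G (P.cls m'' n'' K) = ((-1 : ℤˣ) ^ (((m : ZMod 2) + m' + 1) * s)) •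
      mixedContract (fun a b => P.cls (a + m'') (b + n'') ∘ₗ P.hcomp.flip K) F G := by
  simp only [mixedContract, LinearMap.add_apply, LinearMap.sum_apply, smul_add, Finset.smul_sum,
    hP.wcontract_mulOp_cls _ hK, Nat.cast_add]

/-- The operators of multiplication by operations of total parity `q`. -/
def mulOps (q : ZMod 2) : Submodule k (Module.End k P.Coinvariants) :=
  Submodule.span k {A | ∃ m n, ∃ F ∈ P.gr m n (q + m), A = hP.mulOp m n F}

lemma mulOp_mem {m n : ℕ} {q r : ZMod 2} {F : P.carrier m n} (hF : F ∈ P.gr m n r)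
    (h : r + m = q) : hP.mulOp m n F ∈ hP.mulOps q := by
  refine Submodule.subset_span ⟨m, n, F, ?_, rfl⟩
  rwa [← h, add_assoc, ZMod.two_add_self, add_zero]

lemma mulOps_comm {q r : ZMod 2} {A B : Module.End k P.Coinvariants} (hA : A ∈ hP.mulOps q)
    (hB : B ∈ hP.mulOps r) : A * B = ((-1 : ℤˣ) ^ (q * r)) • (B * A) := by
  induction hA using Submodule.span_induction with
  | zero => simp
  | add x y _ _ hx hy => rw [add_mul, mul_add, smul_add, hx, hy]
  | smul c x _ hx => rw [smul_mul_assoc, mul_smul_comm, hx, smul_comm]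
  | mem A hA =>
    obtain ⟨m, n, F, hF, rfl⟩ := hA
    induction hB using Submodule.span_induction with
    | zero => simp
    | add x y _ _ hx hy => rw [add_mul, mul_add, smul_add, hx, hy]
    | smul c x _ hx => rw [smul_mul_assoc, mul_smul_comm, hx, smul_comm]
    | mem B hB =>
      obtain ⟨m', n', G, hG, rfl⟩ := hB
      rw [hP.mulOp_comm hF hG]
      congr 2
      have : ∀ q r m m' : ZMod 2, (q + m + m) * (r + m' + m') = q * r := by decide
      exact this _ _ _ _

lemma wcontract_mulOp_mem {m n : ℕ} {q r : ZMod 2} {F : P.carrier m n} (hF : F ∈ P.gr m n r)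
    (h : r + m + 1 = q) (i : Fin m) (j : Fin n) : wcontract hP.mulOp i j F ∈ hP.mulOps q := by
  cases m with
  | zero => exact i.elim0
  | succ m =>
    cases n with
    | zero => exact j.elim0
    | succ n =>
      rw [wcontract_succ, Units.smul_def]
      refine zsmul_mem (hP.mulOp_mem (hP.contract_mem i j r F hF) ?_) _
      rw [← h]
      push_cast
      rw [add_assoc, add_assoc, ZMod.two_add_self, add_zero]

lemma totalContract_mulOp_mem {m n : ℕ} {q r : ZMod 2} {F : P.carrier m n} (hF : F ∈ P.gr m n r)
    (h : r + m + 1 = q) : totalContract hP.mulOp m n F ∈ hP.mulOps q := by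
  rw [totalContract_apply]
  exact Submodule.sum_mem _ fun i _ => Submodule.sum_mem _ fun j _ => hP.wcontract_mulOp_mem hF h i j

/-- In the commutator with F there remain the contractions inside F, which commute with the totally
even G, and the edges between F and the argument. Applied to G ⊗ K, the edges from F to K cancel in
the second commutator, and those from F to G remain. -/
lemma laplacian_mulOp_mulOp {m n m' n' : ℕ} {F : P.carrier m n} {G : P.carrier m' n'}
    (hF : F ∈ P.gr m n m) (hG : G ∈ P.gr m' n' m') :
    (hP.laplacian * hP.mulOp m n F - hP.mulOp m n F * hP.laplacian) * hP.mulOp m' n' G -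
      hP.mulOp m' n' G * (hP.laplacian * hP.mulOp m n F - hP.mulOp m n F * hP.laplacian) =
      ((-1 : ℤˣ) ^ ((m : ZMod 2) * m' + m + m')) • mixedContract hP.mulOp F G := by
  refine hP.coinvariants_hom_ext fun m'' n'' s K hK => ?_
  rw [LinearMap.sub_apply, Module.End.mul_apply, Module.End.mul_apply (hP.mulOp m' n' G),
    hP.mulOp_cls G hK, units_smul_apply, hP.laplacian_mulOp_sub hF (hP.hcomp_mem _ _ _ hG _ hK),
    hP.laplacian_mulOp_sub hF hK, hP.mixedContract_hcomp hF hG hK, map_add, units_smul_apply,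
    units_smul_apply, hP.mulOp_mixedContract_cls hF hK, units_smul_linearMap_apply,
    hP.mixedContract_mulOp_cls hK, smul_add, smul_comm _ ((-1 : ℤˣ) ^ (m : ZMod 2)),
    ← units_smul_apply, ← hP.mulOp_cls G hK, ← Module.End.mul_apply, ← Module.End.mul_apply,
    hP.mulOps_comm (hP.totalContract_mulOp_mem hF rfl) (hP.mulOp_mem hG (ZMod.two_add_self _)),
    mul_zero, uzpow_zero, one_smul]
  simp only [smul_add, smul_smul, ← uzpow_add]
  have h1 : ∀ m m' s : ZMod 2, m' * s + (m * (m' + s) + m + (m' + s)) =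
      m * m' + m + m' + (m + m' + 1) * s := by decide
  have h2 : ∀ m m' s : ZMod 2, m * m' + m + m' + (m + m' + 1) * s + m' =
      m * s + m + s + m' * (m + s) := by decide
  have h3 : ∀ m m' s : ZMod 2, m' * s + (m * (m' + s) + m + (m' + s) + m') =
      m * s + m + s + m' * (m + s) := by decide
  rw [h3, h1]
  abel

end IsWheeledProp

end WheeledPropData

/-! ### Power series in two commuting variables -/

namespace PowerSeries

variable {R : Type*} [Ring R]

/-- The coefficients of a power series in two commuting variables. -/
def coeff₂ (m n : ℕ) (A : PowerSeries (PowerSeries R)) : R := coeff n (coeff m A)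

/-- The power series in two commuting variables with given coefficients. -/
def mk₂ (f : ℕ → ℕ → R) : PowerSeries (PowerSeries R) := mk fun m => mk (f m)

/-- The product of the two variables. -/
def prodX : PowerSeries (PowerSeries R) := X * C X

lemma coeff₂_mk₂ (f : ℕ → ℕ → R) (m n : ℕ) : coeff₂ m n (mk₂ f) = f m n := by
  rw [coeff₂, mk₂, coeff_mk, coeff_mk]

lemma ext₂ {A B : PowerSeries (PowerSeries R)} (h : ∀ m n, coeff₂ m n A = coeff₂ m n B) :
    A = B := by
  ext m n; exact h m n

lemma coeff₂_add (m n : ℕ) (A B : PowerSeries (PowerSeries R)) :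
    coeff₂ m n (A + B) = coeff₂ m n A + coeff₂ m n B := by simp [coeff₂]

lemma coeff₂_neg (m n : ℕ) (A : PowerSeries (PowerSeries R)) :
    coeff₂ m n (-A) = -coeff₂ m n A := by simp [coeff₂]

lemma coeff₂_sub (m n : ℕ) (A B : PowerSeries (PowerSeries R)) :
    coeff₂ m n (A - B) = coeff₂ m n A - coeff₂ m n B := by simp [coeff₂]

lemma coeff₂_nsmul (m n a : ℕ) (A : PowerSeries (PowerSeries R)) :
    coeff₂ m n (a • A) = a • coeff₂ m n A := by
  rw [coeff₂, map_nsmul, map_nsmul, coeff₂]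

lemma coeff₂_C_mul (m n : ℕ) (a : R) (A : PowerSeries (PowerSeries R)) :
    coeff₂ m n (C (C a) * A) = a * coeff₂ m n A := by
  rw [coeff₂, coeff_C_mul, coeff_C_mul, coeff₂]

lemma coeff₂_mul_C (m n : ℕ) (a : R) (A : PowerSeries (PowerSeries R)) :
    coeff₂ m n (A * C (C a)) = coeff₂ m n A * a := by
  rw [coeff₂, coeff_mul_C, coeff_mul_C, coeff₂]

lemma coeff₂_mul (m n : ℕ) (A B : PowerSeries (PowerSeries R)) :
    coeff₂ m n (A * B) = ∑ x ∈ Finset.HasAntidiagonal.antidiagonal m,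
      ∑ y ∈ Finset.HasAntidiagonal.antidiagonal n, coeff₂ x.1 y.1 A * coeff₂ x.2 y.2 B := by
  rw [coeff₂, coeff_mul, map_sum]
  exact Finset.sum_congr rfl fun x _ => coeff_mul _ _ _

lemma coeff₂_prodX_mul (m n : ℕ) (A : PowerSeries (PowerSeries R)) :
    coeff₂ (m + 1) (n + 1) (prodX * A) = coeff₂ m n A := by
  rw [coeff₂, prodX, mul_assoc, coeff_succ_X_mul, coeff_C_mul, coeff_succ_X_mul, coeff₂]

lemma coeff₂_zero_prodX_mul (n : ℕ) (A : PowerSeries (PowerSeries R)) :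
    coeff₂ 0 n (prodX * A) = 0 := by
  rw [coeff₂, prodX, mul_assoc, coeff_zero_X_mul, map_zero]

lemma coeff₂_prodX_mul_zero (m : ℕ) (A : PowerSeries (PowerSeries R)) :
    coeff₂ m 0 (prodX * A) = 0 := by
  cases m with
  | zero => exact coeff₂_zero_prodX_mul 0 A
  | succ m => rw [coeff₂, prodX, mul_assoc, coeff_succ_X_mul, coeff_C_mul, coeff_zero_X_mul]

lemma prodX_mul_comm (A : PowerSeries (PowerSeries R)) : prodX * A = A * prodX := by
  have h : (C X : PowerSeries (PowerSeries R)) * A = A * C X := by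
    ext m : 1
    rw [coeff_C_mul, coeff_mul_C, X_mul]
  rw [prodX, mul_assoc, h, ← mul_assoc, X_mul, mul_assoc]

lemma mul_eq_zsmul_mul₂ {A B : PowerSeries (PowerSeries R)} {z : ℤ}
    (h : ∀ m n m' n', coeff₂ m n A * coeff₂ m' n' B = z • (coeff₂ m' n' B * coeff₂ m n A)) :
    A * B = z • (B * A) :=
  mul_eq_zsmul_mul fun m m' => mul_eq_zsmul_mul fun n n' => h m n m' n'

end PowerSeries

/-- When two positions are deleted in the other order, exactly one of the two indices is shifted by
one. The resulting minus sign is the reason for D² = 0. -/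
lemma Fin.neg_one_pow_succAbove_mul_predAbove {m : ℕ} (i : Fin (m + 2)) (i' : Fin (m + 1)) :
    (-1 : ℤˣ) ^ (i.succAbove i' : ℕ) * (-1) ^ (i'.predAbove i : ℕ) =
      -((-1) ^ (i : ℕ) * (-1) ^ (i' : ℕ)) := by
  rcases lt_or_ge i'.castSucc i with h | h
  · rw [Fin.succAbove_of_castSucc_lt _ _ h, Fin.predAbove_of_castSucc_lt _ _ h]
    obtain ⟨j, rfl⟩ := Fin.exists_succ_eq.2 (Fin.ne_zero_of_lt h)
    simp [pow_succ, mul_comm]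
  · rw [Fin.succAbove_of_le_castSucc _ _ h, Fin.predAbove_of_le_castSucc _ _ h]
    simp [pow_succ, mul_comm]

lemma units_smul_add_eq_zero {W : Type*} [AddCommGroup W] {x y : ℤˣ} (h : x = -y) (w : W) :
    x • w + y • w = 0 := by
  rw [h, Units.smul_def, Units.smul_def, ← add_smul]
  simp

namespace WheeledPropData

variable {k : Type u} [Field k] {P : WheeledPropData.{u, v} k}

/-- `δ` is an odd derivation of the wheeled PROP `P`. -/
structure IsOddDerivation (P : WheeledPropData.{u, v} k)
    (δ : ∀ m n, P.carrier m n →ₗ[k] P.carrier m n) : Prop where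
  odd : ∀ m n q, ∀ f ∈ P.gr m n q, δ m n f ∈ P.gr m n (q + 1)
  map_act : ∀ {m n m' n' : ℕ} (σ : Fin m ≃ Fin m') (τ : Fin n ≃ Fin n') (f : P.carrier m n),
    δ m' n' (P.act σ τ f) = P.act σ τ (δ m n f)
  leibniz : ∀ {m n m' n' : ℕ} (q : ZMod 2), ∀ f ∈ P.gr m n q, ∀ g : P.carrier m' n',
    δ (m + m') (n + n') (P.hcomp f g) =
      P.hcomp (δ m n f) g + ((-1 : ℤˣ) ^ q) • P.hcomp f (δ m' n' g)
  map_contract : ∀ {m n : ℕ} (i : Fin (m + 1)) (j : Fin (n + 1)) (f : P.carrier (m + 1) (n + 1)),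
    δ m n (P.contract i j f) = P.contract i j (δ (m + 1) (n + 1) f)
  map_one : δ 1 1 P.one = 0
  map_empty : δ 0 0 P.empty = 0

namespace IsWheeledProp

variable (hP : P.IsWheeledProp)
include hP

section Corollas

variable {W : Type*} [AddCommGroup W] [Module k W] {φ : ∀ m n, P.carrier m n →ₗ[k] W}
  (hφ : IsCoinvariant φ) {c : ∀ m n, P.carrier m n} (hc : P.IsCorollaFamily c)
include hφ hc

/-- The symmetries of the two corollas act transitively on the edges from the first to the second,
so all these weighted contractions coincide. -/
lemma wcontract_corolla_corolla {a l b r : ℕ} (i i' : Fin a) (j j' : Fin r) :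
    wcontract φ (Fin.castAdd b i) (Fin.natAdd l j) (P.hcomp (c a l) (c b r)) =
      wcontract φ (Fin.castAdd b i') (Fin.natAdd l j') (P.hcomp (c a l) (c b r)) := by
  have h := hP.wcontract_act hφ (blockSum (Equiv.swap i i') (Equiv.refl (Fin b)))
    (blockSum (Equiv.refl (Fin l)) (Equiv.swap j j')) (Fin.castAdd b i) (Fin.natAdd l j)
    (P.hcomp (c a l) (c b r))
  rw [← hP.hcomp_act, hc.act, ← Equiv.Perm.one_def, hc.act, blockSum_castAdd, blockSum_natAdd,
    Equiv.swap_apply_left, Equiv.swap_apply_left, inversionSign_blockSum, Equiv.Perm.one_def,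
    inversionSign_refl, inversionSign_perm, Equiv.Perm.sign_refl, one_smul, mul_one,
    units_smul_apply₂, units_smul_apply] at h
  exact (smul_left_cancel _ h).symm

/-- There are (a + 1)(r + 1) equal terms. The one defining the graft uses the output with index a,
whence the sign. -/
lemma joinContract_corolla (a l b r : ℕ) : joinContract φ (c (a + 1) l) (c b (r + 1)) =
    (((a + 1 : ℕ) : k) * ((r + 1 : ℕ) : k)) • ((-1 : ℤˣ) ^ (a : ZMod 2)) •
      φ _ _ (P.graft (c (a + 1) l) (c b (r + 1))) := by
  have h : wcontract φ (Fin.castAdd b (Fin.last a)) (Fin.natAdd l (0 : Fin (r + 1)))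
      (P.hcomp (c (a + 1) l) (c b (r + 1))) =
      ((-1 : ℤˣ) ^ (a : ZMod 2)) • φ _ _ (P.graft (c (a + 1) l) (c b (r + 1))) := by
    rw [← hP.wcontract_cast hφ (Nat.add_right_comm a 1 b) (Nat.add_assoc l r 1).symm, graft,
      uzpow_natCast]
    exact wcontract_succ φ _ _ _
  rw [joinContract, ← h]
  simp only [fun (i : Fin (a + 1)) (j : Fin (r + 1)) =>
    hP.wcontract_corolla_corolla hφ hc (l := l) (b := b) i (Fin.last a) j 0,
    Finset.sum_const, Finset.card_univ, Fintype.card_fin]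
  rw [← Nat.cast_smul_eq_nsmul k, ← Nat.cast_smul_eq_nsmul k, smul_smul]

/-- The same transitivity for loops; the representative is the pair of first legs, of weight 1. -/
lemma totalContract_corolla (m n : ℕ) : totalContract φ (m + 1) (n + 1) (c (m + 1) (n + 1)) =
    (((m + 1 : ℕ) : k) * ((n + 1 : ℕ) : k)) • φ m n (P.contract 0 0 (c (m + 1) (n + 1))) := by
  have h (i : Fin (m + 1)) (j : Fin (n + 1)) : wcontract φ i j (c (m + 1) (n + 1)) =
      φ m n (P.contract 0 0 (c (m + 1) (n + 1))) := by
    have h1 := hP.wcontract_act hφ (Equiv.swap i 0) (Equiv.swap j 0) i j (c (m + 1) (n + 1))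
    rw [hc.act, Equiv.swap_apply_left, Equiv.swap_apply_left, inversionSign_perm,
      units_smul_apply] at h1
    rw [← smul_left_cancel _ h1, wcontract_succ]
    simp
  rw [totalContract_apply]
  simp only [h, Finset.sum_const, Finset.card_univ, Fintype.card_fin]
  rw [← Nat.cast_smul_eq_nsmul k, ← Nat.cast_smul_eq_nsmul k, smul_smul]

end Corollas

/-- A double contraction removes two pairs of legs in either order, and the two orders occur with
opposite weights. -/
lemma laplacian_sq : hP.laplacian * hP.laplacian = 0 := by
  refine hP.coinvariants_hom_ext fun m n q f hf => ?_
  rw [Module.End.mul_apply, LinearMap.zero_apply, hP.laplacian_cls hf, units_smul_apply]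
  suffices h : hP.laplacian (totalContract P.cls m n f) = 0 by rw [h, smul_zero]
  rw [totalContract_apply]
  cases m with
  | zero => simp
  | succ m =>
    cases n with
    | zero => simp
    | succ n =>
      simp only [map_sum, wcontract_succ, units_smul_apply,
        fun i j => hP.laplacian_cls (hP.contract_mem i j q f hf), totalContract_apply]
      cases m with
      | zero => simp
      | succ m =>
        cases n with
        | zero => simp
        | succ n =>
          simp only [wcontract_succ, smul_comm _ ((-1 : ℤˣ) ^ q), ← Finset.smul_sum]
          rw [smul_eq_zero_iff_eq]
          simp only [Finset.smul_sum, smul_smul, ← Fintype.sum_prod_type']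
          -- The involution exchanges the order of the two contractions. It has no fixed point
          -- because `i.succAbove i'` is never `i`.
          refine Finset.sum_involution
            (fun x _ => (x.1.succAbove x.2.2.1, x.2.1.succAbove x.2.2.2,
              x.2.2.1.predAbove x.1, x.2.2.2.predAbove x.2.1)) ?_ ?_
              (fun _ _ => Finset.mem_univ _) ?_
          · rintro ⟨i, j, i', j'⟩ -
            dsimp only
            rw [hP.contract_contract i j i' j', add_comm]
            exact units_smul_add_eq_zero (Fin.neg_one_pow_succAbove_mul_predAbove i i') _
          · rintro ⟨i, j, i', j'⟩ - - h
            simp [Fin.succAbove_ne] at h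
          · rintro ⟨i, j, i', j'⟩ -
            simp [Fin.predAbove_predAbove_succAbove, Fin.succAbove_succAbove_predAbove]

end IsWheeledProp

end WheeledPropData

/-! ### Odd derivations on coinvariants, and detection of skew-symmetric operations -/

namespace WheeledPropData

variable {k : Type u} [Field k] {P : WheeledPropData.{u, v} k}
  {δ : ∀ m n, P.carrier m n →ₗ[k] P.carrier m n}

lemma IsOddDerivation.cls_isCoinvariant (hδ : P.IsOddDerivation δ) :
    IsCoinvariant (fun m n => P.cls m n ∘ₗ δ m n) := by
  intro m n m' n' σ τ f
  rw [LinearMap.comp_apply, hδ.map_act, WheeledPropData.cls_isCoinvariant, LinearMap.comp_apply]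

/-- The operator of an odd derivation on coinvariants. -/
def IsOddDerivation.op (hδ : P.IsOddDerivation δ) : Module.End k P.Coinvariants :=
  coinvariantLift (fun m n => P.cls m n ∘ₗ δ m n) hδ.cls_isCoinvariant

lemma IsOddDerivation.op_cls (hδ : P.IsOddDerivation δ) {m n : ℕ} (f : P.carrier m n) :
    hδ.op (P.cls m n f) = P.cls m n (δ m n f) := 
  coinvariantLift_cls _ hδ.cls_isCoinvariant f

lemma IsOddDerivation.op_empty (hδ : P.IsOddDerivation δ) : hδ.op (P.cls 0 0 P.empty) = 0 := by
  rw [hδ.op_cls, hδ.map_empty, map_zero]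

lemma IsOddDerivation.op_wcontract (hδ : P.IsOddDerivation δ) {m n : ℕ} (i : Fin m) (j : Fin n)
    (f : P.carrier m n) : hδ.op (wcontract P.cls i j f) = wcontract P.cls i j (δ m n f) := by
  cases m with
  | zero => exact i.elim0
  | succ m =>
    cases n with
    | zero => exact j.elim0
    | succ n =>
      rw [wcontract_succ, wcontract_succ, units_smul_apply, hδ.op_cls, hδ.map_contract]

namespace IsWheeledProp

variable (hP : P.IsWheeledProp) (hδ : P.IsOddDerivation δ)
include hP hδ

/-- For totally even F the Leibniz sign is cancelled by the change of the sign in `mulOp` when the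
argument becomes `δ` of itself. -/
lemma op_mul_mulOp {m n : ℕ} {F : P.carrier m n} (hF : F ∈ P.gr m n m) :
    hδ.op * hP.mulOp m n F = hP.mulOp m n F * hδ.op + hP.mulOp m n (δ m n F) := by
  refine hP.coinvariants_hom_ext fun m' n' s K hK => ?_
  rw [Module.End.mul_apply, LinearMap.add_apply, Module.End.mul_apply, hP.mulOp_cls _ hK,
    hP.mulOp_cls _ hK, hδ.op_cls, hP.mulOp_cls _ (hδ.odd _ _ _ _ hK), units_smul_apply, hδ.op_cls,
    hδ.leibniz _ _ hF, map_add, units_smul_apply, smul_add, smul_smul, ← uzpow_add, add_comm,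
    mul_add, mul_one]

/-- A derivation commutes with every contraction. The minus sign stems from the factor (-1)^|f| in
the Laplacian, since δ raises the parity. -/
lemma op_mul_laplacian : hδ.op * hP.laplacian = -(hP.laplacian * hδ.op) := by
  refine hP.coinvariants_hom_ext fun m n s K hK => ?_
  rw [LinearMap.neg_apply, Module.End.mul_apply, Module.End.mul_apply, hP.laplacian_cls hK,
    hδ.op_cls, hP.laplacian_cls (hδ.odd _ _ _ _ hK), units_smul_apply, totalContract_apply,
    totalContract_apply]
  simp only [map_sum, hδ.op_wcontract]
  rw [uzpow_add, uzpow_one, mul_neg, mul_one, Units.neg_smul, neg_neg]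

omit hδ

lemma laplacian_empty : hP.laplacian (P.cls 0 0 P.empty) = 0 := by
  rw [hP.laplacian_cls hP.empty_mem, totalContract_apply]
  simp

/-- The empty operation has no legs and is killed by the Laplacian, so only contractions inside F
contribute. -/
lemma laplacian_mulOp_empty {m n : ℕ} {F : P.carrier m n} (hF : F ∈ P.gr m n m) :
    (hP.laplacian * hP.mulOp m n F) (P.cls 0 0 P.empty) =
      ((-1 : ℤˣ) ^ (m : ZMod 2)) • totalContract hP.mulOp m n F (P.cls 0 0 P.empty) := by
  have h := hP.laplacian_mulOp_sub hF hP.empty_mem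
  rw [LinearMap.sub_apply, Module.End.mul_apply _ hP.laplacian, hP.laplacian_empty, map_zero,
    sub_zero] at h
  rw [h, mixedContract]
  simp

lemma cls_eq_zero_of_mulOp_empty {m n : ℕ} {q : ZMod 2} {F : P.carrier m n} (hF : F ∈ P.gr m n q)
    (h : hP.mulOp m n F (P.cls 0 0 P.empty) = 0) : P.cls m n F = 0 := by
  rw [hP.mulOp_cls F hP.empty_mem, hP.cls_hcomp_comm hF hP.empty_mem, smul_smul,
    smul_eq_zero_iff_eq] at h
  have h2 := cls_isCoinvariant (P := P) (finCongr (Nat.zero_add m)) (finCongr (Nat.zero_add n))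
    (P.hcomp P.empty F)
  rw [hP.empty_hcomp, h, smul_zero] at h2
  exact h2

/-- A skew-symmetric operation whose class in the coinvariants vanishes is zero. -/
lemma eq_zero_of_cls_eq_zero [CharZero k] {m n : ℕ} {F : P.carrier m n}
    (hF : ∀ (σ : Equiv.Perm (Fin m)) (τ : Equiv.Perm (Fin n)),
      P.act σ τ F = inversionSign σ • F) (h : P.cls m n F = 0) : F = 0 := by
  -- Signed symmetrisation descends to the coinvariants and multiplies a skew-symmetric operation by
  -- m! n!, which is invertible in characteristic 0.
  let φ : ∀ m' n', P.carrier m' n' →ₗ[k] P.carrier m n := fun m' n' =>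
    ∑ σ : Fin m' ≃ Fin m, ∑ τ : Fin n' ≃ Fin n, inversionSign σ • P.act σ τ
  have happ (m' n' : ℕ) (f : P.carrier m' n') : φ m' n' f =
      ∑ σ : Fin m' ≃ Fin m, ∑ τ : Fin n' ≃ Fin n, inversionSign σ • P.act σ τ f := by
    simp only [φ, LinearMap.sum_apply, units_smul_linearMap_apply]
  have hφ : IsCoinvariant φ := by
    intro a b a' b' σ τ f
    rw [happ, happ, Finset.smul_sum,
      ← (Equiv.equivCongr σ.symm (Equiv.refl (Fin m))).symm.sum_comp]
    refine Finset.sum_congr rfl fun σ' _ => ?_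
    rw [Finset.smul_sum, ← (Equiv.equivCongr τ.symm (Equiv.refl (Fin n))).symm.sum_comp]
    refine Finset.sum_congr rfl fun τ' _ => ?_
    have e1 : (Equiv.equivCongr σ.symm (Equiv.refl (Fin m))).symm σ' = σ.symm.trans σ' := by
      ext; simp [Equiv.equivCongr]
    have e2 : (Equiv.equivCongr τ.symm (Equiv.refl (Fin n))).symm τ' = τ.symm.trans τ' := by
      ext; simp [Equiv.equivCongr]
    rw [e1, e2, hP.act_act, ← Equiv.trans_assoc, ← Equiv.trans_assoc, Equiv.self_trans_symm,
      Equiv.self_trans_symm, Equiv.refl_trans, Equiv.refl_trans, inversionSign_trans,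
      inversionSign_symm, smul_smul]
  have h1 : φ m n F = ((m.factorial * n.factorial : ℕ) : k) • F := by
    simp only [happ, hF, smul_smul, inversionSign_mul_self, one_smul, Finset.sum_const,
      Finset.card_univ, Fintype.card_perm, Fintype.card_fin]
    rw [Nat.cast_smul_eq_nsmul]
  rw [← coinvariantLift_cls φ hφ, h, map_zero] at h1
  refine (smul_eq_zero.1 h1.symm).resolve_left ?_
  exact_mod_cast mul_ne_zero m.factorial_ne_zero n.factorial_ne_zero

end IsWheeledProp

end WheeledPropData

/-! ### The master relation, and the square of the differential on corollas -/

namespace WheeledPropData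

open PowerSeries

variable {k : Type u} [Field k] {P : WheeledPropData.{u, v} k}
  {δ : ∀ m n, P.carrier m n →ₗ[k] P.carrier m n} {c : ∀ m n, P.carrier m n}

/-- The weight `1 / m! n!`. -/
def weight (k : Type u) [Field k] (m n : ℕ) : k := ((m.factorial : k) * n.factorial)⁻¹

/-- The number of possible edges is absorbed by the factorials: each joined leg lowers one
factorial. -/
lemma weight_mul_weight [CharZero k] (a l b r : ℕ) :
    weight k (a + 1) l * weight k b (r + 1) * (((a + 1 : ℕ) : k) * ((r + 1 : ℕ) : k)) =
      ((a.factorial : k) * b.factorial * (l.factorial * r.factorial))⁻¹ := by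
  have h1 : ((a + 1 : ℕ) : k) ≠ 0 := Nat.cast_ne_zero.2 a.succ_ne_zero
  have h2 : ((r + 1 : ℕ) : k) ≠ 0 := Nat.cast_ne_zero.2 r.succ_ne_zero
  have h3 (n : ℕ) : (n.factorial : k) ≠ 0 := Nat.cast_ne_zero.2 n.factorial_ne_zero
  have := h3 a; have := h3 b; have := h3 l; have := h3 r
  rw [weight, weight, Nat.factorial_succ, Nat.factorial_succ, Nat.cast_mul, Nat.cast_mul]
  field_simp

lemma weight_succ [CharZero k] (m n : ℕ) :
    weight k (m + 1) (n + 1) * (((m + 1 : ℕ) : k) * ((n + 1 : ℕ) : k)) = weight k m n := by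
  have h1 : ((m + 1 : ℕ) : k) ≠ 0 := Nat.cast_ne_zero.2 m.succ_ne_zero
  have h2 : ((n + 1 : ℕ) : k) ≠ 0 := Nat.cast_ne_zero.2 n.succ_ne_zero
  have h3 (n : ℕ) : (n.factorial : k) ≠ 0 := Nat.cast_ne_zero.2 n.factorial_ne_zero
  have := h3 m; have := h3 n
  rw [weight, weight, Nat.factorial_succ, Nat.factorial_succ, Nat.cast_mul, Nat.cast_mul]
  field_simp

/-- The operators annihilating a vector, coefficient by coefficient. -/
def annihilating {T : Type*} [AddCommGroup T] [Module k T] (e : T) :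
    Ideal (PowerSeries (PowerSeries (Module.End k T))) where
  carrier := {A | ∀ m n, coeff₂ m n A e = 0}
  zero_mem' m n := by simp [coeff₂]
  add_mem' {A B} hA hB m n := by rw [coeff₂_add, LinearMap.add_apply, hA, hB, add_zero]
  smul_mem' A B hB m n := by
    rw [smul_eq_mul, coeff₂_mul, LinearMap.sum_apply]
    refine Finset.sum_eq_zero fun x _ => ?_
    rw [LinearMap.sum_apply]
    refine Finset.sum_eq_zero fun y _ => ?_
    rw [Module.End.mul_apply, hB, map_zero]

namespace IsWheeledProp

variable (hP : P.IsWheeledProp)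
include hP

/-- The generating series of the multiplications by given operations. -/
def mulSeries (c : ∀ m n, P.carrier m n) :
    PowerSeries (PowerSeries (Module.End k P.Coinvariants)) :=
  mk₂ fun m n => weight k m n • hP.mulOp m n (c m n)

/-- The generating series of the compositions of two operations along one edge. -/
def joinSeries (c : ∀ m n, P.carrier m n) :
    PowerSeries (PowerSeries (Module.End k P.Coinvariants)) :=
  mk₂ fun m n => ∑ x ∈ Finset.HasAntidiagonal.antidiagonal m,
    ∑ y ∈ Finset.HasAntidiagonal.antidiagonal n, (weight k x.1 y.1 * weight k x.2 y.2) •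
      ((-1 : ℤˣ) ^ ((x.1 : ZMod 2) * x.2 + x.1 + x.2)) •
        joinContract hP.mulOp (c x.1 y.1) (c x.2 y.2)

/-- Coefficientwise this is `laplacian_mulOp_mulOp`. The edges directed the other way are the same
sum with the two indices of the Cauchy product exchanged, which explains the doubling. -/
lemma joinSeries_add_self (hc : P.IsCorollaFamily c) :
    hP.joinSeries c + hP.joinSeries c =
      (C (C hP.laplacian) * hP.mulSeries c - hP.mulSeries c * C (C hP.laplacian)) *
        hP.mulSeries c - hP.mulSeries c *
        (C (C hP.laplacian) * hP.mulSeries c - hP.mulSeries c * C (C hP.laplacian)) := by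
  have hE (m n : ℕ) : coeff₂ m n
      (C (C hP.laplacian) * hP.mulSeries c - hP.mulSeries c * C (C hP.laplacian)) =
      weight k m n • (hP.laplacian * hP.mulOp m n (c m n) -
        hP.mulOp m n (c m n) * hP.laplacian) := by
    rw [coeff₂_sub, coeff₂_C_mul, coeff₂_mul_C, mulSeries, coeff₂_mk₂, mul_smul_comm,
      smul_mul_assoc, smul_sub]
  refine ext₂ fun m n => ?_
  rw [coeff₂_sub, coeff₂_mul, coeff₂_mul]
  simp only [hE]
  rw [coeff₂_add, joinSeries, coeff₂_mk₂]
  conv_lhs =>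
    arg 2
    rw [← Finset.Nat.sum_antidiagonal_swap]
    enter [2, x]
    rw [← Finset.Nat.sum_antidiagonal_swap]
  conv_rhs =>
    arg 2
    rw [← Finset.Nat.sum_antidiagonal_swap]
    enter [2, x]
    rw [← Finset.Nat.sum_antidiagonal_swap]
  rw [← Finset.sum_add_distrib, ← Finset.sum_sub_distrib]
  refine Finset.sum_congr rfl fun x _ => ?_
  rw [← Finset.sum_add_distrib, ← Finset.sum_sub_distrib]
  refine Finset.sum_congr rfl fun y _ => ?_
  have h := hP.laplacian_mulOp_mulOp (hc.mem x.1 y.1) (hc.mem x.2 y.2)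
  rw [hP.mixedContract_eq hP.mulOp_isCoinvariant (hc.mem x.1 y.1) (hc.mem x.2 y.2)] at h
  simp only [Prod.fst_swap, Prod.snd_swap, mulSeries, coeff₂_mk₂, smul_mul_smul_comm]
  rw [mul_comm (weight k x.2 y.2), ← smul_sub, h,
    show (x.2 : ZMod 2) * x.1 + x.2 + x.1 = x.1 * x.2 + x.1 + x.2 by ring, ← smul_add, ← smul_add]

/-- A first factor without outputs or a second one without inputs contributes nothing, so both
indices shift by one. This is the shift that `prodX` performs on the other side of the master
relation. -/
lemma coeff₂_joinSeries [CharZero k] (hc : P.IsCorollaFamily c) (m n : ℕ) :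
    coeff₂ (m + 1) (n + 1) (hP.joinSeries c) =
      -∑ ab ∈ Finset.HasAntidiagonal.antidiagonal m, ∑ lr ∈ Finset.HasAntidiagonal.antidiagonal n,
        ((ab.1.factorial : k) * ab.2.factorial * (lr.1.factorial * lr.2.factorial))⁻¹ •
          (-1 : ℤˣ) ^ (ab.1 * ab.2) •
            hP.mulOp _ _ (P.graft (c (ab.1 + 1) lr.1) (c ab.2 (lr.2 + 1))) := by
  have h0 (a l b r : ℕ) (h : a = 0 ∨ r = 0) : joinContract hP.mulOp (c a l) (c b r) = 0 := by
    rcases h with rfl | rfl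
    · simp [joinContract]
    · simp [joinContract]
  rw [joinSeries, coeff₂_mk₂, Finset.Nat.sum_antidiagonal_succ,
    Finset.sum_eq_zero (fun y _ => by rw [h0 _ _ _ _ (Or.inl rfl), smul_zero, smul_zero]), zero_add,
    ← Finset.sum_neg_distrib]
  refine Finset.sum_congr rfl fun x _ => ?_
  rw [Finset.Nat.sum_antidiagonal_succ', h0 _ _ _ _ (Or.inr rfl), smul_zero, smul_zero, zero_add,
    ← Finset.sum_neg_distrib]
  refine Finset.sum_congr rfl fun y _ => ?_
  rw [hP.joinContract_corolla hP.mulOp_isCoinvariant hc, smul_comm ((-1 : ℤˣ) ^ _) (_ : k),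
    smul_smul, weight_mul_weight, smul_smul, ← uzpow_add, ← smul_neg, ← Units.neg_smul,
    ← uzpow_natCast (R := ZMod 2)]
  congr 2
  have : ∀ a b : ZMod 2, (a + 1) * b + (a + 1) + b + a = 1 + a * b := by decide
  rw [Nat.cast_succ, this, uzpow_add, uzpow_one, neg_one_mul, Nat.cast_mul]

/-- The coefficient at (m + 1, n + 1) is the definition of the corolla differential in bidegree (m,
n): the graphs with two vertices come from `joinSeries`, the loop from the Laplacian. On the axes
all three terms vanish on the empty operation. -/
lemma master_relation [CharZero k] (hc : P.IsCorollaFamily c) :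
    prodX * hP.mulSeries (P.corollaDifferential c) + C (C hP.laplacian) * hP.mulSeries c +
      hP.joinSeries c ∈ annihilating (k := k) (P.cls 0 0 P.empty) := by
  have hL (m n : ℕ) : coeff₂ m n (C (C hP.laplacian) * hP.mulSeries c) (P.cls 0 0 P.empty) =
      weight k m n • ((-1 : ℤˣ) ^ (m : ZMod 2)) •
        totalContract hP.mulOp m n (c m n) (P.cls 0 0 P.empty) := by
    rw [coeff₂_C_mul, mulSeries, coeff₂_mk₂, mul_smul_comm, LinearMap.smul_apply,
      hP.laplacian_mulOp_empty (hc.mem m n)]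
  intro m n
  rw [coeff₂_add, coeff₂_add, LinearMap.add_apply, LinearMap.add_apply, hL]
  cases m with
  | zero =>
    rw [coeff₂_zero_prodX_mul, joinSeries, coeff₂_mk₂]
    simp [totalContract, joinContract]
  | succ m =>
    cases n with
    | zero =>
      rw [coeff₂_prodX_mul_zero, joinSeries, coeff₂_mk₂]
      simp [totalContract, joinContract]
    | succ n =>
      rw [coeff₂_prodX_mul, hP.coeff₂_joinSeries hc, mulSeries, coeff₂_mk₂, weight,
        hP.coinvariant_corollaDifferential hP.mulOp_isCoinvariant hc, LinearMap.add_apply,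
        hP.totalContract_corolla hP.mulOp_isCoinvariant hc, LinearMap.smul_apply _ (hP.mulOp m n _),
        smul_comm ((-1 : ℤˣ) ^ ((m + 1 : ℕ) : ZMod 2)) (_ : k), smul_smul, weight_succ,
        LinearMap.neg_apply, LinearMap.smul_apply, units_smul_linearMap_apply,
        ← uzpow_natCast (R := ZMod 2), Nat.cast_succ, uzpow_add,
        uzpow_one, mul_neg, mul_one, Units.neg_smul, smul_neg, weight]
      abel

/-- An odd derivation with the prescribed values on corollas has square zero on corollas. -/
theorem derivation_corollaDifferential [CharZero k] (hc : P.IsCorollaFamily c)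
    (hδ : P.IsOddDerivation δ) (h : ∀ m n, δ m n (c m n) = P.corollaDifferential c m n) (m n : ℕ) :
    δ m n (P.corollaDifferential c m n) = 0 := by
  have hM (m n : ℕ) : coeff₂ m n (hP.mulSeries (P.corollaDifferential c)) ∈ hP.mulOps 1 := by
    rw [mulSeries, coeff₂_mk₂]
    refine Submodule.smul_mem _ _ (hP.mulOp_mem (hP.corollaDifferential_mem hc m n) ?_)
    rw [add_right_comm, ZMod.two_add_self, zero_add]
  have hL (m n : ℕ) : coeff₂ m n (hP.mulSeries c) ∈ hP.mulOps 0 := by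
    rw [mulSeries, coeff₂_mk₂]
    exact Submodule.smul_mem _ _ (hP.mulOp_mem (hc.mem m n) (ZMod.two_add_self _))
  have hN (m n : ℕ) : coeff₂ m n (hP.joinSeries c) ∈ hP.mulOps 1 := by
    rw [joinSeries, coeff₂_mk₂]
    refine Submodule.sum_mem _ fun x _ => Submodule.sum_mem _ fun y _ => Submodule.smul_mem _ _ ?_
    rw [Units.smul_def]
    refine zsmul_mem (Submodule.sum_mem _ fun i _ => Submodule.sum_mem _ fun j _ =>
      hP.wcontract_mulOp_mem (hP.hcomp_mem _ _ _ (hc.mem _ _) _ (hc.mem _ _)) ?_ _ _) _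
    rw [Nat.cast_add, ZMod.two_add_self, zero_add]
  have hcomm {q r s : ZMod 2} (hs : q * r = s) {A B : PowerSeries (PowerSeries (Module.End k P.Coinvariants))}
      (hA : ∀ m n, coeff₂ m n A ∈ hP.mulOps q) (hB : ∀ m n, coeff₂ m n B ∈ hP.mulOps r) :
      A * B = (((-1 : ℤˣ) ^ s : ℤˣ) : ℤ) • (B * A) :=
    mul_eq_zsmul_mul₂ fun m n m' n' => by
      rw [← Units.smul_def, ← hs]; exact hP.mulOps_comm (hA m n) (hB m' n')
  -- Odd multiplications anticommute with themselves, so twice the square is zero.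
  have hself (A : PowerSeries (PowerSeries (Module.End k P.Coinvariants)))
      (hA : ∀ m n, coeff₂ m n A ∈ hP.mulOps 1) : A * A = 0 := by
    have h1 : A * A = -(A * A) := by simpa using hcomm (one_mul 1) hA hA
    refine ext₂ fun m n => ?_
    have h2 := congrArg (coeff₂ m n) h1
    rw [coeff₂_neg, eq_neg_iff_add_eq_zero, ← two_smul k] at h2
    rw [(smul_eq_zero.1 h2).resolve_left two_ne_zero]
    simp [coeff₂]
  -- The quotient by this left ideal is a module over the series, in which the class of 1 plays the
  -- role of the empty operation: a series kills it exactly when it lies in the ideal.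
  set J := annihilating (k := k) (P.cls 0 0 P.empty) with hJ
  have hsmul (A : PowerSeries (PowerSeries (Module.End k P.Coinvariants))) :
      A • (Submodule.Quotient.mk 1 : _ ⧸ J) = 0 ↔ A ∈ J := by
    rw [← Submodule.Quotient.mk_smul, Submodule.Quotient.mk_eq_zero, smul_eq_mul, mul_one]
  have key := formal_master_identity (v := (Submodule.Quotient.mk 1 : _ ⧸ J))
    (D := C (C hP.laplacian)) (δ := C (C hδ.op)) (L := hP.mulSeries c)
    (M := hP.mulSeries (P.corollaDifferential c)) (N := hP.joinSeries c) (ε := prodX)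
    prodX_mul_comm (by rw [← map_mul, ← map_mul, hP.laplacian_sq, map_zero, map_zero])
    (by rw [← map_mul, ← map_mul, hP.op_mul_laplacian hδ, map_neg, map_neg, map_mul, map_mul])
    (ext₂ fun m n => by
      rw [coeff₂_C_mul, coeff₂_add, coeff₂_mul_C, mulSeries, mulSeries, coeff₂_mk₂, coeff₂_mk₂,
        mul_smul_comm, hP.op_mul_mulOp hδ (hc.mem m n), smul_add, smul_mul_assoc, h])
    (hP.joinSeries_add_self hc) (by simpa using hcomm (mul_zero 1) hN hL)
    (by simpa using hcomm (mul_zero 1) hM hL) (by simpa using hcomm (one_mul 1) hM hN)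
    (hself _ hM) (hself _ hN)
    ((hsmul _).2 fun m n => by
      rw [← one_mul (C (C _)), coeff₂_mul_C, Module.End.mul_apply, hP.laplacian_empty, map_zero])
    ((hsmul _).2 fun m n => by
      rw [← one_mul (C (C _)), coeff₂_mul_C, Module.End.mul_apply, hδ.op_empty, map_zero])
    ((hsmul _).2 (hP.master_relation hc))
  rw [← smul_assoc, hsmul] at key
  -- Two factors `prodX` shift both indices by two, so this coefficient contains `δ` of the corolla
  -- differential in bidegree (m, n).
  have h1 := key (m + 1 + 1) (n + 1 + 1)
  rw [coeff₂_nsmul, mul_assoc, coeff₂_prodX_mul, coeff₂_prodX_mul, coeff₂_C_mul, mulSeries,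
    coeff₂_mk₂, mul_smul_comm, ← Nat.cast_smul_eq_nsmul k, smul_smul, LinearMap.smul_apply] at h1
  have h2 := (smul_eq_zero.1 h1).resolve_left (mul_ne_zero (by norm_num) (by
    simp [weight, Nat.factorial_ne_zero]))
  have hF := hP.corollaDifferential_mem hc m n
  rw [Module.End.mul_apply, hP.mulOp_cls _ hP.empty_mem, mul_zero, uzpow_zero, one_smul, hδ.op_cls,
    hδ.leibniz _ _ hF, hδ.map_empty, map_zero, smul_zero, map_add, map_zero,
    add_zero (P.cls _ _ _)] at h2
  -- The class of the operation vanishes, and its skew-symmetry is inherited from the corolla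
  -- differential.
  refine hP.eq_zero_of_cls_eq_zero (fun σ τ => ?_)
    (hP.cls_eq_zero_of_mulOp_empty (hδ.odd _ _ _ _ hF) ?_)
  · rw [← hδ.map_act, hP.corollaDifferential_act hc, units_smul_apply]
  · rw [hP.mulOp_cls _ hP.empty_mem, mul_zero, uzpow_zero, one_smul]
    exact h2

end IsWheeledProp

lemma freeDifferential_isOddDerivation [CharZero k] :
    (freeData k).IsOddDerivation (freeDifferential k) where
  odd _ _ _ _ hf := freeDifferential_odd hf
  map_act := freeDifferential_act
  leibniz q f hf g := freeDifferential_hcomp q f hf g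
  map_contract := freeDifferential_contract
  map_one := freeDifferential_freeCls .one
  map_empty := freeDifferential_freeCls .empty

lemma freeDifferential_isDifferential [CharZero k] :
    (freeData k).IsDifferential (freeDifferential k) where
  odd := freeDifferential_isOddDerivation.odd
  map_act := freeDifferential_isOddDerivation.map_act
  leibniz := freeDifferential_isOddDerivation.leibniz
  map_contract := freeDifferential_isOddDerivation.map_contract
  map_one := freeDifferential_isOddDerivation.map_one
  map_empty := freeDifferential_isOddDerivation.map_empty
  sq_zero _ _ f := freeDifferential_sq_zero_of_corolla (fun m n => by
    rw [freeDifferential_corolla]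
    exact free_isWheeledProp.derivation_corollaDifferential freeCorolla_isCorollaFamily
      freeDifferential_isOddDerivation freeDifferential_corolla m n) f

end WheeledPropData

/-! ### The wheeled PROP of arrays -/

lemma units_pow_smul_congr {W : Type*} [AddCommGroup W] {x y : ZMod 2} (h : x = y) {w w' : W}
    (hw : w = w') : ((-1 : ℤˣ) ^ x) • w = ((-1 : ℤˣ) ^ y) • w' := by rw [h, hw]

section Arrays

variable {k : Type u} [Field k] {ι : Type w} (p : ι → ZMod 2)

/-- Arrays of parity `q`. -/
def IsHomogeneousArray {m n : ℕ} (q : ZMod 2) (A : Matrix (Fin m → ι) (Fin n → ι) k) : Prop :=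
  ∀ β α, A β α ≠ 0 → (∑ i, p (β i)) + ∑ j, p (α j) = q

lemma arrayAct_apply {m n m' n' : ℕ} (σ : Fin m ≃ Fin m') (τ : Fin n ≃ Fin n')
    (A : Matrix (Fin m → ι) (Fin n → ι) k) (β : Fin m' → ι) (α : Fin n' → ι) :
    arrayAct k p σ τ A β α =
      ((-1 : ℤˣ) ^ (koszulExp σ (fun i => p (β (σ i))) + koszulExp τ (fun i => p (α (τ i))))) •
        A (β ∘ σ) (α ∘ τ) := by
  rw [uzpow_add, ← koszulSign_eq, ← koszulSign_eq]; rfl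

lemma arrayTensor_apply {m n m' n' : ℕ} (A : Matrix (Fin m → ι) (Fin n → ι) k)
    (B : Matrix (Fin m' → ι) (Fin n' → ι) k) (β : Fin (m + m') → ι) (α : Fin (n + n') → ι) :
    arrayTensor k p A B β α =
      ((-1 : ℤˣ) ^ (((∑ i, p (β (Fin.natAdd m i))) + ∑ j, p (α (Fin.natAdd n j))) *
          ∑ j, p (α (Fin.castAdd n' j)))) •
        (A (fun i => β (Fin.castAdd m' i)) (fun j => α (Fin.castAdd n' j)) *
          B (fun i => β (Fin.natAdd m i)) (fun j => α (Fin.natAdd n j))) := rfl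

/-- The sum of the parities of the entries behind the position `i`. -/
def parityBehind {m : ℕ} (i : Fin (m + 1)) (β : Fin m → ι) : ZMod 2 :=
  ∑ l : Fin m, if i ≤ l.castSucc then p (β l) else 0

lemma arrayContract_apply [Fintype ι] [DecidableEq ι] {m n : ℕ} (i : Fin (m + 1)) (j : Fin (n + 1))
    (A : Matrix (Fin (m + 1) → ι) (Fin (n + 1) → ι) k) (β : Fin m → ι) (α : Fin n → ι) :
    arrayContract k p i j A β α = ∑ γ : ι,
      ((-1 : ℤˣ) ^ (p γ * (1 + parityBehind p i β + parityBehind p j α))) •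
        A (i.insertNth γ β) (j.insertNth γ α) := rfl

variable {p}

lemma arrayAct_homogeneous {m n m' n' : ℕ} (σ : Fin m ≃ Fin m') (τ : Fin n ≃ Fin n') {q : ZMod 2}
    {A : Matrix (Fin m → ι) (Fin n → ι) k} (hA : IsHomogeneousArray p q A) :
    IsHomogeneousArray p q (arrayAct k p σ τ A) := by
  intro β α h
  rw [arrayAct_apply] at h
  rw [← hA _ _ fun h0 => h (by rw [h0, smul_zero])]
  simp only [Function.comp_apply, σ.sum_comp (fun i => p (β i)), τ.sum_comp (fun i => p (α i))]

lemma arrayTensor_homogeneous {m n m' n' : ℕ} {q r : ZMod 2}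
    {A : Matrix (Fin m → ι) (Fin n → ι) k} {B : Matrix (Fin m' → ι) (Fin n' → ι) k}
    (hA : IsHomogeneousArray p q A) (hB : IsHomogeneousArray p r B) :
    IsHomogeneousArray p (q + r) (arrayTensor k p A B) := by
  intro β α h
  rw [arrayTensor_apply] at h
  rw [← hA _ _ fun h0 => h (by rw [h0, zero_mul, smul_zero]),
    ← hB _ _ fun h0 => h (by rw [h0, mul_zero, smul_zero]), Fin.sum_univ_add, Fin.sum_univ_add]
  ring

lemma sum_parity_insertNth {m : ℕ} (i : Fin (m + 1)) (γ : ι) (β : Fin m → ι) :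
    ∑ l, p (i.insertNth (α := fun _ => ι) γ β l) = p γ + ∑ l, p (β l) := by
  rw [Fin.sum_univ_succAbove _ i]
  simp

lemma arrayContract_homogeneous [Fintype ι] [DecidableEq ι] {m n : ℕ} (i : Fin (m + 1))
    (j : Fin (n + 1)) {q : ZMod 2} {A : Matrix (Fin (m + 1) → ι) (Fin (n + 1) → ι) k}
    (hA : IsHomogeneousArray p q A) : IsHomogeneousArray p q (arrayContract k p i j A) := by
  intro β α h
  rw [arrayContract_apply] at h
  obtain ⟨γ, -, hγ⟩ := Finset.exists_ne_zero_of_sum_ne_zero h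
  rw [← hA _ _ fun h0 => hγ (by rw [h0, smul_zero]), sum_parity_insertNth, sum_parity_insertNth]
  linear_combination -ZMod.two_add_self (p γ)

variable (p)

lemma arrayAct_refl {m n : ℕ} (A : Matrix (Fin m → ι) (Fin n → ι) k) :
    arrayAct k p (Equiv.refl _) (Equiv.refl _) A = A := by
  ext β α
  rw [arrayAct_apply, koszulExp_refl, koszulExp_refl, add_zero, uzpow_zero, one_smul]
  rfl

lemma arrayAct_finCongr {m n m' n' : ℕ} (hm : m = m') (hn : n = n')
    (A : Matrix (Fin m → ι) (Fin n → ι) k) (β : Fin m' → ι) (α : Fin n' → ι) :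
    arrayAct k p (finCongr hm) (finCongr hn) A β α = A (β ∘ finCongr hm) (α ∘ finCongr hn) := by
  rw [arrayAct_apply, koszulExp_finCongr, koszulExp_finCongr, add_zero, uzpow_zero, one_smul]

lemma arrayAct_arrayAct {m n m' n' m'' n'' : ℕ} (σ : Fin m ≃ Fin m') (τ : Fin n ≃ Fin n')
    (σ' : Fin m' ≃ Fin m'') (τ' : Fin n' ≃ Fin n'') (A : Matrix (Fin m → ι) (Fin n → ι) k) :
    arrayAct k p σ' τ' (arrayAct k p σ τ A) = arrayAct k p (σ.trans σ') (τ.trans τ') A := by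
  ext β α
  rw [arrayAct_apply, arrayAct_apply, arrayAct_apply, smul_smul, ← uzpow_add, koszulExp_trans,
    koszulExp_trans]
  refine units_pow_smul_congr ?_ rfl
  simp only [Function.comp_def, Equiv.trans_apply, Equiv.apply_symm_apply]
  ring

lemma arrayTensor_arrayAct {m n m' n' a b a' b' : ℕ} (σ : Fin m ≃ Fin m') (τ : Fin n ≃ Fin n')
    (σ' : Fin a ≃ Fin a') (τ' : Fin b ≃ Fin b') (A : Matrix (Fin m → ι) (Fin n → ι) k)
    (B : Matrix (Fin a → ι) (Fin b → ι) k) :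
    arrayTensor k p (arrayAct k p σ τ A) (arrayAct k p σ' τ' B) =
      arrayAct k p (blockSum σ σ') (blockSum τ τ') (arrayTensor k p A B) := by
  ext β α
  rw [arrayAct_apply, arrayTensor_apply, arrayTensor_apply, arrayAct_apply, arrayAct_apply,
    smul_mul_smul_comm, smul_smul, smul_smul, koszulExp_blockSum, koszulExp_blockSum, ← uzpow_add,
    ← uzpow_add, ← uzpow_add]
  simp only [Function.comp_def, blockSum_castAdd, blockSum_natAdd,
    σ'.sum_comp (fun i => p (β (Fin.natAdd m' i))), τ'.sum_comp (fun i => p (α (Fin.natAdd n' i))),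
    τ.sum_comp (fun i => p (α (Fin.castAdd b' i)))]
  refine units_pow_smul_congr ?_ rfl
  ring

lemma arrayTensor_assoc {m n m' n' m'' n'' : ℕ} (A : Matrix (Fin m → ι) (Fin n → ι) k)
    (B : Matrix (Fin m' → ι) (Fin n' → ι) k) (C : Matrix (Fin m'' → ι) (Fin n'' → ι) k) :
    arrayAct k p (finCongr (Nat.add_assoc m m' m'')) (finCongr (Nat.add_assoc n n' n''))
      (arrayTensor k p (arrayTensor k p A B) C) = arrayTensor k p A (arrayTensor k p B C) := by
  ext β α
  rw [arrayAct_finCongr, arrayTensor_apply, arrayTensor_apply, arrayTensor_apply,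
    arrayTensor_apply, smul_mul_assoc, mul_smul_comm, smul_smul, smul_smul, ← uzpow_add,
    ← uzpow_add]
  have c1 (a b c : ℕ) (i : Fin a) : finCongr (Nat.add_assoc a b c) (Fin.castAdd c (Fin.castAdd b i))
      = Fin.castAdd (b + c) i := by ext; simp
  have c2 (a b c : ℕ) (i : Fin b) : finCongr (Nat.add_assoc a b c) (Fin.castAdd c (Fin.natAdd a i))
      = Fin.natAdd a (Fin.castAdd c i) := by ext; simp
  have c3 (a b c : ℕ) (i : Fin c) : finCongr (Nat.add_assoc a b c) (Fin.natAdd (a + b) i)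
      = Fin.natAdd a (Fin.natAdd b i) := by ext; simp [add_assoc]
  simp only [Function.comp_def, Fin.sum_univ_add, c1, c2, c3]
  refine units_pow_smul_congr ?_ (mul_assoc _ _ _)
  ring

/-- Signs need comparing only at nonzero entries, where the parity of an array is the sum of the
parities of its indices. -/
lemma arrayTensor_comm {m n m' n' : ℕ} {q r : ZMod 2}
    {A : Matrix (Fin m → ι) (Fin n → ι) k} {B : Matrix (Fin m' → ι) (Fin n' → ι) k}
    (hA : IsHomogeneousArray p q A) (hB : IsHomogeneousArray p r B) :
    arrayAct k p finAddFlip finAddFlip (arrayTensor k p A B) =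
      ((-1 : ℤˣ) ^ (q * r)) • arrayTensor k p B A := by
  ext β α
  rw [Matrix.smul_apply, arrayAct_apply, arrayTensor_apply, arrayTensor_apply, smul_smul,
    ← uzpow_add, koszulExp_finAddFlip, koszulExp_finAddFlip]
  simp only [Function.comp_def, finAddFlip_apply_castAdd, finAddFlip_apply_natAdd]
  by_cases hA0 : A (fun i => β (Fin.natAdd m' i)) (fun j => α (Fin.natAdd n' j)) = 0
  · rw [hA0]; simp
  by_cases hB0 : B (fun i => β (Fin.castAdd m i)) (fun j => α (Fin.castAdd n j)) = 0
  · rw [hB0]; simp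
  rw [smul_smul, ← uzpow_add, ← hA _ _ hA0, ← hB _ _ hB0]
  refine units_pow_smul_congr ?_ (mul_comm _ _)
  have : ∀ a b c d : ZMod 2, a * c + b * d + (c + d) * b = (a + b) * (c + d) + (a + b) * d := by
    decide
  exact this _ _ _ _

lemma parityBehind_eq {m : ℕ} (i : Fin (m + 1)) (β : Fin m → ι) :
    parityBehind p i β = ∑ l, if i < i.succAbove l then p (β l) else 0 := by
  simp only [parityBehind, Fin.lt_succAbove_iff_le_castSucc]

/-- The correction is the difference between the signs of moving the contracted factor to the end
before and after the relabelling, as needed for equivariance of the supertrace. -/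
lemma koszulExp_insertNth {m m' : ℕ} (σ : Fin (m + 1) ≃ Fin (m' + 1)) (σ' : Fin m ≃ Fin m')
    (i : Fin (m + 1)) (h : ∀ x, σ (i.succAbove x) = (σ i).succAbove (σ' x)) (γ : ι)
    (β : Fin m' → ι) :
    koszulExp σ (fun x => p ((σ i).insertNth (α := fun _ => ι) γ β (σ x))) =
      koszulExp σ' (fun x => p (β (σ' x))) +
        p γ * (parityBehind p i (β ∘ σ') + parityBehind p (σ i) β) := by
  rw [koszulExp_succAbove σ σ' i h]
  simp only [h, Fin.insertNth_apply_same, Fin.insertNth_apply_succAbove]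
  rw [parityBehind, parityBehind,
    ← σ'.sum_comp (fun l => if σ i ≤ l.castSucc then p (β l) else 0)]
  rfl

lemma insertNth_comp_equiv {m m' : ℕ} (σ : Fin (m + 1) ≃ Fin (m' + 1)) (σ' : Fin m ≃ Fin m')
    (i : Fin (m + 1)) (h : ∀ x, σ (i.succAbove x) = (σ i).succAbove (σ' x)) (γ : ι)
    (β : Fin m' → ι) :
    (σ i).insertNth (α := fun _ => ι) γ β ∘ σ = i.insertNth (α := fun _ => ι) γ (β ∘ σ') := by
  refine Fin.eq_insertNth_iff.2 ⟨by simp, ?_⟩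
  funext x
  simp [Fin.removeNth, h]

variable [Fintype ι] [DecidableEq ι]

lemma arrayContract_arrayAct {m n m' n' : ℕ} (σ : Fin (m + 1) ≃ Fin (m' + 1))
    (τ : Fin (n + 1) ≃ Fin (n' + 1)) (σ' : Fin m ≃ Fin m') (τ' : Fin n ≃ Fin n') (i : Fin (m + 1))
    (j : Fin (n + 1)) (hσ : ∀ x, σ (i.succAbove x) = (σ i).succAbove (σ' x))
    (hτ : ∀ x, τ (j.succAbove x) = (τ j).succAbove (τ' x))
    (A : Matrix (Fin (m + 1) → ι) (Fin (n + 1) → ι) k) :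
    arrayContract k p (σ i) (τ j) (arrayAct k p σ τ A) =
      arrayAct k p σ' τ' (arrayContract k p i j A) := by
  ext β α
  rw [arrayAct_apply, arrayContract_apply, arrayContract_apply, Finset.smul_sum]
  refine Finset.sum_congr rfl fun γ _ => ?_
  rw [arrayAct_apply, smul_smul, smul_smul, ← uzpow_add, ← uzpow_add,
    koszulExp_insertNth p σ σ' i hσ, koszulExp_insertNth p τ τ' j hτ,
    insertNth_comp_equiv σ σ' i hσ, insertNth_comp_equiv τ τ' j hτ]
  refine units_pow_smul_congr ?_ rfl
  have : ∀ x a b c d s t : ZMod 2, x * (1 + b + d) + (s + x * (a + b) + (t + x * (c + d))) =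
      s + t + x * (1 + a + c) := by decide
  exact this _ _ _ _ _ _ _

omit [Fintype ι] [DecidableEq ι] in
-- Taking out two factors in the two orders differs by their mutual Koszul sign p γ * p γ'. In a
-- double contraction this discrepancy occurs once for the outputs and once for the inputs, so it
-- disappears.
lemma parityBehind_insertNth {m : ℕ} (i : Fin (m + 2)) (i' : Fin (m + 1)) (γ γ' : ι)
    (β : Fin m → ι) :
    p γ * parityBehind p i (i'.insertNth (α := fun _ => ι) γ' β) + p γ' * parityBehind p i' β =
      p γ' * parityBehind p (i.succAbove i') ((i'.predAbove i).insertNth (α := fun _ => ι) γ β) +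
        p γ * parityBehind p (i'.predAbove i) β + p γ * p γ' := by
  have e1 (l : Fin m) : i.succAbove (i'.succAbove l) =
      (i.succAbove i').succAbove ((i'.predAbove i).succAbove l) :=
    (Fin.succAbove_succAbove_succAbove_predAbove i i' l).symm
  have e2 : (i.succAbove i').succAbove (i'.predAbove i) = i :=
    Fin.succAbove_succAbove_predAbove i i'
  have c1 (l : Fin m) : i' < i'.succAbove l ↔ i.succAbove i' < i.succAbove (i'.succAbove l) :=
    Fin.succAbove_lt_succAbove_iff.symm
  have c2 (l : Fin m) : i'.predAbove i < (i'.predAbove i).succAbove l ↔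
      i < i.succAbove (i'.succAbove l) := by
    rw [← Fin.succAbove_lt_succAbove_iff (p := i.succAbove i'), e2, ← e1]
  simp only [parityBehind_eq]
  rw [Fin.sum_univ_succAbove _ i', Fin.sum_univ_succAbove _ (i'.predAbove i)]
  simp only [Fin.insertNth_apply_same, Fin.insertNth_apply_succAbove, ← e1, e2, c1, c2]
  have hne : i.succAbove i' ≠ i := Fin.succAbove_ne i i'
  have key : ∀ x y a b : ZMod 2, x * (y + a) + y * b = y * (0 + b) + x * a + x * y := by decide
  have key' : ∀ x y a b : ZMod 2, x * (0 + a) + y * b = y * (x + b) + x * a + x * y := by decide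
  rcases lt_or_gt_of_ne hne with h | h
  · rw [if_neg h.not_gt, if_pos h]; exact key' _ _ _ _
  · rw [if_pos h, if_neg h.not_gt]; exact key _ _ _ _

omit [Fintype ι] [DecidableEq ι] in
lemma insertNth_insertNth {m : ℕ} (i : Fin (m + 2)) (i' : Fin (m + 1)) (γ γ' : ι)
    (β : Fin m → ι) :
    i.insertNth (α := fun _ => ι) γ (i'.insertNth (α := fun _ => ι) γ' β) =
      (i.succAbove i').insertNth (α := fun _ => ι) γ'
        ((i'.predAbove i).insertNth (α := fun _ => ι) γ β) := by
  have e2 : (i.succAbove i').succAbove (i'.predAbove i) = i :=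
    Fin.succAbove_succAbove_predAbove i i'
  refine Fin.eq_insertNth_iff.2 ⟨by simp, Fin.eq_insertNth_iff.2 ⟨by simp [Fin.removeNth, e2], ?_⟩⟩
  funext x
  simp [Fin.removeNth, Fin.succAbove_succAbove_succAbove_predAbove]

lemma arrayContract_arrayContract {m n : ℕ} (i : Fin (m + 2)) (j : Fin (n + 2)) (i' : Fin (m + 1))
    (j' : Fin (n + 1)) (A : Matrix (Fin (m + 2) → ι) (Fin (n + 2) → ι) k) :
    arrayContract k p i' j' (arrayContract k p i j A) =
      arrayContract k p (i'.predAbove i) (j'.predAbove j)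
        (arrayContract k p (i.succAbove i') (j.succAbove j') A) := by
  ext β α
  simp only [arrayContract_apply, Finset.smul_sum, smul_smul, ← uzpow_add]
  rw [Finset.sum_comm]
  refine Finset.sum_congr rfl fun γ _ => Finset.sum_congr rfl fun γ' _ => ?_
  rw [insertNth_insertNth i i', insertNth_insertNth j j']
  refine units_pow_smul_congr ?_ rfl
  linear_combination parityBehind_insertNth p i i' γ γ' β + parityBehind_insertNth p j j' γ γ' α +
    ZMod.two_add_self (p γ * p γ')

/-- Moving the contracted index past the legs of B gives a sign which the tensor product
compensates, because the index is also an input of A. -/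
lemma arrayContract_arrayTensor {m n a b : ℕ} (i : Fin (m + 1)) (j : Fin (n + 1))
    (A : Matrix (Fin (m + 1) → ι) (Fin (n + 1) → ι) k) (B : Matrix (Fin a → ι) (Fin b → ι) k) :
    arrayContract k p (finCongr (Nat.add_right_comm m 1 a) (Fin.castAdd a i))
      (finCongr (Nat.add_right_comm n 1 b) (Fin.castAdd b j))
      (arrayAct k p (finCongr (Nat.add_right_comm m 1 a)) (finCongr (Nat.add_right_comm n 1 b))
        (arrayTensor k p A B)) = arrayTensor k p (arrayContract k p i j A) B := by
  have s1 (m a : ℕ) (i : Fin (m + 1)) (x : Fin m) :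
      finCongr (Nat.add_right_comm m 1 a) (Fin.castAdd a (i.succAbove x)) =
      (finCongr (Nat.add_right_comm m 1 a) (Fin.castAdd a i)).succAbove (Fin.castAdd a x) := by
    ext
    simp [Fin.succAbove, Fin.lt_def]
    split_ifs <;> simp
  have s2 (m a : ℕ) (i : Fin (m + 1)) (x : Fin a) :
      finCongr (Nat.add_right_comm m 1 a) (Fin.natAdd (m + 1) x) =
      (finCongr (Nat.add_right_comm m 1 a) (Fin.castAdd a i)).succAbove (Fin.natAdd m x) := by
    ext
    have := i.isLt
    simp [Fin.succAbove, Fin.lt_def]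
    split_ifs <;> simp <;> omega
  have t1 (m a : ℕ) (i : Fin (m + 1)) (γ : ι) (β : Fin (m + a) → ι) :
      (fun x => ((finCongr (Nat.add_right_comm m 1 a) (Fin.castAdd a i)).insertNth
        (α := fun _ => ι) γ β ∘ finCongr (Nat.add_right_comm m 1 a)) (Fin.castAdd a x)) =
      i.insertNth (α := fun _ => ι) γ fun x => β (Fin.castAdd a x) := by
    refine Fin.eq_insertNth_iff.2 ⟨by simp, ?_⟩
    funext x
    simp only [Fin.removeNth, Function.comp_apply, s1, Fin.insertNth_apply_succAbove]
  have t2 (m a : ℕ) (i : Fin (m + 1)) (γ : ι) (β : Fin (m + a) → ι) :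
      (fun x => ((finCongr (Nat.add_right_comm m 1 a) (Fin.castAdd a i)).insertNth
        (α := fun _ => ι) γ β ∘ finCongr (Nat.add_right_comm m 1 a)) (Fin.natAdd (m + 1) x)) =
      fun x => β (Fin.natAdd m x) := by
    funext x
    simp only [Function.comp_apply, s2 _ _ i, Fin.insertNth_apply_succAbove]
  have t3 (m a : ℕ) (i : Fin (m + 1)) (β : Fin (m + a) → ι) :
      parityBehind p (finCongr (Nat.add_right_comm m 1 a) (Fin.castAdd a i)) β =
      parityBehind p i (fun x => β (Fin.castAdd a x)) + ∑ x, p (β (Fin.natAdd m x)) := by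
    rw [parityBehind, Fin.sum_univ_add]
    congr 1
    refine Finset.sum_congr rfl fun x _ => if_pos ?_
    have := i.isLt
    simp [Fin.le_def]
    omega
  ext β α
  rw [arrayContract_apply, arrayTensor_apply, arrayContract_apply, Finset.sum_mul, Finset.smul_sum]
  refine Finset.sum_congr rfl fun γ _ => ?_
  rw [arrayAct_finCongr, arrayTensor_apply, smul_mul_assoc, smul_smul, smul_smul, ← uzpow_add,
    ← uzpow_add, t3, t3]
  have h1 := fun m a i γ β x => congrFun (t1 m a i γ β) x
  have h2 := fun m a i γ β x => congrFun (t2 m a i γ β) x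
  simp only [t1, t2]
  simp only [h1, h2]
  rw [sum_parity_insertNth]
  refine units_pow_smul_congr ?_ rfl
  have : ∀ x a b c d e : ZMod 2, x * (1 + (a + b) + (c + d)) + (b + d) * (x + e) =
      (b + d) * e + x * (1 + a + c) := by decide
  exact this _ _ _ _ _ _

end Arrays

/-! ### Units, and the axioms for the endomorphism wheeled PROP -/

section EndProp

variable {k : Type u} [Field k] {ι : Type w} (p : ι → ZMod 2)

lemma parityBehind_zero {m : ℕ} (β : Fin m → ι) : parityBehind p 0 β = ∑ l, p (β l) := by
  simp [parityBehind]

lemma parityBehind_one {m : ℕ} (β : Fin (m + 1) → ι) :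
    parityBehind p 1 β = ∑ l : Fin m, p (β l.succ) := by
  rw [parityBehind, Fin.sum_univ_succ]
  simp [Fin.le_def]

lemma insertNth_one_succ {n : ℕ} (γ : ι) (α : Fin (n + 1) → ι) :
    (Fin.insertNth (α := fun _ => ι) (1 : Fin (n + 2)) γ α) =
      Fin.cons (α 0) (Fin.cons γ fun x : Fin n => α x.succ) := by
  refine Fin.insertNth_eq_iff.2 ⟨rfl, ?_⟩
  funext x
  refine Fin.cases rfl (fun x => ?_) x
  have : (1 : Fin (n + 2)).succAbove x.succ = x.succ.succ := by
    rw [Fin.succAbove_of_le_castSucc]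
    simp [Fin.le_def]
  rw [Fin.removeNth, this]
  rfl

variable [Fintype ι] [DecidableEq ι]

lemma arrayTensor_one_apply {m n : ℕ} (A : Matrix (Fin m → ι) (Fin n → ι) k) (β : Fin m → ι)
    (α : Fin n → ι) (γ γ' : ι) :
    arrayAct k p (finCongr (Nat.add_comm 1 m)) (finCongr (Nat.add_comm 1 n))
      (arrayTensor k p (1 : Matrix (Fin 1 → ι) (Fin 1 → ι) k) A) (Fin.cons γ β) (Fin.cons γ' α) =
      if γ = γ' then ((-1 : ℤˣ) ^ (((∑ i, p (β i)) + ∑ j, p (α j)) * p γ)) • A β α else 0 := by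
  have s1 (m : ℕ) (x : Fin m) : finCongr (Nat.add_comm 1 m) (Fin.natAdd 1 x) = x.succ := by
    ext; simp [add_comm]
  have s2 (m : ℕ) (x : Fin 1) : finCongr (Nat.add_comm 1 m) (Fin.castAdd m x) = 0 := by
    ext; simp
  have t1 (m : ℕ) (γ : ι) (β : Fin m → ι) : (fun x => ((Fin.cons γ β : Fin (m + 1) → ι) ∘
      finCongr (Nat.add_comm 1 m)) (Fin.natAdd 1 x)) = β := by
    funext x; rw [Function.comp_apply, s1, Fin.cons_succ]
  have t2 (m : ℕ) (γ : ι) (β : Fin m → ι) : (fun x => ((Fin.cons γ β : Fin (m + 1) → ι) ∘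
      finCongr (Nat.add_comm 1 m)) (Fin.castAdd m x)) = fun _ => γ := by
    funext x; rw [Function.comp_apply, s2, Fin.cons_zero]
  have h1 := fun m γ β x => congrFun (t1 m γ β) x
  have h2 := fun m γ β x => congrFun (t2 m γ β) x
  rw [arrayAct_finCongr, arrayTensor_apply, t1, t1, t2, t2]
  simp only [h1, h2]
  rw [Matrix.one_apply]
  by_cases h : γ = γ'
  · subst h; simp
  · rw [if_neg h, if_neg fun h' => h (congrFun h' 0), zero_mul, smul_zero]

/-- The unit is the identity matrix and leaves a single summand of the supertrace. Its sign cancels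
against that of the tensor product. -/
lemma arrayTensor_one_input {m n : ℕ} (A : Matrix (Fin m → ι) (Fin (n + 1) → ι) k) :
    arrayContract k p 0 1 (arrayAct k p (finCongr (Nat.add_comm 1 m))
      (finCongr (Nat.add_comm 1 (n + 1)))
      (arrayTensor k p (1 : Matrix (Fin 1 → ι) (Fin 1 → ι) k) A)) = A := by
  ext β α
  rw [arrayContract_apply, Finset.sum_eq_single (α 0)]
  · rw [Fin.insertNth_zero', insertNth_one_succ, arrayTensor_one_apply, if_pos rfl, smul_smul,
      ← uzpow_add]
    conv_rhs => rw [← one_smul ℤˣ (A β α), ← uzpow_zero (R := ZMod 2) (-1 : ℤˣ)]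
    refine units_pow_smul_congr ?_ (congrArg _ ?_)
    · rw [parityBehind_zero, parityBehind_one, Fin.sum_univ_succ]
      simp only [Fin.cons_zero, Fin.cons_succ]
      have : ∀ x a b : ZMod 2, x * (1 + a + b) + (a + (x + b)) * x = 0 := by decide
      exact this _ _ _
    · funext x; refine Fin.cases rfl (fun x => rfl) x
  · intro γ _ hγ
    rw [Fin.insertNth_zero', insertNth_one_succ, arrayTensor_one_apply, if_neg hγ, smul_zero]
  · simp

lemma arrayTensor_one_output {m n : ℕ} (A : Matrix (Fin (m + 1) → ι) (Fin n → ι) k) :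
    arrayContract k p 1 0 (arrayAct k p (finCongr (Nat.add_comm 1 (m + 1)))
      (finCongr (Nat.add_comm 1 n))
      (arrayTensor k p (1 : Matrix (Fin 1 → ι) (Fin 1 → ι) k) A)) = A := by
  ext β α
  rw [arrayContract_apply, Finset.sum_eq_single (β 0)]
  · rw [Fin.insertNth_zero', insertNth_one_succ, arrayTensor_one_apply, if_pos rfl, smul_smul,
      ← uzpow_add]
    conv_rhs => rw [← one_smul ℤˣ (A β α), ← uzpow_zero (R := ZMod 2) (-1 : ℤˣ)]
    refine units_pow_smul_congr ?_ (congrArg (fun x => A x α) ?_)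
    · rw [parityBehind_zero, parityBehind_one, Fin.sum_univ_succ]
      simp only [Fin.cons_zero, Fin.cons_succ]
      have : ∀ x a b : ZMod 2, x * (1 + a + b) + (x + a + b) * x = 0 := by decide
      exact this _ _ _
    · funext x; refine Fin.cases rfl (fun x => rfl) x
  · intro γ _ hγ
    rw [Fin.insertNth_zero', insertNth_one_succ, arrayTensor_one_apply, if_neg (Ne.symm hγ),
      smul_zero]
  · simp

section

variable {M : Type v} [AddCommGroup M] [Module k M] (b : Module.Basis ι k M)

/-- The linear maps in the endomorphism PROP as arrays. -/
def endCoeff (m n : ℕ) :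
    (endWheeledProp b p).carrier m n ≃ₗ[k] Matrix (Fin m → ι) (Fin n → ι) k :=
  tensorCoeff b m n

lemma mem_endGr {m n : ℕ} {q : ZMod 2} {f : (endWheeledProp b p).carrier m n} :
    f ∈ (endWheeledProp b p).gr m n q ↔ IsHomogeneousArray p q (endCoeff p b m n f) := Iff.rfl

lemma endCoeff_act {m n m' n' : ℕ} (σ : Fin m ≃ Fin m') (τ : Fin n ≃ Fin n')
    (f : (endWheeledProp b p).carrier m n) :
    endCoeff p b m' n' ((endWheeledProp b p).act σ τ f) =
      arrayAct k p σ τ (endCoeff p b m n f) :=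
  (tensorCoeff b m' n').apply_symm_apply _

lemma endCoeff_hcomp {m n m' n' : ℕ} (f : (endWheeledProp b p).carrier m n)
    (g : (endWheeledProp b p).carrier m' n') :
    endCoeff p b _ _ ((endWheeledProp b p).hcomp f g) =
      arrayTensor k p (endCoeff p b m n f) (endCoeff p b m' n' g) :=
  (tensorCoeff b _ _).apply_symm_apply _

lemma endCoeff_contract {m n : ℕ} (i : Fin (m + 1)) (j : Fin (n + 1))
    (f : (endWheeledProp b p).carrier (m + 1) (n + 1)) :
    endCoeff p b m n ((endWheeledProp b p).contract i j f) =
      arrayContract k p i j (endCoeff p b _ _ f) :=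
  (tensorCoeff b _ _).apply_symm_apply _

lemma endCoeff_one : endCoeff p b 1 1 (endWheeledProp b p).one = 1 := by
  show LinearMap.toMatrix _ _ (PiTensorProduct.map fun _ => LinearMap.id) = 1
  rw [PiTensorProduct.map_id, LinearMap.toMatrix_id]

lemma endCoeff_empty : endCoeff p b 0 0 (endWheeledProp b p).empty = 1 :=
  LinearMap.toMatrix_id _

lemma endGr_isInternal (m n : ℕ) : DirectSum.IsInternal ((endWheeledProp b p).gr m n) := by
  rw [DirectSum.isInternal_submodule_iff_isCompl _ (i := 0) (j := 1) (by decide)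
    (by ext x; revert x; simp; decide)]
  refine ⟨Submodule.disjoint_def.2 fun f hf hf' => ?_, codisjoint_iff.2 (eq_top_iff.2 fun f _ => ?_)⟩
  · apply (endCoeff p b m n).injective
    ext β α
    by_contra h
    rw [map_zero, Matrix.zero_apply] at h
    exact absurd ((hf β α h).symm.trans (hf' β α h)) (by decide)
  · refine Submodule.mem_sup.2 ?_
    refine ⟨(endCoeff p b m n).symm (Matrix.of fun β α =>
      if (∑ i, p (β i)) + ∑ j, p (α j) = 0 then endCoeff p b m n f β α else 0), (mem_endGr p b).2 fun β α h => ?_,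
      (endCoeff p b m n).symm (Matrix.of fun β α =>
      if (∑ i, p (β i)) + ∑ j, p (α j) = 1 then endCoeff p b m n f β α else 0), (mem_endGr p b).2 fun β α h => ?_, ?_⟩
    · rw [LinearEquiv.apply_symm_apply, Matrix.of_apply] at h
      by_contra h'
      rw [if_neg h'] at h
      exact h rfl
    · rw [LinearEquiv.apply_symm_apply, Matrix.of_apply] at h
      by_contra h'
      rw [if_neg h'] at h
      exact h rfl
    · apply (endCoeff p b m n).injective
      rw [map_add, LinearEquiv.apply_symm_apply, LinearEquiv.apply_symm_apply]
      ext β α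
      rw [Matrix.add_apply, Matrix.of_apply, Matrix.of_apply]
      have h2 : ∀ x : ZMod 2, x = 0 ∨ x = 1 := by decide
      rcases h2 ((∑ i, p (β i)) + ∑ j, p (α j)) with h | h <;> simp [h]

lemma endWheeledProp_isWheeledProp : (endWheeledProp b p).IsWheeledProp where
  isInternal := endGr_isInternal p b
  act_mem σ τ q f hf := by
    rw [mem_endGr, endCoeff_act]; exact arrayAct_homogeneous σ τ hf
  hcomp_mem q r f hf g hg := by
    rw [mem_endGr, endCoeff_hcomp]; exact arrayTensor_homogeneous hf hg
  contract_mem i j q f hf := by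
    rw [mem_endGr, endCoeff_contract]; exact arrayContract_homogeneous i j hf
  one_mem := (mem_endGr p b).2 fun β α h => by
    rw [endCoeff_one, Matrix.one_apply, ite_ne_right_iff] at h
    rw [h.1, ZMod.two_add_self]
  empty_mem β α h := by simp
  act_refl f := (endCoeff p b _ _).injective (by rw [endCoeff_act, arrayAct_refl])
  act_act σ τ σ' τ' f := (endCoeff p b _ _).injective (by
    rw [endCoeff_act, endCoeff_act, endCoeff_act, arrayAct_arrayAct])
  hcomp_act σ τ σ' τ' f g := (endCoeff p b _ _).injective (by
    rw [endCoeff_act, endCoeff_hcomp, endCoeff_hcomp, endCoeff_act, endCoeff_act,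
      arrayTensor_arrayAct])
  hcomp_assoc f g h := (endCoeff p b _ _).injective (by
    rw [endCoeff_act, endCoeff_hcomp, endCoeff_hcomp, endCoeff_hcomp, endCoeff_hcomp,
      arrayTensor_assoc])
  empty_hcomp {m n} f := (endCoeff p b _ _).injective (by
    rw [endCoeff_act, endCoeff_hcomp, endCoeff_empty]
    ext β α
    have s1 (m : ℕ) (x : Fin m) : finCongr (Nat.zero_add m) (Fin.natAdd 0 x) = x := by ext; simp
    rw [arrayAct_finCongr, arrayTensor_apply, Matrix.one_apply, if_pos (Subsingleton.elim _ _)]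
    simp only [Function.comp_apply, s1, Finset.univ_eq_empty, Finset.sum_empty, mul_zero,
      uzpow_zero, one_smul, one_mul])
  hcomp_comm q r f hf g hg := (endCoeff p b _ _).injective (by
    have h : endCoeff p b _ _ (((-1 : ℤˣ) ^ (q * r)) • (endWheeledProp b p).hcomp g f) =
      ((-1 : ℤˣ) ^ (q * r)) • endCoeff p b _ _ ((endWheeledProp b p).hcomp g f) :=
        units_smul_apply (endCoeff p b _ _).toLinearMap _ _
    rw [h, endCoeff_act, endCoeff_hcomp, endCoeff_hcomp, arrayTensor_comm p ((mem_endGr p b).1 hf) ((mem_endGr p b).1 hg)])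
  contract_act σ τ σ' τ' i j hσ hτ f := (endCoeff p b _ _).injective (by
    rw [endCoeff_act, endCoeff_contract, endCoeff_contract, endCoeff_act,
      arrayContract_arrayAct p σ τ σ' τ' i j hσ hτ])
  contract_contract i j i' j' f := (endCoeff p b _ _).injective (by
    simp only [endCoeff_contract]; rw [arrayContract_arrayContract])
  contract_hcomp i j f g := (endCoeff p b _ _).injective (by
    rw [endCoeff_contract, endCoeff_act, endCoeff_hcomp, endCoeff_hcomp,
      endCoeff_contract, arrayContract_arrayTensor])
  one_input f := (endCoeff p b _ _).injective (by
    rw [endCoeff_contract, endCoeff_act, endCoeff_hcomp, endCoeff_one,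
      arrayTensor_one_input])
  one_output f := (endCoeff p b _ _).injective (by
    rw [endCoeff_contract, endCoeff_act, endCoeff_hcomp, endCoeff_one,
      arrayTensor_one_output])

end

end EndProp

/-! ### The differential of arrays -/

/-- Changing one parity affects the pairs containing `i`, and such a pair is inverted when exactly
one of `i < l` and `σ i < σ l` holds. -/
lemma koszulExp_update {m m' : ℕ} (σ : Fin m ≃ Fin m') (q : Fin m → ZMod 2) (i : Fin m) :
    koszulExp σ (Function.update q i (q i + 1)) = koszulExp σ q +
      ((∑ l, if i < l then q l else 0) + ∑ l, if σ i < σ l then q l else 0) := by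
  obtain rfl : m = m' := by simpa using Fintype.card_congr σ
  cases m with
  | zero => exact i.elim0
  | succ m =>
    obtain ⟨σ', hσ⟩ := exists_succAbove_equiv σ i
    rw [koszulExp_succAbove σ σ' i hσ, koszulExp_succAbove σ σ' i hσ, Fin.sum_univ_succAbove _ i,
      Fin.sum_univ_succAbove _ i]
    simp only [lt_self_iff_false, if_false, zero_add, Function.update_self,
      Function.update_of_ne (Fin.succAbove_ne i _), hσ, Fin.lt_succAbove_iff_le_castSucc]
    ring

section ArrayDifferential

variable {k : Type u} [Field k] {ι : Type w} (p : ι → ZMod 2) [Fintype ι] [DecidableEq ι]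
  (D : Matrix ι ι k)

/-- The operator `D` applied to the output `i`. -/
def outDiff {m n : ℕ} (i : Fin m) :
    Matrix (Fin m → ι) (Fin n → ι) k →ₗ[k] Matrix (Fin m → ι) (Fin n → ι) k where
  toFun A := Matrix.of fun β α => ∑ γ, ((-1 : ℤˣ) ^ (∑ l, if l < i then p (β l) else 0)) •
    (D (β i) γ * A (Function.update β i γ) α)
  map_add' A B := by ext β α; simp [mul_add, Finset.sum_add_distrib]
  map_smul' r A := by
    ext β α
    simp only [Matrix.of_apply, Matrix.smul_apply, RingHom.id_apply, Finset.smul_sum]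
    exact Finset.sum_congr rfl fun _ _ => by rw [mul_smul_comm, smul_comm]

/-- The operator `D` applied to the input `j`, up to sign. -/
def inDiff {m n : ℕ} (j : Fin n) :
    Matrix (Fin m → ι) (Fin n → ι) k →ₗ[k] Matrix (Fin m → ι) (Fin n → ι) k where
  toFun A := Matrix.of fun β α => ∑ γ,
    ((-1 : ℤˣ) ^ ((∑ l, p (β l)) + ∑ l, if j ≤ l then p (α l) else 0)) •
      (D γ (α j) * A β (Function.update α j γ))
  map_add' A B := by ext β α; simp [mul_add, Finset.sum_add_distrib]
  map_smul' r A := by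
    ext β α
    simp only [Matrix.of_apply, Matrix.smul_apply, RingHom.id_apply, Finset.smul_sum]
    exact Finset.sum_congr rfl fun _ _ => by rw [mul_smul_comm, smul_comm]

/-- The differential of arrays. -/
def arrayDiff (m n : ℕ) :
    Matrix (Fin m → ι) (Fin n → ι) k →ₗ[k] Matrix (Fin m → ι) (Fin n → ι) k :=
  (∑ i, outDiff p D i) + ∑ j, inDiff p D j

variable {D}

lemma outDiff_apply {m n : ℕ} (i : Fin m) (A : Matrix (Fin m → ι) (Fin n → ι) k) (β : Fin m → ι)
    (α : Fin n → ι) : outDiff p D i A β α =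
      ∑ γ, ((-1 : ℤˣ) ^ (∑ l, if l < i then p (β l) else 0)) •
        (D (β i) γ * A (Function.update β i γ) α) := rfl

lemma inDiff_apply {m n : ℕ} (j : Fin n) (A : Matrix (Fin m → ι) (Fin n → ι) k) (β : Fin m → ι)
    (α : Fin n → ι) : inDiff p D j A β α =
      ∑ γ, ((-1 : ℤˣ) ^ ((∑ l, p (β l)) + ∑ l, if j ≤ l then p (α l) else 0)) •
        (D γ (α j) * A β (Function.update α j γ)) := rfl

lemma arrayDiff_apply {m n : ℕ} (A : Matrix (Fin m → ι) (Fin n → ι) k) :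
    arrayDiff p D m n A = (∑ i, outDiff p D i A) + ∑ j, inDiff p D j A := by
  simp [arrayDiff]

/-- Exponents have to agree only where the coefficient is nonzero. For an entry of `D` this supplies
the relation between parities that expresses its oddness. -/
lemma smul_mul_congr {x y : ZMod 2} {a b c d : k} (h : a ≠ 0 → x = y) (hab : a = b) (hcd : c = d) :
    ((-1 : ℤˣ) ^ x) • (a * c) = ((-1 : ℤˣ) ^ y) • (b * d) := by
  subst hab hcd
  by_cases ha : a = 0
  · rw [ha, zero_mul, smul_zero, smul_zero]
  · rw [h ha]

variable {p} (hD : ∀ a c, D c a ≠ 0 → p c = p a + 1)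

omit [Fintype ι] in
lemma parity_comp_update {m : ℕ} (β : Fin m → ι) (i : Fin m) (γ : ι) :
    (fun l => p (Function.update β i γ l)) = Function.update (fun l => p (β l)) i (p γ) := by
  funext l
  by_cases h : l = i
  · subst h; simp
  · simp [Function.update_of_ne h]

omit [Fintype ι] in
lemma sum_parity_update {m : ℕ} (β : Fin m → ι) (i : Fin m) {γ : ι} (h : p γ = p (β i) + 1) :
    ∑ l, p (Function.update β i γ l) = (∑ l, p (β l)) + 1 := by
  rw [parity_comp_update, Finset.sum_update_of_mem (Finset.mem_univ i), h,
    Finset.sum_eq_add_sum_sdiff_singleton_of_mem (Finset.mem_univ i) (fun l => p (β l))]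
  ring

lemma sum_lt_add_sum_le {m : ℕ} (i : Fin m) (q : Fin m → ZMod 2) :
    (∑ l, if l < i then q l else 0) + (∑ l, if i ≤ l then q l else 0) = ∑ l, q l := by
  rw [← Finset.sum_add_distrib]
  refine Finset.sum_congr rfl fun l _ => ?_
  rcases lt_or_ge l i with h | h
  · rw [if_pos h, if_neg h.not_ge, add_zero]
  · rw [if_neg h.not_gt, if_pos h, zero_add]

lemma sum_le_eq {m : ℕ} (i : Fin m) (q : Fin m → ZMod 2) :
    (∑ l, if i ≤ l then q l else 0) = q i + ∑ l, if i < l then q l else 0 := by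
  rw [← Finset.add_sum_erase _ _ (Finset.mem_univ i),
    ← Finset.add_sum_erase (Finset.univ) (fun l => if i < l then q l else 0) (Finset.mem_univ i),
    if_pos le_rfl, if_neg (lt_irrefl i), zero_add]
  congr 1
  refine Finset.sum_congr rfl fun l hl => ?_
  simp only [(Finset.ne_of_mem_erase hl).symm.le_iff_lt]

lemma sum_lt_add_sum_gt {m : ℕ} (i : Fin m) (q : Fin m → ZMod 2) :
    (∑ l, if l < i then q l else 0) + (∑ l, if i < l then q l else 0) = (∑ l, q l) + q i := by
  rw [← sum_lt_add_sum_le i q, sum_le_eq]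
  linear_combination -ZMod.two_add_self (q i)

include hD

omit [Fintype ι] [DecidableEq ι] in
lemma parity_of_ne_zero {a c : ι} (h : D c a ≠ 0) : p a = p c + 1 := by
  rw [hD a c h, add_assoc, ZMod.two_add_self, add_zero]

omit hD [Fintype ι] in
lemma koszulExp_comp_update {m m' : ℕ} (σ : Fin m ≃ Fin m') (i : Fin m) (β : Fin m' → ι) {γ : ι}
    (h : p γ = p (β (σ i)) + 1) :
    koszulExp σ (fun l => p (Function.update β (σ i) γ (σ l))) =
      koszulExp σ (fun l => p (β (σ l))) + ((∑ l, if i < l then p (β (σ l)) else 0) +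
        ∑ l, if σ i < l then p (β l) else 0) := by
  have h1 : (fun l => p (Function.update β (σ i) γ (σ l))) =
      Function.update (fun l => p (β (σ l))) i (p (β (σ i)) + 1) := by
    funext l
    by_cases hl : l = i
    · subst hl; simp [h]
    · simp [Function.update_of_ne, hl]
  rw [h1, koszulExp_update, σ.sum_comp (fun l => if σ i < l then p (β l) else 0)]

lemma outDiff_arrayAct {m n m' n' : ℕ} (σ : Fin m ≃ Fin m') (τ : Fin n ≃ Fin n') (i : Fin m)
    (A : Matrix (Fin m → ι) (Fin n → ι) k) :
    outDiff p D (σ i) (arrayAct k p σ τ A) = arrayAct k p σ τ (outDiff p D i A) := by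
  ext β α
  rw [outDiff_apply, arrayAct_apply, outDiff_apply, Finset.smul_sum]
  refine Finset.sum_congr rfl fun γ _ => ?_
  rw [arrayAct_apply, mul_smul_comm, smul_smul, smul_smul, ← uzpow_add, ← uzpow_add]
  have h1 : Function.update β (σ i) γ ∘ σ = Function.update (β ∘ σ) i γ :=
    Function.update_comp_eq_of_injective β σ.injective i γ
  refine smul_mul_congr (fun h0 => ?_) rfl (by rw [h1])
  rw [koszulExp_comp_update σ i β (parity_of_ne_zero hD h0)]
  have h2 := sum_lt_add_sum_gt (σ i) (fun l => p (β l))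
  have h3 := sum_lt_add_sum_gt i (fun l => p (β (σ l)))
  rw [σ.sum_comp (fun l => p (β l))] at h3
  simp only [Function.comp_apply]
  linear_combination h2 - h3 + ZMod.two_add_self (∑ l, if i < l then p (β (σ l)) else 0)

lemma inDiff_arrayAct {m n m' n' : ℕ} (σ : Fin m ≃ Fin m') (τ : Fin n ≃ Fin n') (j : Fin n)
    (A : Matrix (Fin m → ι) (Fin n → ι) k) :
    inDiff p D (τ j) (arrayAct k p σ τ A) = arrayAct k p σ τ (inDiff p D j A) := by
  ext β α
  rw [inDiff_apply, arrayAct_apply, inDiff_apply, Finset.smul_sum]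
  refine Finset.sum_congr rfl fun γ _ => ?_
  rw [arrayAct_apply, mul_smul_comm, smul_smul, smul_smul, ← uzpow_add, ← uzpow_add]
  have h1 : Function.update α (τ j) γ ∘ τ = Function.update (α ∘ τ) j γ :=
    Function.update_comp_eq_of_injective α τ.injective j γ
  refine smul_mul_congr (fun h0 => ?_) rfl (by rw [h1])
  rw [koszulExp_comp_update τ j α (hD _ _ h0), sum_le_eq, sum_le_eq]
  simp only [Function.comp_apply]
  rw [σ.sum_comp (fun l => p (β l))]
  linear_combination ZMod.two_add_self (∑ l, if τ j < l then p (α l) else 0)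

lemma arrayDiff_arrayAct {m n m' n' : ℕ} (σ : Fin m ≃ Fin m') (τ : Fin n ≃ Fin n')
    (A : Matrix (Fin m → ι) (Fin n → ι) k) :
    arrayDiff p D m' n' (arrayAct k p σ τ A) = arrayAct k p σ τ (arrayDiff p D m n A) := by
  rw [arrayDiff_apply, arrayDiff_apply, ← σ.sum_comp, ← τ.sum_comp, map_add, map_sum, map_sum]
  simp only [outDiff_arrayAct hD, inDiff_arrayAct hD]

omit hD [Fintype ι] [DecidableEq ι] in
lemma update_castAdd {m m' : ℕ} [DecidableEq ι] (β : Fin (m + m') → ι) (i : Fin m) (γ : ι) :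
    (fun l => Function.update β (Fin.castAdd m' i) γ (Fin.castAdd m' l)) =
      Function.update (fun l => β (Fin.castAdd m' l)) i γ ∧
    (fun l => Function.update β (Fin.castAdd m' i) γ (Fin.natAdd m l)) =
      fun l => β (Fin.natAdd m l) := by
  refine ⟨Function.update_comp_eq_of_injective β (Fin.castAdd_injective m m') i γ, ?_⟩
  funext l
  refine Function.update_of_ne ?_ _ _
  simp [Fin.ext_iff]
  omega

omit hD [Fintype ι] [DecidableEq ι] in
lemma update_natAdd {m m' : ℕ} [DecidableEq ι] (β : Fin (m + m') → ι) (i : Fin m') (γ : ι) :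
    (fun l => Function.update β (Fin.natAdd m i) γ (Fin.natAdd m l)) =
      Function.update (fun l => β (Fin.natAdd m l)) i γ ∧
    (fun l => Function.update β (Fin.natAdd m i) γ (Fin.castAdd m' l)) =
      fun l => β (Fin.castAdd m' l) := by
  refine ⟨Function.update_comp_eq_of_injective β (Fin.natAdd_injective m' m) i γ, ?_⟩
  funext l
  refine Function.update_of_ne ?_ _ _
  simp [Fin.ext_iff]
  omega

omit hD [Fintype ι] [DecidableEq ι] in
lemma natAdd_le_castAdd {m m' : ℕ} (i : Fin m) (j : Fin m') :
    ¬ Fin.natAdd m j ≤ Fin.castAdd m' i ∧ Fin.castAdd m' i < Fin.natAdd m j := by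
  constructor
  · simp [Fin.le_def]; omega
  · simp [Fin.lt_def]; omega

lemma outDiff_castAdd {m n m' n' : ℕ} (i : Fin m) (A : Matrix (Fin m → ι) (Fin n → ι) k)
    (B : Matrix (Fin m' → ι) (Fin n' → ι) k) :
    outDiff p D (Fin.castAdd m' i) (arrayTensor k p A B) =
      arrayTensor k p (outDiff p D i A) B := by
  ext β α
  rw [outDiff_apply, arrayTensor_apply, outDiff_apply, Finset.sum_mul, Finset.smul_sum]
  refine Finset.sum_congr rfl fun γ _ => ?_
  have h1 := update_castAdd (m' := m') β i γ
  have h2 := congrFun h1.2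
  rw [arrayTensor_apply, h1.1, h1.2]
  simp only [h2]
  rw [mul_smul_comm, smul_mul_assoc, smul_smul, smul_smul, mul_assoc, ← uzpow_add, ← uzpow_add,
    Fin.sum_univ_add]
  simp only [(natAdd_le_castAdd _ _).2.not_gt, if_false, Finset.sum_const_zero, add_zero]
  rw [add_comm]
  rfl

/-- Passing the outputs of A is part of the sign of `outDiff`, and the changed parity of B
contributes that of the inputs of A through the tensor sign. Together they give the parity of A. -/
lemma outDiff_natAdd {m n m' n' : ℕ} {q : ZMod 2} (i : Fin m')
    {A : Matrix (Fin m → ι) (Fin n → ι) k} (hA : IsHomogeneousArray p q A)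
    (B : Matrix (Fin m' → ι) (Fin n' → ι) k) :
    outDiff p D (Fin.natAdd m i) (arrayTensor k p A B) =
      ((-1 : ℤˣ) ^ q) • arrayTensor k p A (outDiff p D i B) := by
  ext β α
  rw [Matrix.smul_apply, outDiff_apply, arrayTensor_apply, outDiff_apply,
    Finset.mul_sum _ _ (A _ _),
    Finset.smul_sum, Finset.smul_sum]
  refine Finset.sum_congr rfl fun γ _ => ?_
  have h1 := update_natAdd (m := m) β i γ
  have h2 := congrFun h1.1
  rw [arrayTensor_apply, h1.1, h1.2]
  simp only [h2]
  by_cases hA0 : A (fun i => β (Fin.castAdd m' i)) (fun j => α (Fin.castAdd n' j)) = 0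
  · simp [hA0]
  rw [mul_smul_comm, mul_smul_comm, smul_smul, smul_smul, smul_smul, ← uzpow_add, ← uzpow_add,
    ← uzpow_add, Fin.sum_univ_add, ← hA _ _ hA0, mul_left_comm (A _ _) (D _ _)]
  simp only [(natAdd_le_castAdd _ _).2, if_true]
  refine smul_mul_congr (fun h0 => ?_) rfl rfl
  rw [sum_parity_update (fun l => β (Fin.natAdd m l)) i (parity_of_ne_zero hD h0)]
  simp only [Fin.natAdd_lt_natAdd_iff]
  ring

lemma inDiff_castAdd {m n m' n' : ℕ} (j : Fin n) (A : Matrix (Fin m → ι) (Fin n → ι) k)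
    (B : Matrix (Fin m' → ι) (Fin n' → ι) k) :
    inDiff p D (Fin.castAdd n' j) (arrayTensor k p A B) =
      arrayTensor k p (inDiff p D j A) B := by
  ext β α
  rw [inDiff_apply, arrayTensor_apply, inDiff_apply, Finset.sum_mul, Finset.smul_sum]
  refine Finset.sum_congr rfl fun γ _ => ?_
  have h1 := update_castAdd (m' := n') α j γ
  have h2 := congrFun h1.2
  have h3 := congrFun h1.1
  rw [arrayTensor_apply, h1.1, h1.2]
  simp only [h2, h3]
  rw [mul_smul_comm, smul_mul_assoc, smul_smul, smul_smul, mul_assoc, ← uzpow_add, ← uzpow_add,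
    Fin.sum_univ_add, Fin.sum_univ_add (fun l => if Fin.castAdd n' j ≤ l then p (α l) else 0)]
  simp only [(natAdd_le_castAdd _ _).2.le, if_true]
  refine smul_mul_congr (fun h0 => ?_) rfl rfl
  rw [sum_parity_update (fun l => α (Fin.castAdd n' l)) j (hD _ _ h0)]
  have : ∀ a b c d e x : ZMod 2, x = c → a + b + (x + d) + (b + d) * (e + 1) = (b + d) * e + (a + c) := by decide
  exact this _ _ _ _ _ _ rfl

lemma inDiff_natAdd {m n m' n' : ℕ} {q : ZMod 2} (j : Fin n')
    {A : Matrix (Fin m → ι) (Fin n → ι) k} (hA : IsHomogeneousArray p q A)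
    (B : Matrix (Fin m' → ι) (Fin n' → ι) k) :
    inDiff p D (Fin.natAdd n j) (arrayTensor k p A B) =
      ((-1 : ℤˣ) ^ q) • arrayTensor k p A (inDiff p D j B) := by
  ext β α
  rw [Matrix.smul_apply, inDiff_apply, arrayTensor_apply, inDiff_apply,
    Finset.mul_sum _ _ (A _ _),
    Finset.smul_sum, Finset.smul_sum]
  refine Finset.sum_congr rfl fun γ _ => ?_
  have h1 := update_natAdd (m := n) α j γ
  have h2 := congrFun h1.1
  have h3 := congrFun h1.2
  rw [arrayTensor_apply, h1.1, h1.2]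
  simp only [h2, h3]
  by_cases hA0 : A (fun i => β (Fin.castAdd m' i)) (fun j => α (Fin.castAdd n' j)) = 0
  · simp [hA0]
  rw [mul_smul_comm, mul_smul_comm, smul_smul, smul_smul, smul_smul, ← uzpow_add, ← uzpow_add,
    ← uzpow_add, Fin.sum_univ_add, Fin.sum_univ_add (fun l => if Fin.natAdd n j ≤ l then p (α l) else 0), ← hA _ _ hA0, mul_left_comm (A _ _) (D _ _)]
  simp only [(natAdd_le_castAdd _ _).1, if_false, Finset.sum_const_zero, zero_add]
  refine smul_mul_congr (fun h0 => ?_) rfl rfl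
  rw [sum_parity_update (fun l => α (Fin.natAdd n l)) j (hD _ _ h0)]
  simp only [Fin.natAdd_le_natAdd_iff]
  have : ∀ a b c d e : ZMod 2, a + b + c + (b + (d + 1)) * e = a + e + (b + d) * e + (b + c) := by
    decide
  exact this _ _ _ _ _

lemma arrayDiff_arrayTensor {m n m' n' : ℕ} {q : ZMod 2}
    {A : Matrix (Fin m → ι) (Fin n → ι) k} (hA : IsHomogeneousArray p q A)
    (B : Matrix (Fin m' → ι) (Fin n' → ι) k) :
    arrayDiff p D _ _ (arrayTensor k p A B) = arrayTensor k p (arrayDiff p D m n A) B +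
      ((-1 : ℤˣ) ^ q) • arrayTensor k p A (arrayDiff p D m' n' B) := by
  rw [arrayDiff_apply, arrayDiff_apply, arrayDiff_apply, Fin.sum_univ_add, Fin.sum_univ_add]
  simp only [outDiff_castAdd hD, outDiff_natAdd hD _ hA, inDiff_castAdd hD, inDiff_natAdd hD _ hA,
    map_add, map_sum, LinearMap.add_apply, LinearMap.sum_apply, smul_add, Finset.smul_sum]
  abel

end ArrayDifferential

/-! ### The differential of arrays, contractions and the unit -/

section ArrayDifferential

variable {k : Type u} [Field k] {ι : Type w} {p : ι → ZMod 2} [Fintype ι] [DecidableEq ι]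
  {D : Matrix ι ι k} (hD : ∀ a c, D c a ≠ 0 → p c = p a + 1)

omit [Fintype ι] in
lemma parityBehind_update {m : ℕ} (i : Fin (m + 1)) (β : Fin m → ι) (x : Fin m) {γ : ι}
    (h : p γ = p (β x) + 1) : parityBehind p i (Function.update β x γ) =
      parityBehind p i β + if i < i.succAbove x then 1 else 0 := by
  rw [parityBehind_eq, parityBehind_eq, ← Finset.add_sum_erase _ _ (Finset.mem_univ x),
    ← Finset.add_sum_erase _ (fun l => if i < i.succAbove l then p (β l) else 0)
      (Finset.mem_univ x), Function.update_self, h, add_right_comm]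
  congr 1
  · split_ifs <;> simp
  · refine Finset.sum_congr rfl fun l hl => ?_
    rw [Function.update_of_ne (Finset.ne_of_mem_erase hl)]

include hD

lemma outDiff_arrayContract {m n : ℕ} (i : Fin (m + 1)) (j : Fin (n + 1)) (x : Fin m)
    (A : Matrix (Fin (m + 1) → ι) (Fin (n + 1) → ι) k) :
    outDiff p D x (arrayContract k p i j A) =
      arrayContract k p i j (outDiff p D (i.succAbove x) A) := by
  ext β α
  rw [outDiff_apply, arrayContract_apply]
  simp only [arrayContract_apply, outDiff_apply, Finset.mul_sum, Finset.smul_sum]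
  rw [Finset.sum_comm]
  refine Finset.sum_congr rfl fun γ _ => Finset.sum_congr rfl fun γ' _ => ?_
  rw [mul_smul_comm, smul_smul, smul_smul, ← uzpow_add, ← uzpow_add, ← Fin.insertNth_update,
    Fin.sum_univ_succAbove _ i]
  simp only [Fin.insertNth_apply_same, Fin.insertNth_apply_succAbove,
    Fin.succAbove_lt_succAbove_iff]
  refine smul_mul_congr (fun h0 => ?_) rfl rfl
  rw [parityBehind_update i β x (parity_of_ne_zero hD h0)]
  split_ifs
  · ring
  · ring

lemma inDiff_arrayContract {m n : ℕ} (i : Fin (m + 1)) (j : Fin (n + 1)) (x : Fin n)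
    (A : Matrix (Fin (m + 1) → ι) (Fin (n + 1) → ι) k) :
    inDiff p D x (arrayContract k p i j A) =
      arrayContract k p i j (inDiff p D (j.succAbove x) A) := by
  ext β α
  rw [inDiff_apply, arrayContract_apply]
  simp only [arrayContract_apply, inDiff_apply, Finset.mul_sum, Finset.smul_sum]
  rw [Finset.sum_comm]
  refine Finset.sum_congr rfl fun γ _ => Finset.sum_congr rfl fun γ' _ => ?_
  rw [mul_smul_comm, smul_smul, smul_smul, ← uzpow_add, ← uzpow_add, ← Fin.insertNth_update,
    Fin.sum_univ_succAbove _ i, Fin.sum_univ_succAbove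
      (fun l => if j.succAbove x ≤ l then p ((j.insertNth γ α : Fin (n + 1) → ι) l) else 0) j]
  simp only [Fin.insertNth_apply_same, Fin.insertNth_apply_succAbove,
    Fin.succAbove_le_succAbove_iff]
  refine smul_mul_congr (fun h0 => ?_) rfl rfl
  rw [parityBehind_update j α x (hD _ _ h0)]
  have h1 := ZMod.two_add_self (p γ)
  rcases lt_or_gt_of_ne (Fin.succAbove_ne j x) with h | h
  · rw [if_neg h.not_gt, if_pos h.le]
    linear_combination -h1
  · rw [if_pos h, if_neg h.not_ge]
    ring

/-- The supertrace vanishes on supercommutators: after renaming the two summation indices the terms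
agree up to the factor -1, because `D` is odd. -/
lemma arrayContract_diff {m n : ℕ} (i : Fin (m + 1)) (j : Fin (n + 1))
    (A : Matrix (Fin (m + 1) → ι) (Fin (n + 1) → ι) k) :
    arrayContract k p i j (outDiff p D i A) + arrayContract k p i j (inDiff p D j A) = 0 := by
  ext β α
  rw [Matrix.add_apply, Matrix.zero_apply, arrayContract_apply, arrayContract_apply]
  simp only [outDiff_apply, inDiff_apply, Finset.smul_sum]
  rw [add_comm, Finset.sum_comm, ← Finset.sum_add_distrib]
  refine Finset.sum_eq_zero fun γ _ => ?_
  rw [← Finset.sum_add_distrib]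
  refine Finset.sum_eq_zero fun γ' _ => ?_
  rw [smul_smul, smul_smul, ← uzpow_add, ← uzpow_add, Fin.update_insertNth, Fin.update_insertNth,
    Fin.sum_univ_succAbove _ i, Fin.sum_univ_succAbove _ j, Fin.sum_univ_succAbove _ i]
  simp only [Fin.insertNth_apply_same, Fin.insertNth_apply_succAbove, lt_self_iff_false, if_false,
    le_rfl, if_true, fun l => (Fin.succAbove_ne j l).symm.le_iff_lt]
  by_cases h0 : D γ γ' = 0
  · simp [h0]
  refine units_smul_add_eq_zero ?_ _
  have hneg : ∀ x y : ZMod 2, x = 1 + y → (-1 : ℤˣ) ^ x = -(-1) ^ y := by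
    rintro x y rfl
    rw [uzpow_add, uzpow_one, neg_one_mul]
  refine hneg _ _ ?_
  rw [parity_of_ne_zero hD h0, parityBehind_eq, parityBehind_eq]
  have h1 : (∑ l, if i.succAbove l < i then p (β l) else 0) +
      (∑ l, if i < i.succAbove l then p (β l) else 0) = ∑ l, p (β l) := by
    rw [← Finset.sum_add_distrib]
    refine Finset.sum_congr rfl fun l _ => ?_
    rcases lt_or_gt_of_ne (Fin.succAbove_ne i l) with h | h
    · rw [if_pos h, if_neg h.not_gt, add_zero]
    · rw [if_neg h.not_gt, if_pos h, zero_add]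
  rw [← h1]
  have : ∀ x a b c d : ZMod 2, (x + 1) * (1 + a + b) + (x + 1 + (c + a) + (x + 1 + b)) =
    1 + (x * (1 + a + b) + (0 + c)) := by decide
  exact this _ _ _ _ 0

lemma arrayDiff_arrayContract {m n : ℕ} (i : Fin (m + 1)) (j : Fin (n + 1))
    (A : Matrix (Fin (m + 1) → ι) (Fin (n + 1) → ι) k) :
    arrayDiff p D m n (arrayContract k p i j A) =
      arrayContract k p i j (arrayDiff p D (m + 1) (n + 1) A) := by
  have h := arrayContract_diff hD i j A
  rw [arrayDiff_apply, arrayDiff_apply, Fin.sum_univ_succAbove _ i, Fin.sum_univ_succAbove _ j]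
  simp only [map_add, map_sum, outDiff_arrayContract hD, inDiff_arrayContract hD]
  rw [add_add_add_comm, h, zero_add]

/-- The identity commutes with d₀. Its output and input terms are the same entry of `D` with
opposite signs. -/
lemma arrayDiff_one : arrayDiff p D 1 1 (1 : Matrix (Fin 1 → ι) (Fin 1 → ι) k) = 0 := by
  ext β α
  rw [arrayDiff_apply, Fin.sum_univ_one, Fin.sum_univ_one, Matrix.add_apply, outDiff_apply,
    inDiff_apply, Finset.sum_eq_single (α 0), Finset.sum_eq_single (β 0)]
  · have h1 : Function.update β 0 (α 0) = α := by
      funext x; rw [Subsingleton.elim x 0, Function.update_self]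
    have h2 : Function.update α 0 (β 0) = β := by
      funext x; rw [Subsingleton.elim x 0, Function.update_self]
    rw [h1, h2, Matrix.one_apply_eq, Matrix.one_apply_eq, mul_one]
    simp only [Fin.sum_univ_one, lt_self_iff_false, le_rfl, if_true, if_false, uzpow_zero, one_smul]
    by_cases h0 : D (β 0) (α 0) = 0
    · simp [h0]
    · rw [hD _ _ h0, add_right_comm, ZMod.two_add_self, zero_add, uzpow_one]
      simp
  · intro γ _ hγ
    rw [Matrix.one_apply, if_neg, mul_zero, smul_zero]
    intro h
    exact hγ (by rw [h, Function.update_self])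
  · simp
  · intro γ _ hγ
    rw [Matrix.one_apply, if_neg, mul_zero, smul_zero]
    intro h
    exact hγ (by rw [← h, Function.update_self])
  · simp

lemma arrayDiff_homogeneous {m n : ℕ} {q : ZMod 2} {A : Matrix (Fin m → ι) (Fin n → ι) k}
    (hA : IsHomogeneousArray p q A) : IsHomogeneousArray p (q + 1) (arrayDiff p D m n A) := by
  intro β α h
  have hz : ∀ x : ZMod 2, x + 1 + 1 = x := by decide
  rw [arrayDiff_apply, Matrix.add_apply, Matrix.sum_apply, Matrix.sum_apply] at h
  have h' : (∑ i, outDiff p D i A β α) ≠ 0 ∨ (∑ j, inDiff p D j A β α) ≠ 0 := by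
    by_contra hc
    push Not at hc
    exact h (by rw [hc.1, hc.2, add_zero])
  rcases h' with h | h
  · obtain ⟨i, -, hi⟩ := Finset.exists_ne_zero_of_sum_ne_zero h
    rw [outDiff_apply] at hi
    obtain ⟨γ, -, hγ⟩ := Finset.exists_ne_zero_of_sum_ne_zero hi
    have h1 := hA _ _ fun h0 => hγ (by rw [h0, mul_zero, smul_zero])
    rw [sum_parity_update β i (parity_of_ne_zero hD fun h0 => hγ (by rw [h0, zero_mul, smul_zero]))]
      at h1
    rw [← h1, add_right_comm, hz]
  · obtain ⟨i, -, hi⟩ := Finset.exists_ne_zero_of_sum_ne_zero h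
    rw [inDiff_apply] at hi
    obtain ⟨γ, -, hγ⟩ := Finset.exists_ne_zero_of_sum_ne_zero hi
    have h1 := hA _ _ fun h0 => hγ (by rw [h0, mul_zero, smul_zero])
    rw [sum_parity_update α i (hD _ _ fun h0 => hγ (by rw [h0, zero_mul, smul_zero]))]
      at h1
    rw [← h1, ← add_assoc, hz]

end ArrayDifferential

/-! ### The differential of the endomorphism PROP in coordinates -/

section EndDifferential

variable {k : Type u} [Field k] {ι : Type w} {p : ι → ZMod 2} [Fintype ι] [DecidableEq ι]
  {M : Type v} [AddCommGroup M] [Module k M] {b : Module.Basis ι k M}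

lemma units_smul_eq_mul (ε : ℤˣ) (x : k) : ε • x = ((ε : ℤ) : k) * x := by
  rw [Units.smul_def, zsmul_eq_mul]

omit [DecidableEq ι] [Fintype ι] in
/-- A sum over tuples of a product that forces all entries but one. -/
lemma sum_tuples_eq [Fintype ι] [DecidableEq ι] {n : ℕ} (i : Fin n) (β : Fin n → ι) (c : Fin n → k)
    (F : ι → k) (G : (Fin n → ι) → k) :
    ∑ γ : Fin n → ι, (∏ j, if j = i then F (γ j) else if γ j = β j then c j else 0) * G γ =
      ∑ x, (F x * ∏ j, if j = i then 1 else c j) * G (Function.update β i x) := by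
  symm
  refine Finset.sum_of_injOn (fun x => Function.update β i x) ?_ (fun _ _ => Finset.mem_univ _) ?_ ?_
  · intro x _ y _ h
    exact Function.update_injective β i h
  · intro γ _ hγ
    have : ∃ j, j ≠ i ∧ γ j ≠ β j := by
      by_contra hc
      push Not at hc
      refine hγ ⟨γ i, Finset.mem_univ _, ?_⟩
      funext j
      by_cases hj : j = i
      · subst hj; simp
      · simp only [Function.update_of_ne hj, hc j hj]
    obtain ⟨j, hj, hj'⟩ := this
    rw [Finset.prod_eq_zero (Finset.mem_univ j), zero_mul]
    rw [if_neg hj, if_neg hj']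
  · intro x _
    congr 1
    rw [← Finset.mul_prod_erase _ _ (Finset.mem_univ i), ← Finset.mul_prod_erase Finset.univ
      (fun j => if j = i then F (Function.update β i x j) else
        if Function.update β i x j = β j then c j else 0) (Finset.mem_univ i), if_pos rfl, if_pos rfl,
      one_mul, Function.update_self]
    congr 1
    refine Finset.prod_congr rfl fun j hj => ?_
    have hj := Finset.ne_of_mem_erase hj
    rw [if_neg hj, if_neg hj, Function.update_of_ne hj, if_pos rfl]

variable (b) in
lemma toMatrix_piTensorProduct_map {n : ℕ} (f : Fin n → (M →ₗ[k] M)) (β α : Fin n → ι) :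
    LinearMap.toMatrix (tensorBasis b n) (tensorBasis b n) (PiTensorProduct.map f) β α =
      ∏ j, LinearMap.toMatrix b b (f j) (β j) (α j) := by
  rw [LinearMap.toMatrix_apply, tensorBasis, Basis.piTensorProduct_apply, PiTensorProduct.map_tprod,
    Basis.piTensorProduct_repr_tprod_apply]
  simp only [LinearMap.toMatrix_apply]

variable (b p) in
lemma toMatrix_parityMap (c a : ι) : LinearMap.toMatrix b b (parityMap b p) c a =
    if c = a then ((((-1 : ℤˣ) ^ p a : ℤˣ) : ℤ) : k) else 0 := by
  rw [LinearMap.toMatrix_apply, parityMap, Module.Basis.constr_basis, Units.smul_def, map_zsmul,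
    Finsupp.smul_apply, Module.Basis.repr_self, Finsupp.single_apply]
  by_cases h : c = a
  · subst h; simp
  · rw [if_neg h, if_neg (Ne.symm h)]; simp

lemma prod_units_cast {n : ℕ} (q : Fin n → ZMod 2) (s : Fin n → Prop) [DecidablePred s] :
    (∏ j, if s j then ((((-1 : ℤˣ) ^ q j : ℤˣ) : ℤ) : k) else 1) =
      ((((-1 : ℤˣ) ^ ∑ j, if s j then q j else 0 : ℤˣ) : ℤ) : k) := by
  rw [units_pow_sum, Units.coe_prod, Int.cast_prod]
  refine Finset.prod_congr rfl fun j _ => ?_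
  split_ifs <;> simp

variable (b p) in
lemma toMatrix_parity {n : ℕ} (β α : Fin n → ι) :
    LinearMap.toMatrix (tensorBasis b n) (tensorBasis b n)
      (PiTensorProduct.map fun _ => parityMap b p) β α =
      if β = α then ((((-1 : ℤˣ) ^ ∑ j, p (α j) : ℤˣ) : ℤ) : k) else 0 := by
  rw [toMatrix_piTensorProduct_map]
  simp only [toMatrix_parityMap]
  by_cases h : β = α
  · subst h
    have := prod_units_cast (k := k) (fun j => p (β j)) (fun _ => True)
    simpa using this
  · obtain ⟨j, hj⟩ := Function.ne_iff.1 h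
    rw [if_neg h, Finset.prod_eq_zero (Finset.mem_univ j) (if_neg hj)]

variable (b p) in
lemma toMatrix_tensorDifferential (d₀ : M →ₗ[k] M) {n : ℕ} (β α : Fin n → ι) :
    LinearMap.toMatrix (tensorBasis b n) (tensorBasis b n) (tensorDifferential b p d₀ n) β α =
      ∑ i, ∏ j, if j = i then LinearMap.toMatrix b b d₀ (β j) (α j) else
        if β j = α j then (if j < i then ((((-1 : ℤˣ) ^ p (α j) : ℤˣ) : ℤ) : k) else 1) else 0 := by
  rw [tensorDifferential, map_sum, Matrix.sum_apply]
  refine Finset.sum_congr rfl fun i _ => ?_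
  rw [toMatrix_piTensorProduct_map]
  refine Finset.prod_congr rfl fun j _ => ?_
  rcases lt_trichotomy j i with h | h | h
  · rw [if_pos h, if_neg h.ne, if_pos h, toMatrix_parityMap]
  · subst h; simp
  · rw [if_neg h.not_gt, if_neg h.ne', if_neg h.ne', if_neg h.not_gt, LinearMap.toMatrix_id,
      Matrix.one_apply]

/-- In the matrix of d₀ on a tensor power each summand forces all indices but one to agree, so
matrix products collapse to sums over one index, as in `outDiff` and `inDiff`. -/
lemma tensorCoeff_endDifferential {d₀ : M →ₗ[k] M}
    (hD : ∀ a c, LinearMap.toMatrix b b d₀ c a ≠ 0 → p c = p a + 1) {m n : ℕ}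
    (f : (⨂[k] _ : Fin n, M) →ₗ[k] (⨂[k] _ : Fin m, M)) :
    tensorCoeff b m n (endDifferential b p d₀ m n f) =
      arrayDiff p (LinearMap.toMatrix b b d₀) m n (tensorCoeff b m n f) := by
  have hprod {n : ℕ} (i : Fin n) (c : Fin n → k) :
      (∏ j, if j = i then 1 else if j < i then c j else 1) = ∏ j, if j < i then c j else 1 := by
    refine Finset.prod_congr rfl fun j _ => ?_
    by_cases hj : j = i
    · rw [if_pos hj, if_neg (by rw [hj]; exact lt_irrefl i)]
    · rw [if_neg hj]
  have h1 : LinearMap.toMatrix (tensorBasis b n) (tensorBasis b m)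
      (tensorDifferential b p d₀ m ∘ₗ f) =
      ∑ i, outDiff p (LinearMap.toMatrix b b d₀) i (tensorCoeff b m n f) := by
    rw [LinearMap.toMatrix_comp _ (tensorBasis b m)]
    ext β α
    rw [Matrix.mul_apply, Matrix.sum_apply]
    simp only [toMatrix_tensorDifferential, Finset.sum_mul]
    rw [Finset.sum_comm]
    refine Finset.sum_congr rfl fun i _ => ?_
    rw [outDiff_apply]
    have h2 (γ : Fin m → ι) (j : Fin m) : (if j = i then LinearMap.toMatrix b b d₀ (β j) (γ j) else
        if β j = γ j then
        (if j < i then ((((-1 : ℤˣ) ^ p (γ j) : ℤˣ) : ℤ) : k) else 1) else 0) =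
        if j = i then LinearMap.toMatrix b b d₀ (β i) (γ j) else
        if γ j = β j then (if j < i then ((((-1 : ℤˣ) ^ p (β j) : ℤˣ) : ℤ) : k) else 1) else 0 := by
      by_cases hj : j = i
      · rw [if_pos hj, if_pos hj, hj]
      · rw [if_neg hj, if_neg hj]
        by_cases h : γ j = β j
        · rw [h]
        · rw [if_neg h, if_neg (Ne.symm h)]
    simp only [h2]
    rw [sum_tuples_eq i β _ (fun x => LinearMap.toMatrix b b d₀ (β i) x)]
    refine Finset.sum_congr rfl fun x _ => ?_
    rw [hprod, prod_units_cast (fun j => p (β j)) (fun j => j < i), units_smul_eq_mul, tensorCoeff]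
    ring
  have h3 : LinearMap.toMatrix (tensorBasis b n) (tensorBasis b m)
      ((PiTensorProduct.map fun _ => parityMap b p) ∘ₗ f ∘ₗ
      (PiTensorProduct.map fun _ => parityMap b p) ∘ₗ tensorDifferential b p d₀ n) =
      -∑ j, inDiff p (LinearMap.toMatrix b b d₀) j (tensorCoeff b m n f) := by
    rw [LinearMap.toMatrix_comp _ (tensorBasis b m), LinearMap.toMatrix_comp _ (tensorBasis b n),
      LinearMap.toMatrix_comp _ (tensorBasis b n)]
    ext β α
    rw [Matrix.mul_apply, Finset.sum_eq_single β, Matrix.mul_apply, toMatrix_parity, if_pos rfl,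
      Matrix.neg_apply, Matrix.sum_apply, ← Finset.sum_neg_distrib]
    · have h4 (γ : Fin n → ι) : (LinearMap.toMatrix (tensorBasis b n) (tensorBasis b n)
          (PiTensorProduct.map fun _ => parityMap b p) *
          LinearMap.toMatrix (tensorBasis b n) (tensorBasis b n) (tensorDifferential b p d₀ n)) γ α =
          ((((-1 : ℤˣ) ^ ∑ j, p (γ j) : ℤˣ) : ℤ) : k) * LinearMap.toMatrix (tensorBasis b n)
            (tensorBasis b n) (tensorDifferential b p d₀ n) γ α := by
        rw [Matrix.mul_apply, Finset.sum_eq_single γ, toMatrix_parity, if_pos rfl]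
        · intro γ' _ h
          rw [toMatrix_parity, if_neg (Ne.symm h), zero_mul]
        · simp
      simp only [h4, toMatrix_tensorDifferential, Finset.mul_sum]
      rw [Finset.sum_comm]
      refine Finset.sum_congr rfl fun i _ => ?_
      have h2 (γ : Fin n → ι) (j : Fin n) :
          (if j = i then LinearMap.toMatrix b b d₀ (γ j) (α j) else
          if γ j = α j then
          (if j < i then ((((-1 : ℤˣ) ^ p (α j) : ℤˣ) : ℤ) : k) else 1) else 0) =
          if j = i then LinearMap.toMatrix b b d₀ (γ j) (α i) else
          if γ j = α j then
          (if j < i then ((((-1 : ℤˣ) ^ p (α j) : ℤˣ) : ℤ) : k) else 1) else 0 := by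
        by_cases hj : j = i
        · rw [if_pos hj, if_pos hj, hj]
        · rw [if_neg hj, if_neg hj]
      simp only [h2, ← mul_assoc]
      simp only [mul_comm _ (∏ j, _)]
      rw [sum_tuples_eq i α _ (fun x => LinearMap.toMatrix b b d₀ x (α i)), inDiff_apply,
        ← Finset.sum_neg_distrib]
      refine Finset.sum_congr rfl fun x _ => ?_
      rw [hprod, prod_units_cast (fun j => p (α j)) (fun j => j < i), units_smul_eq_mul, tensorCoeff]
      by_cases h0 : LinearMap.toMatrix b b d₀ x (α i) = 0
      · simp [h0]
      -- The three signs are those of the outputs, of the inputs before `i`, and of all inputs after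
      -- the replacement at `i`. The replacement changes the last parity by one, so the inputs from
      -- `i` on and a minus sign remain.
      have h5 : ((((-1 : ℤˣ) ^ ∑ j, p (β j) : ℤˣ) : ℤ) : k) *
          ((((-1 : ℤˣ) ^ ∑ j, (if j < i then p (α j) else 0) : ℤˣ) : ℤ) : k) *
          ((((-1 : ℤˣ) ^ ∑ j, p (Function.update α i x j) : ℤˣ) : ℤ) : k) =
          -((((-1 : ℤˣ) ^ ((∑ l, p (β l)) + ∑ l, if i ≤ l then p (α l) else 0) : ℤˣ) : ℤ) : k) := by
        rw [sum_parity_update α i (hD _ _ h0), ← sum_lt_add_sum_le i (fun l => p (α l)),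
          ← Int.cast_mul, ← Units.val_mul, ← Int.cast_mul, ← Units.val_mul, ← Int.cast_neg,
          ← Units.val_neg]
        congr 2
        simp only [uzpow_add, uzpow_one]
        generalize (-1 : ℤˣ) ^ (∑ l, p (β l)) = s
        generalize (-1 : ℤˣ) ^ (∑ l, if l < i then p (α l) else 0) = t
        generalize (-1 : ℤˣ) ^ (∑ l, if i ≤ l then p (α l) else 0) = r
        revert s t r
        decide
      linear_combination (LinearMap.toMatrix b b d₀ x (α i) *
        LinearMap.toMatrix (tensorBasis b n) (tensorBasis b m) f β (Function.update α i x)) * h5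
    · intro γ _ h
      rw [toMatrix_parity, if_neg (Ne.symm h), zero_mul]
    · simp
  rw [arrayDiff_apply, endDifferential, map_sub]
  show LinearMap.toMatrix (tensorBasis b n) (tensorBasis b m) _ -
    LinearMap.toMatrix (tensorBasis b n) (tensorBasis b m) _ = _
  rw [h1, h3, sub_neg_eq_add]

end EndDifferential

/-! ### Oddness of d₀ in a homogeneous basis -/

section OddEndomorphism

variable {k : Type u} [Field k] {ι : Type w} {p : ι → ZMod 2} [Fintype ι] [DecidableEq ι]
  {M : Type v} [AddCommGroup M] [Module k M] {b : Module.Basis ι k M}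
  {𝓜 : ZMod 2 → Submodule k M}

omit [DecidableEq ι] in
-- The part `z` of `x` spanned by basis vectors of the wrong parity lies in both homogeneous
-- components, hence is zero.
lemma parity_of_repr_ne_zero (h𝓜 : DirectSum.IsInternal 𝓜) (hb : ∀ a, b a ∈ 𝓜 (p a)) {q : ZMod 2}
    {x : M} (hx : x ∈ 𝓜 q) {c : ι} (hc : b.repr x c ≠ 0) : p c = q := by
  classical
  by_contra hpc
  set y : M := ∑ a, if p a = q then b.repr x a • b a else 0 with hy
  set z : M := ∑ a, if p a = q then 0 else b.repr x a • b a with hz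
  have hxyz : x = y + z := by
    rw [hy, hz, ← Finset.sum_add_distrib]
    conv_lhs => rw [← b.sum_repr x]
    refine Finset.sum_congr rfl fun a _ => ?_
    split_ifs <;> simp
  have hz1 : z ∈ 𝓜 q := by
    have : z = x - y := by rw [hxyz]; abel
    rw [this]
    refine sub_mem hx (sum_mem fun a _ => ?_)
    split_ifs with h
    · exact Submodule.smul_mem _ _ (h ▸ hb a)
    · exact zero_mem _
  have hz2 : z ∈ 𝓜 (q + 1) := by
    refine sum_mem fun a _ => ?_
    split_ifs with h
    · exact zero_mem _
    · have h2 : ∀ s t : ZMod 2, ¬ s = t → s = t + 1 := by decide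
      exact Submodule.smul_mem _ _ (h2 _ _ h ▸ hb a)
  have hq : ∀ q : ZMod 2, q ≠ q + 1 := by decide
  have hdisj := h𝓜.submodule_iSupIndep.pairwiseDisjoint (hq q)
  have hz0 : z = 0 := (Submodule.disjoint_def.1 hdisj) z hz1 hz2
  refine hc ?_
  have := congrArg (fun v => b.repr v c) hz0
  simp only [hz, map_sum, map_zero, Finsupp.coe_zero, Pi.zero_apply, Finsupp.finsetSum_apply] at this
  rw [Finset.sum_eq_single c] at this
  · simpa [hpc] using this
  · intro a _ hac
    split_ifs
    · simp
    · simp [hac]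
  · simp

lemma parity_of_toMatrix_ne_zero (h𝓜 : DirectSum.IsInternal 𝓜) (hb : ∀ a, b a ∈ 𝓜 (p a))
    {d₀ : M →ₗ[k] M} (hd : ∀ q, ∀ x ∈ 𝓜 q, d₀ x ∈ 𝓜 (q + 1)) (a c : ι)
    (h : LinearMap.toMatrix b b d₀ c a ≠ 0) : p c = p a + 1 := by
  rw [LinearMap.toMatrix_apply] at h
  exact parity_of_repr_ne_zero h𝓜 hb (hd _ _ (hb a)) h

end OddEndomorphism

/-! ### The differential of the endomorphism PROP as an odd derivation -/

section EndDerivation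

variable {k : Type u} [Field k] {ι : Type w} (p : ι → ZMod 2) [Fintype ι] [DecidableEq ι]
  {M : Type v} [AddCommGroup M] [Module k M] (b : Module.Basis ι k M) (d₀ : M →ₗ[k] M)

/-- The differential of the endomorphism PROP, as a family of linear maps. -/
def endDiff (m n : ℕ) :
    (endWheeledProp b p).carrier m n →ₗ[k] (endWheeledProp b p).carrier m n :=
  (endCoeff p b m n).symm.toLinearMap ∘ₗ arrayDiff p (LinearMap.toMatrix b b d₀) m n ∘ₗ
    (endCoeff p b m n).toLinearMap

variable {p b d₀}

lemma endCoeff_endDiff {m n : ℕ} (f : (endWheeledProp b p).carrier m n) :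
    endCoeff p b m n (endDiff p b d₀ m n f) =
      arrayDiff p (LinearMap.toMatrix b b d₀) m n (endCoeff p b m n f) :=
  (endCoeff p b m n).apply_symm_apply _

variable (hD : ∀ a c, LinearMap.toMatrix b b d₀ c a ≠ 0 → p c = p a + 1)
include hD

lemma endDifferential_eq {m n : ℕ} (f : (⨂[k] _ : Fin n, M) →ₗ[k] (⨂[k] _ : Fin m, M)) :
    endDifferential b p d₀ m n f = endDiff p b d₀ m n f := by
  apply (endCoeff p b m n).injective
  exact (tensorCoeff_endDifferential hD f).trans (endCoeff_endDiff _).symm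

namespace WheeledPropData

lemma endDiff_isOddDerivation : IsOddDerivation (endWheeledProp b p) (endDiff p b d₀) where
  odd m n q f hf := by
    rw [mem_endGr, endCoeff_endDiff]
    exact arrayDiff_homogeneous hD ((mem_endGr p b).1 hf)
  map_act {m n m' n'} σ τ f := by
    apply (endCoeff p b m' n').injective
    rw [endCoeff_endDiff, endCoeff_act, endCoeff_act, endCoeff_endDiff, arrayDiff_arrayAct hD]
  leibniz {m n m' n'} q f hf g := by
    apply (endCoeff p b (m + m') (n + n')).injective
    rw [endCoeff_endDiff, endCoeff_hcomp, arrayDiff_arrayTensor hD ((mem_endGr p b).1 hf), map_add,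
      endCoeff_hcomp, endCoeff_endDiff, Units.smul_def, Units.smul_def, map_zsmul, endCoeff_hcomp,
      endCoeff_endDiff]
  map_contract {m n} i j f := by
    apply (endCoeff p b m n).injective
    rw [endCoeff_endDiff, endCoeff_contract, endCoeff_contract, endCoeff_endDiff,
      arrayDiff_arrayContract hD]
  map_one := by
    apply (endCoeff p b 1 1).injective
    rw [endCoeff_endDiff, endCoeff_one, arrayDiff_one hD, map_zero]
  map_empty := by
    apply (endCoeff p b 0 0).injective
    rw [endCoeff_endDiff, arrayDiff_apply]
    simp

end WheeledPropData

end EndDerivation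

/-! ### Morphisms of wheeled PROPs and the corolla differential -/

namespace WheeledPropData

variable {k : Type u} [Field k] {P : WheeledPropData.{u, v} k} {Q : WheeledPropData.{u, w} k}

lemma Hom.map_graft (φ : Hom P Q) {a b l r : ℕ} (f : P.carrier (a + 1) l)
    (g : P.carrier b (r + 1)) :
    φ.map _ _ (P.graft f g) = Q.graft (φ.map _ _ f) (φ.map _ _ g) := by
  rw [graft, φ.map_contract, φ.map_act, φ.map_hcomp, graft]

lemma Hom.map_corollaDifferential (φ : Hom P Q) (c : ∀ m n, P.carrier m n) (m n : ℕ) :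
    φ.map m n (P.corollaDifferential c m n) =
      Q.corollaDifferential (fun m n => φ.map m n (c m n)) m n := by
  simp only [corollaDifferential, map_add, map_sum]
  congr 1
  · refine Finset.sum_congr rfl fun ab _ => Finset.sum_congr rfl fun lr _ =>
      Finset.sum_congr rfl fun σ _ => Finset.sum_congr rfl fun τ _ => ?_
    split_ifs
    · rw [units_smul_apply, φ.map_act, φ.map_graft]
    · exact map_zero _
  · rw [units_smul_apply, φ.map_contract]

lemma Hom.isCorollaFamily (φ : Hom P Q) {c : ∀ m n, P.carrier m n} (hc : P.IsCorollaFamily c) :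
    Q.IsCorollaFamily fun m n => φ.map m n (c m n) where
  mem m n := φ.map_mem _ _ _ _ (hc.mem m n)
  act m n σ τ := by
    rw [← φ.map_act, hc.act, units_smul_apply]

/-- A morphism out of the free wheeled PROP commutes with the differentials if it does so on the
corollas. -/
lemma free_comm_differential [CharZero k] (φ : Hom (freeData k) Q)
    {δ : ∀ m n, Q.carrier m n →ₗ[k] Q.carrier m n} (hδ : IsOddDerivation Q δ)
    (h : ∀ m n, Q.corollaDifferential (fun m n => φ.map m n (freeCorolla k m n)) m n =
      δ m n (φ.map m n (freeCorolla k m n))) {m n : ℕ} (f : (freeData k).carrier m n) :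
    φ.map m n (freeDifferential k m n f) = δ m n (φ.map m n f) := by
  have h1 : ∀ {m n : ℕ} (t : WheeledTerm m n),
      φ.map m n (freeDifferential k m n (freeCls k t)) = δ m n (φ.map m n (freeCls k t)) := by
    intro m n t
    induction t with
    | corolla m n =>
      exact (congrArg (φ.map m n) (freeDifferential_corolla m n)).trans
        ((φ.map_corollaDifferential _ m n).trans (h m n))
    | act σ τ t ih =>
      rw [← freeData_act, freeDifferential_act, φ.map_act, ih, φ.map_act, hδ.map_act]
    | hcomp t t' ih ih' =>
      rw [← freeData_hcomp, freeDifferential_hcomp _ _ (freeCls_mem t), φ.map_hcomp, map_add,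
        units_smul_apply, φ.map_hcomp, φ.map_hcomp, ih, ih',
        hδ.leibniz _ _ (φ.map_mem _ _ _ _ (freeCls_mem t))]
    | contract i j t ih =>
      rw [← freeData_contract, freeDifferential_contract, φ.map_contract, ih, φ.map_contract,
        hδ.map_contract]
    | one =>
      rw [← freeData_one, φ.map_one, hδ.map_one, freeDifferential_isDifferential.map_one, map_zero]
    | empty =>
      rw [← freeData_empty, φ.map_empty, hδ.map_empty, freeDifferential_isDifferential.map_empty,
        map_zero]
  induction f using freeData_ind with
  | cls t => exact h1 t
  | add x y hx hy => simp only [map_add, hx, hy]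
  | smul r x hx => simp only [map_smul, hx]

end WheeledPropData

/-! ### Contractions and the parity involution of an exterior algebra -/

section Exterior

variable {k : Type u} [Field k] {V : Type v} [AddCommGroup V] [Module k V]

open CliffordAlgebra in
lemma contractLeft_mul_eq (d : Module.Dual k V) (x y : ExteriorAlgebra k V) :
    contractLeft d (x * y) = contractLeft d x * y + involute x * contractLeft d y := by
  induction x using CliffordAlgebra.left_induction with
  | algebraMap r => simp [contractLeft_algebraMap_mul, contractLeft_algebraMap]
  | add x x' hx hx' => simp only [add_mul, map_add, hx, hx']; abel
  | ι_mul x m hx =>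
    rw [mul_assoc, contractLeft_ι_mul, hx, contractLeft_ι_mul, map_mul, involute_ι]
    simp only [mul_add, sub_mul, smul_mul_assoc, neg_mul, mul_assoc]
    abel

open CliffordAlgebra in
lemma contractLeft_involute (d : Module.Dual k V) (x : ExteriorAlgebra k V) :
    contractLeft d (involute x) = -involute (contractLeft d x) := by
  induction x using CliffordAlgebra.left_induction with
  | algebraMap r => simp [contractLeft_algebraMap]
  | add x x' hx hx' => simp only [map_add, hx, hx']; abel
  | ι_mul x m hx =>
    rw [map_mul, involute_ι, neg_mul, map_neg, contractLeft_ι_mul, hx, contractLeft_ι_mul, map_sub,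
      map_smul, map_mul, involute_ι]
    simp only [neg_mul, mul_neg]

open CliffordAlgebra in
lemma exterior_ι_mul (v : V) (x : ExteriorAlgebra k V) :
    ExteriorAlgebra.ι k v * x = involute x * ExteriorAlgebra.ι k v := by
  induction x using CliffordAlgebra.left_induction with
  | algebraMap r => rw [AlgHom.commutes]; exact (Algebra.commutes r _).symm
  | add x x' hx hx' => rw [mul_add, hx, hx', map_add, add_mul]
  | ι_mul x m hx =>
    have h := ExteriorAlgebra.ι_add_mul_swap (R := k) v m
    rw [map_mul, involute_ι, ← mul_assoc, eq_neg_of_add_eq_zero_left h, neg_mul, mul_assoc, hx,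
      neg_mul, neg_mul, mul_assoc]

open CliffordAlgebra in
-- A generator passes an element at the cost of the involution, so an element fixed by the
-- involution commutes with all generators.
lemma exterior_commute_of_even {x : ExteriorAlgebra k V} (hx : involute x = x)
    (y : ExteriorAlgebra k V) : x * y = y * x := by
  induction y using CliffordAlgebra.left_induction with
  | algebraMap r => exact (Algebra.commutes r _).symm
  | add y y' hy hy' => rw [mul_add, hy, hy', add_mul]
  | ι_mul y m hy =>
    have h := exterior_ι_mul m x
    rw [hx] at h
    rw [← mul_assoc]
    erw [← h]
    rw [mul_assoc, hy, mul_assoc]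

end Exterior

/-! ### Graded calculus in the algebra of polyvector fields -/

section Calculus

variable {k : Type u} [Field k] {ι : Type w} {p : ι → ZMod 2}

lemma varParity_cases (p : ι → ZMod 2) (v : ι ⊕ ι) : varParity p v = 0 ∨ varParity p v = 1 := by
  have : ∀ s : ZMod 2, s = 0 ∨ s = 1 := by decide
  exact this _

lemma coeff_partialDeriv_even {v : ι ⊕ ι} (h : varParity p v = 0) (f : Polyvector k p)
    (e : EvenVar p →₀ ℕ) : MvPowerSeries.coeff e (partialDeriv v f) =
      MvPowerSeries.coeff (e + Finsupp.single ⟨v, h⟩ 1) f * ((e ⟨v, h⟩ : ℕ) + 1) := by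
  have : partialDeriv v f = MvPowerSeries.pderivFun ⟨v, h⟩ f := dif_pos h
  rw [this]; rfl

lemma coeff_partialDeriv_odd {v : ι ⊕ ι} (h : varParity p v = 1) (f : Polyvector k p)
    (e : EvenVar p →₀ ℕ) : MvPowerSeries.coeff e (partialDeriv v f) =
      CliffordAlgebra.contractLeft (Finsupp.lapply ⟨v, h⟩) (MvPowerSeries.coeff e f) := by
  have : partialDeriv v f = fun e => CliffordAlgebra.contractLeft (Finsupp.lapply ⟨v, h⟩)
      (MvPowerSeries.coeff e f) := dif_neg (by rw [h]; decide)
  rw [this]; rfl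

lemma variableElt_even {v : ι ⊕ ι} (h : varParity p v = 0) :
    variableElt k p v = MvPowerSeries.X ⟨v, h⟩ := dif_pos h

lemma variableElt_odd {v : ι ⊕ ι} (h : varParity p v = 1) :
    variableElt k p v = MvPowerSeries.C (ExteriorAlgebra.ι k (Finsupp.single ⟨v, h⟩ 1)) :=
  dif_neg (by rw [h]; decide)

lemma polyvector_coeff_smul (r : k) (f : Polyvector k p) (e : EvenVar p →₀ ℕ) :
    MvPowerSeries.coeff e (r • f) = r • MvPowerSeries.coeff e f := rfl

/-- The parity involution, as a homomorphism of algebras. -/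
def parityHom (k : Type u) [Field k] (p : ι → ZMod 2) : Polyvector k p →ₐ[k] Polyvector k p :=
  MvPowerSeries.mapAlgHom CliffordAlgebra.involute

lemma parityHom_apply (f : Polyvector k p) : parityHom k p f = parityInvolution f := rfl

lemma coeff_parityHom (f : Polyvector k p) (e : EvenVar p →₀ ℕ) :
    MvPowerSeries.coeff e (parityHom k p f) =
      CliffordAlgebra.involute (MvPowerSeries.coeff e f) := rfl

/-- The partial derivatives, as linear maps. -/
def derivLin (k : Type u) [Field k] (p : ι → ZMod 2) (v : ι ⊕ ι) :
    Polyvector k p →ₗ[k] Polyvector k p where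
  toFun f := partialDeriv v f
  map_add' f g := by
    ext e
    rcases varParity_cases p v with h | h
    · rw [map_add, coeff_partialDeriv_even h, coeff_partialDeriv_even h, coeff_partialDeriv_even h,
        map_add, add_mul]
    · rw [map_add, coeff_partialDeriv_odd h, coeff_partialDeriv_odd h, coeff_partialDeriv_odd h,
        map_add, map_add]
  map_smul' r f := by
    ext e
    rw [RingHom.id_apply, polyvector_coeff_smul]
    rcases varParity_cases p v with h | h
    · rw [coeff_partialDeriv_even h, coeff_partialDeriv_even h, polyvector_coeff_smul,
        smul_mul_assoc]
    · rw [coeff_partialDeriv_odd h, coeff_partialDeriv_odd h, polyvector_coeff_smul, map_smul]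

lemma derivLin_apply (v : ι ⊕ ι) (f : Polyvector k p) : derivLin k p v f = partialDeriv v f := rfl

/-- The coefficient form of differentiating the first factor: terms free of the variable vanish, and
in the others its exponent is lowered by one. -/
lemma sum_antidiagonal_mul_single {σ R : Type*} [DecidableEq σ] [Ring R]
    (F G : (σ →₀ ℕ) → R) (i : σ) (d : σ →₀ ℕ) :
    ∑ x ∈ (Finset.HasAntidiagonal.antidiagonal (d + Finsupp.single i 1) :
        Finset ((σ →₀ ℕ) × (σ →₀ ℕ))), ((x.1 i : ℕ) : R) * (F x.1 * G x.2) =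
      ∑ x ∈ (Finset.HasAntidiagonal.antidiagonal d : Finset ((σ →₀ ℕ) × (σ →₀ ℕ))),
        (((x.1 i : ℕ) : R) + 1) * (F (x.1 + Finsupp.single i 1) * G x.2) := by
  symm
  refine Finset.sum_of_injOn (fun x => (x.1 + Finsupp.single i 1, x.2)) ?_ ?_ ?_ ?_
  · rintro ⟨a, b⟩ _ ⟨a', b'⟩ _ h
    simp only [Prod.mk.injEq, add_left_inj] at h
    rw [h.1, h.2]
  · rintro ⟨a, b⟩ h
    simp only [Finset.mem_coe, Finset.HasAntidiagonal.mem_antidiagonal] at h ⊢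
    rw [← h]; abel
  · rintro ⟨a, b⟩ h hn
    simp only [Finset.HasAntidiagonal.mem_antidiagonal] at h
    have : a i = 0 := by
      by_contra ha
      refine hn ⟨(a - Finsupp.single i 1, b), ?_, ?_⟩
      · simp only [Finset.mem_coe, Finset.HasAntidiagonal.mem_antidiagonal]
        have h1 : Finsupp.single i 1 ≤ a := by
          rw [Finsupp.single_le_iff]; omega
        apply add_right_cancel (b := Finsupp.single i 1)
        rw [← h, add_right_comm, tsub_add_cancel_of_le h1]
      · simp only [Prod.mk.injEq, and_true]
        rw [tsub_add_cancel_of_le]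
        rw [Finsupp.single_le_iff]; omega
    simp [this]
  · rintro ⟨a, b⟩ _
    simp

/-- The graded Leibniz rule. -/
lemma derivLin_mul (v : ι ⊕ ι) (f g : Polyvector k p) :
    derivLin k p v (f * g) = derivLin k p v f * g +
      (if varParity p v = 0 then f else parityHom k p f) * derivLin k p v g := by
  classical
  ext e
  rcases varParity_cases p v with h | h
  · rw [if_pos h, map_add]
    simp only [derivLin_apply, coeff_partialDeriv_even h, MvPowerSeries.coeff_mul]
    rw [Finset.sum_mul]
    -- The exponent of the variable is shared between the two factors, which splits the sum into the
    -- two halves of the Leibniz rule.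
    have h1 (x) (hx : x ∈ Finset.HasAntidiagonal.antidiagonal (e + Finsupp.single (⟨v, h⟩ : EvenVar p) 1)) :
        MvPowerSeries.coeff x.1 f * MvPowerSeries.coeff x.2 g * ((e ⟨v, h⟩ : ℕ) + 1) =
        (x.1 ⟨v, h⟩ : ExteriorAlgebra k (OddVar p →₀ k)) *
          (MvPowerSeries.coeff x.1 f * MvPowerSeries.coeff x.2 g) +
        (x.2 ⟨v, h⟩ : ExteriorAlgebra k (OddVar p →₀ k)) *
          (MvPowerSeries.coeff x.1 f * MvPowerSeries.coeff x.2 g) := by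
      have h2 : x.1 ⟨v, h⟩ + x.2 ⟨v, h⟩ = e ⟨v, h⟩ + 1 := by
        have := DFunLike.congr_fun (Finset.HasAntidiagonal.mem_antidiagonal.1 hx) ⟨v, h⟩
        simpa using this
      rw [← add_mul, ← Nat.cast_add, h2, Nat.cast_add, Nat.cast_one]
      have := Nat.cast_commute (e ⟨v, h⟩ + 1) (MvPowerSeries.coeff x.1 f * MvPowerSeries.coeff x.2 g)
      rw [Nat.cast_add, Nat.cast_one] at this
      exact this.eq.symm
    rw [Finset.sum_congr rfl h1, Finset.sum_add_distrib, sum_antidiagonal_mul_single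
      (fun x => MvPowerSeries.coeff x f) (fun x => MvPowerSeries.coeff x g)]
    congr 1
    · refine Finset.sum_congr rfl fun x _ => ?_
      rw [← mul_assoc]
      congr 1
      have := Nat.cast_commute (x.1 ⟨v, h⟩ + 1)
        (MvPowerSeries.coeff (x.1 + Finsupp.single (⟨v, h⟩ : EvenVar p) 1) f)
      rw [Nat.cast_add, Nat.cast_one] at this
      exact this.eq
    · rw [← Finset.HasAntidiagonal.map_swap_antidiagonal, Finset.sum_map, ← Finset.HasAntidiagonal.map_swap_antidiagonal (n := e),
        Finset.sum_map]
      -- The second half follows from the same reindexing in the opposite ring, where the two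
      -- factors change roles.
      have h3 (a b : EvenVar p →₀ ℕ) : MvPowerSeries.coeff b f * MvPowerSeries.coeff a g =
        MulOpposite.unop (MulOpposite.op (MvPowerSeries.coeff a g) *
          MulOpposite.op (MvPowerSeries.coeff b f)) := rfl
      have h4 := congrArg MulOpposite.unop (sum_antidiagonal_mul_single
        (fun x => MulOpposite.op (MvPowerSeries.coeff x g))
        (fun x => MulOpposite.op (MvPowerSeries.coeff x f)) (⟨v, h⟩ : EvenVar p) e)
      rw [Finset.unop_sum, Finset.unop_sum] at h4
      refine Eq.trans (Finset.sum_congr rfl fun x _ => ?_) (h4.trans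
        (Finset.sum_congr rfl fun x _ => ?_))
      · simp only [MulOpposite.unop_mul, MulOpposite.unop_op, MulOpposite.unop_natCast]
        exact (Nat.cast_commute _ _).eq
      · simp only [MulOpposite.unop_mul, MulOpposite.unop_op, MulOpposite.unop_natCast,
          MulOpposite.unop_add, MulOpposite.unop_one]
        rw [mul_assoc]
        rfl
  · rw [if_neg (by rw [h]; decide), map_add]
    simp only [derivLin_apply, coeff_partialDeriv_odd h, MvPowerSeries.coeff_mul, map_sum,
      contractLeft_mul_eq, Finset.sum_add_distrib, coeff_parityHom]

lemma derivLin_variableElt [DecidableEq ι] (v w : ι ⊕ ι) :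
    derivLin k p v (variableElt k p w) = if v = w then 1 else 0 := by
  classical
  ext e
  rw [derivLin_apply]
  rcases varParity_cases p v with h | h <;> rcases varParity_cases p w with h' | h'
  · rw [coeff_partialDeriv_even h, variableElt_even h', MvPowerSeries.coeff_X]
    by_cases hvw : v = w
    · subst hvw
      rw [if_pos rfl, MvPowerSeries.coeff_one]
      by_cases he : e = 0
      · subst he; simp
      · rw [if_neg he, if_neg, zero_mul]
        intro h2
        exact he (by simpa using h2)
    · rw [if_neg hvw, if_neg, zero_mul, map_zero]
      intro h2
      have := DFunLike.congr_fun h2 ⟨v, h⟩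
      rw [Finsupp.add_apply, Finsupp.single_eq_same, Finsupp.single_eq_of_ne] at this
      · omega
      · intro h3; exact hvw (congrArg Subtype.val h3)
  · have hvw : v ≠ w := by rintro rfl; rw [h] at h'; exact absurd h' (by decide)
    rw [coeff_partialDeriv_even h, variableElt_odd h', MvPowerSeries.coeff_C, if_neg hvw, if_neg,
      zero_mul, map_zero]
    intro h2
    have := DFunLike.congr_fun h2 ⟨v, h⟩
    simp at this
  · have hvw : v ≠ w := by rintro rfl; rw [h] at h'; exact absurd h' (by decide)
    rw [coeff_partialDeriv_odd h, variableElt_even h', MvPowerSeries.coeff_X, if_neg hvw, map_zero]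
    split_ifs
    · exact CliffordAlgebra.contractLeft_one _ _
    · exact map_zero _
  · rw [coeff_partialDeriv_odd h, variableElt_odd h', MvPowerSeries.coeff_C]
    by_cases he : e = 0
    · rw [if_pos he]
      erw [CliffordAlgebra.contractLeft_ι]
      rw [Finsupp.lapply_apply, Finsupp.single_apply]
      by_cases hvw : v = w
      · subst hvw; rw [if_pos rfl, if_pos rfl, map_one, he, MvPowerSeries.coeff_zero_one]
      · rw [if_neg hvw, if_neg, map_zero, map_zero]
        intro h3; exact hvw (congrArg Subtype.val h3).symm
    · rw [if_neg he, map_zero]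
      split_ifs
      · rw [MvPowerSeries.coeff_one, if_neg he]
      · rw [map_zero]

lemma derivLin_parityHom (v : ι ⊕ ι) (f : Polyvector k p) :
    derivLin k p v (parityHom k p f) =
      ((-1 : ℤˣ) ^ varParity p v) • parityHom k p (derivLin k p v f) := by
  ext e
  rcases varParity_cases p v with h | h
  · rw [h, uzpow_zero, one_smul, derivLin_apply, derivLin_apply, coeff_partialDeriv_even h,
      coeff_parityHom, coeff_parityHom, coeff_partialDeriv_even h, map_mul, map_add, map_natCast,
      map_one]
  · rw [h, uzpow_one, Units.neg_smul, one_smul, map_neg, derivLin_apply, derivLin_apply,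
      coeff_partialDeriv_odd h, coeff_parityHom, coeff_parityHom, coeff_partialDeriv_odd h,
      contractLeft_involute]

lemma derivLin_comm (v w : ι ⊕ ι) (f : Polyvector k p) :
    derivLin k p v (derivLin k p w f) =
      ((-1 : ℤˣ) ^ (varParity p v * varParity p w)) • derivLin k p w (derivLin k p v f) := by
  ext e
  rcases varParity_cases p v with h | h <;> rcases varParity_cases p w with h' | h'
  · rw [h, h', mul_zero, uzpow_zero, one_smul]
    simp only [derivLin_apply, coeff_partialDeriv_even h, coeff_partialDeriv_even h']
    by_cases hvw : v = w
    · subst hvw; rfl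
    · have h1 : (⟨v, h⟩ : EvenVar p) ≠ ⟨w, h'⟩ := fun h3 => hvw (congrArg Subtype.val h3)
      rw [mul_assoc, mul_assoc, add_right_comm, Finsupp.add_apply, Finsupp.add_apply,
        Finsupp.single_eq_of_ne h1.symm, Finsupp.single_eq_of_ne h1, add_zero, add_zero]
      congr 1
      exact_mod_cast (Nat.cast_commute (e ⟨w, h'⟩ + 1)
        (((e ⟨v, h⟩ + 1 : ℕ) : ExteriorAlgebra k (OddVar p →₀ k)))).eq
  · rw [h, zero_mul, uzpow_zero, one_smul]
    simp only [derivLin_apply, coeff_partialDeriv_even h, coeff_partialDeriv_odd h']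
    -- The numerical factor from the even derivative is a scalar, which contractions annihilate.
    rw [contractLeft_mul_eq]
    have := CliffordAlgebra.contractLeft_algebraMap (Q := (0 : QuadraticForm k (OddVar p →₀ k)))
      (Finsupp.lapply (⟨w, h'⟩ : OddVar p)) ((e ⟨v, h⟩ : k) + 1)
    rw [map_add, map_natCast, map_one] at this
    rw [this, mul_zero, add_zero]
  · rw [h', mul_zero, uzpow_zero, one_smul]
    simp only [derivLin_apply, coeff_partialDeriv_even h', coeff_partialDeriv_odd h]
    rw [contractLeft_mul_eq]
    have := CliffordAlgebra.contractLeft_algebraMap (Q := (0 : QuadraticForm k (OddVar p →₀ k)))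
      (Finsupp.lapply (⟨v, h⟩ : OddVar p)) ((e ⟨w, h'⟩ : k) + 1)
    rw [map_add, map_natCast, map_one] at this
    rw [this, mul_zero, add_zero]
  · rw [h, h', mul_one, uzpow_one, Units.neg_smul, one_smul, map_neg]
    simp only [derivLin_apply, coeff_partialDeriv_odd h, coeff_partialDeriv_odd h']
    exact CliffordAlgebra.contractLeft_comm (Q := (0 : QuadraticForm k (OddVar p →₀ k))) _ _ _

lemma parityHom_variableElt (v : ι ⊕ ι) : parityHom k p (variableElt k p v) =
    ((-1 : ℤˣ) ^ varParity p v) • variableElt k p v := by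
  classical
  ext e
  rcases varParity_cases p v with h | h
  · rw [h, uzpow_zero, one_smul, coeff_parityHom, variableElt_even h, MvPowerSeries.coeff_X]
    split_ifs <;> simp
  · rw [h, uzpow_one, Units.neg_smul, one_smul, map_neg, coeff_parityHom, variableElt_odd h,
      MvPowerSeries.coeff_C]
    split_ifs
    · exact CliffordAlgebra.involute_ι _
    · simp

lemma variableElt_mul (v : ι ⊕ ι) (f : Polyvector k p) : variableElt k p v * f =
    (if varParity p v = 0 then f else parityHom k p f) * variableElt k p v := by
  classical
  rcases varParity_cases p v with h | h
  · rw [if_pos h, variableElt_even h, MvPowerSeries.X_mul]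
  · rw [if_neg (by rw [h]; decide), variableElt_odd h]
    ext e
    rw [MvPowerSeries.coeff_C_mul, MvPowerSeries.coeff_mul_C, coeff_parityHom, exterior_ι_mul]

lemma mul_comm_of_even {f : Polyvector k p} (hf : parityHom k p f = f) (g : Polyvector k p) :
    f * g = g * f := by
  classical
  ext e
  rw [MvPowerSeries.coeff_mul, MvPowerSeries.coeff_mul]
  conv_rhs => rw [← Finset.HasAntidiagonal.map_swap_antidiagonal, Finset.sum_map]
  refine Finset.sum_congr rfl fun x _ => ?_
  refine exterior_commute_of_even ?_ _
  have := congrArg (MvPowerSeries.coeff x.1) hf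
  rwa [coeff_parityHom] at this

end Calculus

/-! ### Products of permuted supercommuting elements -/

section KoszulProducts

lemma sum_lt_val {m : ℕ} (s : Fin m) :
    ∑ y : Fin m, (if y < s then (1 : ZMod 2) else 0) = ((s : ℕ) : ZMod 2) := by
  rw [Finset.sum_boole]
  congr 1
  have : (Finset.univ.filter fun y => y < s) = Finset.Iio s := by ext; simp
  rw [this, Fin.card_Iio]

/-- Raising all parities changes the Koszul sign by the sign of the permutation and by the
displacements of the odd factors. -/
lemma koszulExp_add_one {m m' : ℕ} (σ : Fin m ≃ Fin m') (q : Fin m → ZMod 2) :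
    koszulExp σ (fun i => q i + 1) = koszulExp σ q + koszulExp σ (fun _ => 1) +
      ∑ s, (((σ s : ℕ) : ZMod 2) + ((s : ℕ) : ZMod 2)) * q s := by
  have h1 (s : Fin m) : (((σ s : ℕ) : ZMod 2) + ((s : ℕ) : ZMod 2)) =
      (∑ y, if s < y ∧ σ y < σ s then (1 : ZMod 2) else 0) +
        ∑ y, if y < s ∧ σ s < σ y then (1 : ZMod 2) else 0 := by
    rw [← sum_lt_val s, ← sum_lt_val (σ s), ← σ.sum_comp, ← Finset.sum_add_distrib,
      ← Finset.sum_add_distrib]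
    refine Finset.sum_congr rfl fun y _ => ?_
    rcases lt_trichotomy y s with h | h | h
    · rcases lt_or_gt_of_ne (σ.injective.ne h.ne) with h' | h'
      · simp [h, h', h.not_gt, h'.not_gt, ZMod.two_add_self]
      · simp [h, h', h.not_gt, h'.not_gt]
    · subst h; simp
    · rcases lt_or_gt_of_ne (σ.injective.ne h.ne) with h' | h'
      · simp [h, h', h.not_gt, h'.not_gt]
      · simp [h, h', h.not_gt, h'.not_gt]
  simp only [h1, add_mul, Finset.sum_mul, Finset.sum_add_distrib]
  rw [Finset.sum_comm (γ := Fin m) (f := fun s y => (if y < s ∧ σ s < σ y then (1 : ZMod 2) else 0) *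
    q s)]
  simp only [koszulExp, ← Finset.sum_add_distrib]
  refine Finset.sum_congr rfl fun x _ => Finset.sum_congr rfl fun y _ => ?_
  split_ifs <;> ring

variable {B : Type*} [Ring B]

/-- The factor `x j`, written first, is moved back to its place past the factors preceding it. -/
lemma mul_prod_ofFn_succAbove {m : ℕ} (x : Fin (m + 1) → B) (q : Fin (m + 1) → ZMod 2)
    (h : ∀ i j, x i * x j = ((-1 : ℤˣ) ^ (q i * q j)) • (x j * x i)) (j : Fin (m + 1)) :
    x j * (List.ofFn fun l => x (j.succAbove l)).prod =
      ((-1 : ℤˣ) ^ (q j * ∑ l, if j ≤ l.castSucc then 0 else q (j.succAbove l))) •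
        (List.ofFn x).prod := by
  induction m with
  | zero =>
    obtain rfl : j = 0 := Subsingleton.elim (α := Fin 1) j 0
    simp
  | succ m ih =>
    refine Fin.cases ?_ (fun j => ?_) j
    · simp [List.ofFn_succ]
    · rw [List.ofFn_succ, List.ofFn_succ (f := x), List.prod_cons, List.prod_cons,
        Fin.sum_univ_succ, Fin.succ_succAbove_zero, ← mul_assoc, h, Fin.castSucc_zero,
        if_neg (by simp [Fin.le_def])]
      simp only [Fin.succ_succAbove_succ, ← Fin.succ_castSucc, Fin.succ_le_succ_iff]
      rw [mul_add, uzpow_add, mul_smul, smul_mul_assoc, mul_assoc,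
        ih (fun i => x i.succ) (fun i => q i.succ) (fun i i' => h _ _), mul_smul_comm]

/-- The product of a permuted tuple of supercommuting elements. -/
lemma prod_ofFn_comp_equiv {m m' : ℕ} (σ : Fin m ≃ Fin m') (x : Fin m' → B) (q : Fin m' → ZMod 2)
    (h : ∀ i j, x i * x j = ((-1 : ℤˣ) ^ (q i * q j)) • (x j * x i)) :
    (List.ofFn fun i => x (σ i)).prod =
      ((-1 : ℤˣ) ^ koszulExp σ (fun i => q (σ i))) • (List.ofFn x).prod := by
  obtain rfl : m = m' := by simpa using Fintype.card_congr σ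
  induction m with
  | zero => simp [koszulExp]
  | succ m ih =>
    obtain ⟨σ', hσ'⟩ := exists_succAbove_equiv σ 0
    have hs (l : Fin m) : σ l.succ = (σ 0).succAbove (σ' l) := by rw [← hσ', Fin.zero_succAbove]
    rw [List.ofFn_succ, List.prod_cons]
    simp only [hs]
    rw [ih σ' (fun l => x ((σ 0).succAbove l)) (fun l => q ((σ 0).succAbove l)) (fun _ _ => h _ _),
      mul_smul_comm, mul_prod_ofFn_succAbove x q h, smul_smul, ← uzpow_add,
      koszulExp_succAbove σ σ' 0 hσ']
    refine units_pow_smul_congr ?_ rfl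
    simp only [Fin.zero_succAbove, hs]
    congr 1
    congr 1
    rw [← σ'.sum_comp, ← Finset.sum_add_distrib]
    refine Finset.sum_congr rfl fun l _ => ?_
    rw [if_pos (Fin.zero_le _)]
    split_ifs
    · rw [ZMod.two_add_self]
    · rw [add_zero]

end KoszulProducts

/-! ### Monomials in the variables x and ψ -/

section Words

variable {k : Type u} [Field k] {ι : Type w} {p : ι → ZMod 2}

variable (k p) in
/-- The monomial `x^{β₁} ⋯ x^{βₙ}`. -/
def xWord {n : ℕ} (β : Fin n → ι) : Polyvector k p :=
  (List.ofFn fun l => variableElt k p (Sum.inl (β l))).prod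

variable (k p) in
/-- The monomial `ψ_{αₘ} ⋯ ψ_{α₁}`. -/
def psiWord {m : ℕ} (α : Fin m → ι) : Polyvector k p :=
  (List.ofFn fun s => variableElt k p (Sum.inr (α s))).reverse.prod

lemma variableElt_comm (v w : ι ⊕ ι) : variableElt k p v * variableElt k p w =
    ((-1 : ℤˣ) ^ (varParity p v * varParity p w)) • (variableElt k p w * variableElt k p v) := by
  rw [variableElt_mul]
  rcases varParity_cases p v with h | h
  · rw [if_pos h, h, zero_mul, uzpow_zero, one_smul]
  · rw [if_neg (by rw [h]; decide), h, one_mul, parityHom_variableElt, smul_mul_assoc]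

lemma xWord_comp {n n' : ℕ} (τ : Fin n ≃ Fin n') (β : Fin n' → ι) : xWord k p (β ∘ τ) =
    ((-1 : ℤˣ) ^ koszulExp τ (fun i => p (β (τ i)))) • xWord k p β :=
  prod_ofFn_comp_equiv τ (fun l => variableElt k p (Sum.inl (β l))) (fun l => p (β l))
    fun _ _ => variableElt_comm _ _

/-- The ψ are written in reverse order, so their permutations are treated in the opposite ring. -/
lemma psiWord_eq_unop {m : ℕ} (α : Fin m → ι) : psiWord k p α = MulOpposite.unop
    (List.ofFn fun s => MulOpposite.op (variableElt k p (Sum.inr (α s)))).prod := by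
  rw [MulOpposite.unop_list_prod, List.map_ofFn]
  rfl

lemma psiWord_comp {m m' : ℕ} (σ : Fin m ≃ Fin m') (α : Fin m' → ι) : psiWord k p (α ∘ σ) =
    ((-1 : ℤˣ) ^ koszulExp σ (fun i => p (α (σ i)) + 1)) • psiWord k p α := by
  rw [psiWord_eq_unop, psiWord_eq_unop]
  have := prod_ofFn_comp_equiv σ (fun l => MulOpposite.op (variableElt k p (Sum.inr (α l))))
    (fun l => p (α l) + 1) fun i j => by
      rw [← MulOpposite.op_mul, variableElt_comm (Sum.inr (α j)), ← MulOpposite.op_mul, mul_comm]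
      rfl
  exact congrArg MulOpposite.unop this

lemma xWord_cons {n : ℕ} (a : ι) (β : Fin n → ι) :
    xWord k p (Fin.cons a β : Fin (n + 1) → ι) = variableElt k p (Sum.inl a) * xWord k p β := by
  simp [xWord, List.ofFn_succ]

lemma psiWord_snoc {m : ℕ} (α : Fin m → ι) (a : ι) :
    psiWord k p (Fin.snoc α a : Fin (m + 1) → ι) = variableElt k p (Sum.inr a) * psiWord k p α := by
  rw [psiWord, List.ofFn_succ']
  simp [psiWord]

lemma xWord_append {n n' : ℕ} (β : Fin n → ι) (β' : Fin n' → ι) :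
    xWord k p (Fin.append β β') = xWord k p β * xWord k p β' := by
  rw [xWord, xWord, xWord, ← List.prod_append, ← List.ofFn_fin_append]
  congr 2
  funext i
  refine Fin.addCases (fun i => ?_) (fun i => ?_) i <;> simp

lemma psiWord_append {m m' : ℕ} (α : Fin m → ι) (α' : Fin m' → ι) :
    psiWord k p (Fin.append α α') = psiWord k p α' * psiWord k p α := by
  rw [psiWord, psiWord, psiWord, ← List.prod_append, ← List.reverse_append, ← List.ofFn_fin_append]
  congr 3
  funext i
  refine Fin.addCases (fun i => ?_) (fun i => ?_) i <;> simp

/-- Elements of a given parity. -/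
def IsOfParity (q : ZMod 2) (f : Polyvector k p) : Prop :=
  parityHom k p f = ((-1 : ℤˣ) ^ q) • f

lemma IsOfParity.mul {q r : ZMod 2} {f g : Polyvector k p} (hf : IsOfParity q f)
    (hg : IsOfParity r g) : IsOfParity (q + r) (f * g) := by
  rw [IsOfParity, map_mul, hf, hg, smul_mul_assoc, mul_smul_comm, smul_smul, uzpow_add]

lemma isOfParity_one : IsOfParity 0 (1 : Polyvector k p) := by
  rw [IsOfParity, map_one, uzpow_zero, one_smul]

lemma isOfParity_variableElt (v : ι ⊕ ι) : IsOfParity (varParity p v) (variableElt k p v) :=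
  parityHom_variableElt v

lemma isOfParity_list_prod (l : List (ι ⊕ ι)) :
    IsOfParity (l.map (varParity p)).sum (l.map (variableElt k p)).prod := by
  induction l with
  | nil => exact isOfParity_one
  | cons a l ih =>
    rw [List.map_cons, List.map_cons, List.sum_cons, List.prod_cons]
    exact (isOfParity_variableElt a).mul ih

lemma isOfParity_xWord {n : ℕ} (β : Fin n → ι) : IsOfParity (∑ l, p (β l)) (xWord k p β) := by
  have := isOfParity_list_prod (k := k) (p := p) (List.ofFn fun l => Sum.inl (β l))
  rw [List.map_ofFn, List.map_ofFn, List.sum_ofFn] at this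
  exact this

lemma isOfParity_psiWord {m : ℕ} (α : Fin m → ι) :
    IsOfParity (∑ s, (p (α s) + 1)) (psiWord k p α) := by
  have := isOfParity_list_prod (k := k) (p := p) (List.ofFn fun l => Sum.inr (α l)).reverse
  rw [List.map_reverse, List.map_reverse, List.map_ofFn, List.map_ofFn, List.sum_reverse,
    List.sum_ofFn] at this
  exact this

lemma variableElt_mul_comm {q : ZMod 2} {f : Polyvector k p} (hf : IsOfParity q f) (v : ι ⊕ ι) :
    f * variableElt k p v = ((-1 : ℤˣ) ^ (varParity p v * q)) • (variableElt k p v * f) := by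
  rw [variableElt_mul]
  rcases varParity_cases p v with h | h
  · rw [if_pos h, h, zero_mul, uzpow_zero, one_smul]
  · rw [if_neg (by rw [h]; decide), h, one_mul, hf, smul_mul_assoc, smul_smul, ← uzpow_add,
      ZMod.two_add_self, uzpow_zero, one_smul]

lemma list_prod_mul_comm {q : ZMod 2} {f : Polyvector k p} (hf : IsOfParity q f)
    (l : List (ι ⊕ ι)) : f * (l.map (variableElt k p)).prod =
      ((-1 : ℤˣ) ^ ((l.map (varParity p)).sum * q)) • ((l.map (variableElt k p)).prod * f) := by
  induction l with
  | nil => simp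
  | cons a l ih =>
    rw [List.map_cons, List.map_cons, List.sum_cons, List.prod_cons, ← mul_assoc,
      variableElt_mul_comm hf, smul_mul_assoc, mul_assoc, ih, mul_smul_comm, smul_smul, ← uzpow_add,
      mul_assoc, add_mul]

lemma mul_psiWord {q : ZMod 2} {f : Polyvector k p} (hf : IsOfParity q f) {m : ℕ}
    (α : Fin m → ι) :
    f * psiWord k p α = ((-1 : ℤˣ) ^ ((∑ s, (p (α s) + 1)) * q)) • (psiWord k p α * f) := by
  have := list_prod_mul_comm hf (List.ofFn fun l => Sum.inr (α l)).reverse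
  rw [List.map_reverse, List.map_reverse, List.map_ofFn, List.map_ofFn, List.sum_reverse,
    List.sum_ofFn] at this
  exact this

end Words

/-! ### Generating functions of single arrays -/

section GenRaw

variable {k : Type u} [Field k] {ι : Type w} {p : ι → ZMod 2}

variable (p) in
/-- The exponent of the sign in the generating function. -/
def genExp {m n : ℕ} (α : Fin m → ι) (β : Fin n → ι) : ZMod 2 :=
  (∑ l, p (β l)) + ∑ s : Fin m, ((s.rev : ℕ) : ZMod 2) * p (α s)

lemma units_smul_field_smul {W : Type*} [AddCommGroup W] [Module k W] (ε : ℤˣ) (r : k) (x : W) :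
    (ε • r) • x = ε • r • x := smul_assoc ε r x

variable (k p) in
/-- The generating function of an array, without the factor `1 / m! n!`. -/
def genRaw [Fintype ι] (m n : ℕ) :
    Matrix (Fin m → ι) (Fin n → ι) k →ₗ[k] Polyvector k p where
  toFun A := ∑ α : Fin m → ι, ∑ β : Fin n → ι,
    ((-1 : ℤˣ) ^ genExp p α β) • (A α β • (xWord k p β * psiWord k p α))
  map_add' A B := by
    simp only [Matrix.add_apply, add_smul, smul_add, Finset.sum_add_distrib]
  map_smul' r A := by
    simp only [Matrix.smul_apply, smul_eq_mul, mul_smul, RingHom.id_apply, Finset.smul_sum]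
    exact Finset.sum_congr rfl fun _ _ => Finset.sum_congr rfl fun _ _ => smul_comm _ _ _

lemma genRaw_apply [Fintype ι] {m n : ℕ} (A : Matrix (Fin m → ι) (Fin n → ι) k) :
    genRaw k p m n A = ∑ α : Fin m → ι, ∑ β : Fin n → ι,
      ((-1 : ℤˣ) ^ genExp p α β) • (A α β • (xWord k p β * psiWord k p α)) := rfl

lemma rev_equiv_add {m : ℕ} (σ : Fin m ≃ Fin m) (s : Fin m) :
    (((σ s).rev : ℕ) : ZMod 2) + ((s.rev : ℕ) : ZMod 2) = ((σ s : ℕ) : ZMod 2) + ((s : ℕ) : ZMod 2) := by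
  have h (x : Fin m) : ((x.rev : ℕ) : ZMod 2) + ((x : ℕ) : ZMod 2) + 1 = (m : ZMod 2) := by
    have : (x.rev : ℕ) + x + 1 = m := by rw [Fin.val_rev]; omega
    exact_mod_cast congrArg (Nat.cast (R := ZMod 2)) this
  have h1 := h (σ s)
  rw [← h s] at h1
  revert h1
  generalize ((((σ s).rev : ℕ) : ZMod 2)) = a
  generalize (((s.rev : ℕ) : ZMod 2)) = b
  generalize (((σ s : ℕ) : ZMod 2)) = c
  generalize (((s : ℕ) : ZMod 2)) = d
  revert a b c d
  decide

/-- This explains the exponent (m - s)|e_α| of the generating function: it converts the Koszul sign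
of the variables ψ, of shifted parity, into the Koszul sign of the vectors times the sign of the
permutation. -/
lemma genExp_comp {m n : ℕ} (σ : Fin m ≃ Fin m) (τ : Fin n ≃ Fin n) (α : Fin m → ι) (β : Fin n → ι) :
    genExp p (α ∘ σ) (β ∘ τ) + koszulExp σ (fun i => p (α (σ i)) + 1) =
      genExp p α β + (koszulExp σ (fun _ => 1) + koszulExp σ (fun i => p (α (σ i)))) := by
  rw [koszulExp_add_one, genExp, genExp, ← τ.sum_comp (fun l => p (β l)),
    ← σ.sum_comp (fun s => ((s.rev : ℕ) : ZMod 2) * p (α s))]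
  have h3 : ∑ s, (((σ s : ℕ) : ZMod 2) + ((s : ℕ) : ZMod 2)) * p (α (σ s)) =
      (∑ s, (((σ s).rev : ℕ) : ZMod 2) * p (α (σ s))) +
        ∑ s, ((s.rev : ℕ) : ZMod 2) * p (α (σ s)) := by
    rw [← Finset.sum_add_distrib]
    exact Finset.sum_congr rfl fun s _ => by rw [← add_mul, rev_equiv_add]
  rw [h3]
  simp only [Function.comp_apply]
  linear_combination ZMod.two_add_self (∑ s, ((s.rev : ℕ) : ZMod 2) * p (α (σ s)))

/-- Relabelled arrays have the same generating function up to the sign of the outputs, so it is a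
coinvariant functional on the endomorphism PROP. -/
lemma genRaw_arrayAct [Fintype ι] {m n m' n' : ℕ} (σ : Fin m ≃ Fin m') (τ : Fin n ≃ Fin n')
    (A : Matrix (Fin m → ι) (Fin n → ι) k) :
    genRaw k p m' n' (arrayAct k p σ τ A) = inversionSign σ • genRaw k p m n A := by
  obtain rfl : m = m' := by simpa using Fintype.card_congr σ
  obtain rfl : n = n' := by simpa using Fintype.card_congr τ
  rw [genRaw_apply, genRaw_apply, Finset.smul_sum]
  refine Fintype.sum_equiv (Equiv.arrowCongr σ.symm (Equiv.refl _)) _ _ fun α => ?_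
  rw [Finset.smul_sum]
  refine Fintype.sum_equiv (Equiv.arrowCongr τ.symm (Equiv.refl _)) _ _ fun β => ?_
  have h1 : Equiv.arrowCongr σ.symm (Equiv.refl ι) α = α ∘ σ := rfl
  have h2 : Equiv.arrowCongr τ.symm (Equiv.refl ι) β = β ∘ τ := rfl
  rw [h1, h2, xWord_comp, psiWord_comp, arrayAct_apply, units_smul_field_smul, smul_mul_assoc,
    mul_smul_comm, smul_comm (A _ _) (_ : ℤˣ), smul_comm (A _ _) (_ : ℤˣ), inversionSign_eq]
  simp only [smul_smul, ← uzpow_add]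
  refine units_pow_smul_congr ?_ rfl
  have h3 := genExp_comp (p := p) σ τ α β
  generalize genExp p (α ∘ σ) (β ∘ τ) = a at *
  generalize koszulExp σ (fun i => p (α (σ i)) + 1) = b at *
  generalize koszulExp τ (fun i => p (β (τ i))) = c at *
  generalize koszulExp σ (fun _ => 1) = d at *
  generalize koszulExp σ (fun i => p (α (σ i))) = e at *
  generalize genExp p α β = f at *
  linear_combination -h3 - ZMod.two_add_self d

variable (k p) in
/-- The array of the coefficients of `ψ_a`, moved to the left. -/
def outShift (a : ι) (m n : ℕ) : Matrix (Fin (m + 1) → ι) (Fin n → ι) k →ₗ[k]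
    Matrix (Fin m → ι) (Fin n → ι) k where
  toFun A := Matrix.of fun α β =>
    ((-1 : ℤˣ) ^ ((∑ s, p (α s)) + (p a + 1) * ∑ l, p (β l))) • A (Fin.snoc α a : Fin (m + 1) → ι) β
  map_add' A B := by ext α β; simp
  map_smul' r A := by
    ext α β
    simp only [Matrix.of_apply, Matrix.smul_apply, RingHom.id_apply]
    exact smul_comm _ _ _

variable (k p) in
/-- The array of the coefficients of `x^b`, moved to the left. -/
def inShift (b : ι) (m n : ℕ) : Matrix (Fin m → ι) (Fin (n + 1) → ι) k →ₗ[k]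
    Matrix (Fin m → ι) (Fin n → ι) k where
  toFun A := Matrix.of fun α β => ((-1 : ℤˣ) ^ p b) • A α (Fin.cons b β : Fin (n + 1) → ι)
  map_add' A B := by ext α β; simp
  map_smul' r A := by
    ext α β
    simp only [Matrix.of_apply, Matrix.smul_apply, RingHom.id_apply]
    exact smul_comm _ _ _

lemma outShift_apply (a : ι) {m n : ℕ} (A : Matrix (Fin (m + 1) → ι) (Fin n → ι) k)
    (α : Fin m → ι) (β : Fin n → ι) : outShift k p a m n A α β =
      ((-1 : ℤˣ) ^ ((∑ s, p (α s)) + (p a + 1) * ∑ l, p (β l))) •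
        A (Fin.snoc α a : Fin (m + 1) → ι) β := rfl

lemma inShift_apply (b : ι) {m n : ℕ} (A : Matrix (Fin m → ι) (Fin (n + 1) → ι) k)
    (α : Fin m → ι) (β : Fin n → ι) : inShift k p b m n A α β =
      ((-1 : ℤˣ) ^ p b) • A α (Fin.cons b β : Fin (n + 1) → ι) := rfl

lemma sum_tuples_cons [Fintype ι] {W : Type*} [AddCommMonoid W] {n : ℕ}
    (F : (Fin (n + 1) → ι) → W) : ∑ β, F β = ∑ b, ∑ β : Fin n → ι, F (Fin.cons b β) := by
  rw [← Fintype.sum_prod_type']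
  exact (Fintype.sum_equiv (Fin.consEquiv fun _ => ι) _ _ fun _ => rfl).symm

lemma sum_tuples_snoc [Fintype ι] {W : Type*} [AddCommMonoid W] {n : ℕ}
    (F : (Fin (n + 1) → ι) → W) : ∑ β, F β = ∑ b, ∑ β : Fin n → ι, F (Fin.snoc β b) := by
  rw [← Fintype.sum_prod_type']
  exact (Fintype.sum_equiv (Fin.snocEquiv fun _ => ι) _ _ fun _ => rfl).symm

lemma genExp_snoc {m n : ℕ} (α : Fin m → ι) (a : ι) (β : Fin n → ι) :
    genExp p (Fin.snoc α a : Fin (m + 1) → ι) β = genExp p α β + ∑ s, p (α s) := by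
  rw [genExp, genExp, Fin.sum_univ_castSucc, add_assoc]
  congr 1
  simp only [Fin.snoc_castSucc, Fin.rev_castSucc, Fin.val_succ, Nat.cast_add, Nat.cast_one, add_mul,
    one_mul, Finset.sum_add_distrib, Fin.rev_last, Fin.val_zero, Nat.cast_zero, zero_mul, add_zero]

lemma genExp_cons {m n : ℕ} (α : Fin m → ι) (b : ι) (β : Fin n → ι) :
    genExp p α (Fin.cons b β : Fin (n + 1) → ι) = genExp p α β + p b := by
  rw [genExp, genExp, Fin.sum_univ_succ]
  simp only [Fin.cons_zero, Fin.cons_succ]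
  ring

/-- The last output gives the leftmost ψ of the monomial. Moving it to the front past the x produces
the sign in `outShift`. -/
lemma genRaw_succ_out [Fintype ι] {m n : ℕ} (A : Matrix (Fin (m + 1) → ι) (Fin n → ι) k) :
    genRaw k p (m + 1) n A =
      ∑ a, variableElt k p (Sum.inr a) * genRaw k p m n (outShift k p a m n A) := by
  rw [genRaw_apply, sum_tuples_snoc]
  refine Finset.sum_congr rfl fun a _ => ?_
  rw [genRaw_apply, Finset.mul_sum]
  refine Finset.sum_congr rfl fun α _ => ?_
  rw [Finset.mul_sum]
  refine Finset.sum_congr rfl fun β _ => ?_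
  rw [psiWord_snoc, ← mul_assoc, variableElt_mul_comm (isOfParity_xWord β), smul_mul_assoc,
    outShift_apply, units_smul_field_smul, mul_smul_comm, mul_smul_comm, mul_smul_comm,
    smul_comm (A _ _) (_ : ℤˣ), smul_smul, smul_smul, ← uzpow_add, ← uzpow_add, mul_assoc,
    genExp_snoc]
  refine units_pow_smul_congr ?_ rfl
  rw [varParity, Sum.elim_inr]
  ring

lemma genRaw_succ_in [Fintype ι] {m n : ℕ} (A : Matrix (Fin m → ι) (Fin (n + 1) → ι) k) :
    genRaw k p m (n + 1) A =
      ∑ b, variableElt k p (Sum.inl b) * genRaw k p m n (inShift k p b m n A) := by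
  rw [genRaw_apply]
  simp only [sum_tuples_cons (n := n)]
  rw [Finset.sum_comm]
  refine Finset.sum_congr rfl fun b _ => ?_
  rw [genRaw_apply, Finset.mul_sum]
  refine Finset.sum_congr rfl fun α _ => ?_
  rw [Finset.mul_sum]
  refine Finset.sum_congr rfl fun β _ => ?_
  rw [xWord_cons, inShift_apply, units_smul_field_smul, mul_smul_comm, mul_smul_comm, mul_smul_comm,
    smul_smul, ← uzpow_add, mul_assoc, genExp_cons]

variable (p) in
/-- Arrays that are skew-symmetric in the outputs and symmetric in the inputs. -/
def IsSkewArray {m n : ℕ} (A : Matrix (Fin m → ι) (Fin n → ι) k) : Prop :=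
  ∀ (σ : Fin m ≃ Fin m) (τ : Fin n ≃ Fin n), arrayAct k p σ τ A = inversionSign σ • A

lemma IsSkewArray.apply {m n : ℕ} {A : Matrix (Fin m → ι) (Fin n → ι) k} (hA : IsSkewArray p A)
    (σ : Fin m ≃ Fin m) (τ : Fin n ≃ Fin n) (α : Fin m → ι) (β : Fin n → ι) :
    A (α ∘ σ) (β ∘ τ) = ((-1 : ℤˣ) ^ (koszulExp σ (fun _ => 1) +
      koszulExp σ (fun i => p (α (σ i))) + koszulExp τ (fun i => p (β (τ i))))) • A α β := by
  have h := congrFun (congrFun (hA σ τ) α) β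
  rw [arrayAct_apply, inversionSign_eq] at h
  rw [add_assoc, uzpow_add, mul_comm, mul_smul]
  have h2 : ((-1 : ℤˣ) ^ koszulExp σ (fun _ => 1)) • A α β = (((-1 : ℤˣ) ^ koszulExp σ (fun _ => 1)) • A) α β := rfl
  rw [h2, ← h, smul_smul, ← uzpow_add, ZMod.two_add_self, uzpow_zero, one_smul]

lemma isSkewArray_iff {m n : ℕ} {A : Matrix (Fin m → ι) (Fin n → ι) k} : IsSkewArray p A ↔
    ∀ (σ : Fin m ≃ Fin m) (τ : Fin n ≃ Fin n) (α : Fin m → ι) (β : Fin n → ι),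
    A (α ∘ σ) (β ∘ τ) = ((-1 : ℤˣ) ^ (koszulExp σ (fun _ => 1) +
      koszulExp σ (fun i => p (α (σ i))) + koszulExp τ (fun i => p (β (τ i))))) • A α β := by
  refine ⟨fun h => h.apply, fun h σ τ => ?_⟩
  ext α β
  rw [arrayAct_apply, h, smul_smul, ← uzpow_add, inversionSign_eq]
  refine units_pow_smul_congr ?_ rfl
  generalize koszulExp σ (fun _ => 1) = a
  generalize koszulExp σ (fun i => p (α (σ i))) = b
  generalize koszulExp τ (fun i => p (β (τ i))) = c
  revert a b c
  decide

lemma snoc_comp_blockSum {m : ℕ} (σ : Fin m ≃ Fin m) (α : Fin m → ι) (a : ι) :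
    (Fin.snoc (α ∘ σ) a : Fin (m + 1) → ι) =
      (Fin.snoc α a : Fin (m + 1) → ι) ∘ blockSum σ (Equiv.refl (Fin 1)) := by
  funext i
  refine Fin.lastCases ?_ (fun i => ?_) i
  · have : blockSum σ (Equiv.refl (Fin 1)) (Fin.last m) = Fin.last m := blockSum_natAdd _ _ 0
    rw [Function.comp_apply, this, Fin.snoc_last, Fin.snoc_last]
  · have : blockSum σ (Equiv.refl (Fin 1)) i.castSucc = (σ i).castSucc := blockSum_castAdd _ _ i
    rw [Function.comp_apply, this, Fin.snoc_castSucc, Fin.snoc_castSucc, Function.comp_apply]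

lemma koszulExp_blockSum_refl {m : ℕ} (σ : Fin m ≃ Fin m) (q : Fin (m + 1) → ZMod 2) :
    koszulExp (blockSum σ (Equiv.refl (Fin 1))) q = koszulExp σ (fun i => q i.castSucc) := by
  rw [koszulExp_blockSum, koszulExp_refl, add_zero]
  rfl

lemma cons_comp_decomposeFin {n : ℕ} (τ : Fin n ≃ Fin n) (β : Fin n → ι) (b : ι) :
    (Fin.cons b (β ∘ τ) : Fin (n + 1) → ι) =
      (Fin.cons b β : Fin (n + 1) → ι) ∘ Equiv.Perm.decomposeFin.symm (0, τ) := by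
  funext i
  refine Fin.cases ?_ (fun i => ?_) i <;> simp

lemma koszulExp_decomposeFin {n : ℕ} (τ : Fin n ≃ Fin n) (q : Fin (n + 1) → ZMod 2) :
    koszulExp (Equiv.Perm.decomposeFin.symm (0, τ)) q = koszulExp τ (fun i => q i.succ) := by
  rw [koszulExp_succAbove _ τ 0 (by simp)]
  simp [ZMod.two_add_self]

/-- Permutations of the remaining outputs extend by fixing the last one, without further inversions.
Thus the shifts, and later the derivatives, can be iterated. -/
lemma IsSkewArray.outShift {m n : ℕ} {A : Matrix (Fin (m + 1) → ι) (Fin n → ι) k}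
    (hA : IsSkewArray p A) (a : ι) : IsSkewArray p (outShift k p a m n A) := by
  rw [isSkewArray_iff]
  intro σ τ α β
  rw [outShift_apply, outShift_apply, snoc_comp_blockSum, hA.apply, smul_smul, smul_smul,
    ← uzpow_add, ← uzpow_add, koszulExp_blockSum_refl, koszulExp_blockSum_refl]
  have h1 : ∑ s, p ((α ∘ σ) s) = ∑ s, p (α s) := σ.sum_comp (fun s => p (α s))
  have h2 : ∑ s, p ((β ∘ τ) s) = ∑ s, p (β s) := τ.sum_comp (fun s => p (β s))
  have h3 (i : Fin m) : blockSum σ (Equiv.refl (Fin 1)) i.castSucc = (σ i).castSucc :=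
    blockSum_castAdd _ _ i
  simp only [h1, h2, h3, Fin.snoc_castSucc]
  refine units_pow_smul_congr ?_ rfl
  ring

lemma IsSkewArray.inShift {m n : ℕ} {A : Matrix (Fin m → ι) (Fin (n + 1) → ι) k}
    (hA : IsSkewArray p A) (b : ι) : IsSkewArray p (inShift k p b m n A) := by
  rw [isSkewArray_iff]
  intro σ τ α β
  rw [inShift_apply, inShift_apply, cons_comp_decomposeFin, hA.apply, smul_smul, smul_smul,
    ← uzpow_add, ← uzpow_add, koszulExp_decomposeFin]
  simp only [Equiv.Perm.decomposeFin_symm_apply_succ, Equiv.swap_self, Equiv.refl_apply,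
    Fin.cons_succ]
  refine units_pow_smul_congr ?_ rfl
  ring

end GenRaw

/-! ### Partial derivatives of generating functions -/

section Derivatives

variable {k : Type u} [Field k] {ι : Type w} {p : ι → ZMod 2}

/-- The transposition of the last two elements. -/
def swapLast (m : ℕ) : Fin (m + 2) ≃ Fin (m + 2) :=
  blockSum (Equiv.refl (Fin m)) (finAddFlip : Fin (1 + 1) ≃ Fin (1 + 1))

lemma swapLast_last (m : ℕ) : swapLast m (Fin.last (m + 1)) = (Fin.last m).castSucc :=
  (blockSum_natAdd (Equiv.refl (Fin m)) (finAddFlip : Fin (1 + 1) ≃ Fin (1 + 1)) 1).trans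
    (congrArg (Fin.natAdd m) (finAddFlip_apply_natAdd (m := 1) (n := 1) 0))

lemma swapLast_castSucc_last (m : ℕ) : swapLast m (Fin.last m).castSucc = Fin.last (m + 1) :=
  (blockSum_natAdd (Equiv.refl (Fin m)) (finAddFlip : Fin (1 + 1) ≃ Fin (1 + 1)) 0).trans
    (congrArg (Fin.natAdd m) (finAddFlip_apply_castAdd (m := 1) 0 1))

lemma swapLast_castSucc_castSucc {m : ℕ} (i : Fin m) :
    swapLast m i.castSucc.castSucc = i.castSucc.castSucc :=
  blockSum_castAdd (Equiv.refl (Fin m)) (finAddFlip : Fin (1 + 1) ≃ Fin (1 + 1)) i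

lemma koszulExp_swapLast {m : ℕ} (q : Fin (m + 2) → ZMod 2) :
    koszulExp (swapLast m) q = q (Fin.last m).castSucc * q (Fin.last (m + 1)) := by
  rw [swapLast, koszulExp_blockSum, koszulExp_refl, zero_add, koszulExp_finAddFlip,
    Fin.sum_univ_one, Fin.sum_univ_one]
  rfl

lemma snoc_snoc_comp_swapLast {m : ℕ} (α : Fin m → ι) (a b : ι) :
    (Fin.snoc (Fin.snoc α a : Fin (m + 1) → ι) b : Fin (m + 2) → ι) ∘ swapLast m =
      (Fin.snoc (Fin.snoc α b : Fin (m + 1) → ι) a : Fin (m + 2) → ι) := by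
  funext i
  refine Fin.lastCases ?_ (fun i => Fin.lastCases ?_ (fun i => ?_) i) i
  · rw [Function.comp_apply, swapLast_last, Fin.snoc_castSucc, Fin.snoc_last, Fin.snoc_last]
  · rw [Function.comp_apply, swapLast_castSucc_last, Fin.snoc_last, Fin.snoc_castSucc,
      Fin.snoc_last]
  · simp only [Function.comp_apply, swapLast_castSucc_castSucc, Fin.snoc_castSucc]

/-- Skew-symmetry for the transposition of the last two outputs becomes the commutation rule of ψ_a
and ψ_b. -/
lemma outShift_outShift {m n : ℕ} {A : Matrix (Fin (m + 2) → ι) (Fin n → ι) k}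
    (hA : IsSkewArray p A) (a b : ι) :
    outShift k p a m n (outShift k p b (m + 1) n A) =
      ((-1 : ℤˣ) ^ ((p a + 1) * (p b + 1))) •
        outShift k p b m n (outShift k p a (m + 1) n A) := by
  ext α β
  rw [outShift_apply, outShift_apply, ← snoc_snoc_comp_swapLast]
  have h := hA.apply (swapLast m) (Equiv.refl _)
    (Fin.snoc (Fin.snoc α b : Fin (m + 1) → ι) a) β
  rw [koszulExp_swapLast, koszulExp_swapLast, koszulExp_refl, swapLast_last,
    swapLast_castSucc_last, Fin.snoc_last, Fin.snoc_castSucc, Fin.snoc_last] at h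
  have h2 : (β ∘ (Equiv.refl (Fin n))) = β := rfl
  rw [h2] at h
  rw [h]
  show _ = ((-1 : ℤˣ) ^ ((p a + 1) * (p b + 1))) • (outShift k p b m n
    (outShift k p a (m + 1) n A) α β)
  rw [outShift_apply, outShift_apply]
  simp only [smul_smul, ← uzpow_add, Fin.sum_univ_castSucc, Fin.snoc_castSucc, Fin.snoc_last]
  refine units_pow_smul_congr ?_ rfl
  generalize ∑ l, p (β l) = x
  generalize ∑ l, p (α l) = y
  generalize p a = z
  generalize p b = w
  revert x y z w
  decide

lemma swap_zero_one_succ {n : ℕ} (x : Fin (n + 1)) :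
    Equiv.swap (0 : Fin (n + 2)) 1 x.succ = (1 : Fin (n + 2)).succAbove x := by
  refine Fin.cases ?_ (fun x => ?_) x
  · rw [Fin.succ_zero_eq_one, Equiv.swap_apply_right]
    rfl
  · rw [Equiv.swap_apply_of_ne_of_ne]
    · rw [← Fin.succ_zero_eq_one, Fin.succ_succAbove_succ, Fin.zero_succAbove]
    · exact Fin.succ_ne_zero _
    · rw [← Fin.succ_zero_eq_one]
      exact fun h => Fin.succ_ne_zero _ (Fin.succ_injective _ h)

lemma koszulExp_swap_zero_one {n : ℕ} (q : Fin (n + 2) → ZMod 2) :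
    koszulExp (Equiv.swap (0 : Fin (n + 2)) 1) q = q 0 * q 1 := by
  rw [koszulExp_succAbove _ (Equiv.refl (Fin (n + 1))) 0 fun x => by
    rw [Equiv.swap_apply_left, Fin.zero_succAbove, swap_zero_one_succ, Equiv.refl_apply],
    koszulExp_refl, zero_add, Equiv.swap_apply_left, ← Finset.sum_add_distrib, Fin.sum_univ_succ]
  simp [Fin.le_def, ZMod.two_add_self]

lemma cons_cons_comp_swap {n : ℕ} (β : Fin n → ι) (a b : ι) :
    (Fin.cons a (Fin.cons b β : Fin (n + 1) → ι) : Fin (n + 2) → ι) ∘ Equiv.swap 0 1 =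
      (Fin.cons b (Fin.cons a β : Fin (n + 1) → ι) : Fin (n + 2) → ι) := by
  funext i
  refine Fin.cases ?_ (fun i => Fin.cases ?_ (fun i => ?_) i) i
  · rw [Function.comp_apply, Equiv.swap_apply_left]; rfl
  · rw [Function.comp_apply, swap_zero_one_succ]; rfl
  · rw [Function.comp_apply, swap_zero_one_succ, ← Fin.succ_zero_eq_one, Fin.succ_succAbove_succ,
      Fin.zero_succAbove]
    rfl

lemma inShift_inShift {m n : ℕ} {A : Matrix (Fin m → ι) (Fin (n + 2) → ι) k}
    (hA : IsSkewArray p A) (a b : ι) :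
    inShift k p a m n (inShift k p b m (n + 1) A) =
      ((-1 : ℤˣ) ^ (p a * p b)) • inShift k p b m n (inShift k p a m (n + 1) A) := by
  ext α β
  rw [inShift_apply, inShift_apply, ← cons_cons_comp_swap]
  have h := hA.apply (Equiv.refl _) (Equiv.swap 0 1) α
    (Fin.cons a (Fin.cons b β : Fin (n + 1) → ι) : Fin (n + 2) → ι)
  rw [koszulExp_swap_zero_one, koszulExp_refl, koszulExp_refl, Equiv.swap_apply_left,
    Equiv.swap_apply_right] at h
  have h2 : (α ∘ (Equiv.refl (Fin m))) = α := rfl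
  rw [h2] at h
  rw [h]
  show _ = ((-1 : ℤˣ) ^ (p a * p b)) • (inShift k p b m n (inShift k p a m (n + 1) A) α β)
  rw [inShift_apply, inShift_apply]
  simp only [smul_smul, ← uzpow_add]
  refine units_pow_smul_congr ?_ rfl
  simp only [← Fin.succ_zero_eq_one, Fin.cons_zero, Fin.cons_succ]
  ring

lemma derivLin_one (v : ι ⊕ ι) : derivLin k p v 1 = 0 := by
  have h := derivLin_mul v (1 : Polyvector k p) 1
  have h2 : (if varParity p v = 0 then (1 : Polyvector k p) else parityHom k p 1) = 1 := by
    split_ifs <;> simp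
  rw [h2] at h
  simpa using h

lemma derivLin_variableElt_mul [DecidableEq ι] (v w : ι ⊕ ι) (f : Polyvector k p) :
    derivLin k p v (variableElt k p w * f) = (if v = w then f else 0) +
      ((-1 : ℤˣ) ^ (varParity p v * varParity p w)) • (variableElt k p w * derivLin k p v f) := by
  rw [derivLin_mul, derivLin_variableElt]
  congr 1
  · split_ifs <;> simp
  · rcases varParity_cases p v with h | h
    · rw [if_pos h, h, zero_mul, uzpow_zero, one_smul]
    · rw [if_neg (by rw [h]; decide), h, one_mul, parityHom_variableElt, smul_mul_assoc]

variable [Fintype ι]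

lemma genRaw_zero_zero (A : Matrix (Fin 0 → ι) (Fin 0 → ι) k) :
    genRaw k p 0 0 A = A Fin.elim0 Fin.elim0 • 1 := by
  rw [genRaw_apply, Fintype.sum_unique, Fintype.sum_unique, xWord, psiWord, genExp]
  simp
  congr 1

lemma derivLin_psi_genRaw_zero (a : ι) {n : ℕ} (A : Matrix (Fin 0 → ι) (Fin n → ι) k) :
    derivLin k p (Sum.inr a) (genRaw k p 0 n A) = 0 := by
  classical
  induction n with
  | zero => rw [genRaw_zero_zero, map_smul, derivLin_one, smul_zero]
  | succ n ih =>
    rw [genRaw_succ_in, map_sum]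
    refine Finset.sum_eq_zero fun b _ => ?_
    rw [derivLin_variableElt_mul, ih, mul_zero, smul_zero, if_neg (by simp), add_zero]

lemma derivLin_x_genRaw_zero (a : ι) {m : ℕ} (A : Matrix (Fin m → ι) (Fin 0 → ι) k) :
    derivLin k p (Sum.inl a) (genRaw k p m 0 A) = 0 := by
  classical
  induction m with
  | zero => rw [genRaw_zero_zero, map_smul, derivLin_one, smul_zero]
  | succ n ih =>
    rw [genRaw_succ_out, map_sum]
    refine Finset.sum_eq_zero fun b _ => ?_
    rw [derivLin_variableElt_mul, ih, mul_zero, smul_zero, if_neg (by simp), add_zero]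

/-- The derivative hits the leading ψ or passes it. In the second case, by induction and by the
commutation of the shifts, the sum over the leading ψ reassembles to the same generating function,
so each of the m + 1 outputs contributes once. -/
lemma derivLin_psi_genRaw (a : ι) {m n : ℕ} {A : Matrix (Fin (m + 1) → ι) (Fin n → ι) k}
    (hA : IsSkewArray p A) : derivLin k p (Sum.inr a) (genRaw k p (m + 1) n A) =
      ((m : k) + 1) • genRaw k p m n (outShift k p a m n A) := by
  classical
  have h1 : derivLin k p (Sum.inr a) (genRaw k p (m + 1) n A) =
      genRaw k p m n (outShift k p a m n A) + ∑ b, ((-1 : ℤˣ) ^ ((p a + 1) * (p b + 1))) •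
        (variableElt k p (Sum.inr b) *
          derivLin k p (Sum.inr a) (genRaw k p m n (outShift k p b m n A))) := by
    rw [genRaw_succ_out, map_sum]
    simp only [derivLin_variableElt_mul]
    rw [Finset.sum_add_distrib]
    congr 1
    simp
  rw [h1, add_smul, one_smul, add_comm]
  congr 1
  cases m with
  | zero => simp [derivLin_psi_genRaw_zero]
  | succ m =>
    rw [genRaw_succ_out, Finset.smul_sum]
    refine Finset.sum_congr rfl fun b _ => ?_
    rw [derivLin_psi_genRaw a (hA.outShift b), outShift_outShift hA, units_smul_apply,
      mul_smul_comm, smul_comm (_ : ℤˣ) (_ : k), mul_smul_comm, smul_smul, ← uzpow_add,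
      ZMod.two_add_self, uzpow_zero, one_smul, Nat.cast_add, Nat.cast_one]

lemma derivLin_x_genRaw (a : ι) {m n : ℕ} {A : Matrix (Fin m → ι) (Fin (n + 1) → ι) k}
    (hA : IsSkewArray p A) : derivLin k p (Sum.inl a) (genRaw k p m (n + 1) A) =
      ((n : k) + 1) • genRaw k p m n (inShift k p a m n A) := by
  classical
  have h1 : derivLin k p (Sum.inl a) (genRaw k p m (n + 1) A) =
      genRaw k p m n (inShift k p a m n A) + ∑ b, ((-1 : ℤˣ) ^ (p a * p b)) •
        (variableElt k p (Sum.inl b) *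
          derivLin k p (Sum.inl a) (genRaw k p m n (inShift k p b m n A))) := by
    rw [genRaw_succ_in, map_sum]
    simp only [derivLin_variableElt_mul]
    rw [Finset.sum_add_distrib]
    congr 1
    simp
  rw [h1, add_smul, one_smul, add_comm]
  congr 1
  cases n with
  | zero => simp [derivLin_x_genRaw_zero]
  | succ n =>
    rw [genRaw_succ_in, Finset.smul_sum]
    refine Finset.sum_congr rfl fun b _ => ?_
    rw [derivLin_x_genRaw a (hA.inShift b), inShift_inShift hA, units_smul_apply,
      mul_smul_comm, smul_comm (_ : ℤˣ) (_ : k), mul_smul_comm, smul_smul, ← uzpow_add,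
      ZMod.two_add_self, uzpow_zero, one_smul, Nat.cast_add, Nat.cast_one]

end Derivatives

/-! ### Tensor products, grafts and contractions under the generating function -/

section GenRawOperations

variable {k : Type u} [Field k] {ι : Type w} {p : ι → ZMod 2}

lemma genExp_append {m n m' n' : ℕ} (α : Fin m → ι) (α' : Fin m' → ι) (β : Fin n → ι)
    (β' : Fin n' → ι) : genExp p (Fin.append α α') (Fin.append β β') =
      genExp p α β + genExp p α' β' + (m' : ZMod 2) * ∑ s, p (α s) := by
  have h1 (s : Fin m) : ((Fin.castAdd m' s).rev : ℕ) = s.rev + m' := by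
    simp only [Fin.val_rev, Fin.val_castAdd]; omega
  have h2 (s : Fin m') : ((Fin.natAdd m s).rev : ℕ) = s.rev := by
    simp only [Fin.val_rev, Fin.val_natAdd]; omega
  simp only [genExp, Fin.sum_univ_add, Fin.append_left, Fin.append_right, h1, h2, Nat.cast_add,
    add_mul, Finset.sum_add_distrib, Finset.mul_sum]
  ring

lemma sum_tuples_append [Fintype ι] {W : Type*} [AddCommMonoid W] {m n : ℕ}
    (F : (Fin (m + n) → ι) → W) :
    ∑ β, F β = ∑ β : Fin m → ι, ∑ β' : Fin n → ι, F (Fin.append β β') := by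
  rw [← Fintype.sum_prod_type']
  exact (Fintype.sum_equiv (Fin.appendEquiv m n) _ _ fun _ => rfl).symm

/-- The sign collects the tensor sign, the passage of the ψ of A across the monomial of B, and the
m' new places behind each output of A in the exponent. -/
lemma genRaw_arrayTensor [Fintype ι] {m n m' n' : ℕ} {q r : ZMod 2}
    {A : Matrix (Fin m → ι) (Fin n → ι) k} {B : Matrix (Fin m' → ι) (Fin n' → ι) k}
    (hA : IsHomogeneousArray p q A) (hB : IsHomogeneousArray p r B) :
    genRaw k p (m + m') (n + n') (arrayTensor k p A B) =
      ((-1 : ℤˣ) ^ (r * q + m * r + m * m' : ZMod 2)) • (genRaw k p m n A * genRaw k p m' n' B) := by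
  rw [genRaw_apply, sum_tuples_append]
  simp only [sum_tuples_append (m := n)]
  rw [genRaw_apply, genRaw_apply, Finset.sum_mul, Finset.smul_sum]
  refine Finset.sum_congr rfl fun α _ => ?_
  rw [Finset.mul_sum, Finset.smul_sum]
  refine Finset.sum_congr rfl fun α' _ => ?_
  rw [Finset.sum_mul, Finset.smul_sum]
  refine Finset.sum_congr rfl fun β _ => ?_
  rw [Finset.mul_sum, Finset.smul_sum]
  refine Finset.sum_congr rfl fun β' _ => ?_
  rw [arrayTensor_apply]
  simp only [Fin.append_left, Fin.append_right]
  by_cases hA0 : A α β = 0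
  · simp [hA0]
  by_cases hB0 : B α' β' = 0
  · simp [hB0]
  have h1 := hA α β hA0
  have h2 := hB α' β' hB0
  have hw : xWord k p (Fin.append β β') * psiWord k p (Fin.append α α') =
      ((-1 : ℤˣ) ^ ((∑ s, (p (α s) + 1)) * ((∑ l, p (β' l)) + ∑ s, (p (α' s) + 1)))) •
        (xWord k p β * psiWord k p α * (xWord k p β' * psiWord k p α')) := by
    rw [xWord_append, psiWord_append, mul_assoc, ← mul_assoc (xWord k p β'),
      mul_psiWord ((isOfParity_xWord β').mul (isOfParity_psiWord α')), mul_smul_comm]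
    simp only [mul_assoc]
  rw [hw, genExp_append, units_smul_field_smul]
  simp only [mul_smul_comm, smul_mul_assoc, smul_comm (A α β * B α' β') (_ : ℤˣ), smul_smul,
    ← uzpow_add, smul_comm (A α β) (_ : ℤˣ), smul_comm (B α' β') (_ : ℤˣ), mul_comm (B α' β')]
  refine units_pow_smul_congr ?_ rfl
  simp only [Finset.sum_add_distrib, Finset.sum_const, Finset.card_univ, Fintype.card_fin,
    nsmul_eq_mul, mul_one]
  rw [← h1, ← h2]
  generalize ∑ l, p (β l) = x
  generalize ∑ l, p (α l) = y
  generalize ∑ l, p (β' l) = x'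
  generalize ∑ l, p (α' l) = y'
  generalize genExp p α β = z
  generalize genExp p α' β' = z'
  generalize (m : ZMod 2) = s
  generalize (m' : ZMod 2) = s'
  have h2 : (2 : ZMod 2) = 0 := rfl
  linear_combination (y * s') * h2

lemma outShift_homogeneous {m n : ℕ} {q : ZMod 2} {A : Matrix (Fin (m + 1) → ι) (Fin n → ι) k}
    (hA : IsHomogeneousArray p q A) (a : ι) :
    IsHomogeneousArray p (q + p a) (outShift k p a m n A) := by
  intro α β h
  rw [outShift_apply] at h
  have := hA _ _ fun h0 => h (by rw [h0, smul_zero])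
  rw [← this, Fin.sum_univ_castSucc]
  simp only [Fin.snoc_castSucc, Fin.snoc_last]
  have h2 : (2 : ZMod 2) = 0 := rfl
  linear_combination (-p a) * h2

lemma inShift_homogeneous {m n : ℕ} {q : ZMod 2} {A : Matrix (Fin m → ι) (Fin (n + 1) → ι) k}
    (hA : IsHomogeneousArray p q A) (a : ι) :
    IsHomogeneousArray p (q + p a) (inShift k p a m n A) := by
  intro α β h
  rw [inShift_apply] at h
  have := hA _ _ fun h0 => h (by rw [h0, smul_zero])
  rw [← this, Fin.sum_univ_succ]
  simp only [Fin.cons_zero, Fin.cons_succ]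
  have h2 : (2 : ZMod 2) = 0 := rfl
  linear_combination (-p a) * h2

variable [Fintype ι] [DecidableEq ι]

lemma parityBehind_mid {a b : ℕ} (α : Fin (a + b) → ι) :
    parityBehind p (⟨a, by omega⟩ : Fin (a + b + 1)) α = ∑ i, p (α (Fin.natAdd a i)) := by
  rw [parityBehind, Fin.sum_univ_add]
  have h1 (i : Fin a) : ¬ ((⟨a, by omega⟩ : Fin (a + b + 1)) ≤ (Fin.castAdd b i).castSucc) := by
    simp [Fin.le_def]
  have h2 (i : Fin b) : ((⟨a, by omega⟩ : Fin (a + b + 1)) ≤ (Fin.natAdd a i).castSucc) := by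
    simp [Fin.le_def]
  rw [Finset.sum_eq_zero fun i _ => if_neg (h1 i), zero_add]
  exact Finset.sum_congr rfl fun i _ => if_pos (h2 i)

lemma succAbove_mid_castAdd {a b : ℕ} (i : Fin a) :
    ((⟨a, by omega⟩ : Fin (a + b + 1)).succAbove (Fin.castAdd b i) : ℕ) = i := by
  rw [Fin.succAbove_of_castSucc_lt _ _ (by simp [Fin.lt_def])]; rfl

lemma succAbove_mid_natAdd {a b : ℕ} (i : Fin b) :
    ((⟨a, by omega⟩ : Fin (a + b + 1)).succAbove (Fin.natAdd a i) : ℕ) = a + 1 + i := by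
  rw [Fin.succAbove_of_le_castSucc _ _ (by simp [Fin.le_def])]
  simp only [Fin.val_succ, Fin.val_natAdd]; omega

lemma insertNth_mid_out {a b : ℕ} (γ : ι) (α : Fin (a + b) → ι) :
    ((fun i : Fin (a + 1) => Fin.insertNth (α := fun _ => ι) (⟨a, by omega⟩ : Fin (a + b + 1)) γ α
      (finCongr (Nat.add_right_comm a 1 b) (Fin.castAdd b i))) =
        Fin.snoc (fun i => α (Fin.castAdd b i)) γ) ∧
    ∀ i : Fin b, Fin.insertNth (α := fun _ => ι) (⟨a, by omega⟩ : Fin (a + b + 1)) γ α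
      (finCongr (Nat.add_right_comm a 1 b) (Fin.natAdd (a + 1) i)) = α (Fin.natAdd a i) := by
  constructor
  · funext i
    refine Fin.lastCases ?_ (fun i => ?_) i
    · have h : finCongr (Nat.add_right_comm a 1 b) (Fin.castAdd b (Fin.last a)) =
        (⟨a, by omega⟩ : Fin (a + b + 1)) := Fin.ext rfl
      rw [h, Fin.insertNth_apply_same, Fin.snoc_last]
    · have h : finCongr (Nat.add_right_comm a 1 b) (Fin.castAdd b i.castSucc) =
        (⟨a, by omega⟩ : Fin (a + b + 1)).succAbove (Fin.castAdd b i) :=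
        Fin.ext (succAbove_mid_castAdd i).symm
      rw [h, Fin.insertNth_apply_succAbove, Fin.snoc_castSucc]
  · intro i
    have h : finCongr (Nat.add_right_comm a 1 b) (Fin.natAdd (a + 1) i) =
      (⟨a, by omega⟩ : Fin (a + b + 1)).succAbove (Fin.natAdd a i) :=
      Fin.ext (succAbove_mid_natAdd i).symm
    rw [h, Fin.insertNth_apply_succAbove]

lemma insertNth_mid_in {l r : ℕ} (γ : ι) (β : Fin (l + r) → ι) :
    (∀ i : Fin l, Fin.insertNth (α := fun _ => ι) (⟨l, by omega⟩ : Fin (l + r + 1)) γ β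
      (finCongr (Nat.add_assoc l r 1).symm (Fin.castAdd (r + 1) i)) = β (Fin.castAdd r i)) ∧
    (fun i : Fin (r + 1) => Fin.insertNth (α := fun _ => ι) (⟨l, by omega⟩ : Fin (l + r + 1)) γ β
      (finCongr (Nat.add_assoc l r 1).symm (Fin.natAdd l i))) =
        Fin.cons γ (fun i => β (Fin.natAdd l i)) := by
  constructor
  · intro i
    have h : finCongr (Nat.add_assoc l r 1).symm (Fin.castAdd (r + 1) i) =
      (⟨l, by omega⟩ : Fin (l + r + 1)).succAbove (Fin.castAdd r i) :=
      Fin.ext (succAbove_mid_castAdd i).symm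
    rw [h, Fin.insertNth_apply_succAbove]
  · funext i
    refine Fin.cases ?_ (fun i => ?_) i
    · have h : finCongr (Nat.add_assoc l r 1).symm (Fin.natAdd l (0 : Fin (r + 1))) =
        (⟨l, by omega⟩ : Fin (l + r + 1)) := Fin.ext rfl
      rw [h, Fin.insertNth_apply_same, Fin.cons_zero]
    · have h : finCongr (Nat.add_assoc l r 1).symm (Fin.natAdd l i.succ) =
        (⟨l, by omega⟩ : Fin (l + r + 1)).succAbove (Fin.natAdd l i) := by
        refine Fin.ext ((succAbove_mid_natAdd i).trans ?_).symm
        simp only [finCongr_apply, Fin.val_cast, Fin.val_natAdd, Fin.val_succ]; omega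
      rw [h, Fin.insertNth_apply_succAbove, Fin.cons_succ]

/-- The two-vertex composition of arrays, in terms of the coefficients of the contracted legs. -/
lemma arrayGraft_eq {a b l r : ℕ} {A : Matrix (Fin (a + 1) → ι) (Fin l → ι) k}
    {B : Matrix (Fin b → ι) (Fin (r + 1) → ι) k} (hA : IsHomogeneousArray p ((a : ZMod 2) + 1) A)
    (hB : IsHomogeneousArray p (b : ZMod 2) B) :
    arrayContract k p (⟨a, by omega⟩ : Fin (a + b + 1)) (⟨l, by omega⟩ : Fin (l + r + 1))
      (arrayAct k p (finCongr (Nat.add_right_comm a 1 b)) (finCongr (Nat.add_assoc l r 1).symm)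
        (arrayTensor k p A B)) =
      ∑ γ, ((-1 : ℤˣ) ^ (p γ * b + a + 1 : ZMod 2)) •
        arrayTensor k p (outShift k p γ a l A) (inShift k p γ b r B) := by
  ext α β
  rw [arrayContract_apply, Matrix.sum_apply]
  refine Finset.sum_congr rfl fun γ _ => ?_
  show _ = ((-1 : ℤˣ) ^ (p γ * b + a + 1 : ZMod 2)) •
    (arrayTensor k p (outShift k p γ a l A) (inShift k p γ b r B) α β)
  rw [arrayAct_finCongr, arrayTensor_apply, arrayTensor_apply, parityBehind_mid, parityBehind_mid,
    outShift_apply, inShift_apply]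
  simp only [Function.comp_apply]
  rw [(insertNth_mid_out γ α).1, (insertNth_mid_in γ β).2]
  simp only [(insertNth_mid_out γ α).2, (insertNth_mid_in γ β).1]
  have h3 : ∑ j, p ((Fin.insertNth (α := fun _ => ι) (⟨l, by omega⟩ : Fin (l + r + 1)) γ β
      (finCongr (Nat.add_assoc l r 1).symm (Fin.natAdd l j)))) =
      p γ + ∑ j, p (β (Fin.natAdd l j)) := by
    have h4 (j : Fin (r + 1)) := congrFun (insertNth_mid_in (l := l) (r := r) γ β).2 j
    simp only [h4, Fin.sum_univ_succ, Fin.cons_zero, Fin.cons_succ]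
  rw [h3]
  by_cases hA0 : A (Fin.snoc (fun i => α (Fin.castAdd b i)) γ : Fin (a + 1) → ι)
      (fun j => β (Fin.castAdd r j)) = 0
  · simp [hA0]
  by_cases hB0 : B (fun i => α (Fin.natAdd a i))
      (Fin.cons γ (fun i => β (Fin.natAdd l i)) : Fin (r + 1) → ι) = 0
  · simp [hB0]
  have h1 := hA _ _ hA0
  have h2 := hB _ _ hB0
  simp only [Fin.sum_univ_castSucc, Fin.snoc_castSucc, Fin.snoc_last] at h1
  simp only [Fin.sum_univ_succ, Fin.cons_zero, Fin.cons_succ] at h2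
  simp only [smul_mul_assoc, mul_smul_comm, smul_smul, ← uzpow_add]
  refine units_pow_smul_congr ?_ rfl
  rw [← h2]
  have h1' : (a : ZMod 2) = (∑ i, p (α (Fin.castAdd b i))) + p γ +
      (∑ j, p (β (Fin.castAdd r j))) + 1 := by
    rw [h1, add_assoc, ZMod.two_add_self, add_zero]
  rw [h1']
  generalize ∑ i, p (α (Fin.castAdd b i)) = x1
  generalize ∑ i, p (α (Fin.natAdd a i)) = x2
  generalize ∑ i, p (β (Fin.castAdd r i)) = x3
  generalize ∑ i, p (β (Fin.natAdd l i)) = x4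
  generalize p γ = x5
  revert x1 x2 x3 x4 x5
  decide

/-- Joining the last output of A to the first input of B fixes both legs to a common γ and sums over
it. On generating functions of skew arrays this is the sum of products of a ψ_γ-derivative and an
x^γ-derivative. -/
lemma genRaw_arrayGraft {a b l r : ℕ} {A : Matrix (Fin (a + 1) → ι) (Fin l → ι) k}
    {B : Matrix (Fin b → ι) (Fin (r + 1) → ι) k} (hA : IsHomogeneousArray p ((a : ZMod 2) + 1) A)
    (hB : IsHomogeneousArray p (b : ZMod 2) B) :
    genRaw k p (a + b) (l + r) (arrayContract k p (⟨a, by omega⟩ : Fin (a + b + 1))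
      (⟨l, by omega⟩ : Fin (l + r + 1))
      (arrayAct k p (finCongr (Nat.add_right_comm a 1 b)) (finCongr (Nat.add_assoc l r 1).symm)
        (arrayTensor k p A B))) =
      ((-1 : ℤˣ) ^ (a + b + 1 + a * b : ZMod 2)) •
        ∑ γ, genRaw k p a l (outShift k p γ a l A) * genRaw k p b r (inShift k p γ b r B) := by
  rw [arrayGraft_eq hA hB, map_sum, Finset.smul_sum]
  refine Finset.sum_congr rfl fun γ _ => ?_
  rw [units_smul_apply, genRaw_arrayTensor (outShift_homogeneous hA γ) (inShift_homogeneous hB γ),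
    smul_smul, ← uzpow_add]
  refine units_pow_smul_congr ?_ rfl
  generalize (a : ZMod 2) = x
  generalize (b : ZMod 2) = y
  generalize p γ = z
  revert x y z
  decide

/-- The coefficient counterpart of the odd Laplacian: differentiating in ψ_γ and x^γ and summing
joins the last output to the first input. -/
lemma sum_inShift_outShift {m n : ℕ} {A : Matrix (Fin (m + 1) → ι) (Fin (n + 1) → ι) k}
    (hA : IsHomogeneousArray p ((m : ZMod 2) + 1) A) :
    ∑ γ, inShift k p γ m n (outShift k p γ m (n + 1) A) =
      ((-1 : ℤˣ) ^ (m + 1 : ZMod 2)) • arrayContract k p (Fin.last m) 0 A := by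
  ext α β
  show _ = ((-1 : ℤˣ) ^ (m + 1 : ZMod 2)) • (arrayContract k p (Fin.last m) 0 A α β)
  rw [arrayContract_apply, Matrix.sum_apply, Finset.smul_sum]
  refine Finset.sum_congr rfl fun γ _ => ?_
  rw [inShift_apply, outShift_apply, Fin.insertNth_zero', Fin.insertNth_last']
  by_cases hA0 : A (Fin.snoc α γ : Fin (m + 1) → ι) (Fin.cons γ β : Fin (n + 1) → ι) = 0
  · rw [hA0]; simp
  have h1 := hA _ _ hA0
  rw [smul_smul, smul_smul, ← uzpow_add, ← uzpow_add]
  refine units_pow_smul_congr ?_ rfl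
  have h4 : ∑ i, p ((Fin.snoc α γ : Fin (m + 1) → ι) i) = (∑ i, p (α i)) + p γ := by
    simp [Fin.sum_univ_castSucc]
  have h5 : ∑ i, p ((Fin.cons γ β : Fin (n + 1) → ι) i) = p γ + ∑ i, p (β i) := by
    simp [Fin.sum_univ_succ]
  rw [← h1, h4, h5]
  have h2 : parityBehind p (Fin.last m) α = 0 := by
    refine Finset.sum_eq_zero fun l _ => if_neg ?_
    simp [Fin.le_def]
  have h3 : parityBehind p (0 : Fin (n + 1)) β = ∑ l, p (β l) := parityBehind_zero p β
  rw [h2, h3]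
  generalize ∑ l, p (β l) = x
  generalize ∑ l, p (α l) = y
  generalize p γ = z
  revert x y z
  decide

end GenRawOperations

/-! ### The linear vector field on generating functions -/

section GenRawDiff

variable {k : Type u} [Field k] {ι : Type w} {p : ι → ZMod 2} [Fintype ι] [DecidableEq ι]
  {D : Matrix ι ι k}

lemma sum_snoc_parity {m : ℕ} (α : Fin m → ι) (γ : ι) :
    ∑ i, p ((Fin.snoc α γ : Fin (m + 1) → ι) i) = (∑ i, p (α i)) + p γ := by
  simp [Fin.sum_univ_castSucc]

lemma sum_cons_parity {m : ℕ} (α : Fin m → ι) (γ : ι) :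
    ∑ i, p ((Fin.cons γ α : Fin (m + 1) → ι) i) = p γ + ∑ i, p (α i) := by
  simp [Fin.sum_univ_succ]

variable (hD : ∀ a c, D c a ≠ 0 → p c = p a + 1)
include hD

/-- At a nonzero entry the homogeneity of A and the oddness of `D` express all signs through m, so
that the sign no longer depends on the entry. -/
lemma sum_smul_inShift {m n : ℕ} {A : Matrix (Fin m → ι) (Fin (n + 1) → ι) k}
    (hA : IsHomogeneousArray p (m : ZMod 2) A) (a : ι) :
    ∑ c, D c a • inShift k p c m n A =
      ((-1 : ℤˣ) ^ (m : ZMod 2)) • inShift k p a m n (inDiff p D 0 A) := by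
  ext α β
  show _ = ((-1 : ℤˣ) ^ (m : ZMod 2)) • (inShift k p a m n (inDiff p D 0 A) α β)
  rw [inShift_apply, inDiff_apply, Matrix.sum_apply, Finset.smul_sum, Finset.smul_sum]
  refine Finset.sum_congr rfl fun c _ => ?_
  show D c a • (inShift k p c m n A α β) = _
  rw [inShift_apply, Fin.cons_zero, Fin.update_cons_zero]
  by_cases hD0 : D c a = 0
  · simp [hD0]
  by_cases hA0 : A α (Fin.cons c β : Fin (n + 1) → ι) = 0
  · simp [hA0]
  have h1 := hA _ _ hA0
  rw [smul_comm, smul_eq_mul, smul_smul, smul_smul, ← uzpow_add, ← uzpow_add]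
  refine units_pow_smul_congr ?_ rfl
  have h4 : ∑ l, (if 0 ≤ l then p ((Fin.cons a β : Fin (n + 1) → ι) l) else 0) =
      p a + ∑ l, p (β l) := by
    rw [← sum_cons_parity]
    exact Finset.sum_congr rfl fun l _ => if_pos (Fin.zero_le l)
  rw [← h1, h4, sum_cons_parity, hD a c hD0]
  generalize ∑ l, p (β l) = x
  generalize ∑ l, p (α l) = y
  generalize p a = z
  revert x y z
  decide

lemma sum_smul_outShift {m n : ℕ} {A : Matrix (Fin (m + 1) → ι) (Fin n → ι) k}
    (hA : IsHomogeneousArray p ((m : ZMod 2) + 1) A) (c : ι) :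
    ∑ a, D c a • ((-1 : ℤˣ) ^ p a) • outShift k p a m n A =
      ((-1 : ℤˣ) ^ ((m : ZMod 2) + 1)) • outShift k p c m n (outDiff p D (Fin.last m) A) := by
  ext α β
  show _ = ((-1 : ℤˣ) ^ ((m : ZMod 2) + 1)) •
    (outShift k p c m n (outDiff p D (Fin.last m) A) α β)
  rw [outShift_apply, outDiff_apply, Matrix.sum_apply, Finset.smul_sum, Finset.smul_sum]
  refine Finset.sum_congr rfl fun a _ => ?_
  show D c a • ((-1 : ℤˣ) ^ p a) • (outShift k p a m n A α β) = _
  rw [outShift_apply, Fin.snoc_last, Fin.update_snoc_last]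
  by_cases hD0 : D c a = 0
  · simp [hD0]
  by_cases hA0 : A (Fin.snoc α a : Fin (m + 1) → ι) β = 0
  · simp [hA0]
  have h1 := hA _ _ hA0
  rw [smul_smul, smul_comm, smul_eq_mul, smul_smul, smul_smul, ← uzpow_add, ← uzpow_add,
    ← uzpow_add]
  refine units_pow_smul_congr ?_ rfl
  have h4 : ∑ l, (if l < Fin.last m then p ((Fin.snoc α c : Fin (m + 1) → ι) l) else 0) =
      ∑ l, p (α l) := by
    rw [Fin.sum_univ_castSucc]
    simp [Fin.castSucc_lt_last]
  rw [← h1, h4, sum_snoc_parity, hD a c hD0]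
  generalize ∑ l, p (β l) = x
  generalize ∑ l, p (α l) = y
  generalize p a = z
  revert x y z
  decide

/-- By the symmetry of A a transposition moves `D` from one input to another, so all inputs
contribute equally. -/
lemma genRaw_inDiff {m n : ℕ} {A : Matrix (Fin m → ι) (Fin n → ι) k} (hs : IsSkewArray p A)
    (j : Fin n) (j' : Fin n) :
    genRaw k p m n (inDiff p D j A) = genRaw k p m n (inDiff p D j' A) := by
  have h := inDiff_arrayAct hD (Equiv.refl _) (Equiv.swap j j') j A
  rw [Equiv.swap_apply_left, hs, inversionSign_refl, one_smul] at h
  rw [h, genRaw_arrayAct, inversionSign_refl, one_smul]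

lemma genRaw_outDiff {m n : ℕ} {A : Matrix (Fin m → ι) (Fin n → ι) k} (hs : IsSkewArray p A)
    (i : Fin m) (i' : Fin m) :
    genRaw k p m n (outDiff p D i A) = genRaw k p m n (outDiff p D i' A) := by
  have h := outDiff_arrayAct hD (Equiv.swap i i') (Equiv.refl _) i A
  rw [Equiv.swap_apply_left, hs, units_smul_apply] at h
  have h2 := congrArg (fun B => inversionSign (Equiv.swap i i') • genRaw k p m n B) h
  simp only [units_smul_apply, genRaw_arrayAct, smul_smul, inversionSign_mul_self, one_smul] at h2
  exact h2.symm

/-- The action of the linear vector field on the `x`-variables. -/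
lemma sum_x_genRaw_inShift {m n : ℕ} {A : Matrix (Fin m → ι) (Fin (n + 1) → ι) k}
    (hA : IsHomogeneousArray p (m : ZMod 2) A) (hs : IsSkewArray p A) :
    ((n : k) + 1) • ∑ a, ∑ c, D c a • (variableElt k p (Sum.inl a) *
      genRaw k p m n (inShift k p c m n A)) =
      ((-1 : ℤˣ) ^ (m : ZMod 2)) • genRaw k p m (n + 1) (∑ j, inDiff p D j A) := by
  have h1 (a : ι) : ∑ c, D c a • (variableElt k p (Sum.inl a) *
      genRaw k p m n (inShift k p c m n A)) = ((-1 : ℤˣ) ^ (m : ZMod 2)) •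
        (variableElt k p (Sum.inl a) * genRaw k p m n (inShift k p a m n (inDiff p D 0 A))) := by
    rw [← mul_smul_comm, ← units_smul_apply, ← sum_smul_inShift hD hA, map_sum, Finset.mul_sum]
    exact Finset.sum_congr rfl fun c _ => by rw [map_smul, mul_smul_comm]
  rw [Finset.sum_congr rfl fun a _ => h1 a, ← Finset.smul_sum, ← genRaw_succ_in, map_sum,
    Finset.sum_congr rfl fun j _ => genRaw_inDiff hD hs j 0, Finset.sum_const, Finset.card_univ,
    Fintype.card_fin, smul_comm]
  congr 1
  rw [← Nat.cast_smul_eq_nsmul k, Nat.cast_add, Nat.cast_one]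

/-- The action of the linear vector field on the `ψ`-variables. -/
lemma sum_psi_genRaw_outShift {m n : ℕ} {A : Matrix (Fin (m + 1) → ι) (Fin n → ι) k}
    (hA : IsHomogeneousArray p ((m : ZMod 2) + 1) A) (hs : IsSkewArray p A) :
    ((m : k) + 1) • ∑ a, ∑ c, D c a • ((-1 : ℤˣ) ^ p a) • (variableElt k p (Sum.inr c) *
      genRaw k p m n (outShift k p a m n A)) =
      ((-1 : ℤˣ) ^ ((m : ZMod 2) + 1)) • genRaw k p (m + 1) n (∑ i, outDiff p D i A) := by
  have h1 (c : ι) : ∑ a, D c a • ((-1 : ℤˣ) ^ p a) • (variableElt k p (Sum.inr c) *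
      genRaw k p m n (outShift k p a m n A)) = ((-1 : ℤˣ) ^ ((m : ZMod 2) + 1)) •
        (variableElt k p (Sum.inr c) *
          genRaw k p m n (outShift k p c m n (outDiff p D (Fin.last m) A))) := by
    rw [← mul_smul_comm, ← units_smul_apply, ← sum_smul_outShift hD hA, map_sum, Finset.mul_sum]
    exact Finset.sum_congr rfl fun c _ => by
      rw [map_smul, units_smul_apply, mul_smul_comm, mul_smul_comm]
  rw [Finset.sum_comm, Finset.sum_congr rfl fun a _ => h1 a, ← Finset.smul_sum, ← genRaw_succ_out,
    map_sum, Finset.sum_congr rfl fun j _ => genRaw_outDiff hD hs j (Fin.last m), Finset.sum_const,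
    Finset.card_univ, Fintype.card_fin, smul_comm]
  congr 1
  rw [← Nat.cast_smul_eq_nsmul k, Nat.cast_add, Nat.cast_one]

end GenRawDiff

/-! ### Reindexing finitely supported sums -/

section FiniteSums

lemma finsum_fiberwise {I J W : Type*} [AddCommMonoid W] {f : I → W} (hf : f.support.Finite)
    (g : I → J) (t : J → Finset I) (ht : ∀ i j, i ∈ t j ↔ g i = j) :
    ∑ᶠ i, f i = ∑ᶠ j, ∑ i ∈ t j, f i := by
  classical
  rw [finsum_eq_sum_of_support_subset (s := hf.toFinset) _ (by simp),
    finsum_eq_sum_of_support_subset (s := hf.toFinset.image g)]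
  · rw [← Finset.sum_fiberwise_of_maps_to (t := hf.toFinset.image g) (g := g)
      (fun i hi => Finset.mem_image_of_mem g hi)]
    refine Finset.sum_congr rfl fun j _ => ?_
    refine Finset.sum_subset (fun i hi => (ht i j).2 (Finset.mem_filter.1 hi).2) fun i hi hn => ?_
    by_contra h0
    exact hn (Finset.mem_filter.2 ⟨by simpa using h0, (ht i j).1 hi⟩)
  · intro j hj
    obtain ⟨i, hi, h0⟩ := Finset.exists_ne_zero_of_sum_ne_zero hj
    simp only [Finset.coe_image, Set.Finite.coe_toFinset]
    exact ⟨i, h0, (ht i j).1 hi⟩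

lemma finsum_comp_injective {I J W : Type*} [AddCommMonoid W] {f : I → W} {g : J → I}
    (hg : Function.Injective g) (h : ∀ i, i ∉ Set.range g → f i = 0) :
    ∑ᶠ i, f i = ∑ᶠ j, f (g j) := by
  rw [← finsum_mem_range hg]
  refine finsum_congr fun i => ?_
  by_cases hi : i ∈ Set.range g
  · simp [hi]
  · simp [hi, h i hi]

end FiniteSums

/-! ### Locally finite sums of polyvector fields -/

section LocallyFinite

variable {k : Type u} [Field k] {ι : Type w} {p : ι → ZMod 2}

variable (k p) in
/-- Series of order at least `N` in the even variables. -/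
def orderGE (N : ℕ) : Submodule k (Polyvector k p) where
  carrier := {f | ∀ e : EvenVar p →₀ ℕ, e.degree < N → MvPowerSeries.coeff e f = 0}
  zero_mem' _ _ := map_zero _
  add_mem' hf hg e he := by rw [map_add, hf e he, hg e he, add_zero]
  smul_mem' r f hf e he := by rw [polyvector_coeff_smul, hf e he, smul_zero]

lemma orderGE_mono {N N' : ℕ} (h : N ≤ N') : orderGE k p N' ≤ orderGE k p N :=
  fun _ hf e he => hf e (he.trans_le h)

lemma degree_le_of_mem_antidiagonal {σ : Type*} [DecidableEq σ] {e : σ →₀ ℕ}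
    {x : (σ →₀ ℕ) × (σ →₀ ℕ)} (hx : x ∈ Finset.HasAntidiagonal.antidiagonal e) :
    x.1.degree + x.2.degree = e.degree := by
  rw [← Finset.HasAntidiagonal.mem_antidiagonal.1 hx, map_add]

lemma mul_mem_orderGE_left {N : ℕ} {f : Polyvector k p} (hf : f ∈ orderGE k p N)
    (g : Polyvector k p) : f * g ∈ orderGE k p N := by
  classical
  intro e he
  rw [MvPowerSeries.coeff_mul]
  refine Finset.sum_eq_zero fun x hx => ?_
  have := degree_le_of_mem_antidiagonal hx
  rw [hf x.1 (by omega), zero_mul]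

lemma mul_mem_orderGE_right {N : ℕ} {g : Polyvector k p} (hg : g ∈ orderGE k p N)
    (f : Polyvector k p) : f * g ∈ orderGE k p N := by
  classical
  intro e he
  rw [MvPowerSeries.coeff_mul]
  refine Finset.sum_eq_zero fun x hx => ?_
  have := degree_le_of_mem_antidiagonal hx
  rw [hg x.2 (by omega), mul_zero]

lemma derivLin_mem_orderGE {N : ℕ} {f : Polyvector k p} (hf : f ∈ orderGE k p (N + 1))
    (v : ι ⊕ ι) : derivLin k p v f ∈ orderGE k p N := by
  intro e he
  rw [derivLin_apply]
  rcases varParity_cases p v with h | h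
  · rw [coeff_partialDeriv_even h, hf _ (by rw [map_add, Finsupp.degree_single]; omega), zero_mul]
  · rw [coeff_partialDeriv_odd h, hf _ (by omega), map_zero]

/-- Families of series only finitely many members of which are of order less than any given one. -/
def IsLocallyFinite {I : Type*} (F : I → Polyvector k p) : Prop :=
  ∀ N, {i | F i ∉ orderGE k p N}.Finite

/-- The sum of a locally finite family. -/
def lsum {I : Type*} (F : I → Polyvector k p) : Polyvector k p :=
  fun e => ∑ᶠ i, MvPowerSeries.coeff e (F i)

lemma coeff_lsum {I : Type*} (F : I → Polyvector k p) (e : EvenVar p →₀ ℕ) :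
    MvPowerSeries.coeff e (lsum F) = ∑ᶠ i, MvPowerSeries.coeff e (F i) := rfl

namespace IsLocallyFinite

variable {I J : Type*} {F G : I → Polyvector k p} {H : J → Polyvector k p}

lemma support_finite (hF : IsLocallyFinite F) (e : EvenVar p →₀ ℕ) :
    (Function.support fun i => MvPowerSeries.coeff e (F i)).Finite :=
  (hF (e.degree + 1)).subset fun _ hi h => hi (h e (Nat.lt_succ_self _))

lemma add (hF : IsLocallyFinite F) (hG : IsLocallyFinite G) :
    IsLocallyFinite fun i => F i + G i := fun N =>
  ((hF N).union (hG N)).subset fun i hi => by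
    by_contra h
    simp only [Set.mem_union, Set.mem_setOf_eq, not_or, not_not] at h
    exact hi (add_mem h.1 h.2)

lemma sum {s : Finset J} {F : J → I → Polyvector k p} (hF : ∀ j ∈ s, IsLocallyFinite (F j)) :
    IsLocallyFinite fun i => ∑ j ∈ s, F j i := by
  classical
  induction s using Finset.induction_on with
  | empty => intro N; simp
  | insert a s ha ih =>
    simp only [Finset.sum_insert ha]
    exact (hF a (Finset.mem_insert_self _ _)).add
      (ih fun j hj => hF j (Finset.mem_insert_of_mem hj))

lemma lsum_add (hF : IsLocallyFinite F) (hG : IsLocallyFinite G) :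
    lsum (fun i => F i + G i) = lsum F + lsum G := by
  ext e
  rw [map_add]
  simp only [coeff_lsum, map_add]
  exact finsum_add_distrib (hF.support_finite e) (hG.support_finite e)

lemma lsum_sum {s : Finset J} {F : J → I → Polyvector k p}
    (hF : ∀ j ∈ s, IsLocallyFinite (F j)) :
    lsum (fun i => ∑ j ∈ s, F j i) = ∑ j ∈ s, lsum (F j) := by
  classical
  induction s using Finset.induction_on with
  | empty =>
    ext e
    simp [coeff_lsum]
  | insert a s ha ih =>
    simp only [Finset.sum_insert ha]
    rw [lsum_add (hF a (Finset.mem_insert_self _ _))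
      (sum fun j hj => hF j (Finset.mem_insert_of_mem hj)),
      ih fun j hj => hF j (Finset.mem_insert_of_mem hj)]

lemma sub_sum_mem (hF : IsLocallyFinite F) (N : ℕ) :
    lsum F - ∑ i ∈ (hF N).toFinset, F i ∈ orderGE k p N := by
  intro e he
  rw [map_sub, coeff_lsum, finsum_eq_sum_of_support_subset (s := (hF N).toFinset), map_sum, sub_self]
  intro i hi
  simp only [Set.Finite.coe_toFinset, Set.mem_setOf_eq]
  exact fun h => hi (h e he)

/-- At the exponent `e` only the finite part of the sum of order below `e.degree + 2` matters,
because the remainder keeps order at least `e.degree + 1` after applying `O`. -/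
lemma map_lsum (hF : IsLocallyFinite F) {O : Polyvector k p →ₗ[k] Polyvector k p}
    (hO : ∀ N, ∀ f ∈ orderGE k p (N + 1), O f ∈ orderGE k p N) :
    O (lsum F) = lsum fun i => O (F i) := by
  ext e
  set N := e.degree + 1
  have h := hO N _ (hF.sub_sum_mem (N + 1)) e (Nat.lt_succ_self _)
  rw [map_sub, map_sub, sub_eq_zero] at h
  rw [h, map_sum, map_sum, coeff_lsum,
    finsum_eq_sum_of_support_subset (s := (hF (N + 1)).toFinset)]
  intro i hi
  simp only [Set.Finite.coe_toFinset, Set.mem_setOf_eq]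
  exact fun h => hi (hO N _ h e (Nat.lt_succ_self _))

lemma mul (hF : IsLocallyFinite F) (hH : IsLocallyFinite H) :
    IsLocallyFinite fun x : I × J => F x.1 * H x.2 := fun N =>
  ((hF N).prod (hH N)).subset fun x hx => by
    by_contra h
    simp only [Set.mem_prod, Set.mem_setOf_eq, not_and_or, not_not] at h
    rcases h with h | h
    · exact hx (mul_mem_orderGE_left h _)
    · exact hx (mul_mem_orderGE_right h _)

/-- Multiplication by a fixed series does not lower orders, so it commutes with the sums in both
factors. -/
lemma lsum_mul_lsum (hF : IsLocallyFinite F) (hH : IsLocallyFinite H) :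
    lsum F * lsum H = lsum fun x : I × J => F x.1 * H x.2 := by
  have h1 : lsum F * lsum H = lsum fun i => F i * lsum H :=
    hF.map_lsum (O := LinearMap.mulRight k (lsum H)) fun N f hf =>
      mul_mem_orderGE_left (orderGE_mono (Nat.le_succ N) hf) _
  have h2 (i : I) : F i * lsum H = lsum fun j => F i * H j :=
    hH.map_lsum (O := LinearMap.mulLeft k (F i)) fun N f hf =>
      mul_mem_orderGE_right (orderGE_mono (Nat.le_succ N) hf) _
  rw [h1]
  simp only [h2]
  ext e
  rw [coeff_lsum, coeff_lsum, finsum_curry _ ((hF.mul hH).support_finite e)]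
  rfl

/-- The product of two sums over bidegrees, by bidegree. -/
lemma lsum_mul_antidiagonal {F H : ℕ × ℕ → Polyvector k p} (hF : IsLocallyFinite F)
    (hH : IsLocallyFinite H) : lsum F * lsum H = lsum fun mn : ℕ × ℕ =>
      ∑ ab ∈ Finset.HasAntidiagonal.antidiagonal mn.1,
        ∑ lr ∈ Finset.HasAntidiagonal.antidiagonal mn.2, F (ab.1, lr.1) * H (ab.2, lr.2) := by
  rw [hF.lsum_mul_lsum hH]
  ext e
  rw [coeff_lsum, coeff_lsum, finsum_fiberwise ((hF.mul hH).support_finite e)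
    (fun x => (x.1.1 + x.2.1, x.1.2 + x.2.2))
    (fun mn => (Finset.HasAntidiagonal.antidiagonal mn.1 ×ˢ
      Finset.HasAntidiagonal.antidiagonal mn.2).map
      ⟨fun y => ((y.1.1, y.2.1), (y.1.2, y.2.2)), fun y z h => by
        simp only [Prod.mk.injEq] at h
        ext <;> simp [h]⟩)]
  · refine finsum_congr fun mn => ?_
    rw [Finset.sum_map, Finset.sum_product, map_sum]
    refine Finset.sum_congr rfl fun ab _ => ?_
    rw [map_sum]
    rfl
  · rintro ⟨⟨a, l⟩, ⟨b, r⟩⟩ ⟨m, n⟩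
    simp only [Finset.mem_map, Finset.mem_product, Finset.HasAntidiagonal.mem_antidiagonal,
      Prod.mk.injEq]
    constructor
    · rintro ⟨y, ⟨h1, h2⟩, h⟩
      replace h : ((y.1.1, y.2.1), (y.1.2, y.2.2)) = ((a, l), (b, r)) := h
      simp only [Prod.mk.injEq] at h
      rw [← h1, ← h2, h.1.1, h.1.2, h.2.1, h.2.2]
      exact ⟨rfl, rfl⟩
    · rintro ⟨rfl, rfl⟩
      exact ⟨((a, b), (l, r)), ⟨rfl, rfl⟩, rfl⟩

end IsLocallyFinite

lemma lsum_succ_fst {F : ℕ × ℕ → Polyvector k p} (h : ∀ n, F (0, n) = 0) :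
    lsum F = lsum fun mn : ℕ × ℕ => F (mn.1 + 1, mn.2) := by
  ext e
  rw [coeff_lsum, coeff_lsum]
  refine finsum_comp_injective (g := fun mn : ℕ × ℕ => (mn.1 + 1, mn.2)) (fun x y h => ?_) ?_
  · simp only [Prod.mk.injEq, Nat.add_right_cancel_iff] at h
    exact Prod.ext h.1 h.2
  · rintro ⟨m, n⟩ hmn
    cases m with
    | zero => rw [h, map_zero]
    | succ m => exact (hmn ⟨(m, n), rfl⟩).elim

lemma lsum_succ_snd {F : ℕ × ℕ → Polyvector k p} (h : ∀ m, F (m, 0) = 0) :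
    lsum F = lsum fun mn : ℕ × ℕ => F (mn.1, mn.2 + 1) := by
  ext e
  rw [coeff_lsum, coeff_lsum]
  refine finsum_comp_injective (g := fun mn : ℕ × ℕ => (mn.1, mn.2 + 1)) (fun x y h => ?_) ?_
  · simp only [Prod.mk.injEq, Nat.add_right_cancel_iff] at h
    exact Prod.ext h.1 h.2
  · rintro ⟨m, n⟩ hmn
    cases n with
    | zero => rw [h, map_zero]
    | succ n => exact (hmn ⟨(m, n), rfl⟩).elim

/-- Series all of whose terms are of total degree `L` in the even and odd variables. -/
def IsTotalDegree (L : ℕ) (f : Polyvector k p) : Prop :=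
  ∀ e : EvenVar p →₀ ℕ, MvPowerSeries.coeff e f ∈
    if e.degree ≤ L then (LinearMap.range (ExteriorAlgebra.ι k (M := OddVar p →₀ k))) ^ (L - e.degree)
    else ⊥

lemma isTotalDegree_one : IsTotalDegree 0 (1 : Polyvector k p) := by
  classical
  intro e
  rw [MvPowerSeries.coeff_one]
  by_cases he : e = 0
  · rw [if_pos he, he, map_zero, if_pos le_rfl, Nat.sub_zero, pow_zero]
    exact Submodule.one_le.1 le_rfl
  · rw [if_neg he]; exact zero_mem _

lemma isTotalDegree_variableElt (v : ι ⊕ ι) : IsTotalDegree 1 (variableElt k p v) := by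
  classical
  intro e
  rcases varParity_cases p v with h | h
  · rw [variableElt_even h, MvPowerSeries.coeff_X]
    by_cases h1 : e = Finsupp.single ⟨v, h⟩ 1
    · rw [if_pos h1, h1, Finsupp.degree_single, if_pos le_rfl, Nat.sub_self, pow_zero]
      exact Submodule.one_le.1 le_rfl
    · rw [if_neg h1]; exact zero_mem _
  · rw [variableElt_odd h, MvPowerSeries.coeff_C]
    by_cases he : e = 0
    · rw [if_pos he, he, map_zero, if_pos (Nat.zero_le _), Nat.sub_zero, pow_one]
      exact LinearMap.mem_range_self _ _
    · rw [if_neg he]; exact zero_mem _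

lemma IsTotalDegree.mul {L L' : ℕ} {f g : Polyvector k p} (hf : IsTotalDegree L f)
    (hg : IsTotalDegree L' g) : IsTotalDegree (L + L') (f * g) := by
  classical
  intro e
  rw [MvPowerSeries.coeff_mul]
  refine sum_mem fun x hx => ?_
  have h := degree_le_of_mem_antidiagonal hx
  have h1 := hf x.1
  have h2 := hg x.2
  split_ifs at h1 with h3
  · split_ifs at h2 with h4
    · rw [if_pos (by omega)]
      have : L + L' - e.degree = (L - x.1.degree) + (L' - x.2.degree) := by omega
      rw [this, pow_add]
      exact Submodule.mul_mem_mul h1 h2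
    · rw [(Submodule.mem_bot k).1 h2, mul_zero]; exact zero_mem _
  · rw [(Submodule.mem_bot k).1 h1, zero_mul]; exact zero_mem _

lemma isTotalDegree_list_prod (l : List (ι ⊕ ι)) :
    IsTotalDegree l.length (l.map (variableElt k p)).prod := by
  induction l with
  | nil => exact isTotalDegree_one
  | cons a l ih =>
    rw [List.map_cons, List.prod_cons, List.length_cons, add_comm]
    exact (isTotalDegree_variableElt a).mul ih

lemma isTotalDegree_word {m n : ℕ} (α : Fin m → ι) (β : Fin n → ι) :
    IsTotalDegree (m + n) (xWord k p β * psiWord k p α) := by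
  have h1 := isTotalDegree_list_prod (k := k) (p := p) (List.ofFn fun l => Sum.inl (β l))
  have h2 := isTotalDegree_list_prod (k := k) (p := p) (List.ofFn fun l => Sum.inr (α l)).reverse
  rw [List.map_ofFn, List.length_ofFn] at h1
  rw [List.map_reverse, List.length_reverse, List.map_ofFn, List.length_ofFn] at h2
  rw [add_comm]
  exact h1.mul h2

variable [Fintype ι]

/-- There are finitely many odd variables, and exterior powers beyond their number vanish. High
total degree therefore forces high degree in the even variables. -/
lemma IsTotalDegree.mem_orderGE {L N : ℕ} {f : Polyvector k p} (hf : IsTotalDegree L f)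
    (h : N + Module.finrank k (OddVar p →₀ k) ≤ L) : f ∈ orderGE k p N := by
  intro e he
  have h1 := hf e
  rw [if_pos (by omega)] at h1
  have h2 : (LinearMap.range (ExteriorAlgebra.ι k (M := OddVar p →₀ k))) ^ (L - e.degree) = ⊥ := by
    have h3 := exteriorPower.finrank_eq (R := k) (M := OddVar p →₀ k) (n := L - e.degree)
    rw [Nat.choose_eq_zero_of_lt (by omega)] at h3
    exact Submodule.finrank_eq_zero.1 h3
  rw [h2] at h1
  exact (Submodule.mem_bot k).1 h1

lemma genRaw_mem_orderGE {m n N : ℕ} (A : Matrix (Fin m → ι) (Fin n → ι) k)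
    (h : N + Module.finrank k (OddVar p →₀ k) ≤ m + n) : genRaw k p m n A ∈ orderGE k p N := by
  refine sum_mem fun α _ => sum_mem fun β _ => ?_
  rw [Units.smul_def]
  exact zsmul_mem (Submodule.smul_mem _ _ ((isTotalDegree_word α β).mem_orderGE h)) _

end LocallyFinite

/-! ### Generating series of families: derivatives, Laplacian and bracket -/

section GenSeries

variable {k : Type u} [Field k] {ι : Type w} {p : ι → ZMod 2} [Fintype ι]

variable (k p) in
/-- The generating function of an array. -/
def gen (m n : ℕ) : Matrix (Fin m → ι) (Fin n → ι) k →ₗ[k] Polyvector k p :=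
  ((m.factorial : k) * n.factorial)⁻¹ • genRaw k p m n

lemma gen_apply {m n : ℕ} (A : Matrix (Fin m → ι) (Fin n → ι) k) :
    gen k p m n A = ((m.factorial : k) * n.factorial)⁻¹ • genRaw k p m n A := rfl

/-- The generating function of a family of arrays. -/
def genSeries (p : ι → ZMod 2) (r : ∀ m n, Matrix (Fin m → ι) (Fin n → ι) k) : Polyvector k p :=
  lsum fun mn : ℕ × ℕ => gen k p mn.1 mn.2 (r mn.1 mn.2)

/-- Once m or n reaches N plus the number of odd variables, the term has order at least N, so only a
finite square of bidegrees remains. -/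
lemma isLocallyFinite_gen (r : ∀ m n, Matrix (Fin m → ι) (Fin n → ι) k) :
    IsLocallyFinite fun mn : ℕ × ℕ => gen k p mn.1 mn.2 (r mn.1 mn.2) := by
  intro N
  refine ((Set.finite_Iio (N + Module.finrank k (OddVar p →₀ k))).prod
    (Set.finite_Iio (N + Module.finrank k (OddVar p →₀ k)))).subset ?_
  rintro ⟨m, n⟩ h
  by_contra h'
  simp only [Set.mem_prod, Set.mem_Iio, not_and_or, not_lt] at h'
  exact h (Submodule.smul_mem _ _ (genRaw_mem_orderGE _ (by omega)))

lemma genSeries_add (r s : ∀ m n, Matrix (Fin m → ι) (Fin n → ι) k) :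
    genSeries p (fun m n => r m n + s m n) = genSeries p r + genSeries p s := by
  simp only [genSeries, map_add]
  exact (isLocallyFinite_gen r).lsum_add (isLocallyFinite_gen s)

lemma genSeries_sum {J : Type*} (t : Finset J) (r : J → ∀ m n, Matrix (Fin m → ι) (Fin n → ι) k) :
    genSeries p (fun m n => ∑ j ∈ t, r j m n) = ∑ j ∈ t, genSeries p (r j) := by
  simp only [genSeries, map_sum]
  exact IsLocallyFinite.lsum_sum fun j _ => isLocallyFinite_gen (r j)

variable [CharZero k]

/-- The m + 1 equal contributions cancel against the factorial (m + 1)!. -/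
lemma derivLin_psi_gen (a : ι) {m n : ℕ} {A : Matrix (Fin (m + 1) → ι) (Fin n → ι) k}
    (hA : IsSkewArray p A) : derivLin k p (Sum.inr a) (gen k p (m + 1) n A) =
      gen k p m n (outShift k p a m n A) := by
  rw [gen_apply, gen_apply, map_smul, derivLin_psi_genRaw a hA, smul_smul]
  congr 1
  have h1 : ((m : k) + 1) ≠ 0 := Nat.cast_add_one_ne_zero m
  have h2 : (m.factorial : k) ≠ 0 := by exact_mod_cast m.factorial_ne_zero
  have h3 : (n.factorial : k) ≠ 0 := by exact_mod_cast n.factorial_ne_zero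
  rw [Nat.factorial_succ, Nat.cast_mul, Nat.cast_add, Nat.cast_one]
  field_simp

lemma derivLin_x_gen (a : ι) {m n : ℕ} {A : Matrix (Fin m → ι) (Fin (n + 1) → ι) k}
    (hA : IsSkewArray p A) : derivLin k p (Sum.inl a) (gen k p m (n + 1) A) =
      gen k p m n (inShift k p a m n A) := by
  rw [gen_apply, gen_apply, map_smul, derivLin_x_genRaw a hA, smul_smul]
  congr 1
  have h1 : ((n : k) + 1) ≠ 0 := Nat.cast_add_one_ne_zero n
  have h2 : (m.factorial : k) ≠ 0 := by exact_mod_cast m.factorial_ne_zero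
  have h3 : (n.factorial : k) ≠ 0 := by exact_mod_cast n.factorial_ne_zero
  rw [Nat.factorial_succ, Nat.cast_mul, Nat.cast_add, Nat.cast_one]
  field_simp

lemma derivLin_psi_genSeries (a : ι) {r : ∀ m n, Matrix (Fin m → ι) (Fin n → ι) k}
    (hr : ∀ m n, IsSkewArray p (r m n)) : derivLin k p (Sum.inr a) (genSeries p r) =
      genSeries p fun m n => outShift k p a m n (r (m + 1) n) := by
  rw [genSeries, (isLocallyFinite_gen r).map_lsum fun N f hf => derivLin_mem_orderGE hf _,
    lsum_succ_fst fun n => by rw [gen_apply, map_smul, derivLin_psi_genRaw_zero, smul_zero]]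
  simp only [derivLin_psi_gen a (hr _ _)]
  rfl

lemma derivLin_x_genSeries (a : ι) {r : ∀ m n, Matrix (Fin m → ι) (Fin n → ι) k}
    (hr : ∀ m n, IsSkewArray p (r m n)) : derivLin k p (Sum.inl a) (genSeries p r) =
      genSeries p fun m n => inShift k p a m n (r m (n + 1)) := by
  rw [genSeries, (isLocallyFinite_gen r).map_lsum fun N f hf => derivLin_mem_orderGE hf _,
    lsum_succ_snd fun n => by rw [gen_apply, map_smul, derivLin_x_genRaw_zero, smul_zero]]
  simp only [derivLin_x_gen a (hr _ _)]
  rfl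

omit [CharZero k] in
lemma isOfParity_genRaw {m n : ℕ} {q : ZMod 2} {A : Matrix (Fin m → ι) (Fin n → ι) k}
    (hA : IsHomogeneousArray p q A) : IsOfParity (q + m) (genRaw k p m n A) := by
  rw [IsOfParity, genRaw_apply, map_sum, Finset.smul_sum]
  refine Finset.sum_congr rfl fun α _ => ?_
  rw [map_sum, Finset.smul_sum]
  refine Finset.sum_congr rfl fun β _ => ?_
  have h0 (ε : ℤˣ) (f : Polyvector k p) : parityHom k p (ε • f) = ε • parityHom k p f :=
    units_smul_apply (parityHom k p).toLinearMap ε f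
  rw [h0, map_smul, (isOfParity_xWord β).mul (isOfParity_psiWord α), smul_comm _ (A α β),
    smul_comm _ (A α β), smul_comm _ (A α β)]
  by_cases hA0 : A α β = 0
  · rw [hA0, zero_smul, zero_smul]
  congr 1
  rw [smul_comm]
  refine units_pow_smul_congr ?_ rfl
  rw [← hA α β hA0, Finset.sum_add_distrib]
  simp only [Finset.sum_const, Finset.card_univ, Fintype.card_fin, nsmul_eq_mul, mul_one]
  ring

omit [CharZero k] in
lemma parityHom_genSeries {r : ∀ m n, Matrix (Fin m → ι) (Fin n → ι) k}
    (hr : ∀ m n : ℕ, IsHomogeneousArray p ((m : ℕ) : ZMod 2) (r m n)) :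
    parityHom k p (genSeries p r) = genSeries p r := by
  have h := (isLocallyFinite_gen (p := p) r).map_lsum (O := (parityHom k p).toLinearMap)
    fun N f hf e he => by
      rw [AlgHom.toLinearMap_apply, coeff_parityHom, hf e (by omega), map_zero]
  refine Eq.trans h (congrArg lsum (funext fun mn => ?_))
  rw [gen_apply, map_smul]
  have h2 := isOfParity_genRaw (hr mn.1 mn.2)
  rw [IsOfParity, ZMod.two_add_self, uzpow_zero, one_smul] at h2
  exact congrArg _ h2

omit [Fintype ι] [CharZero k] in
lemma isOfParity_derivLin {f : Polyvector k p} (hf : parityHom k p f = f) (v : ι ⊕ ι) :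
    IsOfParity (varParity p v) (derivLin k p v f) := by
  have h := derivLin_parityHom v f
  rw [hf] at h
  rw [IsOfParity, h, smul_smul, ← uzpow_add, ZMod.two_add_self, uzpow_zero, one_smul, ← h]

omit [CharZero k] in
/-- The odd bracket with an even series. -/
lemma oddBracket_of_even {f : Polyvector k p} (hf : parityHom k p f = f) (g : Polyvector k p) :
    oddBracket f g = ∑ a, (derivLin k p (Sum.inr a) f * derivLin k p (Sum.inl a) g +
      derivLin k p (Sum.inl a) f * derivLin k p (Sum.inr a) g) := by
  have h1 (v : ι ⊕ ι) (g : Polyvector k p) :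
      derivLin k p v (f * g) = derivLin k p v f * g + f * derivLin k p v g := by
    rw [derivLin_mul, hf, ite_self]
  have h2 (a : ι) : derivLin k p (Sum.inl a) (derivLin k p (Sum.inr a) (f * g)) =
      derivLin k p (Sum.inl a) (derivLin k p (Sum.inr a) f) * g +
      derivLin k p (Sum.inr a) f * derivLin k p (Sum.inl a) g +
      (derivLin k p (Sum.inl a) f * derivLin k p (Sum.inr a) g +
      f * derivLin k p (Sum.inl a) (derivLin k p (Sum.inr a) g)) := by
    rw [h1, map_add, h1, derivLin_mul]
    congr 3
    -- If x^a is odd, then ψ_a is even and so is the ψ_a-derivative of the even `f`. In either case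
    -- the Leibniz sign is trivial.
    rcases varParity_cases p (Sum.inl a) with h | h
    · rw [if_pos h]
    · rw [if_neg (by rw [h]; decide), isOfParity_derivLin hf]
      have : varParity p (Sum.inr a) = 0 := by
        have h3 : varParity p (Sum.inr a) = varParity p (Sum.inl a) + 1 := rfl
        rw [h3, h]; rfl
      rw [this, uzpow_zero, one_smul]
  have h3 (g : Polyvector k p) : oddLaplacian g =
    ∑ a, derivLin k p (Sum.inl a) (derivLin k p (Sum.inr a) g) := rfl
  rw [oddBracket, ← parityHom_apply, hf, h3, h3, h3, Finset.sum_congr rfl fun a _ => h2 a]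
  simp only [Finset.sum_add_distrib, Finset.sum_mul, Finset.mul_sum]
  abel

/-- One of x^a and ψ_a is even, so one of the two derivatives of the even `f` is even, hence
central. The two halves of the bracket therefore coincide. -/
lemma half_oddBracket {f : Polyvector k p} (hf : parityHom k p f = f) :
    (1 / 2 : k) • oddBracket f f =
      ∑ a, derivLin k p (Sum.inr a) f * derivLin k p (Sum.inl a) f := by
  have h1 (a : ι) : derivLin k p (Sum.inl a) f * derivLin k p (Sum.inr a) f =
      derivLin k p (Sum.inr a) f * derivLin k p (Sum.inl a) f := by
    have hx := isOfParity_derivLin hf (Sum.inl a)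
    have hy := isOfParity_derivLin hf (Sum.inr a)
    have h3 : varParity p (Sum.inr a) = varParity p (Sum.inl a) + 1 := rfl
    rcases varParity_cases p (Sum.inl a) with h | h
    · rw [IsOfParity, h, uzpow_zero, one_smul] at hx
      exact mul_comm_of_even hx _
    · have h4 : (1 : ZMod 2) + 1 = 0 := rfl
      rw [IsOfParity, h3, h, h4, uzpow_zero, one_smul] at hy
      exact (mul_comm_of_even hy _).symm
  rw [oddBracket_of_even hf, Finset.smul_sum]
  refine Finset.sum_congr rfl fun a _ => ?_
  rw [h1, ← two_smul k, smul_smul]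
  norm_num

lemma oddLaplacian_genSeries [DecidableEq ι] {r : ∀ m n, Matrix (Fin m → ι) (Fin n → ι) k}
    (hs : ∀ m n, IsSkewArray p (r m n))
    (hr : ∀ m n : ℕ, IsHomogeneousArray p ((m : ℕ) : ZMod 2) (r m n)) :
    oddLaplacian (genSeries p r) = genSeries p fun m n =>
      ((-1 : ℤˣ) ^ ((m : ZMod 2) + 1)) • arrayContract k p (Fin.last m) 0 (r (m + 1) (n + 1)) := by
  have h1 (a : ι) : partialDeriv (Sum.inl a) (partialDeriv (Sum.inr a) (genSeries p r)) =
      genSeries p fun m n => inShift k p a m n (outShift k p a m (n + 1) (r (m + 1) (n + 1))) := by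
    rw [← derivLin_apply, ← derivLin_apply, derivLin_psi_genSeries a hs,
      derivLin_x_genSeries a fun m n => (hs _ _).outShift a]
  rw [oddLaplacian, Finset.sum_congr rfl fun a _ => h1 a, ← genSeries_sum]
  congr 1
  funext m n
  have := hr (m + 1) (n + 1)
  rw [Nat.cast_add, Nat.cast_one] at this
  exact sum_inShift_outShift this

omit [Fintype ι] [CharZero k] in
lemma isLocallyFinite_antidiagonal {F H : ℕ × ℕ → Polyvector k p} (hF : IsLocallyFinite F)
    (hH : IsLocallyFinite H) : IsLocallyFinite fun mn : ℕ × ℕ =>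
      ∑ ab ∈ Finset.HasAntidiagonal.antidiagonal mn.1,
        ∑ lr ∈ Finset.HasAntidiagonal.antidiagonal mn.2, F (ab.1, lr.1) * H (ab.2, lr.2) := by
  intro N
  refine (((hF.mul hH) N).image fun x => (x.1.1 + x.2.1, x.1.2 + x.2.2)).subset ?_
  rintro ⟨m, n⟩ hmn
  by_contra hc
  refine hmn (sum_mem fun ab hab => sum_mem fun lr hlr => ?_)
  by_contra h
  refine hc ⟨((ab.1, lr.1), (ab.2, lr.2)), h, ?_⟩
  exact Prod.ext (Finset.HasAntidiagonal.mem_antidiagonal.1 hab)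
    (Finset.HasAntidiagonal.mem_antidiagonal.1 hlr)

/-- The product of the two derivatives is a Cauchy product over bidegrees, matching the
decompositions of outputs and inputs in the corolla differential. -/
lemma half_oddBracket_genSeries {r : ∀ m n, Matrix (Fin m → ι) (Fin n → ι) k}
    (hs : ∀ m n, IsSkewArray p (r m n))
    (hr : ∀ m n : ℕ, IsHomogeneousArray p ((m : ℕ) : ZMod 2) (r m n)) :
    (1 / 2 : k) • oddBracket (genSeries p r) (genSeries p r) = lsum fun mn : ℕ × ℕ =>
      ∑ ab ∈ Finset.HasAntidiagonal.antidiagonal mn.1,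
        ∑ lr ∈ Finset.HasAntidiagonal.antidiagonal mn.2, ∑ γ,
          gen k p ab.1 lr.1 (outShift k p γ ab.1 lr.1 (r (ab.1 + 1) lr.1)) *
            gen k p ab.2 lr.2 (inShift k p γ ab.2 lr.2 (r ab.2 (lr.2 + 1))) := by
  have h1 (γ : ι) := (isLocallyFinite_gen (p := p)
    (fun m n => outShift k p γ m n (r (m + 1) n))).lsum_mul_antidiagonal
      (isLocallyFinite_gen (p := p) (fun m n => inShift k p γ m n (r m (n + 1))))
  rw [half_oddBracket (parityHom_genSeries hr)]
  simp only [derivLin_psi_genSeries _ hs, derivLin_x_genSeries _ hs]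
  simp only [genSeries, h1]
  ext e
  rw [map_sum]
  simp only [coeff_lsum]
  rw [← finsum_sum_comm]
  · refine finsum_congr fun mn => ?_
    rw [← map_sum]
    congr 1
    rw [Finset.sum_comm]
    exact Finset.sum_congr rfl fun ab _ => Finset.sum_comm
  · intro γ _
    exact (isLocallyFinite_antidiagonal (isLocallyFinite_gen (p := p)
      (fun m n => outShift k p γ m n (r (m + 1) n)))
      (isLocallyFinite_gen (p := p) (fun m n => inShift k p γ m n (r m (n + 1))))).support_finite e

end GenSeries

/-! ### The bracket with the linear vector field -/

section VectorField

variable {k : Type u} [Field k] {ι : Type w} {p : ι → ZMod 2} [Fintype ι] [DecidableEq ι]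
  {M : Type v} [AddCommGroup M] [Module k M] {b : Module.Basis ι k M} {d₀ : M →ₗ[k] M}

variable (hD : ∀ a c, LinearMap.toMatrix b b d₀ c a ≠ 0 → p c = p a + 1)
include hD

lemma parityHom_linearVectorField :
    parityHom k p (linearVectorField b p d₀) = linearVectorField b p d₀ := by
  rw [linearVectorField, map_sum]
  refine Finset.sum_congr rfl fun a _ => ?_
  rw [map_sum]
  refine Finset.sum_congr rfl fun c _ => ?_
  have h0 (ε : ℤˣ) (f : Polyvector k p) : parityHom k p (ε • f) = ε • parityHom k p f :=
    units_smul_apply (parityHom k p).toLinearMap ε f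
  rw [h0, map_smul]
  by_cases h : LinearMap.toMatrix b b d₀ c a = 0
  · rw [h, zero_smul, zero_smul]
  have h1 := (isOfParity_variableElt (k := k) (p := p) (Sum.inl a)).mul
    (isOfParity_variableElt (Sum.inr c))
  have h2 : varParity p (Sum.inl a) + varParity p (Sum.inr c) = 0 := by
    have h3 : ∀ x : ZMod 2, x + (x + 1 + 1) = 0 := by decide
    rw [varParity, Sum.elim_inl, Sum.elim_inr, hD a c h, h3]
  rw [h2, IsOfParity, uzpow_zero, one_smul] at h1
  rw [h1]

lemma derivLin_psi_linearVectorField (c : ι) :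
    derivLin k p (Sum.inr c) (linearVectorField b p d₀) =
      ∑ a, LinearMap.toMatrix b b d₀ c a • variableElt k p (Sum.inl a) := by
  rw [linearVectorField, map_sum]
  refine Finset.sum_congr rfl fun a _ => ?_
  simp only [map_sum, units_smul_apply, map_smul]
  rw [Finset.sum_eq_single c]
  · by_cases h : LinearMap.toMatrix b b d₀ c a = 0
    · rw [h]; simp
    rw [derivLin_variableElt_mul, if_neg (by simp), derivLin_variableElt, if_pos rfl, mul_one,
      zero_add, smul_comm, smul_smul, ← uzpow_add]
    have h3 : ∀ x : ZMod 2, x + (x + 1 + 1) * x = 0 := by decide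
    rw [varParity, Sum.elim_inl, Sum.elim_inr, hD a c h, h3, uzpow_zero, one_smul]
  · intro c' _ h
    rw [derivLin_variableElt_mul, if_neg (by simp), derivLin_variableElt,
      if_neg (fun h' => h (Sum.inr.inj h').symm)]
    simp
  · simp

omit hD in
lemma derivLin_x_linearVectorField (a : ι) :
    derivLin k p (Sum.inl a) (linearVectorField b p d₀) =
      ∑ c, LinearMap.toMatrix b b d₀ c a • ((-1 : ℤˣ) ^ p a) • variableElt k p (Sum.inr c) := by
  rw [linearVectorField, map_sum, Finset.sum_eq_single a]
  · simp only [map_sum, units_smul_apply, map_smul]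
    refine Finset.sum_congr rfl fun c _ => ?_
    rw [derivLin_variableElt_mul, if_pos rfl, derivLin_variableElt, if_neg (by simp), mul_zero,
      smul_zero, add_zero, smul_comm]
  · intro a' _ h
    simp only [map_sum, units_smul_apply, map_smul]
    refine Finset.sum_eq_zero fun c _ => ?_
    rw [derivLin_variableElt_mul, if_neg (fun h' => h (Sum.inl.inj h').symm), derivLin_variableElt,
      if_neg (by simp), mul_zero, smul_zero, add_zero, smul_zero, smul_zero]
  · simp

variable (p) in
omit hD in
/-- The bracket with the linear vector field, as a differential operator of the first order. -/
def linearFieldOperator (B : Matrix ι ι k) : Polyvector k p →ₗ[k] Polyvector k p :=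
  (∑ a, ∑ c, B c a • (LinearMap.mulLeft k (variableElt k p (Sum.inl a)) ∘ₗ
      derivLin k p (Sum.inl c))) +
    ∑ a, ∑ c, B c a • ((-1 : ℤˣ) ^ p a) •
      (LinearMap.mulLeft k (variableElt k p (Sum.inr c)) ∘ₗ derivLin k p (Sum.inr a))

omit hD in
lemma linearFieldOperator_apply (B : Matrix ι ι k) (f : Polyvector k p) :
    linearFieldOperator p B f =
      (∑ a, ∑ c, B c a • (variableElt k p (Sum.inl a) * derivLin k p (Sum.inl c) f)) +
      ∑ a, ∑ c, B c a • ((-1 : ℤˣ) ^ p a) •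
        (variableElt k p (Sum.inr c) * derivLin k p (Sum.inr a) f) := by
  simp only [linearFieldOperator, LinearMap.add_apply, LinearMap.sum_apply, LinearMap.smul_apply,
    units_smul_linearMap_apply, LinearMap.comp_apply, LinearMap.mulLeft_apply]

lemma oddBracket_linearVectorField (f : Polyvector k p) :
    oddBracket (linearVectorField b p d₀) f = linearFieldOperator p (LinearMap.toMatrix b b d₀) f := by
  rw [oddBracket_of_even (parityHom_linearVectorField hD), Finset.sum_add_distrib,
    linearFieldOperator_apply]
  simp only [derivLin_psi_linearVectorField hD, derivLin_x_linearVectorField, Finset.sum_mul,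
    smul_mul_assoc]
  rw [Finset.sum_comm]

omit hD in
lemma linearFieldOperator_mem_orderGE (B : Matrix ι ι k) (N : ℕ) (f : Polyvector k p)
    (hf : f ∈ orderGE k p (N + 1)) : linearFieldOperator p B f ∈ orderGE k p N := by
  rw [linearFieldOperator_apply]
  refine add_mem (sum_mem fun a _ => sum_mem fun c _ => ?_) (sum_mem fun a _ => sum_mem fun c _ => ?_)
  · exact Submodule.smul_mem _ _ (mul_mem_orderGE_right (derivLin_mem_orderGE hf _) _)
  · rw [Units.smul_def]
    exact Submodule.smul_mem _ _ (zsmul_mem (mul_mem_orderGE_right (derivLin_mem_orderGE hf _) _) _)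

variable [CharZero k]

/-- The x-derivatives let `D` act on one input and the ψ-derivatives on one output. The number of
equal contributions turns one leg into the sum over all legs. -/
lemma linearFieldOperator_gen {m n : ℕ} {A : Matrix (Fin m → ι) (Fin n → ι) k}
    (hA : IsHomogeneousArray p (m : ZMod 2) A) (hs : IsSkewArray p A) :
    linearFieldOperator p (LinearMap.toMatrix b b d₀) (gen k p m n A) =
      gen k p m n (((-1 : ℤˣ) ^ (m : ZMod 2)) • arrayDiff p (LinearMap.toMatrix b b d₀) m n A) := by
  have hx : ∑ a, ∑ c, LinearMap.toMatrix b b d₀ c a • (variableElt k p (Sum.inl a) *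
      derivLin k p (Sum.inl c) (genRaw k p m n A)) =
      ((-1 : ℤˣ) ^ (m : ZMod 2)) • genRaw k p m n (∑ j, inDiff p (LinearMap.toMatrix b b d₀) j A) := by
    cases n with
    | zero => simp [derivLin_x_genRaw_zero]
    | succ n =>
      rw [← sum_x_genRaw_inShift hD hA hs, Finset.smul_sum]
      simp only [derivLin_x_genRaw _ hs, Finset.smul_sum, mul_smul_comm]
      exact Finset.sum_congr rfl fun a _ => Finset.sum_congr rfl fun c _ => smul_comm _ _ _
  have hpsi : ∑ a, ∑ c, LinearMap.toMatrix b b d₀ c a • ((-1 : ℤˣ) ^ p a) • (variableElt k p (Sum.inr c) *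
      derivLin k p (Sum.inr a) (genRaw k p m n A)) =
      ((-1 : ℤˣ) ^ (m : ZMod 2)) • genRaw k p m n (∑ i, outDiff p (LinearMap.toMatrix b b d₀) i A) := by
    cases m with
    | zero => simp [derivLin_psi_genRaw_zero]
    | succ m =>
      rw [Nat.cast_add, Nat.cast_one] at hA ⊢
      rw [← sum_psi_genRaw_outShift hD hA hs, Finset.smul_sum]
      simp only [derivLin_psi_genRaw _ hs, Finset.smul_sum, mul_smul_comm]
      refine Finset.sum_congr rfl fun a _ => Finset.sum_congr rfl fun c _ => ?_
      rw [smul_comm (_ : ℤˣ) (_ : k), smul_comm]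
  rw [gen_apply, map_smul, linearFieldOperator_apply, hx, hpsi, ← smul_add, ← map_add, gen_apply,
    units_smul_apply, arrayDiff_apply, add_comm]

lemma oddBracket_linearVectorField_genSeries {r : ∀ m n, Matrix (Fin m → ι) (Fin n → ι) k}
    (hs : ∀ m n, IsSkewArray p (r m n))
    (hr : ∀ m n : ℕ, IsHomogeneousArray p ((m : ℕ) : ZMod 2) (r m n)) :
    oddBracket (linearVectorField b p d₀) (genSeries p r) =
      genSeries p fun m n => ((-1 : ℤˣ) ^ (m : ZMod 2)) • arrayDiff p (LinearMap.toMatrix b b d₀) m n (r m n) := by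
  rw [oddBracket_linearVectorField hD, genSeries,
    (isLocallyFinite_gen r).map_lsum (linearFieldOperator_mem_orderGE _)]
  simp only [linearFieldOperator_gen hD (hr _ _) (hs _ _)]
  rfl

end VectorField

/-! ### The master equation for generating series -/

section MasterEquation

variable {k : Type u} [Field k] [CharZero k] {ι : Type w} {p : ι → ZMod 2} [Fintype ι]
  [DecidableEq ι] {M : Type v} [AddCommGroup M] [Module k M] {b : Module.Basis ι k M}

omit [CharZero k] in
-- The cyclic rotation carrying the first output to the last preserves the order of the others and
-- has sign (-1)^m. The corolla differential uses the first output, the Laplacian of the generating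
-- function the last.
lemma arrayContract_zero_zero {m n : ℕ} {A : Matrix (Fin (m + 1) → ι) (Fin (n + 1) → ι) k}
    (hs : IsSkewArray p A) : arrayContract k p 0 0 A =
      ((-1 : ℤˣ) ^ (m : ZMod 2)) • arrayContract k p (Fin.last m) 0 A := by
  set σ : Fin (m + 1) ≃ Fin (m + 1) := (finRotate (m + 1)).symm with hσ
  have h0 : σ 0 = Fin.last m := by rw [hσ, Equiv.symm_apply_eq, finRotate_last]
  have h1 (x : Fin m) : σ ((0 : Fin (m + 1)).succAbove x) = (σ 0).succAbove (Equiv.refl _ x) := by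
    rw [h0, Fin.succAbove_last, Fin.zero_succAbove, hσ, Equiv.symm_apply_eq, Equiv.refl_apply,
      finRotate_succ_apply, Fin.coeSucc_eq_succ]
  have h2 := arrayContract_arrayAct (k := k) (p := p) σ (Equiv.refl (Fin (n + 1))) (Equiv.refl (Fin m))
    (Equiv.refl (Fin n)) 0 0 h1 (fun _ => rfl) A
  rw [hs, arrayAct_refl, h0, units_smul_apply, inversionSign_succAbove σ (Equiv.refl _) 0 h1,
    inversionSign_refl, h0] at h2
  rw [← h2]
  simp only [Fin.val_zero, pow_zero, one_mul, Fin.val_last]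
  exact congrArg (· • _) (uzpow_natCast _ m).symm

omit [CharZero k] [Fintype ι] [DecidableEq ι] in
-- Used to infer the local finiteness of the graft terms from that of the whole corolla differential
-- and of its loop terms.
lemma IsLocallyFinite.congr_sub {I : Type*} {F G H : I → Polyvector k p} (hF : IsLocallyFinite F)
    (hH : IsLocallyFinite H) (h : ∀ i, F i = G i + H i) : IsLocallyFinite G := fun N =>
  ((hF N).union (hH N)).subset fun i hi => by
    by_contra hc
    simp only [Set.mem_union, Set.mem_setOf_eq, not_or, not_not] at hc
    exact hi (by rw [← add_sub_cancel_right (G i) (H i), ← h]; exact sub_mem hc.1 hc.2)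

namespace WheeledPropData

lemma IsCorollaFamily.isSkewArray {c : ∀ m n, (endWheeledProp b p).carrier m n}
    (hc : (endWheeledProp b p).IsCorollaFamily c) (m n : ℕ) :
    IsSkewArray p (endCoeff p b m n (c m n)) := by
  intro σ τ
  rw [← endCoeff_act, hc.act, ← inversionSign_perm, Units.smul_def, map_zsmul, Units.smul_def]

/-- The generating function is a coinvariant functional, so `coinvariant_corollaDifferential`
removes the shuffles. The sign from `genRaw_arrayGraft` cancels the prescribed sign of the graph and
the prefactor. -/
lemma gen_corollaDifferential {c : ∀ m n, (endWheeledProp b p).carrier m n}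
    (hc : (endWheeledProp b p).IsCorollaFamily c) (m n : ℕ) :
    gen k p m n (((-1 : ℤˣ) ^ ((m : ZMod 2) + 1)) •
        endCoeff p b m n ((endWheeledProp b p).corollaDifferential c m n)) =
      (∑ ab ∈ Finset.HasAntidiagonal.antidiagonal m, ∑ lr ∈ Finset.HasAntidiagonal.antidiagonal n,
        ∑ γ, gen k p ab.1 lr.1 (outShift k p γ ab.1 lr.1 (endCoeff p b _ _ (c (ab.1 + 1) lr.1))) *
            gen k p ab.2 lr.2 (inShift k p γ ab.2 lr.2 (endCoeff p b _ _ (c ab.2 (lr.2 + 1))))) +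
      gen k p m n (((-1 : ℤˣ) ^ ((m : ZMod 2) + 1)) •
        arrayContract k p (Fin.last m) 0 (endCoeff p b _ _ (c (m + 1) (n + 1)))) := by
  have hφ : IsCoinvariant (P := endWheeledProp b p)
      (fun m n => genRaw k p m n ∘ₗ (endCoeff p b m n).toLinearMap) := by
    intro m n m' n' σ τ f
    show genRaw k p m' n' (endCoeff p b m' n' _) = _
    rw [endCoeff_act, genRaw_arrayAct]
    rfl
  have h := (endWheeledProp_isWheeledProp p b).coinvariant_corollaDifferential hφ hc m n
  simp only [LinearMap.comp_apply, LinearEquiv.coe_coe] at h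
  rw [units_smul_apply, gen_apply, h, smul_add, Finset.smul_sum]
  refine congrArg₂ _ ?_ ?_
  · refine Finset.sum_congr rfl fun ab hab => ?_
    rw [Finset.smul_sum]
    refine Finset.sum_congr rfl fun lr _ => ?_
    have h1 := mem_endGr p b |>.1 (hc.mem (ab.1 + 1) lr.1)
    have h2 := mem_endGr p b |>.1 (hc.mem ab.2 (lr.2 + 1))
    rw [Nat.cast_add, Nat.cast_one] at h1
    rw [graft, endCoeff_contract, endCoeff_act, endCoeff_hcomp, genRaw_arrayGraft h1 h2]
    simp only [gen_apply, smul_mul_smul_comm]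
    rw [← Finset.smul_sum, smul_comm (_ : ℤˣ) (_ : k)]
    have h5 : ((ab.1.factorial : k) * ab.2.factorial * (lr.1.factorial * lr.2.factorial))⁻¹ =
        ((ab.1.factorial : k) * lr.1.factorial)⁻¹ * ((ab.2.factorial : k) * lr.2.factorial)⁻¹ := by
      rw [← mul_inv]; congr 1; ring
    have h6 : (-1 : ℤˣ) ^ (ab.1 * ab.2) = (-1 : ℤˣ) ^ ((ab.1 : ZMod 2) * ab.2) := by
      rw [← Nat.cast_mul, uzpow_natCast]
    rw [h5, h6, smul_smul, smul_smul, ← uzpow_add, ← uzpow_add,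
      ← Finset.HasAntidiagonal.mem_antidiagonal.1 hab, Nat.cast_add]
    rw [ZMod.two_add_self, uzpow_zero, one_smul]
  · rw [endCoeff_contract, arrayContract_zero_zero (hc.isSkewArray _ _), units_smul_apply,
      units_smul_apply, gen_apply, uzpow_natCast, smul_smul ((-1 : ℤˣ) ^ m), ← mul_pow, neg_one_mul,
      neg_neg, one_pow, one_smul]

/-- The left hand side of the master equation for the generating function of a corolla family. -/
lemma master_genSeries {d₀ : M →ₗ[k] M}
    (hD : ∀ a c, LinearMap.toMatrix b b d₀ c a ≠ 0 → p c = p a + 1)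
    {c : ∀ m n, (endWheeledProp b p).carrier m n}
    (hc : (endWheeledProp b p).IsCorollaFamily c) :
    oddBracket (linearVectorField b p d₀) (genSeries p fun m n => endCoeff p b m n (c m n)) +
      oddLaplacian (genSeries p fun m n => endCoeff p b m n (c m n)) +
      (1 / 2 : k) • oddBracket (genSeries p fun m n => endCoeff p b m n (c m n))
        (genSeries p fun m n => endCoeff p b m n (c m n)) =
      genSeries p fun m n => ((-1 : ℤˣ) ^ (m : ZMod 2)) • endCoeff p b m n
        (endDiff p b d₀ m n (c m n) - (endWheeledProp b p).corollaDifferential c m n) := by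
  have hs := hc.isSkewArray
  have hr (m n : ℕ) := mem_endGr p b |>.1 (hc.mem m n)
  have h1 (m n : ℕ) : ((-1 : ℤˣ) ^ (m : ZMod 2)) • endCoeff p b m n
        (endDiff p b d₀ m n (c m n) - (endWheeledProp b p).corollaDifferential c m n) =
      ((-1 : ℤˣ) ^ (m : ZMod 2)) •
        arrayDiff p (LinearMap.toMatrix b b d₀) m n (endCoeff p b m n (c m n)) +
      ((-1 : ℤˣ) ^ ((m : ZMod 2) + 1)) •
        endCoeff p b m n ((endWheeledProp b p).corollaDifferential c m n) := by
    rw [map_sub, endCoeff_endDiff, smul_sub, uzpow_add, uzpow_one, mul_neg_one, Units.neg_smul,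
      sub_eq_add_neg]
  simp only [h1]
  rw [genSeries_add, oddBracket_linearVectorField_genSeries hD hs hr, add_assoc]
  congr 1
  rw [oddLaplacian_genSeries hs hr, half_oddBracket_genSeries hs hr, add_comm, genSeries, genSeries,
    ← IsLocallyFinite.lsum_add]
  · exact congrArg lsum (funext fun mn => (gen_corollaDifferential hc mn.1 mn.2).symm)
  · refine IsLocallyFinite.congr_sub (isLocallyFinite_gen (p := p) fun m n =>
      ((-1 : ℤˣ) ^ ((m : ZMod 2) + 1)) •
        endCoeff p b m n ((endWheeledProp b p).corollaDifferential c m n))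
      (isLocallyFinite_gen (p := p) fun m n => ((-1 : ℤˣ) ^ ((m : ZMod 2) + 1)) •
        arrayContract k p (Fin.last m) 0 (endCoeff p b _ _ (c (m + 1) (n + 1)))) fun mn => ?_
    exact gen_corollaDifferential hc mn.1 mn.2
  · exact isLocallyFinite_gen (p := p) fun m n => ((-1 : ℤˣ) ^ ((m : ZMod 2) + 1)) •
        arrayContract k p (Fin.last m) 0 (endCoeff p b _ _ (c (m + 1) (n + 1)))

end WheeledPropData

end MasterEquation

/-! ### Polyvector fields are detected by the constant terms of their derivatives -/

section Nondegenerate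

variable {k : Type u} [Field k] {ι : Type w} {p : ι → ZMod 2}

open CliffordAlgebra in
/-- An element of an exterior algebra annihilated by all the contractions with the coordinates is a
scalar. -/
lemma exterior_eq_algebraMap {J : Type*} [Finite J] {x : ExteriorAlgebra k (J →₀ k)}
    (hx : ∀ j : J, contractLeft (Finsupp.lapply j : (J →₀ k) →ₗ[k] k) x = 0) :
    x = algebraMap k _ (ExteriorAlgebra.algebraMapInv x) := by
  classical
  -- `π j` kills the j-th coordinate. On the exterior algebra it subtracts the generator e_j times
  -- the contraction with the j-th coordinate, so it fixes every element annihilated by that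
  -- contraction.
  let π (j : J) : (J →₀ k) →ₗ[k] (J →₀ k) :=
    LinearMap.id - Finsupp.lsingle j ∘ₗ Finsupp.lapply j
  have hπ (j : J) (y : ExteriorAlgebra k (J →₀ k)) : ExteriorAlgebra.map (π j) y =
      y - ExteriorAlgebra.ι k (Finsupp.single j 1) * contractLeft (Finsupp.lapply j) y := by
    induction y using CliffordAlgebra.left_induction with
    | algebraMap r => rw [AlgHom.commutes, contractLeft_algebraMap, mul_zero, sub_zero]
    | add y z hy hz => rw [map_add, hy, hz, map_add, mul_add]; abel
    | ι_mul y w hy =>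
      have h1 : ExteriorAlgebra.ι k (π j w) =
          ExteriorAlgebra.ι k w - w j • ExteriorAlgebra.ι k (Finsupp.single j 1) := by
        rw [← map_smul, ← map_sub, Finsupp.smul_single_one]; rfl
      have h2 := ExteriorAlgebra.ι_add_mul_swap (R := k) (Finsupp.single j 1) w
      have h3 := ExteriorAlgebra.ι_sq_zero (R := k) (Finsupp.single j (1 : k))
      rw [map_mul, hy, contractLeft_ι_mul]
      change ExteriorAlgebra.map (π j) (ExteriorAlgebra.ι k w) * _ = ExteriorAlgebra.ι k w * y - _ *
        (w j • y - ExteriorAlgebra.ι k w * _)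
      rw [ExteriorAlgebra.map_apply_ι, h1, sub_mul, mul_sub, mul_sub, mul_sub, smul_mul_assoc,
        smul_mul_assoc, ← mul_assoc _ _ (contractLeft _ y), ← mul_assoc _ _ (contractLeft _ y),
        ← mul_assoc _ _ (contractLeft _ y), h3, eq_neg_of_add_eq_zero_left h2, mul_smul_comm]
      simp
      abel
  -- Composing the projections over all coordinates gives the zero map of the vector space, which
  -- still fixes `x`. The map it induces on the exterior algebra has only scalars as values.
  have hs (s : Set J) (hs : s.Finite) : ∃ f : (J →₀ k) →ₗ[k] (J →₀ k),
      ExteriorAlgebra.map f x = x ∧ ∀ w, ∀ j ∈ s, f w j = 0 := by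
    induction s, hs using Set.Finite.induction_on with
    | empty => exact ⟨LinearMap.id, by rw [ExteriorAlgebra.map_id]; rfl, by simp⟩
    | @insert j s _ _ ih =>
      obtain ⟨f, hf, hs⟩ := ih
      refine ⟨π j ∘ₗ f, ?_, fun w i hi => ?_⟩
      · rw [← ExteriorAlgebra.map_comp_map, AlgHom.comp_apply, hf, hπ, hx, mul_zero, sub_zero]
      · show f w i - Finsupp.single j (f w j) i = 0
        rcases Set.mem_insert_iff.1 hi with rfl | hi
        · rw [Finsupp.single_eq_same, sub_self]
        · by_cases hij : j = i
          · rw [hij, Finsupp.single_eq_same, sub_self]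
          · rw [Finsupp.single_eq_of_ne' hij, hs w i hi, sub_zero]
  obtain ⟨f, hf, h0⟩ := hs Set.univ Set.finite_univ
  obtain rfl : f = 0 := LinearMap.ext fun w => Finsupp.ext fun j => h0 w j (Set.mem_univ j)
  rw [← hf]
  have h : ExteriorAlgebra.map (0 : (J →₀ k) →ₗ[k] (J →₀ k)) =
      (Algebra.ofId k _).comp ExteriorAlgebra.algebraMapInv := by
    refine ExteriorAlgebra.hom_ext (LinearMap.ext fun w => ?_)
    show ExteriorAlgebra.map 0 (ExteriorAlgebra.ι k w) =
      algebraMap k _ (ExteriorAlgebra.algebraMapInv (ExteriorAlgebra.ι k w))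
    simp [ExteriorAlgebra.algebraMapInv]
  rw [h]
  simp [Algebra.ofId_apply]

open CliffordAlgebra in
-- Induction on the set of coordinates whose contraction with x may be nonzero. Contraction with j
-- yields an element of K that j itself annihilates as well, hence zero by induction; thus j may be
-- dropped.
lemma exterior_eq_zero_of_contractLeft_mem {J : Type*} [Finite J]
    {K : Set (ExteriorAlgebra k (J →₀ k))}
    (hd : ∀ x ∈ K, ∀ j : J, contractLeft (Finsupp.lapply j : (J →₀ k) →ₗ[k] k) x ∈ K)
    (hc : ∀ x ∈ K, ExteriorAlgebra.algebraMapInv x = 0) {x : ExteriorAlgebra k (J →₀ k)}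
    (hx : x ∈ K) : x = 0 := by
  have h (s : Set J) (hs : s.Finite) : ∀ x ∈ K,
      (∀ j ∉ s, contractLeft (Finsupp.lapply j : (J →₀ k) →ₗ[k] k) x = 0) → x = 0 := by
    induction s, hs using Set.Finite.induction_on with
    | empty =>
      intro x hx h
      rw [exterior_eq_algebraMap fun j => h j (Set.notMem_empty j), hc x hx, map_zero]
    | @insert j s _ _ ih =>
      intro x hx h
      have h1 : contractLeft (Finsupp.lapply j : (J →₀ k) →ₗ[k] k) x = 0 := by
        refine ih _ (hd x hx j) fun i hi => ?_
        by_cases hij : i = j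
        · rw [hij, contractLeft_contractLeft]
        · rw [contractLeft_comm, h i (by simp [hij, hi]), map_zero, neg_zero]
      refine ih x hx fun i hi => ?_
      by_cases hij : i = j
      · rw [hij, h1]
      · exact h i (by simp [hij, hi])
  exact h Set.univ Set.finite_univ x hx fun j hj => absurd (Set.mem_univ j) hj

variable (k p) in
/-- The constant term. -/
def counit : Polyvector k p →+* k :=
  (ExteriorAlgebra.algebraMapInv (R := k) (M := OddVar p →₀ k)).toRingHom.comp
    MvPowerSeries.constantCoeff

lemma counit_apply (f : Polyvector k p) :
    counit k p f = ExteriorAlgebra.algebraMapInv (MvPowerSeries.coeff 0 f) := rfl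

lemma counit_smul (r : k) (f : Polyvector k p) : counit k p (r • f) = r * counit k p f := by
  rw [counit_apply, polyvector_coeff_smul, map_smul, counit_apply, smul_eq_mul]

lemma counit_units_smul (ε : ℤˣ) (f : Polyvector k p) : counit k p (ε • f) = ε • counit k p f := by
  rw [Units.smul_def, Units.smul_def, map_zsmul]

lemma counit_variableElt (v : ι ⊕ ι) : counit k p (variableElt k p v) = 0 := by
  classical
  rw [counit_apply]
  rcases varParity_cases p v with h | h
  · rw [variableElt_even h, MvPowerSeries.coeff_zero_X, map_zero]
  · rw [variableElt_odd h, MvPowerSeries.coeff_C, if_pos rfl]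
    simp [ExteriorAlgebra.algebraMapInv]

lemma counit_parityHom (f : Polyvector k p) : counit k p (parityHom k p f) = counit k p f := by
  rw [counit_apply, coeff_parityHom, counit_apply]
  have : (ExteriorAlgebra.algebraMapInv (R := k) (M := OddVar p →₀ k)).comp
      (CliffordAlgebra.involute) = ExteriorAlgebra.algebraMapInv := by
    refine CliffordAlgebra.hom_ext (LinearMap.ext fun w => ?_)
    show ExteriorAlgebra.algebraMapInv (CliffordAlgebra.involute (CliffordAlgebra.ι _ w)) =
      ExteriorAlgebra.algebraMapInv (ExteriorAlgebra.ι k w)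
    rw [CliffordAlgebra.involute_ι, map_neg]
    show - ExteriorAlgebra.algebraMapInv (ExteriorAlgebra.ι k w) = _
    simp [ExteriorAlgebra.algebraMapInv]
  exact DFunLike.congr_fun this _

/-- A set of polyvector fields without constant terms which is stable under the partial
derivatives contains at most the zero field. -/
lemma eq_zero_of_derivLin_mem [CharZero k] [Finite ι] {K : Set (Polyvector k p)}
    (hd : ∀ f ∈ K, ∀ v, derivLin k p v f ∈ K) (hc : ∀ f ∈ K, counit k p f = 0)
    {f : Polyvector k p} (hf : f ∈ K) : f = 0 := by
  have h0 (N : ℕ) : ∀ f ∈ K, ∀ e : EvenVar p →₀ ℕ, e.degree = N →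
      MvPowerSeries.coeff e f = 0 := by
    induction N with
    | zero =>
      intro f hf e he
      obtain rfl : e = 0 := (Finsupp.degree_eq_zero_iff e).1 he
      -- Odd derivatives act on coefficients as contractions, so the coefficients at exponent zero
      -- form a set of the kind required.
      refine exterior_eq_zero_of_contractLeft_mem (K := MvPowerSeries.coeff 0 '' K) ?_ ?_ ⟨f, hf, rfl⟩
      · rintro _ ⟨f, hf, rfl⟩ j
        exact ⟨_, hd f hf j, coeff_partialDeriv_odd j.2 f 0⟩
      · rintro _ ⟨f, hf, rfl⟩
        exact hc f hf
    | succ N ih =>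
      intro f hf e he
      obtain ⟨v, hv⟩ : ∃ v, e v ≠ 0 := by
        by_contra! h
        rw [Finsupp.ext h (g := 0)] at he
        simp at he
      obtain ⟨e', rfl⟩ : ∃ e', e = e' + Finsupp.single v 1 :=
        ⟨e - Finsupp.single v 1, (tsub_add_cancel_of_le (by simpa [Nat.one_le_iff_ne_zero] using hv)).symm⟩
      have h1 := ih _ (hd f hf v) e' (by simpa using he)
      rw [derivLin_apply, coeff_partialDeriv_even v.2] at h1
      have h2 : (((e' v : ℕ) : ExteriorAlgebra k (OddVar p →₀ k)) + 1) =
          algebraMap k _ ((e' v : k) + 1) := by rw [map_add, map_natCast, map_one]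
      -- The even derivative multiplies the coefficient by an exponent plus one, which
      -- characteristic 0 permits to cancel.
      rw [Subtype.coe_eta, h2, ← Algebra.commutes, ← Algebra.smul_def] at h1
      exact (smul_eq_zero.1 h1).resolve_left (Nat.cast_add_one_ne_zero _)
  ext e
  rw [h0 _ f hf e rfl, map_zero]

end Nondegenerate

/-! ### Taylor coefficients -/

section Taylor

variable {k : Type u} [Field k] {ι : Type w} {p : ι → ZMod 2}

lemma eq_of_outShift_eq {m n : ℕ} {A B : Matrix (Fin (m + 1) → ι) (Fin n → ι) k}
    (h : ∀ a, outShift k p a m n A = outShift k p a m n B) : A = B := by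
  ext α β
  have h1 := congrFun (congrFun (h (α (Fin.last m))) (Fin.init α)) β
  rwa [outShift_apply, outShift_apply, Fin.snoc_init_self, smul_left_cancel_iff] at h1

lemma eq_of_inShift_eq {m n : ℕ} {A B : Matrix (Fin m → ι) (Fin (n + 1) → ι) k}
    (h : ∀ a, inShift k p a m n A = inShift k p a m n B) : A = B := by
  ext α β
  have h1 := congrFun (congrFun (h (β 0)) α) (Fin.tail β)
  rwa [inShift_apply, inShift_apply, Fin.cons_self_tail, smul_left_cancel_iff] at h1

variable (k p) in
/-- The product of the partial derivatives with respect to the `ψ_{αₛ}`. -/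
def psiDeriv {m : ℕ} (α : Fin m → ι) : Module.End k (Polyvector k p) :=
  (List.ofFn fun s => derivLin k p (Sum.inr (α s))).prod

variable (k p) in
/-- The product, in the reverse order, of the partial derivatives with respect to the `x^{βₗ}`. -/
def xDeriv {n : ℕ} (β : Fin n → ι) : Module.End k (Polyvector k p) :=
  (List.ofFn fun l => derivLin k p (Sum.inl (β l))).reverse.prod

lemma derivLin_mul_derivLin (v w : ι ⊕ ι) : (derivLin k p v : Module.End k (Polyvector k p)) *
    derivLin k p w =
      ((-1 : ℤˣ) ^ (varParity p v * varParity p w)) • (derivLin k p w * derivLin k p v) :=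
  LinearMap.ext fun f => (derivLin_comm v w f).trans (units_smul_linearMap_apply _ _ _).symm

lemma psiDeriv_comp {m m' : ℕ} (σ : Fin m ≃ Fin m') (α : Fin m' → ι) : psiDeriv k p (α ∘ σ) =
    ((-1 : ℤˣ) ^ koszulExp σ (fun i => p (α (σ i)) + 1)) • psiDeriv k p α :=
  prod_ofFn_comp_equiv σ (fun s => (derivLin k p (Sum.inr (α s)) : Module.End k (Polyvector k p)))
    (fun s => p (α s) + 1) fun _ _ => derivLin_mul_derivLin _ _

lemma xDeriv_eq_unop {n : ℕ} (β : Fin n → ι) : xDeriv k p β = MulOpposite.unop (List.ofFn fun l =>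
    MulOpposite.op (derivLin k p (Sum.inl (β l)) : Module.End k (Polyvector k p))).prod := by
  rw [MulOpposite.unop_list_prod, List.map_ofFn]
  rfl

lemma xDeriv_comp {n n' : ℕ} (τ : Fin n ≃ Fin n') (β : Fin n' → ι) : xDeriv k p (β ∘ τ) =
    ((-1 : ℤˣ) ^ koszulExp τ (fun i => p (β (τ i)))) • xDeriv k p β := by
  rw [xDeriv_eq_unop, xDeriv_eq_unop]
  have := prod_ofFn_comp_equiv τ (fun l =>
    MulOpposite.op (derivLin k p (Sum.inl (β l)) : Module.End k (Polyvector k p)))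
    (fun l => p (β l)) fun i j => by
      rw [← MulOpposite.op_mul, derivLin_mul_derivLin (Sum.inl (β j)), ← MulOpposite.op_mul,
        mul_comm]
      rfl
  exact congrArg MulOpposite.unop this

lemma psiDeriv_snoc {m : ℕ} (α : Fin m → ι) (a : ι) :
    psiDeriv k p (Fin.snoc α a : Fin (m + 1) → ι) =
      psiDeriv k p α * derivLin k p (Sum.inr a) := by
  rw [psiDeriv, List.ofFn_succ']
  simp [psiDeriv]

lemma xDeriv_cons {n : ℕ} (a : ι) (β : Fin n → ι) :
    xDeriv k p (Fin.cons a β : Fin (n + 1) → ι) = xDeriv k p β * derivLin k p (Sum.inl a) := by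
  simp [xDeriv, List.ofFn_succ]

lemma derivLin_xDeriv (v : ι ⊕ ι) {n : ℕ} (β : Fin n → ι) (f : Polyvector k p) :
    derivLin k p v (xDeriv k p β f) =
      ((-1 : ℤˣ) ^ (varParity p v * ∑ l, p (β l))) • xDeriv k p β (derivLin k p v f) := by
  induction n generalizing f with
  | zero => simp [xDeriv]
  | succ n ih =>
    have h1 (g : Polyvector k p) : xDeriv k p β g =
        xDeriv k p (Fin.tail β) (derivLin k p (Sum.inl (β 0)) g) := by
      rw [← Fin.cons_self_tail β, xDeriv_cons]; rfl
    rw [h1, h1, ih, derivLin_comm, units_smul_apply, smul_smul, ← uzpow_add, Fin.sum_univ_succ,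
      add_comm, mul_add]
    rfl

lemma parityHom_derivWord {m n : ℕ} (α : Fin m → ι) (β : Fin n → ι) {f : Polyvector k p}
    (hf : parityHom k p f = f) :
    IsOfParity ((∑ s, (p (α s) + 1)) + ∑ l, p (β l)) (psiDeriv k p α (xDeriv k p β f)) := by
  have h (l : List (ι ⊕ ι)) : IsOfParity (l.map (varParity p)).sum
      ((l.map fun v => (derivLin k p v : Module.End k (Polyvector k p))).prod f) := by
    induction l with
    | nil => rw [IsOfParity]; simpa using hf
    | cons v l ih =>
      have h1 := derivLin_parityHom v
        ((l.map fun v => (derivLin k p v : Module.End k (Polyvector k p))).prod f)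
      rw [ih, units_smul_apply] at h1
      rw [List.map_cons, List.map_cons, List.sum_cons, List.prod_cons, IsOfParity, uzpow_add,
        mul_smul, Module.End.mul_apply, h1, smul_smul, ← uzpow_add, ZMod.two_add_self, uzpow_zero,
        one_smul]
  have h1 := h ((List.ofFn fun s => Sum.inr (α s)) ++ (List.ofFn fun l => Sum.inl (β l)).reverse)
  simp only [List.map_append, List.map_reverse, List.map_ofFn, List.sum_append, List.sum_reverse,
    List.sum_ofFn, List.prod_append] at h1
  exact h1

/-- The array of the Taylor coefficients of a polyvector field in the bidegree `(m, n)`. -/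
def taylor (m n : ℕ) (f : Polyvector k p) : Matrix (Fin m → ι) (Fin n → ι) k :=
  Matrix.of fun α β => ((-1 : ℤˣ) ^ genExp p α β) • counit k p (psiDeriv k p α (xDeriv k p β f))

lemma taylor_apply {m n : ℕ} (f : Polyvector k p) (α : Fin m → ι) (β : Fin n → ι) :
    taylor m n f α β =
      ((-1 : ℤˣ) ^ genExp p α β) • counit k p (psiDeriv k p α (xDeriv k p β f)) := rfl

lemma taylor_sub {m n : ℕ} (f g : Polyvector k p) :
    taylor m n (f - g) = taylor m n f - taylor m n g := by
  ext α β
  rw [Matrix.sub_apply, taylor_apply, map_sub, map_sub, map_sub, smul_sub]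
  rfl

/-- Passing to a derivative shifts the Taylor array in the same way as `derivLin_psi_genSeries`
shifts a family. This permits induction on the bidegree. -/
lemma outShift_taylor (a : ι) (m n : ℕ) (f : Polyvector k p) :
    outShift k p a m n (taylor (m + 1) n f) = taylor m n (derivLin k p (Sum.inr a) f) := by
  ext α β
  rw [outShift_apply, taylor_apply, taylor_apply, psiDeriv_snoc, Module.End.mul_apply,
    derivLin_xDeriv, units_smul_apply, counit_units_smul, smul_smul, smul_smul, ← uzpow_add,
    ← uzpow_add, genExp_snoc]
  refine units_pow_smul_congr ?_ rfl
  have h : varParity p (Sum.inr a) = p a + 1 := rfl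
  rw [h]
  generalize (p a + 1) * ∑ l, p (β l) = x
  generalize ∑ s, p (α s) = y
  generalize genExp p α β = z
  revert x y z
  decide

lemma inShift_taylor (a : ι) (m n : ℕ) (f : Polyvector k p) :
    inShift k p a m n (taylor m (n + 1) f) = taylor m n (derivLin k p (Sum.inl a) f) := by
  ext α β
  rw [inShift_apply, taylor_apply, taylor_apply, xDeriv_cons, Module.End.mul_apply, smul_smul,
    ← uzpow_add, genExp_cons, add_left_comm, ZMod.two_add_self, add_zero]

lemma isSkewArray_taylor (m n : ℕ) (f : Polyvector k p) : IsSkewArray p (taylor m n f) := by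
  rw [isSkewArray_iff]
  intro σ τ α β
  rw [taylor_apply, taylor_apply, psiDeriv_comp, xDeriv_comp, units_smul_linearMap_apply,
    units_smul_linearMap_apply, units_smul_apply, counit_units_smul, counit_units_smul]
  simp only [smul_smul, ← uzpow_add]
  exact units_pow_smul_congr (by linear_combination genExp_comp (p := p) σ τ α β) rfl

/-- An entry of the wrong parity is the constant term of an odd element. It equals its own negative,
hence is zero. -/
lemma taylor_homogeneous [CharZero k] (m n : ℕ) {f : Polyvector k p} (hf : parityHom k p f = f) :
    IsHomogeneousArray p (m : ZMod 2) (taylor m n f) := by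
  intro α β h
  by_contra h'
  apply h
  have h2 : (∑ s, (p (α s) + 1)) + ∑ l, p (β l) = 1 := by
    rw [Finset.sum_add_distrib]
    simp only [Finset.sum_const, Finset.card_univ, Fintype.card_fin, nsmul_eq_mul, mul_one]
    generalize ∑ s, p (α s) = x at h'
    generalize ∑ l, p (β l) = y at h'
    generalize (m : ZMod 2) = z at h'
    revert x y z
    decide
  have h1 := parityHom_derivWord α β hf
  rw [h2, IsOfParity, uzpow_one, Units.neg_smul, one_smul] at h1
  have h3 := counit_parityHom (psiDeriv k p α (xDeriv k p β f))
  rw [h1, map_neg, neg_eq_self] at h3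
  rw [taylor_apply, h3, smul_zero]

end Taylor

/-! ### Generating series and Taylor coefficients are mutually inverse -/

section TaylorSeries

variable {k : Type u} [Field k] [CharZero k] {ι : Type w} {p : ι → ZMod 2} [Fintype ι]
  [DecidableEq ι]

lemma counit_genSeries (r : ∀ m n, Matrix (Fin m → ι) (Fin n → ι) k) :
    counit k p (genSeries p r) = r 0 0 Fin.elim0 Fin.elim0 := by
  have h (mn : ℕ × ℕ) (hmn : mn ≠ 0) : counit k p (gen k p mn.1 mn.2 (r mn.1 mn.2)) = 0 := by
    obtain ⟨m, n⟩ := mn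
    rw [gen_apply, counit_smul]
    cases m with
    | succ m => simp [genRaw_succ_out, counit_variableElt]
    | zero =>
      cases n with
      | succ n => simp [genRaw_succ_in, counit_variableElt]
      | zero => exact absurd rfl hmn
  rw [counit_apply, genSeries, coeff_lsum, ← AlgHom.coe_toLinearMap, ← LinearMap.toAddMonoidHom_coe,
    AddMonoidHom.map_finsum _ ((isLocallyFinite_gen r).support_finite 0)]
  refine (finsum_eq_single _ 0 h).trans ?_
  show counit k p (gen k p 0 0 (r 0 0)) = _
  rw [gen_apply, genRaw_zero_zero, counit_smul, counit_smul, map_one]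
  simp

/-- The Taylor coefficients of the generating function of a family of arrays. -/
theorem taylor_genSeries (m n : ℕ) {r : ∀ m n, Matrix (Fin m → ι) (Fin n → ι) k}
    (hr : ∀ m n, IsSkewArray p (r m n)) : taylor m n (genSeries p r) = r m n := by
  induction m generalizing r with
  | succ m ih =>
    refine eq_of_outShift_eq (p := p) fun a => ?_
    rw [outShift_taylor, derivLin_psi_genSeries a hr, ih fun m n => (hr _ _).outShift a]
  | zero =>
    induction n generalizing r with
    | succ n ih =>
      refine eq_of_inShift_eq (p := p) fun a => ?_
      rw [inShift_taylor, derivLin_x_genSeries a hr, ih fun m n => (hr _ _).inShift a]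
    | zero =>
      ext α β
      rw [Subsingleton.elim α Fin.elim0, Subsingleton.elim β Fin.elim0]
      refine Eq.trans ?_ (counit_genSeries (p := p) r)
      simp [taylor_apply, genExp, psiDeriv, xDeriv]

/-- Fields all of whose Taylor coefficients vanish are stable under derivatives and have no constant
term. -/
lemma eq_of_taylor_eq {f g : Polyvector k p} (h : ∀ m n, taylor m n f = taylor m n g) : f = g := by
  rw [← sub_eq_zero]
  refine eq_zero_of_derivLin_mem (K := {f | ∀ m n, taylor m n f = 0}) ?_ ?_ fun m n => by
    rw [taylor_sub, h, sub_self]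
  · rintro f hf (a | a) m n
    · rw [← inShift_taylor, hf, map_zero]
    · rw [← outShift_taylor, hf, map_zero]
  · intro f hf
    have h1 := congrFun (congrFun (hf 0 0) Fin.elim0) Fin.elim0
    simpa [taylor_apply, genExp, psiDeriv, xDeriv] using h1

theorem genSeries_taylor (f : Polyvector k p) : genSeries p (fun m n => taylor m n f) = f :=
  eq_of_taylor_eq fun m n => taylor_genSeries m n fun m n => isSkewArray_taylor m n f

end TaylorSeries

/-! ### Representations and master functions -/

section Representations

variable {k : Type u} [Field k] [CharZero k] {ι : Type w} {p : ι → ZMod 2} [Fintype ι]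
  [DecidableEq ι] {M : Type v} [AddCommGroup M] [Module k M] {b : Module.Basis ι k M}

omit [CharZero k] in
lemma generatingFunction_eq (R : ∀ m n, (endWheeledProp b p).carrier m n) :
    generatingFunction b p R = genSeries p fun m n => endCoeff p b m n (R m n) := by
  have h (m n : ℕ) : generatingTerm b p m n (R m n) = gen k p m n (endCoeff p b m n (R m n)) := by
    rw [gen_apply, ← one_div, genRaw_apply]
    rfl
  ext e
  exact finsum_congr fun mn => congrArg (MvPowerSeries.coeff e) (h mn.1 mn.2)

namespace WheeledPropData

/-- The corolla family of the Taylor coefficients of an even polyvector field. -/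
lemma isCorollaFamily_taylor {S : Polyvector k p} (hS : parityHom k p S = S) :
    (endWheeledProp b p).IsCorollaFamily fun m n => (endCoeff p b m n).symm (taylor m n S) where
  mem m n := by
    rw [mem_endGr, LinearEquiv.apply_symm_apply]
    exact taylor_homogeneous m n hS
  act m n σ τ := by
    apply (endCoeff p b m n).injective
    rw [endCoeff_act, LinearEquiv.apply_symm_apply, isSkewArray_taylor, inversionSign_perm,
      Units.smul_def, Units.smul_def, map_zsmul, LinearEquiv.apply_symm_apply]

/-- The master equation says that the differential of the endomorphism wheeled PROP takes the
prescribed values on the family of operations. -/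
theorem isMasterFunction_iff {d₀ : M →ₗ[k] M}
    (hD : ∀ a c, LinearMap.toMatrix b b d₀ c a ≠ 0 → p c = p a + 1)
    {c : ∀ m n, (endWheeledProp b p).carrier m n} (hc : (endWheeledProp b p).IsCorollaFamily c) :
    IsMasterFunction b p d₀ (genSeries p fun m n => endCoeff p b m n (c m n)) ↔
      ∀ m n, (endWheeledProp b p).corollaDifferential c m n = endDiff p b d₀ m n (c m n) := by
  have hs (m n : ℕ) : IsSkewArray p (((-1 : ℤˣ) ^ (m : ZMod 2)) • endCoeff p b m n
      (endDiff p b d₀ m n (c m n) - (endWheeledProp b p).corollaDifferential c m n)) := by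
    intro σ τ
    rw [units_smul_apply, ← endCoeff_act, map_sub, ← (endDiff_isOddDerivation hD).map_act,
      corolla_act hc, (endWheeledProp_isWheeledProp p b).corollaDifferential_act hc, units_smul_apply,
      ← smul_sub, smul_comm]
    exact congrArg _ (units_smul_apply (endCoeff p b m n).toLinearMap _ _)
  rw [IsMasterFunction, master_genSeries hD hc]
  refine ⟨fun h m n => ?_, fun h => ⟨?_, ?_⟩⟩
  -- The defect family is skew-symmetric, so it can be read off from its generating series, which is
  -- zero by the master equation.
  · have h1 := taylor_genSeries m n hs
    rw [h.2] at h1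
    have h2 : taylor m n (0 : Polyvector k p) = 0 := by
      rw [← sub_self (0 : Polyvector k p), taylor_sub, sub_self]
    rw [h2, eq_comm, smul_eq_zero_iff_eq, LinearEquiv.map_eq_zero_iff, sub_eq_zero] at h1
    exact h1.symm
  · exact parityHom_genSeries fun m n => (mem_endGr p b).1 (hc.mem m n)
  · simp only [h, sub_self, map_zero, smul_zero]
    ext e
    simp [genSeries, coeff_lsum]

end WheeledPropData

end Representations

theorem mainTheorem11 (k : Type u) [Field k] [CharZero k] :
    ∃ (P : WheeledPropData.{u, u} k) (δ : ∀ m n, P.carrier m n →ₗ[k] P.carrier m n)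
      (c : ∀ m n, P.carrier m n),
      P.IsWheeledProp ∧ P.IsFreeOnCorollas c ∧ P.IsDifferential δ ∧
      (∀ m n, δ m n (c m n) = P.corollaDifferential c m n) ∧
      ∀ (M : Type v) [AddCommGroup M] [Module k M] (𝓜 : ZMod 2 → Submodule k M),
        DirectSum.IsInternal 𝓜 →
        ∀ d₀ : M →ₗ[k] M, (∀ q, ∀ x ∈ 𝓜 q, d₀ x ∈ 𝓜 (q + 1)) → d₀ ∘ₗ d₀ = 0 →
        ∀ (ι : Type w) [Fintype ι] [DecidableEq ι] (b : Module.Basis ι k M) (p : ι → ZMod 2),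
          (∀ a, b a ∈ 𝓜 (p a)) →
          Set.BijOn
            (fun R : WheeledPropData.Hom P (endWheeledProp b p) =>
              generatingFunction b p fun m n => R.map m n (c m n))
            {R | ∀ m n (f : P.carrier m n),
              R.map m n (δ m n f) = endDifferential b p d₀ m n (R.map m n f)}
            {S | IsMasterFunction b p d₀ S} := by
  refine ⟨freeData k, freeDifferential k,
    freeCorolla k, free_isWheeledProp,
    free_isFreeOnCorollas, WheeledPropData.freeDifferential_isDifferential,
    freeDifferential_corolla, ?_⟩
  intro M _ _ 𝓜 h𝓜 d₀ hd _ ι _ _ b p hb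
  have hD := parity_of_toMatrix_ne_zero h𝓜 hb hd
  have hc (R : WheeledPropData.Hom (freeData k) (endWheeledProp b p)) :=
    R.isCorollaFamily freeCorolla_isCorollaFamily
  refine ⟨fun R hR => ?_, fun R _ R' _ h => ?_, fun S hS => ?_⟩
  · show IsMasterFunction b p d₀ (generatingFunction b p _)
    rw [generatingFunction_eq, WheeledPropData.isMasterFunction_iff hD (hc R)]
    intro m n
    rw [← R.map_corollaDifferential, ← freeDifferential_corolla]
    exact (hR m n _).trans (endDifferential_eq hD _)
  -- The series determines its Taylor coefficients, these are the values on corollas, and corollas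
  -- generate.
  · refine freeHom_ext fun m n => (endCoeff p b m n).injective ?_
    have h1 := taylor_genSeries m n (hc R).isSkewArray
    have h2 := taylor_genSeries m n (hc R').isSkewArray
    rw [← h1, ← h2, ← generatingFunction_eq, ← generatingFunction_eq]
    exact congrArg _ h
  -- The Taylor coefficients of an even S form a corolla family, and freeness extends it to a
  -- morphism. By the master equation the morphism respects the differentials on corollas, hence
  -- everywhere.
  · have hT := WheeledPropData.isCorollaFamily_taylor (b := b) hS.1
    set R := freeHom (endWheeledProp_isWheeledProp p b) hT with hR
    have hRc : (fun m n => R.map m n (freeCorolla k m n)) =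
        fun m n => (endCoeff p b m n).symm (taylor m n S) := by
      funext m n
      rw [hR, freeHom_corolla]
    have hRS : genSeries p (fun m n => endCoeff p b m n
        (R.map m n (freeCorolla k m n))) = S := by
      conv_rhs => rw [← genSeries_taylor S]
      congr 1
      funext m n
      rw [congrFun (congrFun hRc m) n, LinearEquiv.apply_symm_apply]
    refine ⟨R, fun m n f => ?_, (generatingFunction_eq _).trans hRS⟩
    refine (WheeledPropData.free_comm_differential R (WheeledPropData.endDiff_isOddDerivation hD)
      ?_ f).trans (endDifferential_eq hD _).symm
    rw [← WheeledPropData.isMasterFunction_iff hD (hc R), hRS]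
    exact hS
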